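/- Consider the following (nondeterministic) procedure $\textsc{MultiPartition}(S,\Delta)$ on an array $S[1..N]$ of elements (duplicates allowed) of a totally ordered universe. Start with one empty bucket and no pivot. As long as not all of $S$ has been distributed, take the next batch of $\Delta$ (or all remaining, if fewer) elements of $S$ and distribute it to the current buckets $S_1,\dots,S_k$ according to the current pivots $P_1\le\dots\le P_{k-1}$, so that every element $x$ put into $S_i$ satisfies $P_{i-1}\le x\le P_i$ (a condition with an absent pivot is void); then, as long as some bucket $S_j$ has more than $\Delta$ elements, replace it by two buckets separated by a new pivot $p$, where $p$ is the element of rank $\lceil |S_j|/2\rceil$ of $S_j$ and the two buckets consist of the elements of smaller and of larger rank (ties broken arbitrarily). Return the pivots and the buckets. Let $\epsilon>0$ and $d=\max\{1+2/\epsilon,\,2\}$. There are a deterministic comparison-based cache-oblivious program implementing $\textsc{MultiPartition}$ (a fixed program for a word RAM with $O(\log N)$-bit words, in which every memory cell holds one element or one word, elements can only be copied and compared, and neither the internal memory size $M$ nor the block size $B$ is known to the program) and a constant $C$, both depending only on $\epsilon$, such that for all integers $N\ge\Delta\ge 1$ with $\Delta^{d+1}\ge(2N)^d$ and every input array $S$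 of $N$ elements the following holds. 1. $\textsc{MultiPartition}(S,\Delta)$ always terminates, and, whatever choices it makes, it returns $k\le 2N/\Delta$ buckets $S_1,\dots,S_k$ and $k-1$ pivots $P_1\le\dots\le P_{k-1}$ which together make up the multiset $S$, such that $P_{i-1}\le x\le P_i$ for all $x\in S_i$ and $|S_i|\le\Delta$ for all $i$. 2. On input $(S,\Delta)$ the program carries out an execution of $\textsc{MultiPartition}(S,\Delta)$: it passes through memory states that store the successive sets of pivots and buckets of this execution, each bucket in consecutive cells, and it ends in one that stores the result. If $k$ is the number of buckets of the result, the program performs at most $C\,N\lg k$ comparisons of elements, and for all integers $B\ge1$ and $M\ge2$ with $M\ge B^{1+\epsilon}$ it performs at most $C\bigl(k^2+\frac NB(1+\log_M k)\bigr)$ I/Os, i.e. transfers of blocks of $B$ consecutive cells between the memory and an initially empty internal memory of capacity $M$ cells, under optimal offline paging. -/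

import Mathlib

universe u

namespace FunnelSelect

/-! ### The machine

A comparison-based word RAM.  Memory cells are addressed by natural numbers; a cell holds either one
(opaque) input element or one machine word.  A program is a fixed finite text, so it uses finitely
many registers; registers hold words only.  Elements can be copied from cell to cell and compared
with each other, nothing else. -/

/-- Contents of a memory cell. -/
inductive Cell (α : Type u) : Type u
  | word (n : ℕ)
  | elem (a : α)

/-- A machine state: registers and memory. -/
structure State (α : Type u) : Type u where
  reg : ℕ → ℕ
  mem : ℕ → Cell α

/-- Arithmetic expressions over the registers; `sub` is truncated, `div` rounds down. -/
inductive Expr : Type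
  | const (n : ℕ)
  | reg (r : ℕ)
  | add (e f : Expr)
  | sub (e f : Expr)
  | mul (e f : Expr)
  | div (e f : Expr)

def Expr.eval (ρ : ℕ → ℕ) : Expr → ℕ
  | .const n => n
  | .reg r => ρ r
  | .add e f => e.eval ρ + f.eval ρ
  | .sub e f => e.eval ρ - f.eval ρ
  | .mul e f => e.eval ρ * f.eval ρ
  | .div e f => e.eval ρ / f.eval ρ

/-- Programs.  A condition is true when its value is not `0`. -/
inductive Cmd : Type
  /-- register `r` gets the value of `e` -/
  | assign (r : ℕ) (e : Expr)
  /-- register `r` gets the word stored at address `a` -/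
  | load (r : ℕ) (a : Expr)
  /-- the word `e` is stored at address `a` -/
  | store (a e : Expr)
  /-- the contents of the cell at address `src` is copied to address `dst` -/
  | move (dst src : Expr)
  /-- register `r` gets `1` if the element at address `a` is `≤` the element at address `b`,
  and `0` otherwise -/
  | compare (r : ℕ) (a b : Expr)
  | seq (c₁ c₂ : Cmd)
  | ite (e : Expr) (c₁ c₂ : Cmd)
  | loop (e : Expr) (c : Cmd)

/-- The record of one elementary instruction: the addresses of the memory cells it accesses (in
order), the number of element comparisons it makes, and the state after it. -/
structure Event (α : Type u) : Type u where
  accesses : List ℕ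
  comparisons : ℕ
  post : State α

def State.setReg {α : Type u} (s : State α) (r n : ℕ) : State α :=
  { s with reg := Function.update s.reg r n }

def State.setMem {α : Type u} (s : State α) (a : ℕ) (v : Cell α) : State α :=
  { s with mem := Function.update s.mem a v }

/-- `Exec W c s t s'`: started in state `s`, the program `c` terminates in state `s'` with record
`t`, on a machine whose words are the numbers below `W`.  A program that produces a number `≥ W`,
loads an element into a register, or compares a word gets stuck (it has no execution). -/
inductive Exec {α : Type u} [LinearOrder α] (W : ℕ) :
    Cmd → State α → List (Event α) → State α → Prop
  | assign (s : State α) (r : ℕ) (e : Expr) (h : e.eval s.reg < W) :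
      Exec W (.assign r e) s [⟨[], 0, s.setReg r (e.eval s.reg)⟩] (s.setReg r (e.eval s.reg))
  | load (s : State α) (r : ℕ) (a : Expr) (n : ℕ) (h : s.mem (a.eval s.reg) = .word n) :
      Exec W (.load r a) s [⟨[a.eval s.reg], 0, s.setReg r n⟩] (s.setReg r n)
  | store (s : State α) (a e : Expr) (h : e.eval s.reg < W) :
      Exec W (.store a e) s
        [⟨[a.eval s.reg], 0, s.setMem (a.eval s.reg) (.word (e.eval s.reg))⟩]
        (s.setMem (a.eval s.reg) (.word (e.eval s.reg)))
  | move (s : State α) (dst src : Expr) :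
      Exec W (.move dst src) s
        [⟨[src.eval s.reg, dst.eval s.reg], 0,
          s.setMem (dst.eval s.reg) (s.mem (src.eval s.reg))⟩]
        (s.setMem (dst.eval s.reg) (s.mem (src.eval s.reg)))
  | compare (s : State α) (r : ℕ) (a b : Expr) (x y : α)
      (hx : s.mem (a.eval s.reg) = .elem x) (hy : s.mem (b.eval s.reg) = .elem y) :
      Exec W (.compare r a b) s
        [⟨[a.eval s.reg, b.eval s.reg], 1, s.setReg r (if x ≤ y then 1 else 0)⟩]
        (s.setReg r (if x ≤ y then 1 else 0))
  | seq {c₁ c₂ : Cmd} {s₀ s₁ s₂ : State α} {t₁ t₂ : List (Event α)}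
      (h₁ : Exec W c₁ s₀ t₁ s₁) (h₂ : Exec W c₂ s₁ t₂ s₂) :
      Exec W (.seq c₁ c₂) s₀ (t₁ ++ t₂) s₂
  | ite_true {e : Expr} {c₁ c₂ : Cmd} {s s' : State α} {t : List (Event α)}
      (he : e.eval s.reg ≠ 0) (h : Exec W c₁ s t s') : Exec W (.ite e c₁ c₂) s t s'
  | ite_false {e : Expr} {c₁ c₂ : Cmd} {s s' : State α} {t : List (Event α)}
      (he : e.eval s.reg = 0) (h : Exec W c₂ s t s') : Exec W (.ite e c₁ c₂) s t s'
  | loop_true {e : Expr} {c : Cmd} {s₀ s₁ s₂ : State α} {t₁ t₂ : List (Event α)}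
      (he : e.eval s₀.reg ≠ 0) (h₁ : Exec W c s₀ t₁ s₁) (h₂ : Exec W (.loop e c) s₁ t₂ s₂) :
      Exec W (.loop e c) s₀ (t₁ ++ t₂) s₂
  | loop_false {e : Expr} {c : Cmd} {s : State α}
      (he : e.eval s.reg = 0) : Exec W (.loop e c) s [] s

/-- Number of element comparisons in an execution record. -/
def comparisonCount {α : Type u} (t : List (Event α)) : ℕ :=
  (t.map Event.comparisons).sum

/-- The sequence of memory addresses accessed in an execution record. -/
def addressTrace {α : Type u} (t : List (Event α)) : List ℕ :=
  t.flatMap Event.accesses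

/-! ### Block transfers under optimal offline paging -/

/-- `Paging m C bs n`: starting with the set `C` of blocks in internal memory, the request sequence
`bs` of blocks can be served by an internal memory of capacity `m` blocks with `n` block transfers.
Every block that enters and every block that leaves internal memory counts as one transfer. -/
inductive Paging (m : ℕ) : Finset ℕ → List ℕ → ℕ → Prop
  | nil (C : Finset ℕ) : Paging m C [] 0
  | cons {C : Finset ℕ} (C' : Finset ℕ) {b : ℕ} {bs : List ℕ} {n : ℕ}
      (hb : b ∈ C') (hC' : C'.card ≤ m) (h : Paging m C' bs n) :
      Paging m C (b :: bs) ((C' \ C).card + (C \ C').card + n)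

/-- The number of I/Os of an address trace for internal memory size `M` and block size `B` (both in
cells): the least number of block transfers of a paging schedule that starts with an empty internal
memory.  Address `a` lies in block `a / B`. -/
noncomputable def ioCost (M B : ℕ) (tr : List ℕ) : ℕ :=
  sInf {n | Paging (M / B) ∅ (tr.map (· / B)) n}

/-- For a memory of at least one block the minimum in `ioCost` is over a nonempty set. -/
theorem exists_paging {m : ℕ} (hm : 0 < m) (bs : List ℕ) (C : Finset ℕ) :
    ∃ n, Paging m C bs n := by
  induction bs generalizing C with
  | nil => exact ⟨0, .nil C⟩
  | cons b bs ih =>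
    obtain ⟨n, hn⟩ := ih {b}
    exact ⟨_, .cons {b} (by simp) (by rw [Finset.card_singleton]; exact hm) hn⟩

/-! ### The procedure MultiPartition -/

/-- The `i`-th bucket (counted from `0`) lies between the pivots number `i - 1` and `i`
(counted from `0`; an absent pivot gives no condition). -/
def Between {α : Type u} [LinearOrder α] (P : List α) (bs : List (Multiset α)) : Prop :=
  ∀ i b, bs[i]? = some b → ∀ x ∈ b,
    (∀ p, P[i]? = some p → x ≤ p) ∧ (∀ j p, j + 1 = i → P[j]? = some p → p ≤ x)

/-- The variables of the procedure: pivots, buckets, and the number of elements of the input array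
that have already been distributed. -/
structure Config (α : Type u) : Type u where
  pivots : List α
  buckets : List (Multiset α)
  used : ℕ

/-- One empty bucket and no pivots. -/
def Config.init (α : Type u) : Config α := ⟨[], [0], 0⟩

/-- One step of the procedure on input array `S` with bucket capacity `Δ`. -/
inductive Step {α : Type u} [LinearOrder α] (S : List α) (Δ : ℕ) : Config α → Config α → Prop
  /-- If no bucket overflows, the next batch of (at most) `Δ` elements is distributed to the
  buckets according to the pivots. -/
  | distribute (c : Config α) (parts : List (Multiset α))
      (hused : c.used < S.length)
      (hfit : ∀ b ∈ c.buckets, b.card ≤ Δ)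
      (hlen : parts.length = c.buckets.length)
      (hsum : parts.sum = (((S.drop c.used).take Δ : List α) : Multiset α))
      (hbetween : Between c.pivots parts) :
      Step S Δ c
        ⟨c.pivots, List.zipWith (· + ·) c.buckets parts, min (c.used + Δ) S.length⟩
  /-- An overflowing bucket `b` is split at its element `p` of rank `⌈|b| / 2⌉`, which becomes a
  pivot; `lo` are the elements of smaller rank and `hi` those of larger rank. -/
  | split (c : Config α) (j : ℕ) (b lo hi : Multiset α) (p : α)
      (hb : c.buckets[j]? = some b)
      (hover : Δ < b.card)
      (hpart : b = lo + {p} + hi)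
      (hrank : lo.card + 1 = (b.card + 1) / 2)
      (hlo : ∀ x ∈ lo, x ≤ p) (hhi : ∀ x ∈ hi, p ≤ x) :
      Step S Δ c
        ⟨c.pivots.take j ++ p :: c.pivots.drop j,
          c.buckets.take j ++ lo :: hi :: c.buckets.drop (j + 1), c.used⟩

/-- `cs` is the sequence of configurations of a complete execution of the procedure: it starts with
the initialization, and no further step is possible after its last configuration `c`. -/
def IsRun {α : Type u} [LinearOrder α] (S : List α) (Δ : ℕ) (cs : List (Config α))
    (c : Config α) : Prop :=
  cs.head? = some (Config.init α) ∧ cs.IsChain (Step S Δ) ∧ cs.getLast? = some c ∧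
    ∀ c', ¬ Step S Δ c c'

/-- The procedure terminates, whatever choices it makes: it has no infinite execution. -/
def Terminates {α : Type u} [LinearOrder α] (S : List α) (Δ : ℕ) : Prop :=
  ¬ ∃ f : ℕ → Config α, f 0 = Config.init α ∧ ∀ n, Step S Δ (f n) (f (n + 1))

/-- The result consists of buckets separated by pivots that together make up the input: there is one
pivot less than there are buckets, the pivots are in nondecreasing order, and the buckets lie between
consecutive pivots. -/
def IsPartition {α : Type u} [LinearOrder α] (S : List α) (c : Config α) : Prop :=
  c.pivots.length + 1 = c.buckets.length ∧
  c.pivots.Pairwise (· ≤ ·) ∧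
  Between c.pivots c.buckets ∧
  (c.pivots : Multiset α) + c.buckets.sum = (S : Multiset α)

/-! ### The procedure on the machine -/

/-- Start of the machine: the array `S` occupies the cells `0, …, N - 1`, the registers `0` and `1`
hold `N` and `Δ`, everything else is `0`. -/
def initState {α : Type u} (S : List α) (Δ : ℕ) : State α where
  reg := fun r => if r = 0 then S.length else if r = 1 then Δ else 0
  mem := fun a => match S[a]? with
    | some x => .elem x
    | none => .word 0

/-- The machine state `s` stores the pivots and buckets of `c`.  Register `2` holds the number of
buckets, register `3` the address of the array of pivots, register `4` the address of a table
with two words for each bucket: the address of its first cell and its size.  The elements of a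
bucket are stored consecutively, in any order; all buckets and the pivot array are disjoint. -/
def Represents {α : Type u} (s : State α) (c : Config α) : Prop :=
  s.reg 2 = c.buckets.length ∧
  (∀ i p, c.pivots[i]? = some p → s.mem (s.reg 3 + i) = .elem p) ∧
  ∃ start : ℕ → ℕ,
    (∀ i b, c.buckets[i]? = some b →
      s.mem (s.reg 4 + 2 * i) = .word (start i) ∧
      s.mem (s.reg 4 + 2 * i + 1) = .word b.card ∧
      (Multiset.range b.card).map (fun j => s.mem (start i + j)) = b.map .elem ∧
      Disjoint (Finset.Ico (start i) (start i + b.card))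
        (Finset.Ico (s.reg 3) (s.reg 3 + c.pivots.length))) ∧
    (∀ i i' b b', i ≠ i' → c.buckets[i]? = some b → c.buckets[i']? = some b' →
      Disjoint (Finset.Ico (start i) (start i + b.card))
        (Finset.Ico (start i') (start i' + b'.card)))

/-- An execution with record `t` and final state `s` carries out the run `cs` of the procedure with
result `c`: it passes, in this order, through states that store the successive configurations of the
run, and it ends in a state that stores the result. -/
def CarriesOut {α : Type u} (t : List (Event α)) (s : State α) (cs : List (Config α))
    (c : Config α) : Prop :=
  (∃ ss : List (State α), ss.Sublist (t.map Event.post) ∧ List.Forall₂ Represents ss cs) ∧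
  Represents s c

end FunnelSelect

namespace FunnelSelect

set_option linter.unusedSectionVars false
set_option linter.unusedSimpArgs false

variable {α : Type u} [LinearOrder α]
  {W K B m n h v u y Δ a i fv q e r x D lo J j p k f src hi dst n' v' r' cur τ N π M z t : ℕ}
  {len len' ρ slot : ℕ → ℕ} {tr tr' vs : List ℕ} {s s' s₀ : State α} {S : List α} {c c' : Config α}
  {A : ℕ → α} {val : ℕ → ℕ → α} {Q : ℕ → List ℕ → State α → Prop}
  {C C' F : Finset ℕ} {σ : Equiv.Perm ℕ} {θ Y : ℝ}

/-! ### Expressions and commands -/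

/-! The program is governed by an integer `a` with `2 ≤ a ≤ d` and `ε (a - 1) ≥ 1`
(`exists_degree`). For the number `k` of buckets the hypothesis on `Δ` yields `k ^ a ≤ Δ`
(`pow_le_cap`), and `M ≥ B ^ (1 + ε)` yields `B ^ a ≤ M ^ (a - 1)` (`pow_le_of_tall`).

The claims about the procedure itself follow from the invariant `Valid`: apart from a sole bucket,
every bucket has at least about `Δ / 2` elements and at most `2 Δ`, and pivots and buckets together
are the part of the input read so far. The number of elements read and the number of pivots never
decrease, one of them grows in every step, and both are at most `N`, so there is no infinite
execution.

A batch is distributed through a complete binary tree with `2 ^ h ≥ k` leaves, the first `k` of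
which are the buckets. Every internal node has a buffer; at height `i` its capacity is `2 ^ ((2 a -
1) r)`, where `r` is the largest power of two dividing `i`. To flush a node, its elements are moved
one by one to its children; a child that becomes full is emptied recursively before the work goes
on. Flushing all nodes in preorder leaves every element in a bucket (`DSteps.zero`), and every
element is compared at most `h` times (`AStep.cost`).

For the block transfers, fix `M` and `B` and cut the tree at the heights divisible by `D = 2 ^ j`. A
base tree between two cuts has buffers of total size at most `4 * 2 ^ (a D)` strictly inside it
(`sum_bufSize_le`), so `j` can be chosen such that a base tree fits into the internal memory while
`D` is still of order `log M` (`exists_scale`). Buffers at the cuts are streamed. They hold at least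
`2 ^ ((2 a - 1) D)` elements when full, and a base tree has `O(2 ^ D + 2 ^ (a D) / B)` blocks, hence
loading a base tree in order to empty a full buffer costs `O(1 / B)` per element. The potential
`flushPot` turns this into a bound for every single iteration (`AStep.sched`), and `batch_io` sums
up: `O(Δ / B * (1 + h / D) + 2 ^ h + 2 ^ (a h) / B)` per batch. As `2 ^ h ≤ 2 k` and `k ^ a ≤ Δ`,
the last two terms are `O(k + Δ / B)`. The program knows neither `j` nor `D`, since the buffer sizes
serve all scales at once.

An overflowing bucket is split at its median by a deterministic selection that consists of scans
(`runs_select`). An approximate median comes from repeated sampling: in groups of size `g` every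
fourth element is kept, and `g` doubles from round to round. The product of array length and group
size thus at least halves per round, so the costs form a geometric series, while the errors in rank,
of relative size `O(1 / g)`, stay bounded (`approx_step`). Partitioning around it leaves at most
three quarters of the array.

There are `O(N / Δ) = O(k)` batches and `k - 1` splits. Each split costs `O(Δ)` comparisons and `O(Δ
/ B + k)` loads, the `k` for shifting tables, which explains the term `k ^ 2`. While there is a
single bucket no comparison is made in a distribution, which is what makes the bound `N lg k`
correct for `k = 1`. If `M` is bounded by a constant depending on `a`, each access may be counted as
a constant number of loads.

The specification of the program is proved for each pair `M`, `B` separately; since executions are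
unique (`Exec.deterministic`), a single execution satisfies all the bounds. -/

instance : Add Expr := ⟨Expr.add⟩
instance : Sub Expr := ⟨Expr.sub⟩
instance : Mul Expr := ⟨Expr.mul⟩
instance : Div Expr := ⟨Expr.div⟩
instance (n : ℕ) : OfNat Expr n := ⟨Expr.const n⟩

/-- Register `r` as an expression. -/
def V (r : ℕ) : Expr := .reg r

infixr:60 ";;" => Cmd.seq

@[simp] theorem eval_add (ρ : ℕ → ℕ) (e f : Expr) : (e + f).eval ρ = e.eval ρ + f.eval ρ := rfl
@[simp] theorem eval_sub (ρ : ℕ → ℕ) (e f : Expr) : (e - f).eval ρ = e.eval ρ - f.eval ρ := rfl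
@[simp] theorem eval_mul (ρ : ℕ → ℕ) (e f : Expr) : (e * f).eval ρ = e.eval ρ * f.eval ρ := rfl
@[simp] theorem eval_div (ρ : ℕ → ℕ) (e f : Expr) : (e / f).eval ρ = e.eval ρ / f.eval ρ := rfl
@[simp] theorem eval_V (ρ : ℕ → ℕ) (r : ℕ) : (V r).eval ρ = ρ r := rfl
@[simp] theorem eval_ofNat (ρ : ℕ → ℕ) (n : ℕ) :
    Expr.eval ρ (no_index (OfNat.ofNat n : Expr)) = OfNat.ofNat n := rfl
@[simp] theorem eval_zero (ρ : ℕ → ℕ) : Expr.eval ρ (0 : Expr) = 0 := rfl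
@[simp] theorem eval_one (ρ : ℕ → ℕ) : Expr.eval ρ (1 : Expr) = 1 := rfl
@[simp] theorem eval_const (ρ : ℕ → ℕ) (n : ℕ) : Expr.eval ρ (.const n) = n := rfl

@[simp] theorem setReg_mem {α : Type u} (s : State α) (r n : ℕ) : (s.setReg r n).mem = s.mem := rfl
@[simp] theorem setMem_reg {α : Type u} (s : State α) (a : ℕ) (v : Cell α) :
    (s.setMem a v).reg = s.reg := rfl
@[simp] theorem setReg_reg {α : Type u} (s : State α) (r n r' : ℕ) :
    (s.setReg r n).reg r' = if r' = r then n else s.reg r' := by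
  simp [State.setReg, Function.update_apply]
@[simp] theorem setMem_mem {α : Type u} (s : State α) (a : ℕ) (v : Cell α) (a' : ℕ) :
    (s.setMem a v).mem a' = if a' = a then v else s.mem a' := by
  simp [State.setMem, Function.update_apply]

/-! ### A weakest precondition calculus -/

@[simp] theorem comparisonCount_nil {α : Type u} : comparisonCount ([] : List (Event α)) = 0 := rfl
@[simp] theorem comparisonCount_append {α : Type u} (t t' : List (Event α)) :
    comparisonCount (t ++ t') = comparisonCount t + comparisonCount t' := by
  simp [comparisonCount]
@[simp] theorem addressTrace_nil {α : Type u} : addressTrace ([] : List (Event α)) = [] := rfl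
@[simp] theorem addressTrace_append {α : Type u} (t t' : List (Event α)) :
    addressTrace (t ++ t') = addressTrace t ++ addressTrace t' := by
  simp [addressTrace]

/-- The program `c` has an execution from `s`; its number of comparisons, its address trace and its
final state satisfy `Q`. -/
def Runs (W : ℕ) (c : Cmd) (s : State α) (Q : ℕ → List ℕ → State α → Prop) : Prop :=
  ∃ t s', Exec W c s t s' ∧ Q (comparisonCount t) (addressTrace t) s'

section
variable {c c₁ c₂ : Cmd} {a b d e : Expr}

theorem Runs.mono {Q' : ℕ → List ℕ → State α → Prop} (h : Runs W c s Q)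
    (hQ : ∀ n tr s', Q n tr s' → Q' n tr s') : Runs W c s Q' := by
  obtain ⟨t, s', h1, h2⟩ := h
  exact ⟨t, s', h1, hQ _ _ _ h2⟩

theorem runs_assign :
    Runs W (.assign r e) s Q ↔ e.eval s.reg < W ∧ Q 0 [] (s.setReg r (e.eval s.reg)) :=
  ⟨fun ⟨_, _, .assign _ _ _ h, h'⟩ => ⟨h, h'⟩, fun ⟨h, h'⟩ => ⟨_, _, .assign s r e h, h'⟩⟩

theorem runs_load : Runs W (.load r a) s Q ↔
      ∃ n, s.mem (a.eval s.reg) = .word n ∧ Q 0 [a.eval s.reg] (s.setReg r n) :=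
  ⟨fun ⟨_, _, .load _ _ _ n h, h'⟩ => ⟨n, h, h'⟩, fun ⟨n, h, h'⟩ => ⟨_, _, .load s r a n h, h'⟩⟩

theorem runs_store : Runs W (.store a e) s Q ↔ e.eval s.reg < W ∧
      Q 0 [a.eval s.reg] (s.setMem (a.eval s.reg) (.word (e.eval s.reg))) :=
  ⟨fun ⟨_, _, .store _ _ _ h, h'⟩ => ⟨h, h'⟩, fun ⟨h, h'⟩ => ⟨_, _, .store s a e h, h'⟩⟩

theorem runs_move : Runs W (.move d a) s Q ↔
      Q 0 [a.eval s.reg, d.eval s.reg] (s.setMem (d.eval s.reg) (s.mem (a.eval s.reg))) :=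
  ⟨fun ⟨_, _, .move _ _ _, h⟩ => h, fun h => ⟨_, _, .move s d a, h⟩⟩

theorem runs_compare :
    Runs W (.compare r a b) s Q ↔ ∃ x y, s.mem (a.eval s.reg) = .elem x ∧
      s.mem (b.eval s.reg) = .elem y ∧
      Q 1 [a.eval s.reg, b.eval s.reg] (s.setReg r (if x ≤ y then 1 else 0)) :=
  ⟨fun ⟨_, _, .compare _ _ _ _ x y hx hy, h⟩ => ⟨x, y, hx, hy, h⟩,
    fun ⟨x, y, hx, hy, h⟩ => ⟨_, _, .compare s r a b x y hx hy, h⟩⟩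

theorem runs_seq : Runs W (c₁ ;; c₂) s Q ↔ Runs W c₁ s fun n tr s₁ => Runs W c₂ s₁ fun n' tr' s₂ =>
      Q (n + n') (tr ++ tr') s₂ := by
  constructor
  · rintro ⟨t, s', h1, h2⟩
    cases h1 with
    | seq h₁ h₂ => exact ⟨_, _, h₁, _, _, h₂, by simpa using h2⟩
  · rintro ⟨t, s', h1, t', s'', h2, h3⟩
    exact ⟨_, _, .seq h1 h2, by simpa using h3⟩

/-- The requirement that the value is a word is an auto-parameter, so that in most uses only the
continuation has to be treated. The costs `0 + n` and `[] ++ tr` are left unreduced because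
`runs_seq` produces them in this form. -/
theorem runs_assign_seq
    (h : Runs W c (s.setReg r (e.eval s.reg)) fun n tr s' => Q (0 + n) ([] ++ tr) s')
    (he : e.eval s.reg < W := by simp; omega) : Runs W (.assign r e ;; c) s Q :=
  runs_seq.2 (runs_assign.2 ⟨he, h⟩)

theorem runs_ite : Runs W (.ite e c₁ c₂) s Q ↔
      (e.eval s.reg ≠ 0 → Runs W c₁ s Q) ∧ (e.eval s.reg = 0 → Runs W c₂ s Q) := by
  constructor
  · rintro ⟨t, s', h1, h2⟩
    cases h1 with
    | ite_true he h => exact ⟨fun _ => ⟨_, _, h, h2⟩, fun h' => absurd h' he⟩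
    | ite_false he h => exact ⟨fun h' => absurd he h', fun _ => ⟨_, _, h, h2⟩⟩
  · rintro ⟨h1, h2⟩
    by_cases he : e.eval s.reg = 0
    · obtain ⟨t, s', h, h'⟩ := h2 he
      exact ⟨_, _, .ite_false he h, h'⟩
    · obtain ⟨t, s', h, h'⟩ := h1 he
      exact ⟨_, _, .ite_true he h, h'⟩

theorem runs_loop_zero (he : e.eval s.reg = 0) (h : Q 0 [] s) :
    Runs W (.loop e c) s Q := ⟨_, _, .loop_false he, h⟩

theorem runs_loop_succ (he : e.eval s.reg ≠ 0)
    (h : Runs W c s fun n tr s₁ => Runs W (.loop e c) s₁ fun n' tr' s₂ => Q (n + n') (tr ++ tr') s₂) :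
    Runs W (.loop e c) s Q := by
  obtain ⟨t, s', h1, t', s'', h2, h3⟩ := h
  exact ⟨_, _, .loop_true he h1 h2, by simpa using h3⟩

/-- Loop rule with a ghost state, a termination measure, and a compositional relation that records
the costs. -/
theorem runs_loop {G : Type*} (I : G → State α → Prop) (μ : G → ℕ)
    (Rel : G → ℕ → List ℕ → G → Prop) (hrefl : ∀ g s, I g s → Rel g 0 [] g)
    (htrans : ∀ g n tr g' n' tr' g'', Rel g n tr g' → Rel g' n' tr' g'' →
      Rel g (n + n') (tr ++ tr') g'')
    (hstep : ∀ g s, I g s → e.eval s.reg ≠ 0 →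
      Runs W c s fun n tr s' => ∃ g', I g' s' ∧ μ g' < μ g ∧ Rel g n tr g')
    (g : G) (s : State α) (h : I g s) :
    Runs W (.loop e c) s fun n tr s' => ∃ g', I g' s' ∧ e.eval s'.reg = 0 ∧ Rel g n tr g' := by
  induction hm : μ g using Nat.strong_induction_on generalizing g s with
  | _ k ih =>
    by_cases he : e.eval s.reg = 0
    · exact runs_loop_zero he ⟨g, h, he, hrefl g s h⟩
    · refine runs_loop_succ he ((hstep g s h he).mono ?_)
      rintro n tr s' ⟨g', h1, h2, h3⟩
      refine (ih _ (hm ▸ h2) g' s' h1 rfl).mono ?_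
      rintro n' tr' s'' ⟨g'', h4, h5, h6⟩
      exact ⟨g'', h4, h5, htrans _ _ _ _ _ _ _ h3 h6⟩

/-- Loop rule for loops that neither compare nor access the memory. -/
theorem runs_loop_pure {G : Type*} (I : G → State α → Prop) (μ : G → ℕ)
    (hstep : ∀ g s, I g s → e.eval s.reg ≠ 0 →
      Runs W c s fun n tr s' => n = 0 ∧ tr = [] ∧ ∃ g', I g' s' ∧ μ g' < μ g)
    (g : G) (s : State α) (h : I g s) :
    Runs W (.loop e c) s fun n tr s' => n = 0 ∧ tr = [] ∧ ∃ g', I g' s' ∧ e.eval s'.reg = 0 := by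
  refine (runs_loop I μ (fun _ n tr _ => n = 0 ∧ tr = []) (fun _ _ _ => ⟨rfl, rfl⟩) ?_ ?_ g s
    h).mono ?_
  · rintro g n tr g' n' tr' g'' ⟨rfl, rfl⟩ ⟨rfl, rfl⟩
    exact ⟨rfl, rfl⟩
  · intro g s hI he
    refine (hstep g s hI he).mono ?_
    rintro n tr s' ⟨h1, h2, g', h3, h4⟩
    exact ⟨g', h3, h4, h1, h2⟩
  · rintro n tr s' ⟨g', h1, h2, h3, h4⟩
    exact ⟨h3, h4, g', h1, h2⟩

/-- The cost analysis produces an execution for each choice of `M` and `B`. This lemma identifies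
them all, which is how one record comes to satisfy the transfer bound for every `M` and `B`. -/
theorem Exec.deterministic {s₁ s₂ : State α} {t₁ t₂ : List (Event α)}
    (h₁ : Exec W c s t₁ s₁) (h₂ : Exec W c s t₂ s₂) : t₁ = t₂ ∧ s₁ = s₂ := by
  induction h₁ generalizing t₂ s₂ <;> cases h₂ <;> grind

/-! ### Executions with marked states -/

/-- Like `Runs`, with in addition a list of states which the execution passes through. -/
def RunsV (W : ℕ) (c : Cmd) (s : State α)
    (Q : ℕ → List ℕ → List (State α) → State α → Prop) : Prop :=
  ∃ t s' ss, Exec W c s t s' ∧ ss.Sublist (t.map Event.post) ∧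
    Q (comparisonCount t) (addressTrace t) ss s'

variable {Q Q' : ℕ → List ℕ → List (State α) → State α → Prop}

theorem RunsV.mono (h : RunsV W c s Q) (hQ : ∀ n tr ss s', Q n tr ss s' → Q' n tr ss s') :
    RunsV W c s Q' := by
  obtain ⟨t, s', ss, h1, h2, h3⟩ := h
  exact ⟨t, s', ss, h1, h2, hQ _ _ _ _ h3⟩

theorem Runs.toRunsV {Q : ℕ → List ℕ → State α → Prop} (h : Runs W c s Q) :
    RunsV W c s fun n tr ss s' => ss = [] ∧ Q n tr s' := by
  obtain ⟨t, s', h1, h2⟩ := h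
  exact ⟨t, s', [], h1, List.nil_sublist _, rfl, h2⟩

theorem runsV_seq (h : RunsV W c₁ s fun n tr ss s₁ =>
      RunsV W c₂ s₁ fun n' tr' ss' s₂ => Q (n + n') (tr ++ tr') (ss ++ ss') s₂) :
    RunsV W (c₁ ;; c₂) s Q := by
  obtain ⟨t, s₁, ss, h1, h2, t', s₂, ss', h3, h4, h5⟩ := h
  refine ⟨_, _, ss ++ ss', .seq h1 h3, ?_, by simpa using h5⟩
  rw [List.map_append]
  exact h2.append h4

/-- For a first command in which no state is marked; only the record of the second one contributes
marks. -/
theorem runsV_seq_left (h : Runs W c₁ s fun n tr s₁ =>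
      RunsV W c₂ s₁ fun n' tr' ss' s₂ => Q (n + n') (tr ++ tr') ss' s₂) :
    RunsV W (c₁ ;; c₂) s Q := by
  obtain ⟨t, s₁, h1, t', s₂, ss', h3, h4, h5⟩ := h
  refine ⟨_, _, ss', .seq h1 h3, ?_, by simpa using h5⟩
  rw [List.map_append]
  exact h4.trans (List.sublist_append_right _ _)

/-- A final assignment marks the state after it. -/
theorem runsV_assign (he : e.eval s.reg < W)
    (h : Q 0 [] [s.setReg r (e.eval s.reg)] (s.setReg r (e.eval s.reg))) :
    RunsV W (.assign r e) s Q :=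
  ⟨_, _, _, .assign s r e he, List.Sublist.refl _, h⟩

theorem runsV_ite (h₁ : e.eval s.reg ≠ 0 → RunsV W c₁ s Q)
    (h₂ : e.eval s.reg = 0 → RunsV W c₂ s Q) :
    RunsV W (.ite e c₁ c₂) s Q := by
  by_cases he : e.eval s.reg = 0
  · obtain ⟨t, s', ss, h, h', h''⟩ := h₂ he
    exact ⟨_, _, _, .ite_false he h, h', h''⟩
  · obtain ⟨t, s', ss, h, h', h''⟩ := h₁ he
    exact ⟨_, _, _, .ite_true he h, h', h''⟩

theorem runsV_loop {G : Type*} (I : G → State α → Prop) (μ : G → ℕ)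
    (Rel : G → ℕ → List ℕ → List (State α) → G → Prop) (hrefl : ∀ g s, I g s → Rel g 0 [] [] g)
    (htrans : ∀ g n tr ss g' n' tr' ss' g'', Rel g n tr ss g' → Rel g' n' tr' ss' g'' →
      Rel g (n + n') (tr ++ tr') (ss ++ ss') g'')
    (hstep : ∀ g s, I g s → e.eval s.reg ≠ 0 →
      RunsV W c s fun n tr ss s' => ∃ g', I g' s' ∧ μ g' < μ g ∧ Rel g n tr ss g')
    (g : G) (s : State α) (h : I g s) :
    RunsV W (.loop e c) s fun n tr ss s' =>
      ∃ g', I g' s' ∧ e.eval s'.reg = 0 ∧ Rel g n tr ss g' := by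
  induction hm : μ g using Nat.strong_induction_on generalizing g s with
  | _ k ih =>
    by_cases he : e.eval s.reg = 0
    · exact ⟨_, _, [], .loop_false he, List.nil_sublist _, g, h, he, hrefl g s h⟩
    · obtain ⟨t, s', ss, h1, h2, g', h3, h4, h5⟩ := hstep g s h he
      obtain ⟨t', s'', ss', h6, h7, g'', h8, h9, h10⟩ := ih _ (hm ▸ h4) g' s' h3 rfl
      refine ⟨_, _, ss ++ ss', .loop_true he h1 h6, ?_, g'', h8, h9, ?_⟩
      · rw [List.map_append]
        exact h2.append h7
      · simpa using htrans _ _ _ _ _ _ _ _ _ h5 h10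

end

/-! ### Paging schedules -/

/-- `Sched m B C tr n C'`: a cache of `m` blocks can serve the address trace `tr`, going from the
cache contents `C` to `C'` and loading `n` blocks. -/
inductive Sched (m B : ℕ) : Finset ℕ → List ℕ → ℕ → Finset ℕ → Prop
  | nil (C : Finset ℕ) : Sched m B C [] 0 C
  | access {C C' : Finset ℕ} {a : ℕ} {tr : List ℕ} {n : ℕ} (ha : a / B ∈ C) (hC : C.card ≤ m)
      (h : Sched m B C tr n C') : Sched m B C (a :: tr) n C'
  | shift {C : Finset ℕ} (C₁ : Finset ℕ) {C' : Finset ℕ} {tr : List ℕ} {n : ℕ}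
      (h : Sched m B C₁ tr n C') : Sched m B C tr ((C₁ \ C).card + n) C'

theorem Sched.append {C₁ C₂ : Finset ℕ} {tr₁ tr₂ : List ℕ} {n₁ n₂ : ℕ} (h₁ : Sched m B C tr₁ n₁ C₁)
    (h₂ : Sched m B C₁ tr₂ n₂ C₂) : Sched m B C (tr₁ ++ tr₂) (n₁ + n₂) C₂ := by
  induction h₁ with
  | nil C => simpa using h₂
  | access ha hC _ ih => exact .access ha hC (ih h₂)
  | shift C₁ _ ih => rw [add_assoc]; exact .shift C₁ (ih h₂)

theorem card_sdiff_triangle (A B C : Finset ℕ) :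
    (A \ C).card ≤ (A \ B).card + (B \ C).card := by
  refine (Finset.card_le_card ?_).trans (Finset.card_union_le _ _)
  intro x hx
  simp only [Finset.mem_sdiff, Finset.mem_union] at hx ⊢
  tauto

/-- `Sched` counts loads only and restricts the capacity only at accesses, so the real cache `C₀`
lags behind and jumps to `C` at the next access. Every block evicted was either loaded before or
present at the start, whence the factor `2` and the term `C₀.card`; changes without an access in
between are merged by the triangle inequality. -/
theorem Sched.paging (h : Sched m B C tr n C') (C₀ : Finset ℕ) :
    ∃ n', Paging m C₀ (tr.map (· / B)) n' ∧ n' ≤ 2 * (n + (C \ C₀).card) + C₀.card := by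
  induction h generalizing C₀ with
  | nil C => exact ⟨0, .nil _, Nat.zero_le _⟩
  | @access C C' a tr n ha hC _ ih =>
    obtain ⟨n', h1, h2⟩ := ih C
    refine ⟨_, .cons C ha hC h1, ?_⟩
    have h3 := Finset.card_sdiff_add_card_inter C C₀
    have h4 := Finset.card_sdiff_add_card_inter C₀ C
    rw [Finset.inter_comm] at h4
    simp only [Finset.sdiff_self, Finset.card_empty] at h2
    omega
  | @shift C C₁ C' tr n _ ih =>
    obtain ⟨n', h1, h2⟩ := ih C₀
    have := card_sdiff_triangle C₁ C C₀
    exact ⟨n', h1, by omega⟩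

theorem ioCost_le_of_sched (h : Sched (M / B) B ∅ tr n C') : ioCost M B tr ≤ 2 * n := by
  obtain ⟨n', h1, h2⟩ := h.paging ∅
  exact (Nat.sInf_le h1).trans (by simpa using h2)

theorem Sched.of_subset (h : ∀ a ∈ tr, a / B ∈ C) (hC : C.card ≤ m) : Sched m B C tr 0 C := by
  induction tr with
  | nil => exact .nil C
  | cons a tr ih =>
    exact .access (h a (by simp)) hC (ih fun b hb => h b (List.mem_cons_of_mem _ hb))

theorem Sched.change (C C' : Finset ℕ) : Sched m B C [] (C' \ C).card C' := by
  have h : Sched m B C [] (_ + 0) C' := .shift C' (.nil C')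
  simpa using h

/-- A segment that touches only blocks of `C` and of `C'`. -/
theorem Sched.of_union (h : ∀ a ∈ tr, a / B ∈ C ∪ C') (hC : (C ∪ C').card ≤ m) :
    Sched m B C tr (C' \ C).card C' := by
  have h1 := (Sched.change (m := m) (B := B) C (C ∪ C')).append
    ((Sched.of_subset h hC).append (Sched.change (C ∪ C') C'))
  have e1 : (C ∪ C') \ C = C' \ C := Finset.union_sdiff_left _ _
  have e2 : C' \ (C ∪ C') = ∅ := Finset.sdiff_eq_empty_iff_subset.2 Finset.subset_union_right
  simpa [e1, e2] using h1

/-- From every cache contents, `tr` can be served with at most `x` loads. -/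
def IOB (m B : ℕ) (tr : List ℕ) (x : ℝ) : Prop :=
  ∀ C, ∃ C' n, Sched m B C tr n C' ∧ (n : ℝ) ≤ x

theorem IOB.nil {x : ℝ} (hx : 0 ≤ x) : IOB m B [] x :=
  fun C => ⟨C, 0, .nil C, by simpa using hx⟩

theorem IOB.mono {x y : ℝ} (h : IOB m B tr x) (hxy : x ≤ y) : IOB m B tr y := fun C =>
  let ⟨C', n, h1, h2⟩ := h C
  ⟨C', n, h1, h2.trans hxy⟩

theorem IOB.append {tr₁ tr₂ : List ℕ} {x y : ℝ} (h₁ : IOB m B tr₁ x) (h₂ : IOB m B tr₂ y) :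
    IOB m B (tr₁ ++ tr₂) (x + y) := by
  intro C
  obtain ⟨C₁, n₁, h3, h4⟩ := h₁ C
  obtain ⟨C₂, n₂, h5, h6⟩ := h₂ C₁
  exact ⟨C₂, _, h3.append h5, by push_cast; linarith⟩

theorem IOB.of_subset (F : Finset ℕ) (h : ∀ a ∈ tr, a / B ∈ F) (hF : F.card ≤ m) :
    IOB m B tr F.card := by
  intro C
  refine ⟨F, _, (Sched.change C F).append (Sched.of_subset h hF), ?_⟩
  rw [add_zero]
  exact_mod_cast Finset.card_le_card Finset.sdiff_subset

theorem IOB.of_length (hm : 0 < m) (tr : List ℕ) : IOB m B tr tr.length := by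
  induction tr with
  | nil => exact IOB.nil (by simp)
  | cons a tr ih =>
    have h1 : IOB m B [a] 1 := by
      simpa using IOB.of_subset (m := m) (B := B) (tr := [a]) {a / B} (by simp)
        (by simpa using Nat.one_le_iff_ne_zero.2 hm.ne')
    simpa [add_comm] using h1.append ih

/-- A trace preceded by loading the cache contents `F`. -/
theorem IOB.of_sched {x : ℝ} (h : Sched m B F tr n C') (hx : (F.card : ℝ) + n ≤ x) :
    IOB m B tr x := by
  intro C
  refine ⟨C', _, (Sched.change C F).append h, ?_⟩
  have : ((F \ C).card : ℝ) ≤ F.card := by exact_mod_cast Finset.card_le_card Finset.sdiff_subset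
  push_cast
  linarith

/-! ### The procedure: termination and correctness -/

theorem getElem?_insert_at {β : Type*} (l : List β) (j : ℕ) (a : β) (hj : j ≤ l.length) (i : ℕ) :
    (l.take j ++ a :: l.drop j)[i]? = if i < j then l[i]? else if i = j then some a else
      l[i - 1]? := by
  have hl : (l.take j).length = j := by simp [hj]
  rw [List.getElem?_append, hl]
  split_ifs with h1 h2
  · simp [h1]
  · subst h2; simp
  · obtain ⟨e, rfl⟩ : ∃ e, i = j + 1 + e := ⟨i - j - 1, by omega⟩
    have h3 : j + 1 + e - j = e + 1 := by omega
    have h4 : j + 1 + e - 1 = j + e := by omega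
    rw [h3, h4, List.getElem?_cons_succ, List.getElem?_drop]

theorem getElem?_replace_two {β : Type*} (l : List β) (j : ℕ) (a b : β) (hj : j < l.length)
    (i : ℕ) :
    (l.take j ++ a :: b :: l.drop (j + 1))[i]? = if i < j then l[i]? else if i = j then some a
      else if i = j + 1 then some b else l[i - 1]? := by
  have hl : (l.take j).length = j := by simp [hj.le]
  rw [List.getElem?_append, hl]
  split_ifs with h1 h2 h3
  · simp [h1]
  · subst h2; simp
  · subst h3; simp
  · obtain ⟨e, rfl⟩ : ∃ e, i = j + 2 + e := ⟨i - j - 2, by omega⟩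
    have h3 : j + 2 + e - j = e + 1 + 1 := by omega
    have h4 : j + 2 + e - 1 = j + 1 + e := by omega
    rw [h3, h4, List.getElem?_cons_succ, List.getElem?_cons_succ, List.getElem?_drop]

/-- The invariant of the procedure. -/
structure Valid (S : List α) (Δ : ℕ) (c : Config α) : Prop where
  length : c.pivots.length + 1 = c.buckets.length
  sorted : c.pivots.Pairwise (· ≤ ·)
  between : Between c.pivots c.buckets
  total : (c.pivots : Multiset α) + c.buckets.sum = (S.take c.used : List α)
  used_le : c.used ≤ S.length
  lower : c.buckets.length = 1 ∨ ∀ b ∈ c.buckets, Δ ≤ 2 * b.card + 1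
  upper : ∀ b ∈ c.buckets, b.card ≤ 2 * Δ

theorem Valid.initial (S : List α) (Δ : ℕ) : Valid S Δ (Config.init α) where
  length := rfl
  sorted := by simp [Config.init]
  between := by
    intro i b hb x hx
    rcases i with _ | i
    · simp only [Config.init, List.getElem?_cons_zero, Option.some.injEq] at hb
      subst hb
      simp at hx
    · simp [Config.init] at hb
  total := by simp [Config.init]
  used_le := by simp [Config.init]
  lower := Or.inl rfl
  upper := by simp [Config.init]

theorem sum_zipWith_add {β : Type*} (l l' : List (Multiset β)) (h : l.length = l'.length) :
    (List.zipWith (· + ·) l l').sum = l.sum + l'.sum := by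
  induction l generalizing l' with
  | nil =>
    cases l' with
    | nil => simp
    | cons => simp at h
  | cons a l ih =>
    cases l' with
    | nil => simp at h
    | cons b l' =>
      simp only [List.zipWith_cons_cons, List.sum_cons]
      rw [ih l' (by simpa using h)]
      abel

theorem Valid.card_total (h : Valid S Δ c) : c.pivots.length + c.buckets.sum.card = c.used := by
  have := congrArg Multiset.card h.total
  simpa [h.used_le] using this

theorem Valid.distribute {parts : List (Multiset α)} (h : Valid S Δ c) (hused : c.used < S.length)
    (hfit : ∀ b ∈ c.buckets, b.card ≤ Δ) (hlen : parts.length = c.buckets.length)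
    (hsum : parts.sum = (((S.drop c.used).take Δ : List α) : Multiset α))
    (hbetween : Between c.pivots parts) :
    Valid S Δ ⟨c.pivots, List.zipWith (· + ·) c.buckets parts, min (c.used + Δ) S.length⟩ where
  length := by simp [hlen, h.length]
  sorted := h.sorted
  between := by
    intro i b hb x hx
    simp only [List.getElem?_zipWith] at hb
    rcases h1 : c.buckets[i]? with _ | b1
    · simp [h1] at hb
    rcases h2 : parts[i]? with _ | b2
    · simp [h1, h2] at hb
    simp only [h1, h2, Option.some.injEq] at hb
    subst hb
    rcases Multiset.mem_add.1 hx with hx | hx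
    · exact h.between i b1 h1 x hx
    · exact hbetween i b2 h2 x hx
  total := by
    simp only
    rw [sum_zipWith_add _ _ hlen.symm, ← add_assoc, h.total, hsum, Multiset.coe_add]
    congr 1
    rcases le_total (c.used + Δ) S.length with h1 | h1
    · rw [min_eq_left h1, List.take_add]
    · rw [min_eq_right h1, List.take_length, List.take_of_length_le (i := Δ)
        (by rw [List.length_drop]; omega), List.take_append_drop]
  used_le := min_le_right _ _
  lower := by
    simp only [List.length_zipWith, hlen, min_self]
    rcases h.lower with h1 | h1
    · exact Or.inl h1
    · right
      intro b hb
      obtain ⟨i, hi⟩ := List.mem_iff_getElem?.1 hb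
      simp only [List.getElem?_zipWith] at hi
      rcases h3 : c.buckets[i]? with _ | b1
      · simp [h3] at hi
      rcases h2 : parts[i]? with _ | b2
      · simp [h3, h2] at hi
      simp only [h3, h2, Option.some.injEq] at hi
      subst hi
      have := h1 b1 (List.mem_of_getElem? h3)
      rw [Multiset.card_add]
      omega
  upper := by
    intro b hb
    obtain ⟨i, hi⟩ := List.mem_iff_getElem?.1 hb
    simp only [List.getElem?_zipWith] at hi
    rcases h3 : c.buckets[i]? with _ | b1
    · simp [h3] at hi
    rcases h2 : parts[i]? with _ | b2
    · simp [h3, h2] at hi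
    simp only [h3, h2, Option.some.injEq] at hi
    subst hi
    have h4 := hfit b1 (List.mem_of_getElem? h3)
    have h5 : b2.card ≤ parts.sum.card :=
      Multiset.card_le_card (List.single_le_sum (by simp) b2 (List.mem_of_getElem? h2))
    rw [hsum] at h5
    have h6 : b2.card ≤ Δ := h5.trans (by simp)
    rw [Multiset.card_add]
    omega

theorem Valid.split {b lo hi : Multiset α} {p : α} (h : Valid S Δ c) (hb : c.buckets[j]? = some b)
    (hover : Δ < b.card) (hpart : b = lo + {p} + hi) (hrank : lo.card + 1 = (b.card + 1) / 2)
    (hlo : ∀ x ∈ lo, x ≤ p) (hhi : ∀ x ∈ hi, p ≤ x) :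
    Valid S Δ ⟨c.pivots.take j ++ p :: c.pivots.drop j,
      c.buckets.take j ++ lo :: hi :: c.buckets.drop (j + 1), c.used⟩ := by
  have hj : j < c.buckets.length := (List.getElem?_eq_some_iff.1 hb).1
  have hlen := h.length
  have hj' : j ≤ c.pivots.length := by omega
  have hp : p ∈ b := by rw [hpart]; simp
  have hcard : b.card = lo.card + 1 + hi.card := by rw [hpart]; simp
  have hbt := h.between j b hb
  have hnew : ∀ b' ∈ c.buckets.take j ++ lo :: hi :: c.buckets.drop (j + 1),
      b' ∈ c.buckets ∨ b' = lo ∨ b' = hi := by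
    intro b' hb'
    simp only [List.mem_append, List.mem_cons] at hb'
    rcases hb' with hb' | hb' | hb' | hb'
    · exact Or.inl (List.mem_of_mem_take hb')
    · exact Or.inr (Or.inl hb')
    · exact Or.inr (Or.inr hb')
    · exact Or.inl (List.mem_of_mem_drop hb')
  have hbu := h.upper b (List.mem_of_getElem? hb)
  refine ⟨?_, ?_, ?_, ?_, h.used_le, ?_, ?_⟩
  · simp; omega
  · have hs := h.sorted
    rw [← List.take_append_drop j c.pivots, List.pairwise_append] at hs
    obtain ⟨h1, h2, h3⟩ := hs
    have hpw := List.pairwise_iff_getElem.1 h.sorted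
    have h4 : ∀ x ∈ c.pivots.take j, x ≤ p := by
      intro x hx
      obtain ⟨i, hi, rfl⟩ := List.mem_iff_getElem.1 hx
      simp only [List.length_take] at hi
      obtain ⟨e, rfl⟩ : ∃ e, j = e + 1 := ⟨j - 1, by omega⟩
      have h5 := (hbt p hp).2 e (c.pivots[e]'(by omega)) rfl (by simp)
      rw [List.getElem_take]
      rcases (show i ≤ e by omega).lt_or_eq with h6 | h6
      · exact (hpw i e (by omega) (by omega) h6).trans h5
      · subst h6; exact h5
    have h5 : ∀ x ∈ c.pivots.drop j, p ≤ x := by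
      intro x hx
      obtain ⟨i, hi, rfl⟩ := List.mem_iff_getElem.1 hx
      simp only [List.length_drop] at hi
      have h5 := (hbt p hp).1 (c.pivots[j]'(by omega)) (by simp)
      rw [List.getElem_drop]
      rcases Nat.eq_zero_or_pos i with h6 | h6
      · subst h6; exact h5
      · exact h5.trans (hpw j (j + i) (by omega) (by omega) (by omega))
    rw [List.pairwise_append, List.pairwise_cons]
    refine ⟨h1, ⟨h5, h2⟩, ?_⟩
    intro x hx y hy
    rcases List.mem_cons.1 hy with rfl | hy
    · exact h4 x hx
    · exact h3 x hx y hy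
  · intro i b' hb' x hx
    rw [getElem?_replace_two _ _ _ _ hj] at hb'
    simp only [getElem?_insert_at _ _ _ hj']
    split_ifs at hb' with h1 h2 h3
    · refine ⟨fun q hq => (h.between i b' hb' x hx).1 q (by simpa [h1] using hq), ?_⟩
      intro e q he hq
      exact (h.between i b' hb' x hx).2 e q he (by simpa [show e < j by omega] using hq)
    · subst h2
      have hb'' : b' = lo := by simpa using hb'.symm
      subst hb''
      have hx' : x ∈ b := by rw [hpart]; simp [hx]
      refine ⟨fun q hq => ?_, fun e q he hq => ?_⟩
      · simp only [lt_irrefl, if_false, if_true, Option.some.injEq] at hq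
        subst hq
        exact hlo x hx
      · exact (hbt x hx').2 e q he (by simpa [show e < i by omega] using hq)
    · subst h3
      have hb'' : b' = hi := by simpa using hb'.symm
      subst hb''
      have hx' : x ∈ b := by rw [hpart]; simp [hx]
      refine ⟨fun q hq => ?_, fun e q he hq => ?_⟩
      · exact (hbt x hx').1 q (by simpa using hq)
      · obtain rfl : e = j := by omega
        simp only [lt_irrefl, if_false, if_true, Option.some.injEq] at hq
        subst hq
        exact hhi x hx
    · have h4 := h.between (i - 1) b' hb' x hx
      refine ⟨fun q hq => h4.1 q (by simpa [h1, h2] using hq), fun e q he hq => ?_⟩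
      refine h4.2 (e - 1) q (by omega) ?_
      simpa [show ¬ e < j by omega, show e ≠ j by omega] using hq
  · have ht := h.total
    have e1 : c.buckets.sum = (c.buckets.take j).sum + (b + (c.buckets.drop (j + 1)).sum) := by
      conv_lhs => rw [← List.take_append_drop j c.buckets]
      rw [List.sum_append, List.drop_eq_getElem_cons hj, List.sum_cons,
        (List.getElem?_eq_some_iff.1 hb).2]
    have e2 : (c.pivots : Multiset α) = ((c.pivots.take j : List α) : Multiset α) +
        ((c.pivots.drop j : List α) : Multiset α) := by
      rw [Multiset.coe_add, List.take_append_drop]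
    simp only
    rw [← ht, e1, e2, hpart, ← Multiset.coe_add, ← Multiset.cons_coe, ← Multiset.singleton_add]
    simp only [List.sum_append, List.sum_cons]
    abel
  · right
    intro b' hb'
    rcases hnew b' hb' with h1 | rfl | rfl
    -- `hnew` does not exclude the bucket that was split. If there was only one bucket, `b'` is that
    -- one and has more than `Δ` elements. The two new buckets, treated after this, have `⌈|b| / 2⌉
    -- - 1` and `⌊|b| / 2⌋` elements with `|b| > Δ`.
    · rcases h.lower with h2 | h2
      · obtain ⟨b0, hb0⟩ := List.length_eq_one_iff.1 h2
        rw [hb0] at h1 hb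
        have : j = 0 := by rw [hb0] at hj; simpa using hj
        subst this
        simp only [List.mem_singleton, List.getElem?_cons_zero, Option.some.injEq] at h1 hb
        subst h1 hb
        omega
      · exact h2 b' h1
    · omega
    · omega
  · intro b' hb'
    rcases hnew b' hb' with h1 | rfl | rfl
    · exact h.upper b' h1
    · omega
    · omega

theorem Valid.step (h : Valid S Δ c) (hs : Step S Δ c c') : Valid S Δ c' := by
  cases hs with
  | distribute parts h1 h2 h3 h4 h5 => exact h.distribute h1 h2 h3 h4 h5
  | split j b lo hi p h1 h2 h3 h4 h5 h6 => exact h.split h1 h2 h3 h4 h5 h6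

/-- A distribution increases `used`, a split increases the number of pivots, and both are at most
`N` by `card_total`, so the truncated differences really decrease. -/
theorem Valid.step_lt (hΔ : 0 < Δ) (h : Valid S Δ c) (hs : Step S Δ c c') :
    2 * S.length - c'.used - c'.pivots.length < 2 * S.length - c.used - c.pivots.length := by
  have h1 := h.card_total
  have h2 := h.used_le
  have h3 := (h.step hs).card_total
  cases hs with
  | distribute parts h1 _ _ _ _ => simp only at *; omega
  | split j b lo hi p hb _ _ _ _ _ =>
    simp only [List.length_append, List.length_cons, List.length_take, List.length_drop] at *
    omega

theorem terminates (S : List α) (hΔ : 0 < Δ) : Terminates S Δ := by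
  rintro ⟨f, h0, hf⟩
  have hv : ∀ n, Valid S Δ (f n) := by
    intro n
    induction n with
    | zero => rw [h0]; exact Valid.initial S Δ
    | succ n ih => exact ih.step (hf n)
  have hd : ∀ n, 2 * S.length - (f n).used - (f n).pivots.length + n ≤ 2 * S.length := by
    intro n
    induction n with
    | zero => omega
    | succ n ih =>
      have := (hv n).step_lt hΔ (hf n)
      omega
  have := hd (2 * S.length + 1)
  omega

/-- Summing `Δ ≤ 2 |b| + 1` over `k` buckets gives `k Δ ≤ 2 ∑ |b| + k`, and `∑ |b| + (k - 1) ≤ N`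
because the pivots are not in the buckets. For `k ≥ 2` the pivots make up for the `k`; for `k = 1`
the assumption `Δ ≤ N` is needed. -/
theorem Valid.bucket_count (hΔS : Δ ≤ S.length) (h : Valid S Δ c) :
    c.buckets.length * Δ ≤ 2 * S.length := by
  rcases h.lower with h1 | h1
  · rw [h1]; omega
  · have h2 : ∀ l : List (Multiset α), (∀ b ∈ l, Δ ≤ 2 * b.card + 1) →
        l.length * Δ ≤ 2 * l.sum.card + l.length := by
      intro l
      induction l with
      | nil => simp
      | cons b l ih =>
        intro hl
        have h3 := ih fun b hb => hl b (List.mem_cons_of_mem _ hb)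
        have h4 := hl b (by simp)
        simp only [List.length_cons, List.sum_cons, Multiset.card_add]
        nlinarith
    have h3 := h2 _ h1
    have h4 := h.card_total
    have h5 := h.length
    have h6 := h.used_le
    by_cases h7 : c.buckets.length = 1
    · rw [h7]; omega
    · omega

/-- The number of pivots smaller than `x` is the index of a bucket that may receive `x`. -/
theorem count_lt_le {P : List α} (hP : P.Pairwise (· ≤ ·)) (x : α) :
    (∀ p, P[P.countP (· < x)]? = some p → x ≤ p) ∧
      ∀ j p, j + 1 = P.countP (· < x) → P[j]? = some p → p ≤ x := by
  induction P with
  | nil => simp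
  | cons q P ih =>
    rw [List.pairwise_cons] at hP
    obtain ⟨ih1, ih2⟩ := ih hP.2
    by_cases hq : q < x
    · rw [List.countP_cons_of_pos (by simpa using hq)]
      refine ⟨fun p hp => ih1 p (by simpa using hp), fun j p hj hp => ?_⟩
      rcases j with _ | j
      · simp only [List.getElem?_cons_zero, Option.some.injEq] at hp
        exact hp ▸ hq.le
      · exact ih2 j p (by omega) (by simpa using hp)
    · have h0 : P.countP (· < x) = 0 := by
        rw [List.countP_eq_zero]
        intro p hp
        simpa using (not_lt.1 hq).trans (hP.1 p hp)
      rw [List.countP_cons_of_neg (by simpa using hq), h0]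
      refine ⟨fun p hp => ?_, fun j p hj => by omega⟩
      simp only [List.getElem?_cons_zero, Option.some.injEq] at hp
      exact hp ▸ not_lt.1 hq

/-- A distribution step is always possible: bucket `i` takes the elements with exactly `i` smaller
pivots. Together with `exists_median` this shows that an execution can only stop when everything is
distributed and nothing overflows. -/
theorem exists_parts {P : List α} (hP : P.Pairwise (· ≤ ·)) (l : List α) :
    ∃ parts : List (Multiset α), parts.length = P.length + 1 ∧ parts.sum = (l : Multiset α) ∧
      Between P parts := by
  classical
  refine ⟨(List.range (P.length + 1)).map fun i =>
    ((l.filter fun x => P.countP (· < x) = i : List α) : Multiset α), by simp, ?_, ?_⟩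
  · induction l with
    | nil => simp
    | cons x l ih =>
      have h1 : P.countP (· < x) < P.length + 1 := Nat.lt_succ_of_le List.countP_le_length
      rw [← Multiset.cons_coe, ← Multiset.singleton_add, ← ih]
      have h2 : ∀ n, ((List.range n).map fun i => (((x :: l).filter
          fun x => P.countP (· < x) = i : List α) : Multiset α)).sum =
          (if P.countP (· < x) < n then {x} else 0) + ((List.range n).map fun i =>
            ((l.filter fun x => P.countP (· < x) = i : List α) : Multiset α)).sum := by
        intro n
        induction n with
        | zero => simp
        | succ n ihn =>
          rw [List.range_succ, List.map_append, List.sum_append, ihn, List.map_append,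
            List.sum_append]
          simp only [List.map_cons, List.map_nil, List.sum_cons, List.sum_nil, add_zero]
          rw [List.filter_cons]
          by_cases h3 : P.countP (· < x) = n
          · simp only [h3, lt_irrefl, if_false, decide_true, if_true, Nat.lt_succ_self]
            rw [← Multiset.cons_coe, ← Multiset.singleton_add]
            abel
          · by_cases h4 : P.countP (· < x) < n
            · simp [h3, h4, show P.countP (· < x) < n + 1 by omega]
            · simp [h3, h4, show ¬ P.countP (· < x) < n + 1 by omega]
      rw [h2, if_pos h1]
  · intro i b hb x hx
    simp only [List.getElem?_map, Option.map_eq_some_iff] at hb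
    obtain ⟨i', h1, rfl⟩ := hb
    have h2 : i' = i := by
      obtain ⟨_, h⟩ := List.getElem?_eq_some_iff.1 h1
      simpa using h.symm
    subst h2
    simp only [Multiset.mem_coe, List.mem_filter, decide_eq_true_eq] at hx
    have h3 := count_lt_le hP x
    rw [hx.2] at h3
    exact h3

theorem exists_median (b : Multiset α) (hb : 0 < b.card) : ∃ lo hi : Multiset α, ∃ p,
    b = lo + {p} + hi ∧ lo.card + 1 = (b.card + 1) / 2 ∧ (∀ x ∈ lo, x ≤ p) ∧
      ∀ x ∈ hi, p ≤ x := by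
  set l := b.sort (· ≤ ·) with hl
  have hlen : l.length = b.card := Multiset.length_sort _
  have hs : l.Pairwise (· ≤ ·) := Multiset.pairwise_sort _ _
  set r := (b.card + 1) / 2 - 1 with hr
  have hrl : r < l.length := by omega
  have hdec : l = l.take r ++ l[r] :: l.drop (r + 1) := by
    rw [← List.drop_eq_getElem_cons hrl, List.take_append_drop]
  rw [hdec, List.pairwise_append, List.pairwise_cons] at hs
  refine ⟨(l.take r : List α), (l.drop (r + 1) : List α), l[r], ?_, ?_, ?_, ?_⟩
  · have h1 : b = (l : Multiset α) := (Multiset.sort_eq b _).symm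
    conv_lhs => rw [h1, hdec]
    rw [← Multiset.coe_add, ← Multiset.cons_coe, ← Multiset.singleton_add, add_assoc]
  · simp; omega
  · intro x hx
    exact hs.2.2 x (by simpa using hx) _ List.mem_cons_self
  · intro x hx
    exact hs.2.1.1 x (by simpa using hx)

theorem Valid.of_stuck (h : Valid S Δ c) (hstuck : ∀ c', ¬ Step S Δ c c') :
    c.used = S.length ∧ ∀ b ∈ c.buckets, b.card ≤ Δ := by
  have hfit : ∀ b ∈ c.buckets, b.card ≤ Δ := by
    intro b hb
    by_contra hover
    obtain ⟨j, hj⟩ := List.mem_iff_getElem?.1 hb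
    obtain ⟨lo, hi, p, h1, h2, h3, h4⟩ := exists_median b (by omega)
    exact hstuck _ (.split c j b lo hi p hj (by omega) h1 h2 h3 h4)
  refine ⟨?_, hfit⟩
  by_contra hne
  obtain ⟨parts, h1, h2, h3⟩ := exists_parts h.sorted ((S.drop c.used).take Δ)
  exact hstuck _ (.distribute c parts (lt_of_le_of_ne h.used_le hne) hfit (h1.trans h.length) h2 h3)

theorem IsRun.valid {cs : List (Config α)} (h : IsRun S Δ cs c) : Valid S Δ c := by
  obtain ⟨h1, h2, h3, -⟩ := h
  have key : ∀ (cs : List (Config α)) (c₀ : Config α), Valid S Δ c₀ → cs.head? = some c₀ →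
      cs.IsChain (Step S Δ) → cs.getLast? = some c → Valid S Δ c := by
    intro cs
    induction cs with
    | nil => simp
    | cons a cs ih =>
      intro c₀ hv hh hc hl
      simp only [List.head?_cons, Option.some.injEq] at hh
      subst hh
      rcases cs with _ | ⟨b, cs⟩
      · simp only [List.getLast?_singleton, Option.some.injEq] at hl
        exact hl ▸ hv
      · rw [List.isChain_cons_cons] at hc
        exact ih b (hv.step hc.1) rfl hc.2 (by simpa using hl)
  exact key cs _ (Valid.initial S Δ) h1 h2 h3

theorem IsRun.result (hΔ : 0 < Δ) (hΔS : Δ ≤ S.length) {cs : List (Config α)} (h : IsRun S Δ cs c) :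
    (c.buckets.length : ℝ) ≤ 2 * (S.length : ℝ) / Δ ∧ IsPartition S c ∧
      ∀ b ∈ c.buckets, b.card ≤ Δ := by
  have hv := h.valid
  obtain ⟨h1, h2⟩ := hv.of_stuck h.2.2.2
  refine ⟨?_, ⟨hv.length, hv.sorted, hv.between, ?_⟩, h2⟩
  · rw [le_div_iff₀ (by exact_mod_cast hΔ)]
    exact_mod_cast hv.bucket_count hΔS
  · rw [hv.total, h1, List.take_length]

/-! ### Complete binary trees in heap order -/

/-- The height of node `u` in the complete binary tree of height `h` (the root is node `1`). -/
def ht (h u : ℕ) : ℕ := h - Nat.log 2 u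

theorem log_lt_of_internal (h1 : 1 ≤ u) (h2 : u < 2 ^ h) : Nat.log 2 u < h :=
  (Nat.log_lt_iff_lt_pow (by norm_num) (by omega)).2 h2

theorem log_child (h1 : 1 ≤ u) (hv : v = 2 * u ∨ v = 2 * u + 1) :
    Nat.log 2 v = Nat.log 2 u + 1 := by
  have : v / 2 = u := by omega
  rw [Nat.log_of_one_lt_of_le (by norm_num) (by omega), this]

theorem ht_child (h1 : 1 ≤ u) (h2 : u < 2 ^ h) (hv : v = 2 * u ∨ v = 2 * u + 1) :
    ht h v + 1 = ht h u := by
  have := log_lt_of_internal h1 h2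
  unfold ht
  rw [log_child h1 hv]
  omega

theorem ht_pos (h1 : 1 ≤ u) (h2 : u < 2 ^ h) : 1 ≤ ht h u := by
  have := log_lt_of_internal h1 h2
  unfold ht
  omega

theorem ht_le : ht h u ≤ h := Nat.sub_le _ _

theorem ht_parent (h1 : 2 ≤ u) (h2 : u < 2 ^ h) : ht h (u / 2) = ht h u + 1 :=
  (ht_child (h := h) (u := u / 2) (v := u) (by omega) (by omega) (by omega)).symm

theorem ht_leaf (h1 : 2 ^ h ≤ u) : ht h u = 0 := by
  have : h ≤ Nat.log 2 u := (Nat.le_log_iff_pow_le (by norm_num) (by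
    have := Nat.two_pow_pos h; omega)).2 h1
  unfold ht
  omega

theorem ht_eq_of_bounds (hi : i ≤ h) (h1 : 2 ^ (h - i) ≤ u) (h2 : u < 2 ^ (h - i + 1)) :
    ht h u = i := by
  have : Nat.log 2 u = h - i := Nat.log_eq_of_pow_le_of_lt_pow h1 h2
  unfold ht
  omega

/-- `x` is `y` or an ancestor of `y`. -/
def Anc (x y : ℕ) : Prop := ∃ e, y / 2 ^ e = x

theorem Anc.refl (x : ℕ) : Anc x x := ⟨0, by simp⟩

theorem Anc.le (h : Anc x y) : x ≤ y := by
  obtain ⟨e, rfl⟩ := h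
  exact Nat.div_le_self _ _

theorem Anc.trans (h1 : Anc x y) (h2 : Anc y z) : Anc x z := by
  obtain ⟨e, rfl⟩ := h1
  obtain ⟨f, rfl⟩ := h2
  exact ⟨f + e, by rw [pow_add, Nat.div_div_eq_div_mul]⟩

theorem anc_child (hv : v = 2 * y ∨ v = 2 * y + 1) : Anc x v ↔ x = v ∨ Anc x y := by
  have h2 : v / 2 = y := by omega
  constructor
  · rintro ⟨e, rfl⟩
    rcases e with _ | e
    · left; simp
    · right
      exact ⟨e, by rw [pow_succ', ← Nat.div_div_eq_div_mul, h2]⟩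
  · rintro (rfl | h)
    · exact Anc.refl _
    · exact h.trans ⟨1, by simpa using h2⟩

theorem anc_half (h : Anc x y) (hne : x ≠ y) : Anc x (y / 2) := by
  rcases (anc_child (x := x) (y := y / 2) (v := y) (by omega)).1 h with h | h
  · exact absurd h hne
  · exact h

/-! ### The flushing process, seen abstractly -/

/-- A tree of buffers: height, capacity at each height, address of the buffer of each node and
further cells that belong to it. -/
structure BufTree where
  h : ℕ
  sz : ℕ → ℕ
  st : ℕ → ℕ
  aux : ℕ → List ℕ

/-- The current node and the number of elements in each buffer. -/
structure FlushState where
  cur : ℕ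
  len : ℕ → ℕ

variable {T : BufTree} {g g' : FlushState}

/-- The buffer lengths after an element moved from node `v` to node `u`. -/
def moveLen (len : ℕ → ℕ) (v u : ℕ) : ℕ → ℕ :=
  fun x => if x = u then len u + 1 else if x = v then len v - 1 else len x

/-- The cells accessed when an element moves from node `v` to node `u`. -/
def MoveCells (T : BufTree) (len : ℕ → ℕ) (v u : ℕ) (tr : List ℕ) : Prop :=
  tr.length ≤ 9 ∧ ∀ a ∈ tr, a ∈ T.aux v ∨ a ∈ T.aux u ∨ a = T.st v + (len v - 1) ∨
    a = T.st u + len u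

/-- One iteration of flushing node `fv`, with its number of comparisons and its accesses. -/
inductive AStep (T : BufTree) (fv : ℕ) : FlushState → ℕ → List ℕ → FlushState → Prop
  | pop (v u : ℕ) (len : ℕ → ℕ) (n : ℕ) (tr : List ℕ) (hv : v < 2 ^ T.h) (hlen : 0 < len v)
      (hu : u = 2 * v ∨ u = 2 * v + 1) (hn : n ≤ 1) (htr : MoveCells T len v u tr)
      (hfull : u < 2 ^ T.h → len u + 1 < T.sz (ht T.h u)) :
      AStep T fv ⟨v, len⟩ n tr ⟨v, moveLen len v u⟩
  | popDown (v u : ℕ) (len : ℕ → ℕ) (n : ℕ) (tr : List ℕ) (hv : v < 2 ^ T.h) (hlen : 0 < len v)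
      (hu : u = 2 * v ∨ u = 2 * v + 1) (hn : n ≤ 1) (htr : MoveCells T len v u tr)
      (huh : u < 2 ^ T.h) (hfull : T.sz (ht T.h u) ≤ len u + 1) :
      AStep T fv ⟨v, len⟩ n tr ⟨u, moveLen len v u⟩
  | up (v : ℕ) (len : ℕ → ℕ) (tr : List ℕ) (hv : v < 2 ^ T.h) (hlen : len v = 0) (hne : v ≠ fv)
      (htr : tr.length ≤ 1) (haux : ∀ a ∈ tr, a ∈ T.aux v) :
      AStep T fv ⟨v, len⟩ 0 tr ⟨v / 2, len⟩

/-- Sequences of iterations. -/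
inductive ASteps (T : BufTree) (fv : ℕ) : FlushState → ℕ → List ℕ → FlushState → Prop
  | refl (g : FlushState) : ASteps T fv g 0 [] g
  | head {g g₁ g₂ : FlushState} {n n' : ℕ} {tr tr' : List ℕ} (h : AStep T fv g n tr g₁)
      (h' : ASteps T fv g₁ n' tr' g₂) : ASteps T fv g (n + n') (tr ++ tr') g₂

/-- The invariant of flushing node `fv`. -/
structure FlushInv (T : BufTree) (fv : ℕ) (g : FlushState) : Prop where
  fv_pos : 1 ≤ fv
  cur_lt : g.cur < 2 ^ T.h
  anc : Anc fv g.cur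
  off : ∀ u, 1 ≤ u → u < 2 ^ T.h → ¬ (Anc u g.cur ∧ Anc fv u) → g.len u < T.sz (ht T.h u)
  on : ∀ u, 1 ≤ u → u < 2 ^ T.h → u ≠ 1 → g.len u ≤ T.sz (ht T.h u)

theorem FlushInv.cur_pos (h : FlushInv T fv g) : 1 ≤ g.cur := h.fv_pos.trans h.anc.le

theorem not_anc_child (hv : 1 ≤ v) (hu : u = 2 * v ∨ u = 2 * v + 1) : ¬ Anc u v :=
  fun h => by have := h.le; omega

/-- Only nodes on the path from `fv` to the current node may be full. A child below capacity after
the move keeps this true without a change of the current node. -/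
theorem FlushInv.pop (h : FlushInv T fv ⟨v, len⟩) (hu : u = 2 * v ∨ u = 2 * v + 1)
    (hfull : u < 2 ^ T.h → len u + 1 < T.sz (ht T.h u)) : FlushInv T fv ⟨v, moveLen len v u⟩ := by
  refine ⟨h.fv_pos, h.cur_lt, h.anc, ?_, ?_⟩
  · intro x h1 h2 h3
    simp only [moveLen]
    split_ifs with hx hx'
    · exact hx ▸ hfull (hx ▸ h2)
    · subst hx'
      exact absurd ⟨Anc.refl _, h.anc⟩ h3
    · exact h.off x h1 h2 h3
  · intro x h1 h2 h3
    simp only [moveLen]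
    split_ifs with hx hx'
    · exact hx ▸ (hfull (hx ▸ h2)).le
    · subst hx'
      have := h.on x h1 h2 h3
      simp only at this
      omega
    · exact h.on x h1 h2 h3

/-- Before the move the child is off the path and hence below its capacity, so one more element does
not exceed the capacity; the child then joins the path, where full buffers are allowed. -/
theorem FlushInv.popDown (h : FlushInv T fv ⟨v, len⟩) (hu : u = 2 * v ∨ u = 2 * v + 1)
    (huh : u < 2 ^ T.h) : FlushInv T fv ⟨u, moveLen len v u⟩ := by
  have hv := h.cur_pos
  simp only at hv
  have hnu := not_anc_child hv hu
  have hlt := h.off u (by omega) huh (fun hh => hnu hh.1)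
  simp only at hlt
  refine ⟨h.fv_pos, huh, (anc_child hu).2 (Or.inr h.anc), ?_, ?_⟩
  · intro x h1 h2 h3
    simp only [moveLen]
    split_ifs with hx hx'
    · subst hx
      exact absurd ⟨Anc.refl _, (anc_child hu).2 (Or.inr h.anc)⟩ h3
    · subst hx'
      exact absurd ⟨(anc_child hu).2 (Or.inr (Anc.refl _)), h.anc⟩ h3
    · refine h.off x h1 h2 fun hh => h3 ⟨(anc_child hu).2 (Or.inr hh.1), hh.2⟩
  · intro x h1 h2 h3
    simp only [moveLen]
    split_ifs with hx hx'
    · subst hx; omega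
    · subst hx'
      have := h.on x h1 h2 h3
      simp only at this
      omega
    · exact h.on x h1 h2 h3

/-- The node that leaves the path is empty, and capacities are positive. -/
theorem FlushInv.up (hsz : ∀ i, 0 < T.sz i) (h : FlushInv T fv ⟨v, len⟩) (hlen : len v = 0)
    (hne : v ≠ fv) : FlushInv T fv ⟨v / 2, len⟩ := by
  have hlt := h.cur_lt
  refine ⟨h.fv_pos, lt_of_le_of_lt (Nat.div_le_self _ _) hlt, anc_half h.anc (Ne.symm hne), ?_,
    h.on⟩
  intro x h1 h2 h3
  by_cases hx : x = v
  · subst hx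
    simp only
    rw [hlen]
    exact hsz _
  · refine h.off x h1 h2 fun hh => h3 ⟨anc_half hh.1 hx, hh.2⟩

theorem FlushInv.step (hsz : ∀ i, 0 < T.sz i) (h : FlushInv T fv g) (hs : AStep T fv g n tr g') :
    FlushInv T fv g' := by
  cases hs with
  | pop v u len n tr hv hlen hu hn htr hfull => exact h.pop hu hfull
  | popDown v u len n tr hv hlen hu hn htr huh hfull => exact h.popDown hu huh
  | up v len tr hv hlen hne htr haux => exact h.up hsz hlen hne

theorem FlushInv.steps (hsz : ∀ i, 0 < T.sz i) (h : FlushInv T fv g) (hs : ASteps T fv g n tr g') :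
    FlushInv T fv g' := by
  induction hs with
  | refl => exact h
  | head h1 _ ih => exact ih (h.step hsz h1)

theorem sum_change_two {ι : Type*} [DecidableEq ι] {M : Type*} [AddCommMonoid M] {s : Finset ι}
    {a b : ι} (ha : a ∈ s) (hb : b ∈ s) (hab : a ≠ b) {f f' : ι → M}
    (h : ∀ x ∈ s, x ≠ a → x ≠ b → f x = f' x) :
    ∑ x ∈ s, f x + (f' a + f' b) = ∑ x ∈ s, f' x + (f a + f b) := by
  have hb' : b ∈ s.erase a := Finset.mem_erase.2 ⟨hab.symm, hb⟩
  rw [← Finset.add_sum_erase s f ha, ← Finset.add_sum_erase s f' ha,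
    ← Finset.add_sum_erase _ f hb', ← Finset.add_sum_erase _ f' hb']
  have : ∑ x ∈ (s.erase a).erase b, f x = ∑ x ∈ (s.erase a).erase b, f' x := by
    refine Finset.sum_congr rfl fun x hx => ?_
    simp only [Finset.mem_erase] at hx
    exact h x hx.2.2 hx.2.1 hx.1
  rw [this]
  abel

theorem sum_change_one {ι : Type*} [DecidableEq ι] {M : Type*} [AddCommMonoid M] {s : Finset ι}
    {a : ι} (ha : a ∈ s) {f f' : ι → M} (h : ∀ x ∈ s, x ≠ a → f x = f' x) :
    ∑ x ∈ s, f x + f' a = ∑ x ∈ s, f' x + f a := by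
  rw [← Finset.add_sum_erase s f ha, ← Finset.add_sum_erase s f' ha]
  have : ∑ x ∈ s.erase a, f x = ∑ x ∈ s.erase a, f' x := by
    refine Finset.sum_congr rfl fun x hx => ?_
    simp only [Finset.mem_erase] at hx
    exact h x hx.2 hx.1
  rw [this]
  abel

/-! ### Time -/

/-- The number of element moves still to be made. -/
def workLeft (h : ℕ) (len : ℕ → ℕ) : ℕ := ∑ u ∈ Finset.range (2 ^ (h + 1)), len u * ht h u

theorem workLeft_move (hv : 1 ≤ v) (hvh : v < 2 ^ h) (hlen : 0 < len v)
    (hu : u = 2 * v ∨ u = 2 * v + 1) : workLeft h (moveLen len v u) + 1 = workLeft h len := by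
  have h1 := ht_child hv hvh hu
  have h3 := sum_change_two (s := Finset.range (2 ^ (h + 1))) (a := v) (b := u)
    (f := fun x => len x * ht h x) (f' := fun x => moveLen len v u x * ht h x)
    (by simp; omega) (by simp; omega) (by omega) (by
      intro x _ hx1 hx2
      simp [moveLen, hx1, hx2])
  simp only [moveLen, show v ≠ u by omega, if_true, if_false] at h3
  unfold workLeft
  simp only [moveLen]
  have h4 : len v * ht h v = (len v - 1) * ht h v + ht h v := by
    obtain ⟨e, he⟩ : ∃ e, len v = e + 1 := ⟨len v - 1, by omega⟩
    rw [he]; simp; ring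
  have h5 : (len u + 1) * ht h u = len u * ht h u + ht h u := by ring
  omega

/-- The potential that bounds the number of remaining accesses. -/
def flushTime (T : BufTree) (fv : ℕ) (g : FlushState) : ℕ :=
  10 * workLeft T.h g.len + (ht T.h fv - ht T.h g.cur)

theorem ht_anti (hxy : x ≤ y) : ht h y ≤ ht h x := by
  have := Nat.log_mono_right (b := 2) hxy
  unfold ht
  omega

/-- A move lowers `workLeft` by one and thus the potential by `10`: nine units for its accesses and
one for a descent, which raises the second term. That unit later pays for the access of the step
back up. -/
theorem AStep.cost (h : FlushInv T fv g) (hs : AStep T fv g n tr g') :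
    n + workLeft T.h g'.len ≤ workLeft T.h g.len ∧
      tr.length + flushTime T fv g' ≤ flushTime T fv g ∧ flushTime T fv g' < flushTime T fv g := by
  have hv := h.cur_pos
  cases hs with
  | pop v u len n tr hvh hlen hu hn htr hfull =>
    simp only at hv
    have := workLeft_move hv hvh hlen hu
    have h2 := htr.1
    simp only [flushTime]
    omega
  | popDown v u len n tr hvh hlen hu hn htr huh hfull =>
    simp only at hv
    have := workLeft_move hv hvh hlen hu
    have h2 := htr.1
    have h3 := ht_child hv hvh hu
    simp only [flushTime]
    omega
  | up v len tr hvh hlen hne htr haux =>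
    have h0 := h.anc.le
    have hfv := h.fv_pos
    simp only at h0
    have h1 : 2 ≤ v := by omega
    have h3 := ht_parent h1 hvh
    have h4 := ht_anti (h := T.h) (anc_half h.anc (Ne.symm hne)).le
    simp only at h4
    simp only [flushTime]
    omega

theorem ASteps.cost (hsz : ∀ i, 0 < T.sz i) (h : FlushInv T fv g) (hs : ASteps T fv g n tr g') :
    n + workLeft T.h g'.len ≤ workLeft T.h g.len ∧
      tr.length + flushTime T fv g' ≤ flushTime T fv g := by
  induction hs with
  | refl => simp
  | head h1 _ ih =>
    have h2 := h1.cost h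
    have h3 := ih (h.step hsz h1)
    simp only [List.length_append]
    omega

/-! ### The block transfers of the flushing process -/

/-- The heights at which buffers are streamed rather than kept in the cache. -/
abbrev StrmH (h D i : ℕ) : Prop := D ∣ i ∨ i = h

/-- The blocks of a node that are kept in the cache. -/
def nodeBlocks (T : BufTree) (B D : ℕ) (len : ℕ → ℕ) (u : ℕ) : Finset ℕ :=
  ((T.aux u).map (· / B)).toFinset ∪ {T.st u / B, T.st u / B + 1, (T.st u + len u) / B} ∪
    if StrmH T.h D (ht T.h u) then ∅
    else Finset.Icc (T.st u / B) ((T.st u + T.sz (ht T.h u)) / B)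

/-- The cache contents while nodes of the family of the current node are processed. -/
def cacheSet (T : BufTree) (B D : ℕ) (fam : ℕ → Finset ℕ) (g : FlushState) : Finset ℕ :=
  (fam g.cur).biUnion (nodeBlocks T B D g.len)

/-- The number of blocks of a buffer beyond the first two. -/
def farBlocks (T : BufTree) (B : ℕ) (len : ℕ → ℕ) (u : ℕ) : ℕ :=
  (T.st u + len u) / B - T.st u / B - 1

theorem add_div_le_add_div_add_one (x y B : ℕ) : (x + y) / B ≤ x / B + y / B + 1 := by
  rcases Nat.eq_zero_or_pos B with rfl | hB
  · simp
  · rw [Nat.add_div hB]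
    split_ifs <;> omega

/-- Leaving out the first two blocks, which are always kept in the cache, absorbs the misalignment
of the buffer, so there is no additive constant per buffer. -/
theorem farBlocks_le (T : BufTree) (B : ℕ) (len : ℕ → ℕ) (u : ℕ) :
    (farBlocks T B len u : ℝ) ≤ len u / B := by
  have h1 : farBlocks T B len u ≤ len u / B := by
    have := add_div_le_add_div_add_one (T.st u) (len u) B
    have := Nat.zero_le (len u / B)
    unfold farBlocks
    omega
  calc (farBlocks T B len u : ℝ) ≤ ((len u / B : ℕ) : ℝ) := by exact_mod_cast h1
    _ ≤ _ := Nat.cast_div_le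

theorem farBlocks_zero (h : len u = 0) : farBlocks T B len u = 0 := by
  unfold farBlocks
  simp [h]

theorem nodeBlocks_congr (h : len u = len' u) :
    nodeBlocks T B D len u = nodeBlocks T B D len' u := by
  unfold nodeBlocks
  rw [h]

theorem mem_nodeBlocks_of_aux (h : a ∈ T.aux u) : a / B ∈ nodeBlocks T B D len u := by
  refine Finset.mem_union_left _ (Finset.mem_union_left _ ?_)
  simp only [List.mem_toFinset, List.mem_map]
  exact ⟨a, h, rfl⟩

/-- Only the block at the end of the buffer can be new. For a streamed buffer it is new only if the
number of far blocks changes, and the two truncated differences form the absolute value of that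
change. A buffer kept as a whole already contains the block, unless it is over capacity. -/
theorem card_nodeBlocks_sdiff (h : ¬ StrmH T.h D (ht T.h u) → len' u ≤ T.sz (ht T.h u)) :
    (nodeBlocks T B D len' u \ nodeBlocks T B D len u).card ≤
      if StrmH T.h D (ht T.h u) then
        (farBlocks T B len' u - farBlocks T B len u) + (farBlocks T B len u - farBlocks T B len' u)
      else 0 := by
  have hsub : nodeBlocks T B D len' u \ nodeBlocks T B D len u ⊆ {(T.st u + len' u) / B} := by
    intro x hx
    simp only [nodeBlocks, Finset.mem_sdiff, Finset.mem_union, Finset.mem_insert,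
      Finset.mem_singleton] at hx ⊢
    tauto
  by_cases hs : StrmH T.h D (ht T.h u)
  · rw [if_pos hs]
    by_cases he : farBlocks T B len' u = farBlocks T B len u
    · have : nodeBlocks T B D len' u \ nodeBlocks T B D len u = ∅ := by
        rw [Finset.eq_empty_iff_forall_notMem]
        intro x hx
        have h1 := Finset.mem_singleton.1 (hsub hx)
        have h2 := (Finset.mem_sdiff.1 hx).2
        simp only [nodeBlocks, Finset.mem_union, Finset.mem_insert, Finset.mem_singleton,
          not_or] at h2
        have h3 : T.st u / B ≤ (T.st u + len' u) / B := Nat.div_le_div_right (by omega)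
        unfold farBlocks at he
        omega
      rw [this]
      simp
    · have := Finset.card_le_card hsub
      rw [Finset.card_singleton] at this
      omega
  · rw [if_neg hs, Nat.le_zero, Finset.card_eq_zero, Finset.eq_empty_iff_forall_notMem]
    intro x hx
    have h1 := Finset.mem_singleton.1 (hsub hx)
    have h2 := (Finset.mem_sdiff.1 hx).2
    simp only [nodeBlocks, if_neg hs, Finset.mem_union, Finset.mem_Icc, not_or] at h2
    refine h2.2 ⟨?_, ?_⟩
    · rw [h1]; exact Nat.div_le_div_right (by omega)
    · rw [h1]
      exact Nat.div_le_div_right (by omega)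

open Classical in
/-- The contribution of node `u` to the potential. -/
noncomputable def nodePot (T : BufTree) (B D : ℕ) (w : ℕ → ℝ) (Y : ℝ) (fv : ℕ) (g : FlushState)
    (u : ℕ) : ℝ :=
  g.len u * w (ht T.h u) +
    if StrmH T.h D (ht T.h u) then
      if Anc u g.cur ∧ Anc fv u then farBlocks T B g.len u + if u = fv then 0 else Y
      else 2 * g.len u / B - farBlocks T B g.len u +
        if 1 ≤ ht T.h u ∧ ht T.h u < T.h then 2 * Y * g.len u / T.sz (ht T.h u) else 0
    else 0

/-- The potential that bounds the number of loads. -/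
noncomputable def flushPot (T : BufTree) (B D : ℕ) (w : ℕ → ℝ) (Y : ℝ) (fv : ℕ)
    (g : FlushState) : ℝ :=
  ∑ u ∈ Finset.range (2 ^ (T.h + 1)), nodePot T B D w Y fv g u

/-- What the analysis of the block transfers requires of its parameters. -/
structure CacheParams (T : BufTree) (B D m : ℕ) (w : ℕ → ℝ) (X : ℕ) (Y : ℝ)
    (fam : ℕ → Finset ℕ) : Prop where
  B_pos : 0 < B
  sz_pos : ∀ i, 0 < T.sz i
  Y_nonneg : 0 ≤ Y
  w_zero : 0 ≤ w 0
  w_step : ∀ i < T.h, w i + (if StrmH T.h D i then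
    2 / (B : ℝ) + if 1 ≤ i then 2 * Y / T.sz i else 0 else 0) ≤ w (i + 1)
  self_mem : ∀ v, 1 ≤ v → v < 2 ^ T.h → v ∈ fam v
  child_mem : ∀ v u, 1 ≤ v → v < 2 ^ T.h → u = 2 * v ∨ u = 2 * v + 1 → u ∈ fam v
  fam_eq : ∀ v u, 1 ≤ v → u < 2 ^ T.h → u = 2 * v ∨ u = 2 * v + 1 → ¬ D ∣ ht T.h u →
    fam u = fam v
  card_le : ∀ g, 1 ≤ g.cur → g.cur < 2 ^ T.h → (cacheSet T B D fam g).card ≤ X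
  X_le : 2 * X ≤ m
  change : ∀ v u, fam v = fam u ∨ (X : ℝ) ≤ Y

/-! ### Every iteration pays for its loads out of the potential -/

section
variable {T : BufTree} {B D m : ℕ} {w : ℕ → ℝ} {X : ℕ} {Y : ℝ} {fam : ℕ → Finset ℕ}

theorem CacheParams.w_nonneg (hp : CacheParams T B D m w X Y fam) (hi : i ≤ T.h) : 0 ≤ w i := by
  induction i with
  | zero => exact hp.w_zero
  | succ i ih =>
    have h1 := hp.w_step i (by omega)
    have h2 := ih (by omega)
    have h3 : (0 : ℝ) ≤ (if StrmH T.h D i then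
        2 / (B : ℝ) + if 1 ≤ i then 2 * Y / T.sz i else 0 else 0) := by
      have := hp.Y_nonneg
      split_ifs <;> positivity
    linarith

theorem nodePot_nonneg (hp : CacheParams T B D m w X Y fam) (fv : ℕ) (g : FlushState) (u : ℕ) :
    0 ≤ nodePot T B D w Y fv g u := by
  have h1 := farBlocks_le T B g.len u
  have h2 := hp.w_nonneg (i := ht T.h u) ht_le
  have h3 := hp.Y_nonneg
  have h5 : (2 : ℝ) * g.len u / B = 2 * (g.len u / B) := by ring
  unfold nodePot
  have h6 : (0 : ℝ) ≤ g.len u * w (ht T.h u) := by positivity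
  have h7 : (0 : ℝ) ≤ if 1 ≤ ht T.h u ∧ ht T.h u < T.h then
      2 * Y * g.len u / T.sz (ht T.h u) else 0 := by split_ifs <;> positivity
  split_ifs <;> first | linarith | (simp_all; try linarith)

theorem flushPot_nonneg (hp : CacheParams T B D m w X Y fam) (fv : ℕ) (g : FlushState) :
    0 ≤ flushPot T B D w Y fv g := Finset.sum_nonneg fun u _ => nodePot_nonneg hp fv g u

/-- For a node on the path the potential holds its far blocks, which will be loaded as the buffer
shrinks. For a node off the path it holds `2 len / B` minus the far blocks, so that an arriving
element pays for the loads of writing and for the later loads of reading. The element finances this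
with the drop of its weight `w` from one height to the next. The trace touches blocks of the old and
of the new cache contents, hence the requirement `2 * X ≤ m`. -/
theorem sched_pop (hp : CacheParams T B D m w X Y fam) (hI : FlushInv T fv ⟨v, len⟩)
    (hlen : 0 < len v) (hu : u = 2 * v ∨ u = 2 * v + 1) (htr : MoveCells T len v u tr) :
    ∃ L, Sched m B (cacheSet T B D fam ⟨v, len⟩) tr L
        (cacheSet T B D fam ⟨v, moveLen len v u⟩) ∧
      L + flushPot T B D w Y fv ⟨v, moveLen len v u⟩ ≤ flushPot T B D w Y fv ⟨v, len⟩ := by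
  have hv := hI.cur_pos
  have hvh := hI.cur_lt
  simp only at hv hvh
  set len' := moveLen len v u with hlen'
  have hlu : len' u = len u + 1 := by simp [hlen', moveLen]
  have hlv : len' v = len v - 1 := by simp [hlen', moveLen, show v ≠ u by omega]
  have hlx : ∀ x, x ≠ v → x ≠ u → len' x = len x := by
    intro x h1 h2
    simp [hlen', moveLen, h1, h2]
  have hmv := hp.self_mem v hv hvh
  have hmu := hp.child_mem v u hv hvh hu
  have hht := ht_child hv hvh hu
  have hnu := not_anc_child hv hu
  have hhv : ht T.h v ≤ T.h := ht_le
  refine ⟨_, Sched.of_union ?_ ?_, ?_⟩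
  · intro a ha
    simp only [Finset.mem_union, cacheSet, Finset.mem_biUnion]
    rcases htr.2 a ha with h | h | h | h
    · exact Or.inl ⟨v, hmv, mem_nodeBlocks_of_aux h⟩
    · exact Or.inl ⟨u, hmu, mem_nodeBlocks_of_aux h⟩
    · exact Or.inr ⟨v, hmv, by simp [nodeBlocks, hlv, h]⟩
    · exact Or.inl ⟨u, hmu, by simp [nodeBlocks, h]⟩
  · have h1 := hp.card_le ⟨v, len⟩ hv hvh
    have h2 := hp.card_le ⟨v, len'⟩ hv hvh
    have h3 := hp.X_le
    exact (Finset.card_union_le _ _).trans (by omega)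
  · have hsub : cacheSet T B D fam ⟨v, len'⟩ \ cacheSet T B D fam ⟨v, len⟩ ⊆
        (nodeBlocks T B D len' v \ nodeBlocks T B D len v) ∪
          (nodeBlocks T B D len' u \ nodeBlocks T B D len u) := by
      intro x hx
      simp only [cacheSet, Finset.mem_sdiff, Finset.mem_biUnion, not_exists, not_and,
        Finset.mem_union] at hx ⊢
      obtain ⟨⟨y, hy, hxy⟩, h2⟩ := hx
      by_cases h3 : y = v
      · subst h3
        exact Or.inl ⟨hxy, h2 y hy⟩
      by_cases h4 : y = u
      · subst h4
        exact Or.inr ⟨hxy, h2 y hy⟩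
      · exact absurd (nodeBlocks_congr (T := T) (B := B) (D := D) (hlx y h3 h4) ▸ hxy) (h2 y hy)
    have hc1 := card_nodeBlocks_sdiff (T := T) (B := B) (D := D) (len := len) (len' := len')
      (u := v) (by
        intro hs
        -- The root is the one node that may be over capacity, but its height is streamed.
        by_cases h1 : v = 1
        · subst h1
          simp [StrmH, ht] at hs
        · have := hI.on v hv hvh h1
          simp only at this
          omega)
    have hc2 := card_nodeBlocks_sdiff (T := T) (B := B) (D := D) (len := len) (len' := len')
      (u := u) (by
        intro hs
        -- Leaves have height `0`, which is divisible by `D` and therefore streamed.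
        have huh : u < 2 ^ T.h := by
          by_contra h1
          rw [ht_leaf (not_lt.1 h1)] at hs
          simp [StrmH] at hs
        have := hI.off u (by omega) huh (fun hh => hnu hh.1)
        simp only at this
        omega)
    have hc := (Finset.card_le_card hsub).trans (Finset.card_union_le _ _)
    have hc' : ((cacheSet T B D fam ⟨v, len'⟩ \ cacheSet T B D fam ⟨v, len⟩).card : ℝ) ≤
        ((nodeBlocks T B D len' v \ nodeBlocks T B D len v).card : ℝ) +
          (nodeBlocks T B D len' u \ nodeBlocks T B D len u).card := by exact_mod_cast hc
    have hsum := sum_change_two (s := Finset.range (2 ^ (T.h + 1))) (a := v) (b := u)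
      (f := nodePot T B D w Y fv ⟨v, len⟩) (f' := nodePot T B D w Y fv ⟨v, len'⟩)
      (by rw [pow_succ]; simp; omega) (by rw [pow_succ]; simp; omega) (by omega) (by
        intro x _ h1 h2
        simp [nodePot, farBlocks, hlx x h1 h2])
    -- The far blocks of `v` shrink by at least the number of loads, and the departing element
    -- releases its weight `w (ht v)`.
    have hfv : ((nodeBlocks T B D len' v \ nodeBlocks T B D len v).card : ℝ) +
        nodePot T B D w Y fv ⟨v, len'⟩ v + w (ht T.h v) ≤ nodePot T B D w Y fv ⟨v, len⟩ v := by
      have e1 : farBlocks T B len' v ≤ farBlocks T B len v := by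
        have : (T.st v + len' v) / B ≤ (T.st v + len v) / B := Nat.div_le_div_right (by omega)
        unfold farBlocks
        omega
      have e2 : ((len' v : ℕ) : ℝ) = len v - 1 := by
        rw [hlv, Nat.cast_sub hlen]; simp
      simp only [nodePot, e2, hI.anc, Anc.refl, and_self, if_true]
      by_cases hs : StrmH T.h D (ht T.h v)
      · rw [if_pos hs] at hc1
        have hc1' : ((nodeBlocks T B D len' v \ nodeBlocks T B D len v).card : ℝ) +
            farBlocks T B len' v ≤ farBlocks T B len v := by
          have : (nodeBlocks T B D len' v \ nodeBlocks T B D len v).card +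
            farBlocks T B len' v ≤ farBlocks T B len v := by omega
          exact_mod_cast this
        simp only [if_pos hs]
        linarith
      · rw [if_neg hs] at hc1
        have hc1' : ((nodeBlocks T B D len' v \ nodeBlocks T B D len v).card : ℝ) = 0 := by
          exact_mod_cast Nat.le_zero.1 hc1
        simp only [if_neg hs, hc1']
        linarith
    -- The released weight covers the new weight at `u`, the amount `2 / B` for streaming, and the
    -- contribution `2 Y / sz` towards the next emptying of `u`.
    have hfu : ((nodeBlocks T B D len' u \ nodeBlocks T B D len u).card : ℝ) +
        nodePot T B D w Y fv ⟨v, len'⟩ u ≤ nodePot T B D w Y fv ⟨v, len⟩ u + w (ht T.h v) := by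
      have e1 : farBlocks T B len u ≤ farBlocks T B len' u := by
        have : (T.st u + len u) / B ≤ (T.st u + len' u) / B := Nat.div_le_div_right (by omega)
        unfold farBlocks
        omega
      have e2 : ((len' u : ℕ) : ℝ) = len u + 1 := by
        rw [hlu]; simp
      have hw := hp.w_step (ht T.h u) (by omega)
      rw [hht] at hw
      simp only [nodePot, e2, hnu, false_and, if_false]
      by_cases hs : StrmH T.h D (ht T.h u)
      · rw [if_pos hs] at hc2 hw
        have hc2' : ((nodeBlocks T B D len' u \ nodeBlocks T B D len u).card : ℝ) +
            farBlocks T B len u ≤ farBlocks T B len' u := by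
          have : (nodeBlocks T B D len' u \ nodeBlocks T B D len u).card +
            farBlocks T B len u ≤ farBlocks T B len' u := by omega
          exact_mod_cast this
        simp only [if_pos hs]
        have e3 : (2 : ℝ) * (len u + 1) / B = 2 * len u / B + 2 / B := by ring
        by_cases h1 : 1 ≤ ht T.h u
        · have h2 : ht T.h u < T.h := by omega
          rw [if_pos h1] at hw
          simp only [h1, h2, and_self, if_true, e3]
          have e4 : 2 * Y * ((len u : ℝ) + 1) / T.sz (ht T.h u) =
            2 * Y * len u / T.sz (ht T.h u) + 2 * Y / T.sz (ht T.h u) := by ring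
          rw [e4]
          linarith
        · rw [if_neg h1] at hw
          simp only [h1, false_and, if_false, e3]
          linarith
      · rw [if_neg hs] at hc2 hw
        have hc2' : ((nodeBlocks T B D len' u \ nodeBlocks T B D len u).card : ℝ) = 0 := by
          exact_mod_cast Nat.le_zero.1 hc2
        simp only [if_neg hs, hc2']
        linarith
    unfold flushPot
    linarith

theorem card_cacheSet_change (hp : CacheParams T B D m w X Y fam) (hu : 1 ≤ u) (huh : u < 2 ^ T.h) :
    ((cacheSet T B D fam ⟨u, len⟩ \ cacheSet T B D fam ⟨v, len⟩).card : ℝ) ≤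
      if fam u = fam v then 0 else Y := by
  split_ifs with h
  · have : cacheSet T B D fam ⟨u, len⟩ \ cacheSet T B D fam ⟨v, len⟩ = ∅ := by
      simp [cacheSet, h]
    rw [this]
    simp
  · have h1 : (cacheSet T B D fam ⟨u, len⟩ \ cacheSet T B D fam ⟨v, len⟩).card ≤ X :=
      (Finset.card_le_card Finset.sdiff_subset).trans (hp.card_le ⟨u, len⟩ hu huh)
    have h2 := (hp.change u v).resolve_left h
    exact le_trans (by exact_mod_cast h1) h2

/-- A full buffer has collected `2 Y`: one `Y` pays for loading the family of `u` now, the other is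
stored at `u` for the return. The streaming part does not increase because the far blocks number at
most `len / B`. At heights that are not streamed the family does not change. -/
theorem sched_down (hp : CacheParams T B D m w X Y fam) (hv : 1 ≤ v) (hvh : v < 2 ^ T.h)
    (hanc : Anc fv v) (hu : u = 2 * v ∨ u = 2 * v + 1) (huh : u < 2 ^ T.h)
    (hfull : T.sz (ht T.h u) ≤ len u) :
    ∃ L, Sched m B (cacheSet T B D fam ⟨v, len⟩) [] L (cacheSet T B D fam ⟨u, len⟩) ∧
      L + flushPot T B D w Y fv ⟨u, len⟩ ≤ flushPot T B D w Y fv ⟨v, len⟩ := by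
  have hnu := not_anc_child hv hu
  have hht := ht_child hv hvh hu
  have hhv : ht T.h v ≤ T.h := ht_le
  have hY := hp.Y_nonneg
  refine ⟨_, Sched.change _ _, ?_⟩
  have h1 := card_cacheSet_change hp (v := v) (u := u) (len := len) (by omega) huh
  have hsum := sum_change_one (s := Finset.range (2 ^ (T.h + 1))) (a := u)
    (f := nodePot T B D w Y fv ⟨v, len⟩) (f' := nodePot T B D w Y fv ⟨u, len⟩)
    (by rw [pow_succ]; simp; omega) (by
      intro x _ hx
      have hA : Anc x u = Anc x v := by rw [anc_child hu]; simp [hx]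
      simp only [nodePot]
      rw [hA])
  have hpu := ht_pos (show 1 ≤ u by omega) huh
  have hfvu : Anc fv u := (anc_child hu).2 (Or.inr hanc)
  have hne : u ≠ fv := by
    rintro rfl
    exact hnu hanc
  have key : ((cacheSet T B D fam ⟨u, len⟩ \ cacheSet T B D fam ⟨v, len⟩).card : ℝ) +
      nodePot T B D w Y fv ⟨u, len⟩ u ≤ nodePot T B D w Y fv ⟨v, len⟩ u := by
    simp only [nodePot, Anc.refl, hfvu, and_self, if_true, hne, if_false, hnu, false_and]
    by_cases hs : StrmH T.h D (ht T.h u)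
    · have h2 : ht T.h u < T.h := by omega
      simp only [if_pos hs, hpu, h2, and_self, if_true]
      have h3 := farBlocks_le T B len u
      have h4 : (1 : ℝ) ≤ len u / T.sz (ht T.h u) := by
        rw [one_le_div (by exact_mod_cast hp.sz_pos _)]
        exact_mod_cast hfull
      have h5 : 2 * Y * len u / T.sz (ht T.h u) = 2 * Y * (len u / T.sz (ht T.h u)) := by ring
      have h6 : 2 * Y * 1 ≤ 2 * Y * ((len u : ℝ) / T.sz (ht T.h u)) := by gcongr
      have h7 : (2 : ℝ) * len u / B = 2 * (len u / B) := by ring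
      have h8 : ((cacheSet T B D fam ⟨u, len⟩ \ cacheSet T B D fam ⟨v, len⟩).card : ℝ) ≤ Y :=
        h1.trans (by split_ifs <;> linarith)
      rw [h5, h7]
      linarith
    · have h2 : ¬ D ∣ ht T.h u := fun h => hs (Or.inl h)
      rw [if_pos (hp.fam_eq v u hv huh hu h2)] at h1
      simp only [if_neg hs]
      linarith
  unfold flushPot
  linarith

/-- The amount `Y` stored at the node on the way down pays for loading the family of the parent
again. The node is empty, so it retains no other potential. -/
theorem sched_up (hp : CacheParams T B D m w X Y fam) (hI : FlushInv T fv ⟨v, len⟩)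
    (hlen : len v = 0) (hne : v ≠ fv) (haux : ∀ a ∈ tr, a ∈ T.aux v) :
    ∃ L, Sched m B (cacheSet T B D fam ⟨v, len⟩) tr L (cacheSet T B D fam ⟨v / 2, len⟩) ∧
      L + flushPot T B D w Y fv ⟨v / 2, len⟩ ≤ flushPot T B D w Y fv ⟨v, len⟩ := by
  have hv := hI.cur_pos
  have hvh := hI.cur_lt
  have hle := hI.anc.le
  have hfv := hI.fv_pos
  simp only at hv hvh hle
  have hY := hp.Y_nonneg
  have hu : v = 2 * (v / 2) ∨ v = 2 * (v / 2) + 1 := by omega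
  have hnu := not_anc_child (show 1 ≤ v / 2 by omega) hu
  have hmv := hp.self_mem v hv hvh
  have hcv := hp.card_le ⟨v, len⟩ hv hvh
  have hXm := hp.X_le
  have hs1 : Sched m B (cacheSet T B D fam ⟨v, len⟩) tr 0 (cacheSet T B D fam ⟨v, len⟩) := by
    refine Sched.of_subset ?_ (by omega)
    intro a ha
    simp only [cacheSet, Finset.mem_biUnion]
    exact ⟨v, hmv, mem_nodeBlocks_of_aux (haux a ha)⟩
  refine ⟨_, by simpa using hs1.append (Sched.change _ _), ?_⟩
  have h1 := card_cacheSet_change hp (v := v) (u := v / 2) (len := len) (by omega) (by omega)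
  have hsum := sum_change_one (s := Finset.range (2 ^ (T.h + 1))) (a := v)
    (f := nodePot T B D w Y fv ⟨v, len⟩) (f' := nodePot T B D w Y fv ⟨v / 2, len⟩)
    (by rw [pow_succ]; simp; omega) (by
      intro x _ hx
      have hA : Anc x v = Anc x (v / 2) := by rw [anc_child (x := x) hu]; simp [hx]
      simp only [nodePot]
      rw [hA])
  have key : ((cacheSet T B D fam ⟨v / 2, len⟩ \ cacheSet T B D fam ⟨v, len⟩).card : ℝ) +
      nodePot T B D w Y fv ⟨v / 2, len⟩ v ≤ nodePot T B D w Y fv ⟨v, len⟩ v := by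
    have hf : farBlocks T B len v = 0 := farBlocks_zero hlen
    have hanc := hI.anc
    simp only [nodePot, Anc.refl, hanc, and_self, if_true, hne, if_false, hnu, false_and, hlen, hf]
    by_cases hs : StrmH T.h D (ht T.h v)
    · simp only [if_pos hs]
      have h8 : ((cacheSet T B D fam ⟨v / 2, len⟩ \ cacheSet T B D fam ⟨v, len⟩).card : ℝ) ≤ Y :=
        h1.trans (by split_ifs <;> linarith)
      simp
      linarith
    · have h2 : ¬ D ∣ ht T.h v := fun h => hs (Or.inl h)
      rw [if_pos (hp.fam_eq (v / 2) v (by omega) hvh hu h2).symm] at h1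
      simp only [if_neg hs]
      linarith
  unfold flushPot
  linarith

theorem AStep.sched (hp : CacheParams T B D m w X Y fam) (hI : FlushInv T fv g)
    (hs : AStep T fv g n tr g') :
    ∃ L, Sched m B (cacheSet T B D fam g) tr L (cacheSet T B D fam g') ∧
      L + flushPot T B D w Y fv g' ≤ flushPot T B D w Y fv g := by
  cases hs with
  | pop v u len n tr hv hlen hu hn htr hfull => exact sched_pop hp hI hlen hu htr
  | popDown v u len n tr hv hlen hu hn htr huh hfull =>
    obtain ⟨L1, h1, h2⟩ := sched_pop hp hI hlen hu htr
    obtain ⟨L2, h3, h4⟩ := sched_down (len := moveLen len v u) hp hI.cur_pos hv hI.anc hu huh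
      (by simpa [moveLen] using hfull)
    refine ⟨L1 + L2, by simpa using h1.append h3, ?_⟩
    push_cast
    linarith
  | up v len tr hv hlen hne htr haux => exact sched_up hp hI hlen hne haux

theorem ASteps.sched (hp : CacheParams T B D m w X Y fam) (hI : FlushInv T fv g)
    (hs : ASteps T fv g n tr g') :
    ∃ L, Sched m B (cacheSet T B D fam g) tr L (cacheSet T B D fam g') ∧
      L + flushPot T B D w Y fv g' ≤ flushPot T B D w Y fv g := by
  induction hs with
  | refl => exact ⟨0, .nil _, by simp⟩
  | head h1 _ ih =>
    obtain ⟨L1, h2, h3⟩ := h1.sched hp hI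
    obtain ⟨L2, h4, h5⟩ := ih (hI.step hp.sz_pos h1)
    refine ⟨L1 + L2, h2.append h4, ?_⟩
    push_cast
    linarith

end

/-! ### Buffer sizes -/

/-- The largest power of two that divides `i`. -/
def ruler (i : ℕ) : ℕ := 2 ^ padicValNat 2 i

theorem padicValNat_two_unique (hi : i ≠ 0) (h1 : 2 ^ e ∣ i) (h2 : ¬ 2 ^ (e + 1) ∣ i) :
    padicValNat 2 i = e := by
  rw [padicValNat_dvd_iff_le hi] at h1 h2
  omega

theorem padicValNat_two_add (hi : 0 < i) (hJ : i < 2 ^ J) :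
    padicValNat 2 (2 ^ J * q + i) = padicValNat 2 i := by
  set e := padicValNat 2 i with he
  have h1 : 2 ^ e ∣ i := (padicValNat_dvd_iff_le hi.ne').2 le_rfl
  have h2 : ¬ 2 ^ (e + 1) ∣ i := by
    rw [padicValNat_dvd_iff_le hi.ne']; omega
  have h3 : e < J := by
    have := Nat.le_of_dvd hi h1
    exact (Nat.pow_lt_pow_iff_right (by norm_num : 1 < 2)).1 (lt_of_le_of_lt this hJ)
  refine padicValNat_two_unique (by omega) ?_ ?_
  · exact Nat.dvd_add ((pow_dvd_pow 2 h3.le).mul_right q) h1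
  · intro h
    exact h2 ((Nat.dvd_add_right ((pow_dvd_pow 2 (show e + 1 ≤ J by omega)).mul_right q)).1 h)

/-- The sequence of buffer sizes repeats within every aligned interval of heights of length `2 ^ J`,
so that all base trees look alike in their interior. -/
theorem ruler_add (hi : 0 < i) (hJ : i < 2 ^ J) : ruler (2 ^ J * q + i) = ruler i := by
  unfold ruler
  rw [padicValNat_two_add hi hJ]

theorem ruler_pow (J : ℕ) : ruler (2 ^ J) = 2 ^ J := by
  unfold ruler
  rw [padicValNat.prime_pow]

theorem le_ruler (hi : 0 < i) (h : 2 ^ J ∣ i) : 2 ^ J ≤ ruler i :=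
  Nat.pow_le_pow_right (by norm_num) ((padicValNat_dvd_iff_le hi.ne').1 h)

theorem ruler_le (hi : 0 < i) : ruler i ≤ i :=
  Nat.le_of_dvd hi ((padicValNat_dvd_iff_le hi.ne').2 le_rfl)

/-- The capacity of the buffers at height `i`. -/
def bufSize (a i : ℕ) : ℕ := 2 ^ ((2 * a - 1) * ruler i)

theorem bufSize_pos (a i : ℕ) : 0 < bufSize a i := Nat.two_pow_pos _

/-- With `D = 2 ^ J`, a tree of height `2 D` consists of a top tree of height `D`, `2 ^ D` bottom
trees of height `D`, and between them `2 ^ D` buffers of size `2 ^ ((2 a - 1) D)`. The terms count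
buffer cells strictly between the root and the leaves. -/
theorem sum_bufSize_succ (a J : ℕ) :
    ∑ i ∈ Finset.Ioo 0 (2 ^ (J + 1)), 2 ^ (2 ^ (J + 1) - i) * bufSize a i =
      (2 ^ 2 ^ J + 1) * ∑ i ∈ Finset.Ioo 0 (2 ^ J), 2 ^ (2 ^ J - i) * bufSize a i +
        2 ^ 2 ^ J * 2 ^ ((2 * a - 1) * 2 ^ J) := by
  set D := 2 ^ J with hD
  have hDpos : 0 < D := Nat.two_pow_pos J
  have h2 : 2 ^ (J + 1) = 2 * D := by rw [pow_succ, hD]; ring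
  have hsplit : Finset.Ioo 0 (2 ^ (J + 1)) =
      (Finset.Ioo 0 D ∪ {D}) ∪ (Finset.Ioo 0 D).image (D + ·) := by
    ext x
    simp only [Finset.mem_Ioo, Finset.mem_union, Finset.mem_singleton, Finset.mem_image, h2]
    constructor
    · intro hx
      rcases lt_trichotomy x D with h | h | h
      · exact Or.inl (Or.inl ⟨hx.1, h⟩)
      · exact Or.inl (Or.inr h)
      · exact Or.inr ⟨x - D, by omega, by omega⟩
    · rintro ((h | h) | ⟨y, h, rfl⟩) <;> omega
  rw [hsplit, Finset.sum_union, Finset.sum_union, Finset.sum_image, Finset.sum_singleton]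
  · have e1 : ∑ i ∈ Finset.Ioo 0 D, 2 ^ (2 ^ (J + 1) - i) * bufSize a i =
        2 ^ D * ∑ i ∈ Finset.Ioo 0 D, 2 ^ (D - i) * bufSize a i := by
      rw [Finset.mul_sum]
      refine Finset.sum_congr rfl fun i hi => ?_
      simp only [Finset.mem_Ioo] at hi
      rw [h2, show 2 * D - i = D + (D - i) by omega, pow_add]
      ring
    have e2 : ∑ i ∈ Finset.Ioo 0 D, 2 ^ (2 ^ (J + 1) - (D + i)) * bufSize a (D + i) =
        ∑ i ∈ Finset.Ioo 0 D, 2 ^ (D - i) * bufSize a i := by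
      refine Finset.sum_congr rfl fun i hi => ?_
      simp only [Finset.mem_Ioo] at hi
      have : ruler (D + i) = ruler i := by
        simpa [hD] using ruler_add (J := J) (q := 1) hi.1 (hD ▸ hi.2)
      rw [h2, show 2 * D - (D + i) = D - i by omega, bufSize, this, bufSize]
    have e3 : 2 ^ (2 ^ (J + 1) - D) * bufSize a D = 2 ^ D * 2 ^ ((2 * a - 1) * D) := by
      rw [h2, show 2 * D - D = D by omega, bufSize, hD, ruler_pow]
    rw [e1, e2, e3]
    ring
  · intro x _ y _ h
    simpa using h
  · rw [Finset.disjoint_left]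
    intro x hx
    simp only [Finset.mem_Ioo, Finset.mem_singleton] at hx ⊢
    omega
  · rw [Finset.disjoint_left]
    intro x hx hx'
    simp only [Finset.mem_union, Finset.mem_Ioo, Finset.mem_singleton, Finset.mem_image] at hx hx'
    omega

/-- In the recursion the middle layer has exactly `2 ^ (2 a D)` cells; this is what the exponent `2
a - 1` is made for. As `a ≥ 2`, the recursive trees contribute at most three times as much, so the
constant `4` reproduces itself. -/
theorem sum_bufSize_le (ha : 2 ≤ a) (J : ℕ) :
    ∑ i ∈ Finset.Ioo 0 (2 ^ J), 2 ^ (2 ^ J - i) * bufSize a i ≤ 4 * 2 ^ (a * 2 ^ J) := by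
  induction J with
  | zero =>
    have : Finset.Ioo 0 (2 ^ 0) = ∅ := by ext x; simp; omega
    rw [this]
    simp
  | succ J ih =>
    rw [sum_bufSize_succ]
    set D := 2 ^ J with hD
    have hDpos : 0 < D := Nat.two_pow_pos J
    have h1 : 2 ^ D * 2 ^ ((2 * a - 1) * D) = 2 ^ (a * D) * 2 ^ (a * D) := by
      rw [← pow_add, ← pow_add]
      congr 1
      obtain ⟨e, rfl⟩ : ∃ e, a = e + 1 := ⟨a - 1, by omega⟩
      rw [show 2 * (e + 1) - 1 = 2 * e + 1 by omega]
      ring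
    have h2 : 2 ^ (a * 2 ^ (J + 1)) = 2 ^ (a * D) * 2 ^ (a * D) := by
      rw [← pow_add]
      congr 1
      rw [pow_succ]
      ring
    have h3 : 2 ^ D * 2 ^ D ≤ 2 ^ (a * D) := by
      rw [← pow_add]
      exact Nat.pow_le_pow_right (by norm_num) (by nlinarith)
    have h4 : 2 ≤ 2 ^ D := by
      calc 2 = 2 ^ 1 := rfl
        _ ≤ _ := Nat.pow_le_pow_right (by norm_num) hDpos
    rw [h1, h2]
    generalize 2 ^ (a * D) = z at *
    generalize 2 ^ D = x at *
    generalize ∑ i ∈ Finset.Ioo 0 D, 2 ^ (D - i) * bufSize a i = s at *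
    -- Here `x = 2 ^ D ≥ 2` and `x * x ≤ z`; equality at `x = 2` shows that the constant `4` is just
    -- large enough.
    have h6 : 4 * (x + 1) ≤ 3 * (x * x) := by nlinarith
    nlinarith

/-! ### The order in which the nodes are flushed -/

/-- The ancestors of leaf `y` at the heights `i, …, 1`. -/
def chain (y : ℕ) : ℕ → List ℕ
  | 0 => []
  | i + 1 => y / 2 ^ (i + 1) :: chain y i

/-- The internal nodes whose leftmost leaf is one of `y, y + 2, …, y + 2 (n - 1)`, in preorder. -/
def preorder : ℕ → ℕ → List ℕ
  | 0, _ => []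
  | n + 1, y => chain y (padicValNat 2 y) ++ preorder n (y + 2)

/-- Flushing the nodes of a list, one after the other. -/
inductive DSteps (T : BufTree) : List ℕ → (ℕ → ℕ) → ℕ → List ℕ → (ℕ → ℕ) → Prop
  | nil (len : ℕ → ℕ) : DSteps T [] len 0 [] len
  | cons {v : ℕ} {vs : List ℕ} {len len' len'' : ℕ → ℕ} {n n' : ℕ} {tr te tr' : List ℕ}
      (h : ASteps T v ⟨v, len⟩ n tr ⟨v, len'⟩) (h0 : len' v = 0)
      (hte : te.length ≤ 1) (haux : ∀ a ∈ te, a ∈ T.aux v) (h' : DSteps T vs len' n' tr' len'') :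
      DSteps T (v :: vs) len (n + n') (tr ++ te ++ tr') len''

theorem DSteps.append {vs' : List ℕ} {len'' : ℕ → ℕ} (h : DSteps T vs len n tr len')
    (h' : DSteps T vs' len' n' tr' len'') :
    DSteps T (vs ++ vs') len (n + n') (tr ++ tr') len'' := by
  induction h with
  | nil => simpa using h'
  | cons h1 h0 hte haux _ ih =>
    have := DSteps.cons h1 h0 hte haux (ih h')
    simpa [add_assoc] using this

/-- When the flushed node is the current one, the path consists of it alone, so once it is empty no
internal node is full and any other node may be flushed next. -/
theorem FlushInv.not_full (hsz : ∀ i, 0 < T.sz i) (h : FlushInv T v ⟨v, len⟩) (h0 : len v = 0) :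
    ∀ u, 1 ≤ u → u < 2 ^ T.h → len u < T.sz (ht T.h u) := by
  intro u h1 h2
  by_cases hu : u = v
  · subst hu
    rw [h0]
    exact hsz _
  · exact h.off u h1 h2 fun hh => hu (le_antisymm hh.1.le hh.2.le)

theorem FlushInv.of_not_full (hv : 1 ≤ v) (hvh : v < 2 ^ T.h)
    (h : ∀ u, 1 ≤ u → u < 2 ^ T.h → u = v ∨ len u < T.sz (ht T.h u))
    (hv' : v ≠ 1 → len v < T.sz (ht T.h v)) : FlushInv T v ⟨v, len⟩ := by
  refine ⟨hv, hvh, Anc.refl _, ?_, ?_⟩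
  · intro u h1 h2 h3
    rcases h u h1 h2 with rfl | h4
    · exact absurd ⟨Anc.refl _, Anc.refl _⟩ h3
    · exact h4
  · intro u h1 h2 h3
    rcases h u h1 h2 with rfl | h4
    · exact (hv' h3).le
    · exact h4.le

theorem DSteps.cost (hsz : ∀ i, 0 < T.sz i) (hvs : ∀ v ∈ vs, 1 ≤ v ∧ v < 2 ^ T.h)
    (hI : ∀ v ∈ vs.head?, FlushInv T v ⟨v, len⟩) (hs : DSteps T vs len n tr len') :
    n + workLeft T.h len' ≤ workLeft T.h len ∧
      tr.length + 10 * workLeft T.h len' ≤ 10 * workLeft T.h len + vs.length := by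
  induction hs with
  | nil => simp
  | @cons v vs len len' len'' n n' tr te tr' h h0 hte haux h' ih =>
    have hI1 := hI v (by simp)
    have hI2 := hI1.steps hsz h
    have h1 := h.cost hsz hI1
    have h2 := ih (fun x hx => hvs x (List.mem_cons_of_mem _ hx)) (by
      intro v' hv'
      have h3 := hvs v' (List.mem_cons_of_mem _ (List.mem_of_mem_head? hv'))
      have h4 := hI2.not_full hsz h0
      exact .of_not_full h3.1 h3.2 (fun u h5 h6 => Or.inr (h4 u h5 h6)) fun _ => h4 v' h3.1 h3.2)
    simp only [flushTime, List.length_append, List.length_cons] at *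
    omega

/-! ### The loads of flushing a list of nodes -/

section
variable {T : BufTree} {B D m : ℕ} {w : ℕ → ℝ} {X : ℕ} {Y : ℝ} {fam : ℕ → Finset ℕ}

/-- Passing from `v` to `v'` does not increase the potential: `v` is empty, and for `v'` the far
blocks number at most `len / B`, so the amount for a node on the path is at most that for a node off
the path. -/
theorem nodePot_next_le (hp : CacheParams T B D m w X Y fam) (h0 : len v = 0) (u : ℕ) :
    nodePot T B D w Y v' ⟨v', len⟩ u ≤ nodePot T B D w Y v ⟨v, len⟩ u := by
  have hiff : ∀ x : ℕ, (Anc u x ∧ Anc x u) ↔ u = x := fun x =>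
    ⟨fun hh => le_antisymm hh.1.le hh.2.le, fun hh => hh ▸ ⟨Anc.refl _, Anc.refl _⟩⟩
  have h1 := farBlocks_le T B len u
  have h3 := hp.Y_nonneg
  have h5 : (2 : ℝ) * len u / B = 2 * (len u / B) := by ring
  have h7 : (0 : ℝ) ≤ if 1 ≤ ht T.h u ∧ ht T.h u < T.h then
      2 * Y * len u / T.sz (ht T.h u) else 0 := by split_ifs <;> positivity
  simp only [nodePot]
  gcongr
  by_cases hs : StrmH T.h D (ht T.h u)
  · rw [if_pos hs, if_pos hs]
    by_cases hv' : u = v'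
    · rw [if_pos ((hiff v').2 hv'), if_pos hv']
      by_cases hv : u = v
      · rw [if_pos ((hiff v).2 hv), if_pos hv]
      · rw [if_neg (mt (hiff v).1 hv), h5]
        linarith
    · rw [if_neg (mt (hiff v').1 hv')]
      by_cases hv : u = v
      · subst hv
        have hf : farBlocks T B len u = 0 := farBlocks_zero h0
        rw [if_pos ((hiff u).2 rfl), if_pos rfl]
        simp [h0, hf]
      · rw [if_neg (mt (hiff v).1 hv)]
  · rw [if_neg hs, if_neg hs]

/-- Beyond the potential, the only loads are those for the family of the next node, and none are
needed if the family stays the same. They are charged to the next node by `c`. -/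
theorem DSteps.sched (hp : CacheParams T B D m w X Y fam) {c : ℕ → ℝ}
    (hvs : ∀ v ∈ vs, 1 ≤ v ∧ v < 2 ^ T.h) (hc : ∀ v, 0 ≤ c v)
    (hchain : vs.IsChain fun v v' => fam v' = fam v ∨ Y ≤ c v')
    (hI : ∀ v ∈ vs.head?, FlushInv T v ⟨v, len⟩) (hs : DSteps T vs len n tr len') :
    ∀ v ∈ vs.head?, ∃ L C', Sched m B (cacheSet T B D fam ⟨v, len⟩) tr L C' ∧
      L ≤ flushPot T B D w Y v ⟨v, len⟩ + (vs.tail.map c).sum := by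
  induction hs with
  | nil => simp
  | @cons v vs len len' len'' n n' tr te tr' h h0 hte haux h' ih =>
    have hI1 := hI v (by simp)
    have hI2 := hI1.steps hp.sz_pos h
    obtain ⟨L1, h1, h2⟩ := h.sched hp hI1
    have hvv := hvs v (by simp)
    have hcv := hp.card_le ⟨v, len'⟩ hvv.1 hvv.2
    have hXm := hp.X_le
    have h3 : Sched m B (cacheSet T B D fam ⟨v, len'⟩) te 0 (cacheSet T B D fam ⟨v, len'⟩) := by
      refine Sched.of_subset ?_ (by omega)
      intro a ha
      simp only [cacheSet, Finset.mem_biUnion]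
      exact ⟨v, hp.self_mem v hvv.1 hvv.2, mem_nodeBlocks_of_aux (haux a ha)⟩
    intro v₀ hv₀
    obtain rfl : v = v₀ := by simpa using hv₀
    rcases vs with _ | ⟨v', vs⟩
    · cases h'
      refine ⟨_, _, by simpa using h1.append h3, ?_⟩
      have := flushPot_nonneg hp v ⟨v, len'⟩
      simp only [List.tail_cons, List.map_nil, List.sum_nil]
      linarith
    · have hv' := hvs v' (by simp)
      have h4 := hI2.not_full hp.sz_pos h0
      rw [List.isChain_cons_cons] at hchain
      obtain ⟨L2, C', h5, h6⟩ := ih (fun x hx => hvs x (List.mem_cons_of_mem _ hx)) hchain.2 (by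
        intro x hx
        obtain rfl : v' = x := by simpa using hx
        exact .of_not_full hv'.1 hv'.2 (fun u h5 h6 => Or.inr (h4 u h5 h6))
          fun _ => h4 v' hv'.1 hv'.2) v' (by simp)
      have h7 := (h1.append h3).append ((Sched.change _ _).append h5)
      refine ⟨_, C', by simpa using h7, ?_⟩
      have h8 := card_cacheSet_change hp (v := v) (u := v') (len := len') hv'.1 hv'.2
      have h9 : ((cacheSet T B D fam ⟨v', len'⟩ \ cacheSet T B D fam ⟨v, len'⟩).card : ℝ) ≤
          c v' := by
        refine h8.trans ?_
        have := hc v'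
        rcases hchain.1 with h | h
        · rw [if_pos h]; exact this
        · split_ifs <;> linarith
      have h10 : flushPot T B D w Y v' ⟨v', len'⟩ ≤ flushPot T B D w Y v ⟨v, len'⟩ :=
        Finset.sum_le_sum fun u _ => nodePot_next_le hp h0 u
      simp only [List.tail_cons, List.map_cons, List.sum_cons] at h6 ⊢
      push_cast
      linarith

end

/-! ### Properties of the preorder -/

theorem one_le_padicValNat_two (h0 : y ≠ 0) (h : Even y) : 1 ≤ padicValNat 2 y :=
  (padicValNat_dvd_iff_le h0).1 (by simpa using h.two_dvd)

theorem padicValNat_two_le (h1 : 2 ^ h ≤ y) (h2 : y < 2 ^ (h + 1)) : padicValNat 2 y ≤ h := by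
  have hy : 0 < y := lt_of_lt_of_le (Nat.two_pow_pos h) h1
  have h3 : 2 ^ padicValNat 2 y ∣ y := (padicValNat_dvd_iff_le hy.ne').2 le_rfl
  have h4 := lt_of_le_of_lt (Nat.le_of_dvd hy h3) h2
  have := (Nat.pow_lt_pow_iff_right (by norm_num : 1 < 2)).1 h4
  omega

theorem div_pow_bounds (h1 : 2 ^ h ≤ y) (h2 : y < 2 ^ (h + 1)) (hi : i ≤ h) :
    2 ^ (h - i) ≤ y / 2 ^ i ∧ y / 2 ^ i < 2 ^ (h - i + 1) := by
  rw [Nat.le_div_iff_mul_le (Nat.two_pow_pos i), Nat.div_lt_iff_lt_mul (Nat.two_pow_pos i),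
    ← pow_add, ← pow_add]
  rw [show h - i + i = h by omega, show h - i + 1 + i = h + 1 by omega]
  exact ⟨h1, h2⟩

theorem ht_div_pow (h1 : 2 ^ h ≤ y) (h2 : y < 2 ^ (h + 1)) (hi : i ≤ h) : ht h (y / 2 ^ i) = i :=
  ht_eq_of_bounds hi (div_pow_bounds h1 h2 hi).1 (div_pow_bounds h1 h2 hi).2

/-- `v'` may follow `v` in the preorder: the two have the same ancestors above `v'`. -/
def PreAdj (h v v' : ℕ) : Prop :=
  ∀ i, ht h v' < i → i ≤ h → ht h v ≤ i ∧ v / 2 ^ (i - ht h v) = v' / 2 ^ (i - ht h v')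

theorem mem_chain : ∀ {i : ℕ}, v ∈ chain y i → ∃ e, 1 ≤ e ∧ e ≤ i ∧ v = y / 2 ^ e
  | 0, h => by simp [chain] at h
  | i + 1, h => by
    simp only [chain, List.mem_cons] at h
    rcases h with h | h
    · exact ⟨i + 1, by omega, le_rfl, h⟩
    · obtain ⟨e, h1, h2, h3⟩ := mem_chain h
      exact ⟨e, h1, by omega, h3⟩

theorem div_div_pow_sub (h : e ≤ i) : y / 2 ^ e / 2 ^ (i - e) = y / 2 ^ i := by
  rw [Nat.div_div_eq_div_mul, ← pow_add, Nat.add_sub_cancel' h]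

theorem isChain_chain (h1 : 2 ^ h ≤ y) (h2 : y < 2 ^ (h + 1)) :
    ∀ {i : ℕ}, i ≤ h → (chain y i).IsChain (PreAdj h)
  | 0, _ => by simp [chain]
  | 1, _ => by simp [chain]
  | i + 2, hi => by
    rw [chain, chain, List.isChain_cons_cons]
    refine ⟨?_, isChain_chain h1 h2 (i := i + 1) (by omega)⟩
    intro k hk hkh
    rw [ht_div_pow h1 h2 (by omega)] at hk
    rw [ht_div_pow h1 h2 hi, ht_div_pow h1 h2 (by omega), div_div_pow_sub (by omega),
      div_div_pow_sub (by omega)]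
    exact ⟨by omega, rfl⟩

theorem getLast?_chain : ∀ {i : ℕ}, 1 ≤ i → (chain y i).getLast? = some (y / 2)
  | 1, _ => by simp [chain]
  | i + 2, _ => by
    rw [chain, List.getLast?_cons, getLast?_chain (by omega)]
    simp

theorem add_two_div_pow (hi : 1 ≤ i) (hy : Even y) (h : ¬ 2 ^ i ∣ y + 2) :
    (y + 2) / 2 ^ i = y / 2 ^ i := by
  have h1 : ¬ 2 ^ i ∣ y + 1 := by
    intro h
    have h2 : 2 ∣ y + 1 := (dvd_pow_self 2 (by omega)).trans h
    obtain ⟨e, he⟩ := hy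
    omega
  rw [Nat.succ_div, if_neg h, Nat.succ_div, if_neg h1]
  simp

/-- The part of the list that belongs to leaf `y` ends with its parent, and the next part starts at
height `padicValNat 2 (y + 2)`. Above that height no multiple of the power of two lies between `y`
and `y + 2`, so the ancestors agree. -/
theorem isChain_preorder : ∀ {n y : ℕ}, 2 ^ h ≤ y → Even y →
    y + 2 * n ≤ 2 ^ (h + 1) → (preorder n y).IsChain (PreAdj h)
  | 0, y, _, _, _ => by simp [preorder]
  | n + 1, y, h1, h2, h3 => by
    have hy : y < 2 ^ (h + 1) := by omega
    have hy0 : y ≠ 0 := by omega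
    have hv := one_le_padicValNat_two hy0 h2
    rw [preorder, List.isChain_append]
    refine ⟨isChain_chain h1 hy (padicValNat_two_le h1 hy),
      isChain_preorder (by omega) (h2.add (by norm_num)) (by omega), ?_⟩
    rw [getLast?_chain hv]
    rcases n with _ | n
    · simp [preorder]
    · have hy2 : y + 2 < 2 ^ (h + 1) := by omega
      have hv2 := one_le_padicValNat_two (y := y + 2) (by omega) (h2.add (by norm_num))
      have hv3 := padicValNat_two_le (h := h) (y := y + 2) (by omega) hy2
      obtain ⟨e, he⟩ : ∃ e, padicValNat 2 (y + 2) = e + 1 := ⟨_, (Nat.sub_add_cancel hv2).symm⟩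
      simp only [preorder, he, chain, List.cons_append, List.head?_cons, Option.mem_def,
        Option.some.injEq, forall_eq']
      intro k hk hkh
      rw [he] at hv3
      rw [ht_div_pow (by omega) hy2 hv3] at hk
      have e1 : ht h (y / 2) = 1 := by
        simpa using ht_div_pow (i := 1) h1 hy (by omega)
      rw [ht_div_pow (by omega) hy2 hv3, e1, div_div_pow_sub (by omega)]
      refine ⟨by omega, ?_⟩
      rw [add_two_div_pow (by omega) h2 (by
        rw [padicValNat_dvd_iff_le (by omega)]; omega)]
      simpa using div_div_pow_sub (y := y) (e := 1) (i := k) (by omega)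

theorem mem_preorder : ∀ {n y : ℕ}, 2 ^ h ≤ y → y + 2 * n ≤ 2 ^ (h + 1) →
    v ∈ preorder n y → 1 ≤ v ∧ v < 2 ^ h
  | 0, y, _, _, hv => by simp [preorder] at hv
  | n + 1, y, h1, h3, hv => by
    have hy : y < 2 ^ (h + 1) := by omega
    rw [preorder, List.mem_append] at hv
    rcases hv with hv | hv
    · obtain ⟨e, h4, h5, rfl⟩ := mem_chain hv
      have h6 := padicValNat_two_le h1 hy
      have h7 := div_pow_bounds h1 hy (h5.trans h6)
      have h9 : 2 ^ (h - e + 1) ≤ 2 ^ h := Nat.pow_le_pow_right (by norm_num) (by omega)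
      omega
    · exact mem_preorder (by omega) (by omega) hv

theorem sum_chain (c : ℕ → ℝ) (h1 : 2 ^ h ≤ y) (h2 : y < 2 ^ (h + 1)) :
    ∀ {i : ℕ}, i ≤ h → ((chain y i).map fun v => c (ht h v)).sum = ∑ e ∈ Finset.Icc 1 i, c e
  | 0, _ => by simp [chain]
  | i + 1, hi => by
    rw [chain, List.map_cons, List.sum_cons, sum_chain c h1 h2 (by omega), ht_div_pow h1 h2 hi,
      Finset.sum_Icc_succ_top (by omega), add_comm]

theorem sum_preorder (c : ℕ → ℝ) : ∀ {n y : ℕ}, 2 ^ h ≤ y → y + 2 * n ≤ 2 ^ (h + 1) →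
    ((preorder n y).map fun v => c (ht h v)).sum =
      ∑ x ∈ Finset.range n, ∑ e ∈ Finset.Icc 1 h, if 2 ^ e ∣ y + 2 * x then c e else 0
  | 0, y, _, _ => by simp [preorder]
  | n + 1, y, h1, h3 => by
    have hy : y < 2 ^ (h + 1) := by omega
    have hy0 : y ≠ 0 := by omega
    rw [preorder, List.map_append, List.sum_append, sum_preorder c (by omega) (by omega),
      sum_chain c h1 hy (padicValNat_two_le h1 hy), Finset.sum_range_succ', add_comm]
    congr 1
    · refine Finset.sum_congr rfl fun x _ => ?_
      rw [show y + 2 + 2 * x = y + 2 * (x + 1) by ring]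
    · rw [← Finset.sum_filter]
      refine Finset.sum_congr ?_ fun _ _ => rfl
      ext e
      simp only [Finset.mem_Icc, Finset.mem_filter, mul_zero, add_zero,
        padicValNat_dvd_iff_le hy0]
      have := padicValNat_two_le h1 hy
      omega

/-- The double sum is exchanged so that nodes are counted by height; at height `e` there are at most
`2 ^ (h - e)` of them. -/
theorem sum_preorder_le (c : ℕ → ℝ) (hc : ∀ i, 0 ≤ c i) :
    ((preorder (2 ^ (h - 1)) (2 ^ h)).map fun v => c (ht h v)).sum ≤
      ∑ e ∈ Finset.Icc 1 h, 2 ^ (h - e) * c e := by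
  rcases Nat.eq_zero_or_pos h with rfl | hh
  · simp [preorder, chain]
  have hpow : 2 ^ h = 2 * 2 ^ (h - 1) := by
    rw [← pow_succ', Nat.sub_add_cancel hh]
  rw [sum_preorder c le_rfl (by rw [pow_succ]; omega), Finset.sum_comm]
  refine Finset.sum_le_sum fun e he => ?_
  rw [Finset.mem_Icc] at he
  rw [← Finset.sum_filter, Finset.sum_const, nsmul_eq_mul]
  refine mul_le_mul_of_nonneg_right ?_ (hc e)
  have : (Finset.range (2 ^ (h - 1))).filter (fun x => 2 ^ e ∣ 2 ^ h + 2 * x) ⊆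
      (Finset.range (2 ^ (h - e))).image (· * 2 ^ (e - 1)) := by
    intro x hx
    simp only [Finset.mem_filter, Finset.mem_range, Finset.mem_image] at hx ⊢
    have h1 : 2 ^ e ∣ 2 * x := (Nat.dvd_add_right (pow_dvd_pow 2 he.2)).1 hx.2
    have h2 : 2 ^ (e - 1) ∣ x := by
      rw [show 2 ^ e = 2 * 2 ^ (e - 1) by rw [← pow_succ', Nat.sub_add_cancel he.1]] at h1
      exact Nat.dvd_of_mul_dvd_mul_left (by norm_num) h1
    obtain ⟨q, rfl⟩ := h2
    refine ⟨q, ?_, by ring⟩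
    have h3 : 2 ^ (h - 1) = 2 ^ (e - 1) * 2 ^ (h - e) := by
      rw [← pow_add]
      congr 1
      omega
    rw [h3] at hx
    exact Nat.lt_of_mul_lt_mul_left hx.1
  have h4 := (Finset.card_le_card this).trans Finset.card_image_le
  rw [Finset.card_range] at h4
  exact_mod_cast h4

theorem head?_preorder : (preorder (2 ^ (h - 1)) (2 ^ h)).head? = if h = 0 then none
    else some 1 := by
  obtain ⟨e, he⟩ : ∃ e, 2 ^ (h - 1) = e + 1 :=
    ⟨_, (Nat.sub_add_cancel (Nat.one_le_two_pow)).symm⟩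
  rw [he, preorder, padicValNat.prime_pow]
  rcases h with _ | h
  · simp only [Nat.zero_sub, pow_zero] at he
    obtain rfl : e = 0 := by omega
    simp [chain, preorder]
  · simp [chain, Nat.div_self (Nat.two_pow_pos (h + 1))]

/-! ### Families of nodes -/

/-- The node `ρ` and its descendants down to depth `dep` below it. -/
def family (ρ dep : ℕ) : Finset ℕ :=
  (Finset.range (dep + 1)).biUnion fun δ => (Finset.range (2 ^ δ)).image fun x => ρ * 2 ^ δ + x

theorem mem_family {ρ dep δ : ℕ} (hδ : δ ≤ dep) (h : v / 2 ^ δ = ρ) : v ∈ family ρ dep := by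
  simp only [family, Finset.mem_biUnion, Finset.mem_range, Finset.mem_image]
  refine ⟨δ, by omega, v % 2 ^ δ, Nat.mod_lt _ (Nat.two_pow_pos δ), ?_⟩
  rw [← h, mul_comm]
  exact Nat.div_add_mod v (2 ^ δ)

theorem ht_descendant {ρ δ : ℕ} (hρ : 1 ≤ ρ) (hx : x < 2 ^ δ) :
    ht h (ρ * 2 ^ δ + x) = ht h ρ - δ := by
  have h1 : Nat.log 2 (ρ * 2 ^ δ + x) = Nat.log 2 ρ + δ := by
    refine Nat.log_eq_of_pow_le_of_lt_pow ?_ ?_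
    · rw [pow_add]
      have := Nat.mul_le_mul_right (2 ^ δ) (Nat.pow_log_le_self 2 (show ρ ≠ 0 by omega))
      omega
    · rw [show Nat.log 2 ρ + δ + 1 = Nat.log 2 ρ + 1 + δ by ring, pow_add]
      have h2 : ρ + 1 ≤ 2 ^ (Nat.log 2 ρ + 1) := Nat.lt_pow_succ_log_self (by norm_num) ρ
      have := Nat.mul_le_mul_right (2 ^ δ) h2
      rw [add_mul, one_mul] at this
      omega
  unfold ht
  omega

/-- The seven blocks are two for `aux`, three for the ends of the buffer, and two for the
misalignment of a buffer kept as a whole. -/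
theorem card_nodeBlocks_le (haux : (T.aux u).length ≤ 2) : (nodeBlocks T B D len u).card ≤
      7 + if StrmH T.h D (ht T.h u) then 0 else T.sz (ht T.h u) / B := by
  have h1 : ((T.aux u).map (· / B)).toFinset.card ≤ 2 :=
    (List.toFinset_card_le _).trans (by simpa using haux)
  have h2 : ({T.st u / B, T.st u / B + 1, (T.st u + len u) / B} : Finset ℕ).card ≤ 3 :=
    Finset.card_le_three
  have h3 := Finset.card_union_le ((T.aux u).map (· / B)).toFinset
    {T.st u / B, T.st u / B + 1, (T.st u + len u) / B}
  refine (Finset.card_union_le _ _).trans ?_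
  split_ifs
  · simp only [Finset.card_empty]
    omega
  · rw [Nat.card_Icc]
    have := add_div_le_add_div_add_one (T.st u) (T.sz (ht T.h u)) B
    have := Nat.zero_le (T.sz (ht T.h u) / B)
    omega

theorem card_family_le {ρ dep : ℕ} (hρ : 1 ≤ ρ) (haux : ∀ u, (T.aux u).length ≤ 2) :
    ((family ρ dep).biUnion (nodeBlocks T B D len)).card ≤ 14 * 2 ^ dep +
      ∑ δ ∈ Finset.range (dep + 1), 2 ^ δ * (if StrmH T.h D (ht T.h ρ - δ) then 0 else
        T.sz (ht T.h ρ - δ) / B) := by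
  have h1 : ((family ρ dep).biUnion (nodeBlocks T B D len)).card ≤
      ∑ δ ∈ Finset.range (dep + 1), 2 ^ δ * (7 + if StrmH T.h D (ht T.h ρ - δ) then 0 else
        T.sz (ht T.h ρ - δ) / B) := by
    unfold family
    rw [Finset.biUnion_biUnion]
    refine Finset.card_biUnion_le.trans (Finset.sum_le_sum fun δ _ => ?_)
    refine Finset.card_biUnion_le.trans ?_
    have h2 : ∀ u ∈ (Finset.range (2 ^ δ)).image fun x => ρ * 2 ^ δ + x,
        (nodeBlocks T B D len u).card ≤ 7 + if StrmH T.h D (ht T.h ρ - δ) then 0 else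
          T.sz (ht T.h ρ - δ) / B := by
      intro u hu
      simp only [Finset.mem_image, Finset.mem_range] at hu
      obtain ⟨x, hx, rfl⟩ := hu
      rw [← ht_descendant hρ hx]
      exact card_nodeBlocks_le (haux _)
    refine (Finset.sum_le_card_nsmul _ _ _ h2).trans ?_
    rw [smul_eq_mul]
    refine Nat.mul_le_mul_right _ (Finset.card_image_le.trans ?_)
    rw [Finset.card_range]
  refine h1.trans ?_
  simp only [mul_add, Finset.sum_add_distrib]
  gcongr
  rw [← Finset.sum_mul, Nat.geomSum_eq (by norm_num)]
  rw [pow_succ]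
  omega

theorem sum_div_le_div {ι : Type*} {s : Finset ι} {f : ι → ℕ} {e : ι → ℕ} {P : ι → Prop}
    [DecidablePred P] {G : ℕ} (hB : 0 < B) (h : ∑ i ∈ s, (if P i then 0 else f i * e i) ≤ G) :
    ∑ i ∈ s, f i * (if P i then 0 else e i / B) ≤ G / B := by
  rw [Nat.le_div_iff_mul_le hB, Finset.sum_mul]
  refine le_trans (Finset.sum_le_sum fun i _ => ?_) h
  split_ifs
  · simp
  · rw [mul_assoc]
    exact Nat.mul_le_mul_left _ (Nat.div_mul_le_self _ _)

/-- The bottom of the base tree is at a height `β` divisible by `D = 2 ^ J`. Its streamed layers are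
not counted, and by the periodicity of `ruler` the remaining layers have the sizes of the heights
strictly between `0` and `D`. A depth below `D` occurs at the top of the tree and only decreases the
sum. -/
theorem sum_base_tree_le {β dep : ℕ} (ha : 2 ≤ a) (hβ : 2 ^ J ∣ β) (hdep : dep ≤ 2 ^ J) :
    ∑ δ ∈ Finset.range (dep + 1), (if StrmH h (2 ^ J) (β + dep - δ) then 0 else
      2 ^ δ * bufSize a (β + dep - δ)) ≤ 4 * 2 ^ (a * 2 ^ J) := by
  refine le_trans ?_ (sum_bufSize_le ha J)
  rw [← Finset.sum_range_reflect]
  have h1 : ∀ i ∈ Finset.range (dep + 1), (if StrmH h (2 ^ J) (β + dep - (dep + 1 - 1 - i)) then 0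
      else 2 ^ (dep + 1 - 1 - i) * bufSize a (β + dep - (dep + 1 - 1 - i))) ≤
      if i ∈ Finset.Ioo 0 (2 ^ J) then 2 ^ (2 ^ J - i) * bufSize a i else 0 := by
    intro i hi
    rw [Finset.mem_range] at hi
    rw [show β + dep - (dep + 1 - 1 - i) = β + i by omega, show dep + 1 - 1 - i = dep - i by omega]
    by_cases hs : StrmH h (2 ^ J) (β + i)
    · rw [if_pos hs]
      exact Nat.zero_le _
    · rw [if_neg hs]
      have h2 : ¬ 2 ^ J ∣ i := fun h' => hs (Or.inl (Dvd.dvd.add hβ h'))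
      have h3 : 0 < i := Nat.pos_of_ne_zero fun h' => h2 (h' ▸ dvd_zero _)
      have h4 : i < 2 ^ J := lt_of_le_of_ne (by omega) fun h' => h2 (h' ▸ dvd_rfl)
      rw [if_pos (Finset.mem_Ioo.2 ⟨h3, h4⟩)]
      obtain ⟨q, rfl⟩ := hβ
      rw [bufSize, ruler_add h3 h4, ← bufSize]
      exact Nat.mul_le_mul_right _ (Nat.pow_le_pow_right (by norm_num) (by omega))
  refine (Finset.sum_le_sum h1).trans ?_
  rw [← Finset.sum_filter]
  refine Finset.sum_le_sum_of_subset ?_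
  intro i hi
  exact (Finset.mem_filter.1 hi).2

/-- Height `2 ^ J` cuts the tree into one upper base tree of depth `h - 2 ^ J` and `2 ^ (h - 2 ^ J)`
lower ones; each of the two layers contributes at most `4 * 2 ^ (a * h)`. -/
theorem sum_whole_tree_le (ha : 2 ≤ a) (h1 : 2 ^ J ≤ h) (h2 : h < 2 ^ (J + 1)) :
    ∑ δ ∈ Finset.range (h + 1), (if StrmH h (2 ^ J) (h - δ) then 0 else
      2 ^ δ * bufSize a (h - δ)) ≤ 8 * 2 ^ (a * h) := by
  set D := 2 ^ J with hD
  have hsplit : Finset.range (h + 1) = Finset.range (h - D + 1) ∪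
      (Finset.range D).image (fun x => x + (h - D + 1)) := by
    ext x
    simp only [Finset.mem_range, Finset.mem_union, Finset.mem_image]
    constructor
    · intro hx
      by_cases h3 : x < h - D + 1
      · exact Or.inl h3
      · exact Or.inr ⟨x - (h - D + 1), by omega, by omega⟩
    · rintro (h3 | ⟨y, h3, rfl⟩) <;> omega
  rw [hsplit, Finset.sum_union (by
    rw [Finset.disjoint_left]
    intro x hx hx'
    simp only [Finset.mem_range, Finset.mem_image] at hx hx'
    omega), Finset.sum_image (by intro x _ y _ h; simpa using h)]
  have e1 := sum_base_tree_le (a := a) (J := J) (h := h) (β := D) (dep := h - D) ha dvd_rfl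
    (by omega)
  rw [← hD, show D + (h - D) = h by omega] at e1
  have e2 : ∑ x ∈ Finset.range D, (if StrmH h D (h - (x + (h - D + 1))) then 0 else
      2 ^ (x + (h - D + 1)) * bufSize a (h - (x + (h - D + 1)))) ≤
      2 ^ (h - D) * (4 * 2 ^ (a * D)) := by
    have e3 := sum_base_tree_le (a := a) (J := J) (h := h) (β := 0) (dep := D) ha (dvd_zero _)
      le_rfl
    rw [Finset.sum_range_succ'] at e3
    refine le_trans ?_ (Nat.mul_le_mul_left _ (le_trans (Nat.le_add_right _ _) e3))
    rw [Finset.mul_sum]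
    refine Finset.sum_le_sum fun x hx => ?_
    rw [Finset.mem_range] at hx
    rw [show h - (x + (h - D + 1)) = 0 + D - (x + 1) by omega]
    split_ifs
    · simp
    · rw [← mul_assoc, ← pow_add, show x + (h - D + 1) = h - D + (x + 1) by omega]
  have e4 : 2 ^ (h - D) * 2 ^ (a * D) ≤ 2 ^ (a * h) := by
    rw [← pow_add]
    refine Nat.pow_le_pow_right (by norm_num) ?_
    have h5 : h = D + (h - D) := by omega
    have h6 : a * h = a * D + a * (h - D) := by rw [← mul_add, ← h5]
    have h7 : 1 * (h - D) ≤ a * (h - D) := Nat.mul_le_mul_right _ (by omega)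
    omega
  have e5 : 2 ^ (a * D) ≤ 2 ^ (a * h) :=
    Nat.pow_le_pow_right (by norm_num) (Nat.mul_le_mul_left _ h1)
  have e6 : 2 ^ (h - D) * (4 * 2 ^ (a * D)) = 4 * (2 ^ (h - D) * 2 ^ (a * D)) := by ring
  omega

/-! ### The weights -/

/-- The potential of an element at height `i`. -/
noncomputable def elemWeight (T : BufTree) (B D : ℕ) (Y : ℝ) (i : ℕ) : ℝ :=
  ∑ e ∈ Finset.range i, if StrmH T.h D e then
    2 / (B : ℝ) + if 1 ≤ e then 2 * Y / T.sz e else 0 else 0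

/-- There are at most `h / D + 1` multiples of `D` below `h`, and at each positive one the capacity
is at least `2 ^ ((2 a - 1) D)`. -/
theorem elemWeight_le (hsz : T.sz = bufSize a) (hY : 0 ≤ Y) : elemWeight T B (2 ^ J) Y T.h ≤
      (T.h / (2 ^ J : ℕ) + 1) * (2 / B + 2 * (Y / 2 ^ ((2 * a - 1) * 2 ^ J))) := by
  set D := 2 ^ J with hD
  have hDpos : 0 < D := Nat.two_pow_pos J
  have h1 : ∀ e ∈ Finset.range T.h, (if StrmH T.h D e then
      2 / (B : ℝ) + if 1 ≤ e then 2 * Y / T.sz e else 0 else 0) ≤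
      if D ∣ e then 2 / (B : ℝ) + 2 * (Y / 2 ^ ((2 * a - 1) * D)) else 0 := by
    intro e he
    rw [Finset.mem_range] at he
    by_cases hd : D ∣ e
    · rw [if_pos hd, if_pos (Or.inl hd)]
      gcongr
      split_ifs with h2
      · rw [mul_div_assoc]
        gcongr
        rw [hsz, bufSize]
        push_cast
        gcongr
        · norm_num
        · exact le_ruler h2 hd
      · positivity
    · rw [if_neg hd, if_neg (by rintro (h | h); exacts [hd h, by omega])]
  refine (Finset.sum_le_sum h1).trans ?_
  rw [← Finset.sum_filter, Finset.sum_const, nsmul_eq_mul]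
  gcongr
  have h3 : (Finset.range T.h).filter (D ∣ ·) ⊆ (Finset.range (T.h / D + 1)).image (D * ·) := by
    intro e he
    simp only [Finset.mem_filter, Finset.mem_range, Finset.mem_image] at he ⊢
    obtain ⟨h4, q, rfl⟩ := he
    refine ⟨q, ?_, rfl⟩
    have : q ≤ T.h / D := (Nat.le_div_iff_mul_le hDpos).2 (by rw [mul_comm]; exact h4.le)
    omega
  have h4 := (Finset.card_le_card h3).trans Finset.card_image_le
  rw [Finset.card_range] at h4
  calc (((Finset.range T.h).filter (D ∣ ·)).card : ℝ) ≤ ((T.h / D + 1 : ℕ) : ℝ) := by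
        exact_mod_cast h4
    _ ≤ T.h / D + 1 := by push_cast; gcongr; exact Nat.cast_div_le

/-! ### The two choices of parameters -/

/-- If the tree fits into memory as a whole, the cache never changes its family, so reloading costs
`Y = 0`. The scale `J` is tied to the height of the tree, so besides the root and the leaves at most
one layer is streamed. -/
theorem cacheParams_whole (ha : 2 ≤ a) (hB : 0 < B) (hsz : T.sz = bufSize a)
    (haux : ∀ u, (T.aux u).length ≤ 2) (h1 : 2 ^ J ≤ T.h) (h2 : T.h < 2 ^ (J + 1))
    (hm : 2 * (14 * 2 ^ T.h + 8 * 2 ^ (a * T.h) / B) ≤ m) :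
    CacheParams T B (2 ^ J) m (elemWeight T B (2 ^ J) 0)
      (14 * 2 ^ T.h + 8 * 2 ^ (a * T.h) / B) 0 (fun _ => family 1 T.h) where
  B_pos := hB
  sz_pos i := by rw [hsz]; exact bufSize_pos a i
  Y_nonneg := le_rfl
  w_zero := by simp [elemWeight]
  w_step i _ := by rw [elemWeight, elemWeight, Finset.sum_range_succ]
  self_mem v hv hvh := by
    refine mem_family (δ := Nat.log 2 v) (log_lt_of_internal hv hvh).le ?_
    refine Nat.div_eq_of_lt_le ?_ ?_
    · simpa using Nat.pow_log_le_self 2 (show v ≠ 0 by omega)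
    · have := Nat.lt_pow_succ_log_self (b := 2) (by norm_num) v
      rw [pow_succ] at this
      omega
  child_mem v u hv hvh hu := by
    have := log_lt_of_internal hv hvh
    have h3 := log_child hv hu
    refine mem_family (δ := Nat.log 2 u) (by omega) ?_
    refine Nat.div_eq_of_lt_le ?_ ?_
    · simpa using Nat.pow_log_le_self 2 (show u ≠ 0 by omega)
    · have := Nat.lt_pow_succ_log_self (b := 2) (by norm_num) u
      rw [pow_succ] at this
      omega
  fam_eq _ _ _ _ _ _ := rfl
  card_le g _ _ := by
    refine (card_family_le le_rfl haux).trans ?_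
    have h3 : ht T.h 1 = T.h := by simp [ht]
    rw [h3, hsz]
    gcongr
    exact sum_div_le_div hB (sum_whole_tree_le ha h1 h2)
  X_le := hm
  change _ _ := Or.inl rfl

/-- The height of the root of the base tree of a node of height `i`. -/
def baseTop (h D i : ℕ) : ℕ := min h (D * ((i - 1) / D) + D)

/-- The base tree of a node. -/
def baseTree (h D v : ℕ) : Finset ℕ :=
  family (v / 2 ^ (baseTop h D (ht h v) - ht h v))
    (baseTop h D (ht h v) - D * ((ht h v - 1) / D))

theorem baseTop_bounds (hD : 0 < D) (hi : 1 ≤ i) (hih : i ≤ h) :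
    i ≤ baseTop h D i ∧ baseTop h D i ≤ h ∧ D * ((i - 1) / D) + 1 ≤ i ∧
      baseTop h D i ≤ D * ((i - 1) / D) + D := by
  have h1 := Nat.div_add_mod (i - 1) D
  have h2 := Nat.mod_lt (i - 1) hD
  unfold baseTop
  omega

theorem div_pow_ne_zero (hv : 1 ≤ v) (h1 : ht h v + e ≤ h) : 1 ≤ v / 2 ^ e := by
  rw [Nat.le_div_iff_mul_le (Nat.two_pow_pos e), one_mul]
  unfold ht at h1
  calc 2 ^ e ≤ 2 ^ Nat.log 2 v := Nat.pow_le_pow_right (by norm_num) (by omega)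
    _ ≤ v := Nat.pow_log_le_self 2 (by omega)

theorem ht_div_pow_of_le (hv : 1 ≤ v) (h1 : ht h v + e ≤ h) (h2 : v < 2 ^ h) :
    ht h (v / 2 ^ e) = ht h v + e := by
  have h3 := div_pow_ne_zero hv h1
  have h4 := ht_descendant (h := h) (δ := e) h3 (Nat.mod_lt v (Nat.two_pow_pos e))
  rw [mul_comm, Nat.div_add_mod] at h4
  have h5 := ht_pos hv h2
  omega

/-- A node at a cut height is the root of the base tree below it, because `baseTop` uses `(i - 1) /
D`. Hence the family changes on a descent only when the child is at a cut, that is, when a full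
streamed buffer pays for it. -/
theorem cacheParams_base (ha : 2 ≤ a) (hB : 0 < B) (hsz : T.sz = bufSize a)
    (haux : ∀ u, (T.aux u).length ≤ 2) (hm : 2 * (14 * 2 ^ 2 ^ J + 4 * 2 ^ (a * 2 ^ J) / B) ≤ m) :
    CacheParams T B (2 ^ J) m
      (elemWeight T B (2 ^ J) ((14 * 2 ^ 2 ^ J + 4 * 2 ^ (a * 2 ^ J) / B : ℕ) : ℝ))
      (14 * 2 ^ 2 ^ J + 4 * 2 ^ (a * 2 ^ J) / B)
      ((14 * 2 ^ 2 ^ J + 4 * 2 ^ (a * 2 ^ J) / B : ℕ) : ℝ) (baseTree T.h (2 ^ J)) where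
  B_pos := hB
  sz_pos i := by rw [hsz]; exact bufSize_pos a i
  Y_nonneg := by positivity
  w_zero := by simp [elemWeight]
  w_step i _ := by rw [elemWeight, elemWeight, Finset.sum_range_succ]
  self_mem v hv hvh := by
    have h1 := baseTop_bounds (Nat.two_pow_pos J) (ht_pos hv hvh) ht_le
    exact mem_family (by omega) rfl
  child_mem v u hv hvh hu := by
    have h1 := baseTop_bounds (Nat.two_pow_pos J) (ht_pos hv hvh) ht_le
    refine mem_family (δ := baseTop T.h (2 ^ J) (ht T.h v) - ht T.h v + 1) (by omega) ?_
    rw [pow_succ', ← Nat.div_div_eq_div_mul, show u / 2 = v by omega]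
  fam_eq v u hv huh hu hd := by
    have hvh : v < 2 ^ T.h := by omega
    have h1 := baseTop_bounds (Nat.two_pow_pos J) (ht_pos hv hvh) ht_le
    have h2 := ht_child hv hvh hu
    have h3 : (ht T.h u - 1) / 2 ^ J = (ht T.h v - 1) / 2 ^ J := by
      rw [← h2, Nat.add_sub_cancel]
      have h4 : ht T.h u - 1 + 1 = ht T.h u :=
        Nat.sub_add_cancel (ht_pos (show 1 ≤ u by omega) huh)
      conv_rhs => rw [← h4, Nat.succ_div, h4, if_neg hd]
      simp
    have h5 : baseTop T.h (2 ^ J) (ht T.h u) = baseTop T.h (2 ^ J) (ht T.h v) := by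
      unfold baseTop
      rw [h3]
    unfold baseTree
    rw [h3, h5]
    congr 1
    rw [show baseTop T.h (2 ^ J) (ht T.h v) - ht T.h u =
      baseTop T.h (2 ^ J) (ht T.h v) - ht T.h v + 1 by omega, pow_succ',
      ← Nat.div_div_eq_div_mul, show u / 2 = v by omega]
  card_le g hv hvh := by
    have h1 := baseTop_bounds (Nat.two_pow_pos J) (ht_pos hv hvh) ht_le
    set i := ht T.h g.cur with hi
    set τ := baseTop T.h (2 ^ J) i with hτ
    have hρ : 1 ≤ g.cur / 2 ^ (τ - i) := div_pow_ne_zero (h := T.h) hv (by omega)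
    refine (card_family_le hρ haux).trans ?_
    rw [ht_div_pow_of_le hv (by omega) hvh, ← hi, hsz]
    refine add_le_add ?_ ?_
    · exact Nat.mul_le_mul_left _ (Nat.pow_le_pow_right (by norm_num) (by omega))
    · refine sum_div_le_div hB ?_
      have h3 := sum_base_tree_le (a := a) (J := J) (h := T.h) (β := 2 ^ J * ((i - 1) / 2 ^ J))
        (dep := τ - 2 ^ J * ((i - 1) / 2 ^ J)) ha (dvd_mul_right _ _) (by omega)
      rw [show 2 ^ J * ((i - 1) / 2 ^ J) + (τ - 2 ^ J * ((i - 1) / 2 ^ J)) = i + (τ - i) by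
        omega] at h3
      exact h3
  X_le := hm
  change _ _ := Or.inr le_rfl

/-- Internal nodes below height `D` lie in the base tree rooted at their ancestor of height `D`,
which consecutive nodes of the preorder share as long as the later one is below `D`. -/
theorem baseTree_eq_of_preAdj (hDh : D ≤ h) (hv : 1 ≤ ht h v) (hv' : 1 ≤ ht h v')
    (hadj : PreAdj h v v') (hlt : ht h v' < D) : baseTree h D v' = baseTree h D v := by
  obtain ⟨h1, h2⟩ := hadj D hlt hDh
  have e1 : (ht h v - 1) / D = 0 := Nat.div_eq_of_lt (by omega)
  have e2 : (ht h v' - 1) / D = 0 := Nat.div_eq_of_lt (by omega)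
  unfold baseTree baseTop
  rw [e1, e2]
  simp only [mul_zero, zero_add, min_eq_right hDh, h2]

/-! ### The block transfers of a batch -/

theorem flushPot_init_le {w : ℕ → ℝ} (hlen : ∀ u, u ≠ 1 → len u = 0) :
    flushPot T B D w Y 1 ⟨1, len⟩ ≤ len 1 * w T.h + len 1 / B := by
  have h1 : (1 : ℕ) ∈ Finset.range (2 ^ (T.h + 1)) := by
    rw [Finset.mem_range]
    exact Nat.one_lt_two_pow (by omega)
  unfold flushPot
  rw [Finset.sum_eq_single_of_mem 1 h1]
  · have h2 : ht T.h 1 = T.h := by simp [ht]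
    have h3 := farBlocks_le T B len 1
    simp only [nodePot, h2, if_true, Anc.refl, and_self]
    rw [if_pos (Or.inr rfl)]
    linarith
  · intro u _ hu
    have h0 := hlen u hu
    have h2 : ¬ (Anc u 1 ∧ Anc 1 u) := fun h => hu (le_antisymm h.1.le h.2.le)
    simp [nodePot, h0, h2, farBlocks_zero]

theorem sum_tail_le {c : ℕ → ℝ} (hc : ∀ v, 0 ≤ c v) (vs : List ℕ) :
    (vs.tail.map c).sum ≤ (vs.map c).sum := by
  rcases vs with _ | ⟨v, vs⟩
  · simp
  · simpa using hc v

theorem sum_geom_ge (hY : 0 ≤ Y) (hDh : D ≤ h) :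
    ∑ e ∈ Finset.Icc 1 h, (2 : ℝ) ^ (h - e) * (if D ≤ e then Y else 0) ≤
      2 * 2 ^ (h - D) * Y := by
  have h1 : ∑ e ∈ Finset.Icc 1 h, (2 : ℝ) ^ (h - e) * (if D ≤ e then Y else 0) ≤
      ∑ e ∈ Finset.Icc D h, (2 : ℝ) ^ (h - e) * Y := by
    simp only [mul_ite, mul_zero]
    rw [← Finset.sum_filter]
    refine Finset.sum_le_sum_of_subset_of_nonneg ?_ fun _ _ _ => by positivity
    intro e he
    simp only [Finset.mem_filter, Finset.mem_Icc] at he ⊢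
    exact ⟨he.2, he.1.2⟩
  refine h1.trans ?_
  rw [← Finset.sum_mul]
  gcongr
  have h2 : ∑ e ∈ Finset.Icc D h, (2 : ℝ) ^ (h - e) = ∑ x ∈ Finset.range (h - D + 1), (2 : ℝ) ^ x := by
    refine Finset.sum_bij (fun e _ => h - e) ?_ ?_ ?_ ?_
    · intro e he
      simp only [Finset.mem_Icc, Finset.mem_range] at he ⊢
      omega
    · intro e he e' he' h3
      simp only [Finset.mem_Icc] at he he'
      omega
    · intro x hx
      simp only [Finset.mem_range] at hx
      exact ⟨h - x, by simp only [Finset.mem_Icc]; omega, by omega⟩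
    · intro e _
      rfl
  rw [h2, geom_sum_eq (by norm_num), pow_succ]
  linarith

theorem isChain_imp_of_mem {R S : ℕ → ℕ → Prop} {l : List ℕ}
    (h : l.IsChain R) (hRS : ∀ x ∈ l, ∀ y ∈ l, R x y → S x y) : l.IsChain S := by
  induction l with
  | nil => exact .nil
  | cons x l ih =>
    rcases l with _ | ⟨y, l⟩
    · exact .singleton _
    · rw [List.isChain_cons_cons] at h ⊢
      exact ⟨hRS _ (by simp) _ (by simp) h.1, ih h.2 fun x' hx' y' hy' =>
        hRS x' (List.mem_cons_of_mem _ hx') y' (List.mem_cons_of_mem _ hy')⟩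

/-- Flushing a batch of elements at the root, with base trees of height `2 ^ j` in the cache. -/
theorem batch_io {C : ℝ} (ha : 2 ≤ a) (hB : 0 < B) (hh : 1 ≤ T.h) (hsz : T.sz = bufSize a)
    (haux : ∀ u, (T.aux u).length ≤ 2) (hC : 0 ≤ C)
    (hm : 2 * (14 * 2 ^ 2 ^ j + 8 * 2 ^ (a * 2 ^ j) / B) ≤ m)
    (hBC : (B : ℝ) ≤ C * 2 ^ ((2 * a - 2) * 2 ^ j)) (hlen : ∀ u, u ≠ 1 → len u = 0)
    (hs : DSteps T (preorder (2 ^ (T.h - 1)) (2 ^ T.h)) len n tr len') :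
    IOB m B tr ((42 + 28 * C) * (len 1 / B * (1 + T.h / (2 ^ j : ℕ)) + 2 ^ T.h +
      2 ^ (a * T.h) / B)) := by
  have hBR : (0 : ℝ) < B := by exact_mod_cast hB
  have hpow : 2 ^ T.h + 2 * 2 ^ (T.h - 1) ≤ 2 ^ (T.h + 1) := by
    rw [← pow_succ', Nat.sub_add_cancel hh, pow_succ]
    omega
  have hmem : ∀ v ∈ preorder (2 ^ (T.h - 1)) (2 ^ T.h), 1 ≤ v ∧ v < 2 ^ T.h :=
    fun v hv => mem_preorder le_rfl hpow hv
  have hhead : (1 : ℕ) ∈ (preorder (2 ^ (T.h - 1)) (2 ^ T.h)).head? := by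
    rw [head?_preorder, if_neg (by omega)]
    rfl
  have hI : ∀ v ∈ (preorder (2 ^ (T.h - 1)) (2 ^ T.h)).head?, FlushInv T v ⟨v, len⟩ := by
    intro v hv
    obtain rfl : 1 = v := by
      rw [Option.mem_def] at hhead hv
      rw [hhead] at hv
      simpa using hv
    refine .of_not_full le_rfl (Nat.one_lt_two_pow (by omega)) ?_ (by simp)
    intro u _ _
    by_cases hu : u = 1
    · exact Or.inl hu
    · right
      rw [hlen u hu, hsz]
      exact bufSize_pos a _
  have hdiv : ∀ x y : ℕ, ((x + y / B : ℕ) : ℝ) ≤ x + y / B := by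
    intro x y
    push_cast
    gcongr
    exact Nat.cast_div_le
  have hn0 : (0 : ℝ) ≤ len 1 / B := by positivity
  have hp2 : (0 : ℝ) ≤ 2 ^ (a * T.h) / B := by positivity
  have hr : (0 : ℝ) ≤ T.h / (2 ^ j : ℕ) := by positivity
  -- A tree no taller than a base tree is kept in the cache as a whole, with cuts at the power of
  -- two next to its own height.
  by_cases hcase : T.h ≤ 2 ^ j
  · have h1 : 2 ^ Nat.log 2 T.h ≤ T.h := Nat.pow_log_le_self 2 (by omega)
    have h2 : T.h < 2 ^ (Nat.log 2 T.h + 1) := Nat.lt_pow_succ_log_self (by norm_num) _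
    have hp := cacheParams_whole (T := T) (m := m) ha hB hsz haux h1 h2 (by
      refine le_trans ?_ hm
      gcongr <;> norm_num)
    obtain ⟨L, C', h3, h4⟩ := hs.sched hp (c := fun _ => 0) hmem (fun _ => le_rfl)
      (isChain_imp_of_mem (isChain_preorder le_rfl
        ((Nat.even_pow.2 ⟨even_two, by omega⟩)) hpow) fun _ _ _ _ _ => Or.inl rfl) hI 1 hhead
    refine IOB.of_sched h3 ?_
    have h5 := hp.card_le ⟨1, len⟩ le_rfl (Nat.one_lt_two_pow (by omega))
    have h6 : ((cacheSet T B (2 ^ Nat.log 2 T.h) (fun _ => family 1 T.h) ⟨1, len⟩).card : ℝ) ≤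
        14 * 2 ^ T.h + 8 * (2 ^ (a * T.h) / B) := by
      refine le_trans (b := ((14 * 2 ^ T.h + 8 * 2 ^ (a * T.h) / B : ℕ) : ℝ))
        (by exact_mod_cast h5) ((hdiv _ _).trans (le_of_eq ?_))
      push_cast
      ring
    have h7 := flushPot_init_le (T := T) (B := B) (D := 2 ^ Nat.log 2 T.h)
      (w := elemWeight T B (2 ^ Nat.log 2 T.h) 0) (Y := 0) hlen
    have h8 := elemWeight_le (T := T) (B := B) (J := Nat.log 2 T.h) hsz (le_refl (0 : ℝ))
    have h9 : (T.h : ℝ) / (2 ^ Nat.log 2 T.h : ℕ) ≤ 2 := by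
      rw [div_le_iff₀ (by positivity)]
      rw [pow_succ, mul_comm] at h2
      exact_mod_cast h2.le
    have h10 : elemWeight T B (2 ^ Nat.log 2 T.h) 0 T.h ≤ 6 / B := by
      refine h8.trans ?_
      rw [zero_div, mul_zero, add_zero]
      calc _ ≤ (2 + 1) * (2 / (B : ℝ)) := by gcongr
        _ = _ := by ring
    have h11 : (len 1 : ℝ) * elemWeight T B (2 ^ Nat.log 2 T.h) 0 T.h ≤ 6 * (len 1 / B) := by
      calc _ ≤ (len 1 : ℝ) * (6 / B) := by gcongr
        _ = _ := by ring
    have h12 : (((preorder (2 ^ (T.h - 1)) (2 ^ T.h)).tail).map fun _ => (0 : ℝ)).sum = 0 := by simp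
    rw [h12] at h4
    have h13 : 0 ≤ (len 1 : ℝ) / B * (T.h / (2 ^ j : ℕ)) := by positivity
    nlinarith
  · rw [not_le] at hcase
    set X : ℕ := 14 * 2 ^ 2 ^ j + 4 * 2 ^ (a * 2 ^ j) / B with hX
    have hp := cacheParams_base (T := T) (m := m) (J := j) ha hB hsz haux (by
      refine le_trans ?_ hm
      gcongr
      norm_num)
    rw [← hX] at hp
    obtain ⟨L, C', h3, h4⟩ := hs.sched hp (c := fun v => if 2 ^ j ≤ ht T.h v then (X : ℝ) else 0)
      hmem (fun _ => by split_ifs <;> positivity)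
      (isChain_imp_of_mem (isChain_preorder le_rfl
        ((Nat.even_pow.2 ⟨even_two, by omega⟩)) hpow) fun v hv v' hv' hadj => by
          by_cases h : 2 ^ j ≤ ht T.h v'
          · right
            rw [if_pos h]
          · left
            exact baseTree_eq_of_preAdj hcase.le (ht_pos (hmem v hv).1 (hmem v hv).2)
              (ht_pos (hmem v' hv').1 (hmem v' hv').2) hadj (by omega)) hI 1 hhead
    refine IOB.of_sched h3 ?_
    have h5 := hp.card_le ⟨1, len⟩ le_rfl (Nat.one_lt_two_pow (by omega))
    have hXR : (X : ℝ) ≤ 14 * 2 ^ 2 ^ j + 4 * (2 ^ (a * 2 ^ j) / B) := by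
      refine (hdiv _ _).trans (le_of_eq ?_)
      push_cast
      ring
    -- One load of a base tree for each node at height `D` is no more than the number of nodes plus
    -- the tree's share `2 ^ (a h)` of buffer cells, because `a ≥ 1`.
    have hXh : (2 : ℝ) ^ (T.h - 2 ^ j) * X ≤ 14 * 2 ^ T.h + 4 * (2 ^ (a * T.h) / B) := by
      have e1 : (2 : ℝ) ^ T.h = 2 ^ (T.h - 2 ^ j) * 2 ^ 2 ^ j := by
        rw [← pow_add, Nat.sub_add_cancel hcase.le]
      have e2 : (2 : ℝ) ^ (T.h - 2 ^ j) * 2 ^ (a * 2 ^ j) ≤ 2 ^ (a * T.h) := by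
        rw [← pow_add]
        refine pow_le_pow_right₀ (by norm_num) ?_
        obtain ⟨x, hx⟩ := Nat.exists_eq_add_of_le hcase.le
        rw [hx, mul_add]
        have : 1 * x ≤ a * x := Nat.mul_le_mul_right _ (by omega)
        omega
      calc (2 : ℝ) ^ (T.h - 2 ^ j) * X
          ≤ 2 ^ (T.h - 2 ^ j) * (14 * 2 ^ 2 ^ j + 4 * (2 ^ (a * 2 ^ j) / B)) := by gcongr
        _ = 14 * (2 ^ (T.h - 2 ^ j) * 2 ^ 2 ^ j) +
            4 * (2 ^ (T.h - 2 ^ j) * 2 ^ (a * 2 ^ j) / B) := by ring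
        _ ≤ _ := by rw [← e1]; gcongr
    have hX1 : (X : ℝ) ≤ 2 ^ (T.h - 2 ^ j) * X :=
      le_mul_of_one_le_left (by positivity) (one_le_pow₀ (by norm_num))
    have h6 : ((cacheSet T B (2 ^ j) (baseTree T.h (2 ^ j)) ⟨1, len⟩).card : ℝ) ≤ X := by
      exact_mod_cast h5
    have h7 := flushPot_init_le (T := T) (B := B) (D := 2 ^ j)
      (w := elemWeight T B (2 ^ j) X) (Y := X) hlen
    have h8 := elemWeight_le (T := T) (B := B) (J := j) hsz (show (0 : ℝ) ≤ (X : ℝ) by positivity)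
    -- A base tree of `X` blocks is loaded for at least `2 ^ ((2 a - 1) D)` elements. The part `2 ^
    -- D` of `X` is spread thinly enough by the bound `hBC` on `B`, the part `2 ^ (a D) / B` because
    -- `a ≤ 2 a - 1`.
    have h9 : (X : ℝ) / 2 ^ ((2 * a - 1) * 2 ^ j) ≤ (14 * C + 4) / B := by
      have e1 : (2 : ℝ) ^ ((2 * a - 1) * 2 ^ j) = 2 ^ ((2 * a - 2) * 2 ^ j) * 2 ^ 2 ^ j := by
        rw [← pow_add]
        congr 1
        obtain ⟨x, hx⟩ : ∃ x, a = x + 1 := ⟨a - 1, by omega⟩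
        rw [hx, show 2 * (x + 1) - 1 = 2 * x + 1 by omega, show 2 * (x + 1) - 2 = 2 * x by omega]
        ring
      have e2 : (2 : ℝ) ^ (a * 2 ^ j) ≤ 2 ^ ((2 * a - 1) * 2 ^ j) :=
        pow_le_pow_right₀ (by norm_num) (Nat.mul_le_mul_right _ (by omega))
      rw [div_le_div_iff₀ (by positivity) hBR]
      calc (X : ℝ) * B ≤ (14 * 2 ^ 2 ^ j + 4 * (2 ^ (a * 2 ^ j) / B)) * B := by gcongr
        _ = 14 * 2 ^ 2 ^ j * B + 4 * 2 ^ (a * 2 ^ j) := by field_simp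
        _ ≤ 14 * 2 ^ 2 ^ j * (C * 2 ^ ((2 * a - 2) * 2 ^ j)) + 4 * 2 ^ ((2 * a - 1) * 2 ^ j) := by
          gcongr
        _ = _ := by rw [e1]; ring
    have h11 : (len 1 : ℝ) * elemWeight T B (2 ^ j) X T.h ≤
        (10 + 28 * C) * (len 1 / B * (1 + T.h / (2 ^ j : ℕ))) := by
      calc _ ≤ (len 1 : ℝ) * ((T.h / (2 ^ j : ℕ) + 1) * (2 / B + 2 * ((14 * C + 4) / B))) := by
            gcongr
            refine h8.trans ?_
            gcongr
        _ = _ := by ring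
    -- Only at nodes of height at least `D` does the sequence of flushes change the base tree; the
    -- geometric sum over these heights is dominated by height `D`.
    have h12 : (((preorder (2 ^ (T.h - 1)) (2 ^ T.h)).tail).map
        fun v => if 2 ^ j ≤ ht T.h v then (X : ℝ) else 0).sum ≤ 2 * 2 ^ (T.h - 2 ^ j) * X := by
      refine (sum_tail_le (fun _ => by split_ifs <;> positivity) _).trans ?_
      refine (sum_preorder_le (h := T.h) (fun e => if 2 ^ j ≤ e then (X : ℝ) else 0)
        (fun _ => by split_ifs <;> positivity)).trans ?_
      exact sum_geom_ge (by positivity) hcase.le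
    nlinarith

/-! ### Memory layout -/

/-- Cell `x` of memory region `i`, when regions have `K` cells. -/
def loc (K i x : ℕ) : ℕ := i * K + x

theorem loc_eq_iff (hx : x < K) (hy : y < K) : loc K i x = loc K j y ↔ i = j ∧ x = y := by
  unfold loc
  constructor
  · intro h
    have hK : 0 < K := by omega
    have h1 : (i * K + x) / K = i := by
      rw [mul_comm, Nat.mul_add_div hK, Nat.div_eq_of_lt hx, add_zero]
    have h2 : (j * K + y) / K = j := by
      rw [mul_comm, Nat.mul_add_div hK, Nat.div_eq_of_lt hy, add_zero]
    have h3 : i = j := by rw [← h1, h, h2]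
    subst h3
    exact ⟨rfl, by omega⟩
  · rintro ⟨rfl, rfl⟩
    rfl

/-- All hypotheses are auto-parameters for `omega`: distinct cells are told apart by their region or
by their offset. -/
theorem loc_ne {x' : ℕ} (hx : x < K := by omega) (hx' : x' < K := by omega)
    (h : r ≠ r' ∨ x ≠ x' := by omega) : loc K r x ≠ loc K r' x' := by
  rw [Ne, loc_eq_iff hx hx']
  omega

theorem loc_add (K i x y : ℕ) : loc K i x + y = loc K i (x + y) := by
  unfold loc
  omega

/-- The expression for cell `x` of region `i`; register `6` holds the size of the regions. -/
def L (i x : Expr) : Expr := i * V 6 + x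

@[simp] theorem eval_L (ρ : ℕ → ℕ) (i x : Expr) :
    (L i x).eval ρ = loc (ρ 6) (i.eval ρ) (x.eval ρ) := rfl

def skip : Cmd := .assign 29 0

/-! ### Computing the buffer sizes -/

/-- Register `23` gets the buffer size of the height below that in register `15`. -/
def flushSize (a : ℕ) : Cmd :=
  .assign 24 1 ;;
  .loop (1 - ((V 15 - 1) - (V 15 - 1) / (2 * V 24) * (2 * V 24))) (.assign 24 (2 * V 24)) ;;
  .assign 25 (.const (2 * a - 1) * V 24) ;;
  .assign 23 1 ;;
  .loop (V 25) (.assign 23 (2 * V 23) ;; .assign 25 (V 25 - 1))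

/-- Register `24` is doubled while twice its value divides `e`, so it ends as `ruler e`; the loop
condition is `1` minus a remainder, which in truncated arithmetic tests divisibility. The power of
two is then built by doubling, with all intermediate values below the final one. -/
theorem runs_flushSize (he : s.reg 15 = e + 1) (he1 : 1 ≤ e)
    (hW : ∀ x ≤ e, 1 ≤ x → (2 * a) * bufSize a x < W) (heW : 4 * a * e + 2 < W) (ha : 2 ≤ a) :
    Runs W (flushSize a) s fun n tr s' => n = 0 ∧ tr = [] ∧ s'.mem = s.mem ∧
      s'.reg 23 = bufSize a e ∧ ∀ r, r ≠ 23 → r ≠ 24 → r ≠ 25 → s'.reg r = s.reg r := by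
  have hea : e ≤ a * e := Nat.le_mul_of_pos_left _ (by omega)
  have hae : 4 * a * e = 4 * (a * e) := by ring
  unfold flushSize
  refine runs_assign_seq ?_
  rw [runs_seq]
  refine (runs_loop_pure (G := ℕ) (fun j s' => s'.mem = s.mem ∧ s'.reg 24 = 2 ^ j ∧ 2 ^ j ∣ e ∧
    ∀ r, r ≠ 23 → r ≠ 24 → r ≠ 25 → s'.reg r = s.reg r) (fun j => e - 2 ^ j) ?_ 0 _ ?_).mono ?_
  · rintro j s' ⟨h1, h2, h3, h4⟩ hc
    have h15 : s'.reg 15 = e + 1 := by simp [h4, he]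
    simp only [eval_sub, eval_one, eval_V, h15, eval_mul, eval_div, eval_ofNat, h2,
      Nat.add_sub_cancel] at hc
    have hd : 2 * 2 ^ j ∣ e := by
      have h5 := Nat.div_add_mod e (2 * 2 ^ j)
      rw [mul_comm] at h5
      exact Nat.dvd_of_mod_eq_zero (by omega)
    have hle := Nat.le_of_dvd he1 hd
    rw [runs_assign]
    refine ⟨by simp [h2]; omega, rfl, rfl, j + 1, ⟨by simpa using h1, ?_, ?_, ?_⟩, ?_⟩
    · simp [h2, pow_succ']
    · rwa [pow_succ']
    · intro r h5 h6 h7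
      simp [h6, h4 r h5 h6 h7]
    · rw [pow_succ']
      omega
  · refine ⟨rfl, by simp, by simp, ?_⟩
    intro r h5 h6 h7
    simp [h6]
  rintro n tr s' ⟨rfl, rfl, j, ⟨h1, h2, h3, h4⟩, hc⟩
  have h15 : s'.reg 15 = e + 1 := by simp [h4, he]
  simp only [eval_sub, eval_one, eval_V, h15, eval_mul, eval_div, eval_ofNat, h2,
    Nat.add_sub_cancel] at hc
  have hnd : ¬ 2 ^ (j + 1) ∣ e := by
    rintro hd
    rw [pow_succ'] at hd
    rw [Nat.div_mul_cancel hd] at hc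
    omega
  have hr : 2 ^ j = ruler e := by
    rw [ruler, padicValNat_two_unique (by omega) h3 hnd]
  have hre := ruler_le he1
  have hra : (2 * a - 1) * ruler e ≤ 2 * (a * e) := by
    calc (2 * a - 1) * ruler e ≤ (2 * a) * e := Nat.mul_le_mul (by omega) hre
      _ = _ := by ring
  refine runs_assign_seq ?_ (by simp [h2, hr]; omega)
  refine runs_assign_seq ?_
  refine (runs_loop_pure (G := ℕ) (fun t s' => s'.mem = s.mem ∧ s'.reg 25 = t ∧
    t ≤ (2 * a - 1) * ruler e ∧ s'.reg 23 = 2 ^ ((2 * a - 1) * ruler e - t) ∧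
    ∀ r, r ≠ 23 → r ≠ 24 → r ≠ 25 → s'.reg r = s.reg r) (fun t => t) ?_
    ((2 * a - 1) * ruler e) _ ?_).mono ?_
  · rintro t s' ⟨h1, h2, h3, h4, h5⟩ hc
    simp only [eval_V, h2] at hc
    have hp : 2 * 2 ^ ((2 * a - 1) * ruler e - t) = 2 ^ ((2 * a - 1) * ruler e - (t - 1)) := by
      rw [← pow_succ']
      congr 1
      omega
    have hle : 2 ^ ((2 * a - 1) * ruler e - (t - 1)) ≤ bufSize a e :=
      Nat.pow_le_pow_right (by norm_num) (by omega)
    have hb := hW e le_rfl he1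
    have hb' : bufSize a e ≤ (2 * a) * bufSize a e := Nat.le_mul_of_pos_left _ (by omega)
    refine runs_assign_seq ?_ (by simp [h4, hp]; omega)
    rw [runs_assign]
    refine ⟨by simp [h2]; omega, rfl, rfl, t - 1, ⟨by simpa using h1, by simp [h2], by omega,
      by simp [h4, hp], ?_⟩, by omega⟩
    intro r h6 h7 h8
    simp [h6, h8, h5 r h6 h7 h8]
  · refine ⟨by simpa using h1, by simp [h2, hr], le_rfl, by simp, ?_⟩
    intro r h6 h7 h8
    simp [h6, h8, h4 r h6 h7 h8]
  rintro n tr s' ⟨rfl, rfl, t, ⟨h1, h2, h3, h4, h5⟩, hc⟩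
  simp only [eval_V, h2] at hc
  subst hc
  exact ⟨rfl, rfl, h1, by rw [h4]; rfl, h5⟩

/-! ### The state of a distribution -/

/-- What stays fixed while a batch is distributed: the number of buckets, the size of the memory
regions, the number of elements distributed before, the height of the tree of buffers, the pivots,
the memory region and the old size of each bucket, the elements of the batch, and the memory
contents at the beginning. -/
structure Batch (α : Type u) where
  k : ℕ
  K : ℕ
  used : ℕ
  h : ℕ
  a : ℕ
  P : ℕ → α
  slot : ℕ → ℕ
  size : ℕ → ℕ
  items : Multiset α
  mem₀ : ℕ → Cell α

namespace Batch

/-- The memory region of a node. -/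
def region (b : Batch α) (v : ℕ) : ℕ :=
  if v < 2 ^ b.h then 2 * (v - 1) else 11 + 2 * b.slot (v - 2 ^ b.h)

/-- The offset of the buffer of a node in its memory region. -/
def off (b : Batch α) (v : ℕ) : ℕ := if v < 2 ^ b.h then b.used else b.size (v - 2 ^ b.h)

/-- The cell that stores the number of elements of a node. -/
def cnt (b : Batch α) (v : ℕ) : ℕ :=
  if v < 2 ^ b.h then loc b.K 5 v else loc b.K 3 (2 * (v - 2 ^ b.h) + 1)

/-- The number of elements at a node that do not belong to the batch. -/
def base (b : Batch α) (v : ℕ) : ℕ := if v < 2 ^ b.h then 0 else b.size (v - 2 ^ b.h)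

/-- The leftmost bucket to the right of the middle of the subtree of an internal node. -/
def mid (b : Batch α) (v : ℕ) : ℕ := (2 * v + 1) * 2 ^ (ht b.h v - 1) - 2 ^ b.h

/-- The root lies in region `0` at offset `used`, so its buffer is the batch in the input array
itself. Internal nodes use the even regions. The odd ones hold the pivots (`1`), the table (`3`),
the counts (`5`), scratch cells (`7`), samples (`9`), and from `11` on the buckets. `aux` lists the
count and the separating pivot of an internal node, or the table entries of a bucket. -/
def tree (b : Batch α) : BufTree where
  h := b.h
  sz := bufSize b.a
  st v := loc b.K (b.region v) (b.off v)
  aux v := if v < 2 ^ b.h then [loc b.K 5 v, loc b.K 1 (b.mid v - 1)]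
    else [loc b.K 3 (2 * (v - 2 ^ b.h)), loc b.K 3 (2 * (v - 2 ^ b.h) + 1)]

/-- The subtree of node `v` holds an element `x` that belongs to one of its buckets. -/
def InB (b : Batch α) (v : ℕ) (x : α) : Prop :=
  v * 2 ^ ht b.h v < 2 ^ b.h + b.k ∧
  (∀ i, i + 1 < b.k → i + 1 + 2 ^ b.h = v * 2 ^ ht b.h v → b.P i ≤ x) ∧
  ∀ i, i + 1 < b.k → i + 1 + 2 ^ b.h = (v + 1) * 2 ^ ht b.h v → x ≤ b.P i

/-- Regions must have room for a count per internal node, for the table, and for a whole batch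
behind the old contents of a bucket or behind the offset `used`. -/
structure Ok (b : Batch α) : Prop where
  k_le : b.k ≤ 2 ^ b.h
  le_k : 2 ^ b.h ≤ 2 * b.k
  K_gt : 4 * b.k + 4 ≤ b.K
  a_ge : 2 ≤ b.a
  slot_inj : ∀ i j, i < b.k → j < b.k → b.slot i = b.slot j → i = j
  used_lt : b.used + b.items.card + 4 ≤ b.K
  size_lt : ∀ i, i < b.k → b.size i + b.items.card + 4 ≤ b.K
  pivot : ∀ i, i + 1 < b.k → b.mem₀ (loc b.K 1 i) = .elem (b.P i)
  start : ∀ i, i < b.k → b.mem₀ (loc b.K 3 (2 * i)) = .word (loc b.K (11 + 2 * b.slot i) 0)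

/-- The cells that do not change. -/
def Keep (b : Batch α) (c : ℕ) : Prop :=
  ∀ v, 1 ≤ v → v < 2 ^ b.h + b.k → c ≠ b.cnt v ∧
    (v ≠ 1 → ∀ i, i < b.items.card → c ≠ b.tree.st v + i)

/-- `val v i` is the `i`-th element of the batch at node `v`; cells beyond `len v` are not
constrained and may contain stale copies. At the end, `total` and `inb` show that the parts given to
the buckets make up the batch and respect the pivots, and `zero` keeps the leaves without a bucket
empty. -/
structure Mem (b : Batch α) (len : ℕ → ℕ) (val : ℕ → ℕ → α) (m : ℕ → Cell α) : Prop where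
  cnt : ∀ v, 1 ≤ v → v < 2 ^ b.h + b.k → m (b.cnt v) = .word (b.base v + len v)
  buf : ∀ v, 1 ≤ v → v < 2 ^ b.h + b.k → ∀ i < len v, m (b.tree.st v + i) = .elem (val v i)
  keep : ∀ c, b.Keep c → m c = b.mem₀ c
  total : ∑ v ∈ Finset.range (2 ^ (b.h + 1)), (Multiset.range (len v)).map (val v) = b.items
  inb : ∀ v, ∀ i < len v, b.InB v (val v i)
  zero : ∀ v, v < 1 ∨ 2 ^ b.h + b.k ≤ v → len v = 0

theorem Mem.len_le {b : Batch α} {m : ℕ → Cell α} (h : b.Mem len val m) (hb : b.Ok) (v : ℕ) :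
    len v ≤ b.items.card := by
  by_cases hv : v < 2 ^ b.h + b.k
  · have h1 : v ∈ Finset.range (2 ^ (b.h + 1)) := by
      have := hb.k_le
      rw [Finset.mem_range, pow_succ]
      omega
    rw [← h.total, ← Finset.add_sum_erase _ _ h1]
    simp
  · rw [h.zero v (Or.inr (by omega))]
    exact Nat.zero_le _

theorem st_add (b : Batch α) (v i : ℕ) :
    b.tree.st v + i = loc b.K (b.region v) (b.off v + i) := loc_add _ _ _ _

variable {b : Batch α}

theorem Ok.off_lt (hb : b.Ok) (hv' : v < 2 ^ b.h + b.k) : b.off v + b.items.card + 4 ≤ b.K := by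
  unfold off
  split_ifs with h
  · exact hb.used_lt
  · exact hb.size_lt _ (by omega)

theorem cnt_ne (hb : b.Ok) (hv' : v < 2 ^ b.h + b.k) (hw' : v' < 2 ^ b.h + b.k) (hne : v ≠ v') :
    b.cnt v ≠ b.cnt v' := by
  have := hb.K_gt
  have := hb.le_k
  unfold cnt
  split_ifs <;> exact loc_ne

theorem st_ne_cnt (hb : b.Ok) (hv' : v < 2 ^ b.h + b.k) (hw' : v' < 2 ^ b.h + b.k)
    (hi : i ≤ b.items.card) : b.tree.st v + i ≠ b.cnt v' := by
  have := hb.K_gt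
  have := hb.le_k
  have := hb.off_lt hv'
  rw [st_add]
  unfold cnt region
  split_ifs <;> exact loc_ne

theorem st_ne_st (hb : b.Ok) {i' : ℕ} (hv : 1 ≤ v) (hv' : v < 2 ^ b.h + b.k) (hw : 1 ≤ v')
    (hw' : v' < 2 ^ b.h + b.k) (hi : i ≤ b.items.card) (hi' : i' ≤ b.items.card) (hne : v ≠ v') :
    b.tree.st v + i ≠ b.tree.st v' + i' := by
  have h1 := hb.off_lt hv'
  have h2 := hb.off_lt hw'
  have h3 := hb.slot_inj (v - 2 ^ b.h) (v' - 2 ^ b.h)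
  rw [st_add, st_add, Ne, loc_eq_iff (by omega) (by omega)]
  unfold region
  split_ifs
  · omega
  · omega
  · omega
  · rintro ⟨h4, -⟩
    omega

theorem keep_of_region (hb : b.Ok) (hx : x < b.K)
    (hr : r = 0 ∨ r = 1 ∨ (r = 3 ∧ x % 2 = 0) ∨ r = 7 ∨ r = 9) : b.Keep (loc b.K r x) := by
  intro v hv hv'
  have := hb.K_gt
  have := hb.le_k
  have h1 := hb.off_lt hv'
  refine ⟨?_, ?_⟩
  · unfold cnt
    split_ifs <;> exact loc_ne
  · intro hv1 i hi
    rw [st_add, Ne, loc_eq_iff (by omega) (by omega)]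
    unfold region
    split_ifs <;> omega

/-- Buckets grow only behind their old contents. -/
theorem keep_of_size (hb : b.Ok) (hy : y < b.k) (hx : x < b.size y) :
    b.Keep (loc b.K (11 + 2 * b.slot y) x) := by
  intro v hv hv'
  have := hb.K_gt
  have := hb.le_k
  have h1 := hb.off_lt hv'
  have h2 := hb.size_lt y hy
  refine ⟨?_, ?_⟩
  · unfold cnt
    split_ifs <;> exact loc_ne
  · intro hv1 i hi
    rw [st_add, Ne, loc_eq_iff (by omega) (by omega)]
    unfold region off
    split_ifs with h3
    · omega
    · rintro ⟨h4, h5⟩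
      have := hb.slot_inj y (v - 2 ^ b.h) hy (by omega) (by omega)
      subst this
      omega

/-- The buffer contents after the last element of node `v` moved to node `u`. -/
def moveVal (len : ℕ → ℕ) (val : ℕ → ℕ → α) (v u : ℕ) : ℕ → ℕ → α :=
  fun x i => if x = u ∧ i = len u then val v (len v - 1) else val x i

theorem map_range_congr {β : Type*} {f g : ℕ → β} (h : ∀ i < n, f i = g i) :
    (Multiset.range n).map f = (Multiset.range n).map g :=
  Multiset.map_congr rfl fun i hi => h i (Multiset.mem_range.1 hi)

/-- An element is moved by copying it and changing two counts; the old copy simply ceases to be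
counted. Everything else is unchanged because the counts and buffers of different nodes occupy
different cells. -/
theorem Mem.move {m m' : ℕ → Cell α} (h : b.Mem len val m) (hb : b.Ok) (hv : 1 ≤ v)
    (hvh : v < 2 ^ b.h) (hlen : 0 < len v) (hu : u = 2 * v ∨ u = 2 * v + 1)
    (hin : b.InB u (val v (len v - 1))) (h1 : m' (b.cnt v) = .word (b.base v + (len v - 1)))
    (h2 : m' (b.cnt u) = .word (b.base u + (len u + 1)))
    (h3 : m' (b.tree.st u + len u) = .elem (val v (len v - 1)))
    (h4 : ∀ c, c ≠ b.cnt v → c ≠ b.cnt u → c ≠ b.tree.st u + len u → m' c = m c) :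
    b.Mem (moveLen len v u) (moveVal len val v u) m' := by
  have hu' : u < 2 ^ b.h + b.k := by
    have h5 := hin.1
    have : 1 ≤ 2 ^ ht b.h u := Nat.one_le_two_pow
    nlinarith
  have hv' : v < 2 ^ b.h + b.k := by omega
  have hlu : len u < b.items.card := by
    have h5 : v ∈ Finset.range (2 ^ (b.h + 1)) := by
      rw [Finset.mem_range, pow_succ]; omega
    have h6 : u ∈ (Finset.range (2 ^ (b.h + 1))).erase v := by
      rw [Finset.mem_erase, Finset.mem_range, pow_succ]; omega
    rw [← h.total, ← Finset.add_sum_erase _ _ h5, ← Finset.add_sum_erase _ _ h6]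
    simp
    omega
  refine ⟨?_, ?_, ?_, ?_, ?_, ?_⟩
  · intro x hx hx'
    by_cases hxu : x = u
    · subst hxu
      simp [moveLen, h2]
    by_cases hxv : x = v
    · subst hxv
      simp [moveLen, hxu, h1]
    · rw [h4 _ (cnt_ne hb hx' hv' hxv) (cnt_ne hb hx' hu' hxu)
        (st_ne_cnt hb hu' hx' hlu.le).symm, h.cnt x hx hx']
      simp [moveLen, hxu, hxv]
  · intro x hx hx' i hi
    have hlx := h.len_le hb x
    by_cases hxu : x = u
    · subst hxu
      by_cases hi' : i = len x
      · subst hi'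
        simp [moveVal, h3]
      · have hi2 : i < len x := by
          simp only [moveLen, if_true] at hi
          omega
        rw [h4 _ (st_ne_cnt hb hx' hv' (by omega)) (st_ne_cnt hb hx' hx' (by omega)) (by omega),
          h.buf x hx hx' i hi2]
        simp [moveVal, hi']
    · have hi2 : i < len x := by
        simp only [moveLen, if_neg hxu] at hi
        split_ifs at hi with hxv
        · subst hxv; omega
        · exact hi
      rw [h4 _ (st_ne_cnt hb hx' hv' (by omega)) (st_ne_cnt hb hx' hu' (by omega))
        (st_ne_st hb hx hx' (by omega) hu' (by omega) hlu.le hxu), h.buf x hx hx' i hi2]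
      simp [moveVal, hxu]
  · intro c hc
    rw [h4 c (hc v hv hv').1 (hc u (by omega) hu').1 ((hc u (by omega) hu').2 (by omega) _ hlu),
      h.keep c hc]
  · rw [← h.total]
    have h5 := sum_change_two (s := Finset.range (2 ^ (b.h + 1))) (a := v) (b := u)
      (f := fun x => (Multiset.range (len x)).map (val x))
      (f' := fun x => (Multiset.range (moveLen len v u x)).map (moveVal len val v u x))
      (by rw [Finset.mem_range, pow_succ]; omega) (by rw [Finset.mem_range, pow_succ]; omega)
      (by omega) (by
        intro x _ hxv hxu
        simp only [moveLen, if_neg hxv, if_neg hxu]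
        exact map_range_congr fun i _ => by simp [moveVal, hxu])
    have hvu : v ≠ u := by omega
    have e1 : (Multiset.range (moveLen len v u v)).map (moveVal len val v u v) =
        (Multiset.range (len v - 1)).map (val v) := by
      simp only [moveLen, if_neg hvu, if_true]
      exact map_range_congr fun i _ => by simp [moveVal, hvu]
    have e2 : (Multiset.range (moveLen len v u u)).map (moveVal len val v u u) =
        val v (len v - 1) ::ₘ (Multiset.range (len u)).map (val u) := by
      simp only [moveLen, if_true]
      rw [Multiset.range_succ, Multiset.map_cons]
      congr 1
      · simp [moveVal]
      · exact map_range_congr fun i hi => by simp [moveVal, hi.ne]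
    have e3 : (Multiset.range (len v)).map (val v) =
        val v (len v - 1) ::ₘ (Multiset.range (len v - 1)).map (val v) := by
      conv_lhs => rw [show len v = len v - 1 + 1 by omega]
      rw [Multiset.range_succ, Multiset.map_cons]
    simp only [e1, e2, e3] at h5
    have e4 : (Multiset.range (len v - 1)).map (val v) +
        (val v (len v - 1) ::ₘ (Multiset.range (len u)).map (val u)) =
        (val v (len v - 1) ::ₘ (Multiset.range (len v - 1)).map (val v)) +
          (Multiset.range (len u)).map (val u) := by
      rw [Multiset.add_cons, Multiset.cons_add]
    rw [e4] at h5
    exact (add_right_cancel h5).symm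
  · intro x i hi
    by_cases hxu : x = u
    · subst hxu
      by_cases hi' : i = len x
      · subst hi'
        simpa [moveVal] using hin
      · simp only [moveLen, if_true] at hi
        simpa [moveVal, hi'] using h.inb x i (by omega)
    · simp only [moveLen, if_neg hxu] at hi
      have hi2 : i < len x := by
        split_ifs at hi with hxv
        · subst hxv; omega
        · exact hi
      simpa [moveVal, hxu] using h.inb x i hi2
  · intro x hx
    simp only [moveLen]
    rw [if_neg (by omega), if_neg (by omega)]
    exact h.zero x hx

end Batch

/-! ### The program for flushing a node -/

/-- The cell of the last element of the current node. -/
def srcCell : Expr := L (2 * (V 13 - 1)) (V 5 + (V 17 - 1))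

/-- Register `18` gets the child of the current node to which its last element belongs. -/
def route : Cmd :=
  .assign 18 (2 * V 13) ;;
  .assign 20 ((2 * V 13 + 1) * (V 14 / 2) - V 7) ;;
  .ite (V 2 - V 20)
    (.compare 21 srcCell (L 1 (V 20 - 1)) ;; .ite (V 21) skip (.assign 18 (V 18 + 1)))
    skip

/-- Move the last element of the current node to an internal child; continue there if it is full. -/
def deliverInner (a : ℕ) : Cmd :=
  .store (L 5 (V 13)) (V 17 - 1) ;;
  .load 22 (L 5 (V 18)) ;;
  .move (L (2 * (V 18 - 1)) (V 5 + V 22)) srcCell ;;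
  .store (L 5 (V 18)) (V 22 + 1) ;;
  flushSize a ;;
  .ite (V 22 + 2 - V 23)
    (.assign 13 (V 18) ;; .assign 14 (V 14 / 2) ;; .assign 15 (V 15 - 1)) skip

/-- Move the last element of the current node to a bucket. -/
def deliverLeaf : Cmd :=
  .store (L 5 (V 13)) (V 17 - 1) ;;
  .load 26 (L 3 (2 * (V 18 - V 7))) ;;
  .load 22 (L 3 (2 * (V 18 - V 7) + 1)) ;;
  .move (V 26 + V 22) srcCell ;;
  .store (L 3 (2 * (V 18 - V 7) + 1)) (V 22 + 1)

/-- Registers `13`, `14`, `15` hold the current node, two to the power of its height, and its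
height; `16` is the flag of the loop and `17` the count of the node. No stack is needed, since the
parent of node `v` is `v / 2` and the descent ends at the height in register `12`. -/
def flushBody (a : ℕ) : Cmd :=
  .load 17 (L 5 (V 13)) ;;
  .ite (V 17)
    (route ;; .ite (V 15 - 1) (deliverInner a) deliverLeaf)
    (.ite (V 12 - V 15)
      (.assign 13 (V 13 / 2) ;; .assign 14 (V 14 * 2) ;; .assign 15 (V 15 + 1))
      (.assign 16 0))

/-- Flush node `y / p` of height `i`; the registers `10`, `11`, `12` hold `y`, `p = 2 ^ i`, `i`. -/
def flush (a : ℕ) : Cmd :=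
  .assign 13 (V 10 / V 11) ;; .assign 14 (V 11) ;; .assign 15 (V 12) ;; .assign 16 1 ;;
  .loop (V 16) (flushBody a)

/-! ### Correctness of routing and delivery -/

namespace Batch
variable {b : Batch α}

/-- The contents of the registers while the node `fv` is flushed. -/
structure Regs (b : Batch α) (ρ : ℕ → ℕ) (fv cur : ℕ) (s : State α) : Prop where
  low : ∀ r < 13, s.reg r = ρ r
  cur_eq : s.reg 13 = cur
  pow : s.reg 14 = 2 ^ ht b.h cur
  height : s.reg 15 = ht b.h cur
  high : ∀ r, 30 ≤ r → s.reg r = ρ r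
  k : ρ 2 = b.k
  used : ρ 5 = b.used
  K : ρ 6 = b.K
  H : ρ 7 = 2 ^ b.h
  top : ρ 12 = ht b.h fv

theorem mid_bounds (hv : 1 ≤ v) (hvh : v < 2 ^ h) :
    2 ^ h + 1 ≤ (2 * v + 1) * 2 ^ (ht h v - 1) ∧ (2 * v + 1) * 2 ^ (ht h v - 1) < 2 * 2 ^ h := by
  have h1 := log_lt_of_internal hv hvh
  have h2 : ht h v - 1 = h - Nat.log 2 v - 1 := rfl
  have h3 := Nat.pow_log_le_self 2 (show v ≠ 0 by omega)
  have h4 := Nat.lt_pow_succ_log_self (b := 2) (by norm_num) v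
  set l := Nat.log 2 v
  have h5 : 2 ^ h = 2 ^ l * (2 * 2 ^ (h - l - 1)) := by
    rw [← pow_succ', ← pow_add]
    congr 1
    omega
  rw [pow_succ] at h4
  rw [h2, h5]
  generalize 2 ^ (h - l - 1) = x at *
  generalize 2 ^ l = y at *
  constructor <;> nlinarith

theorem InB.left {x : α} (hv : 1 ≤ v) (hvh : v < 2 ^ b.h) (h : b.InB v x)
    (hx : ∀ i, i + 1 < b.k → i + 1 = b.mid v → x ≤ b.P i) : b.InB (2 * v) x := by
  have h1 := ht_child hv hvh (Or.inl rfl)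
  obtain ⟨h2, h3⟩ := mid_bounds hv hvh
  have h4 : 2 * v * 2 ^ ht b.h (2 * v) = v * 2 ^ ht b.h v := by rw [← h1, pow_succ]; ring
  refine ⟨by rw [h4]; exact h.1, by rw [h4]; exact h.2.1, ?_⟩
  intro i hi hi'
  refine hx i hi ?_
  unfold mid
  rw [← h1, Nat.add_sub_cancel]
  omega

theorem InB.right {x : α} (hv : 1 ≤ v) (hvh : v < 2 ^ b.h) (h : b.InB v x) (hk : b.mid v < b.k)
    (hx : ∀ i, i + 1 < b.k → i + 1 = b.mid v → b.P i ≤ x) : b.InB (2 * v + 1) x := by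
  have h1 := ht_child hv hvh (Or.inr rfl)
  obtain ⟨h2, h3⟩ := mid_bounds hv hvh
  have h4 : (2 * v + 1 + 1) * 2 ^ ht b.h (2 * v + 1) = (v + 1) * 2 ^ ht b.h v := by
    rw [← h1, pow_succ]; ring
  have h5 : (2 * v + 1) * 2 ^ ht b.h (2 * v + 1) = b.mid v + 2 ^ b.h := by
    unfold mid
    rw [← h1, Nat.add_sub_cancel] at h2 ⊢
    omega
  refine ⟨by rw [h5]; omega, ?_, by rw [h4]; exact h.2.2⟩
  intro i hi hi'
  exact hx i hi (by omega)

/-- If no bucket belongs to the right subtree, the element goes left without a comparison. Since the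
middle is at least `1`, a single bucket never causes a comparison, which the bound `N lg k` needs
for `k = 1`. -/
theorem runs_route (hb : b.Ok) (hW : 2 * b.K < W) (hr : b.Regs ρ fv cur s)
    (hm : b.Mem len val s.mem) (hv : 1 ≤ cur) (hvh : cur < 2 ^ b.h) (hlen : 0 < len cur)
    (h17 : s.reg 17 = len cur) :
    Runs W route s fun n tr s' => n ≤ 1 ∧ (b.k = 1 → n = 0) ∧ tr.length ≤ 2 ∧
      (∀ c ∈ tr, c ∈ b.tree.aux cur ∨ c = b.tree.st cur + (len cur - 1)) ∧ s'.mem = s.mem ∧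
      (∃ u, (u = 2 * cur ∨ u = 2 * cur + 1) ∧ s'.reg 18 = u ∧
        b.InB u (val cur (len cur - 1))) ∧ s'.reg 17 = len cur ∧ s'.reg 16 = s.reg 16 ∧
      b.Regs ρ fv cur s' := by
  obtain ⟨m1, m2⟩ := mid_bounds hv hvh
  have hK := hb.K_gt
  have hle := hb.le_k
  have r2 : s.reg 2 = b.k := by simp [hr.low, hr.k]
  have r5 : s.reg 5 = b.used := by simp [hr.low, hr.used]
  have r6 : s.reg 6 = b.K := by simp [hr.low, hr.K]
  have r7 : s.reg 7 = 2 ^ b.h := by simp [hr.low, hr.H]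
  have e1 : 2 ^ ht b.h cur / 2 = 2 ^ (ht b.h cur - 1) := by
    have := ht_pos hv hvh
    conv_lhs => rw [show ht b.h cur = ht b.h cur - 1 + 1 by omega, pow_succ]
    simp
  have hmid : (2 * cur + 1) * (2 ^ ht b.h cur / 2) - 2 ^ b.h = b.mid cur := by
    rw [e1]; rfl
  have hmid1 : 1 ≤ b.mid cur ∧ b.mid cur < 2 ^ b.h := by
    unfold mid
    omega
  have hin := hm.inb cur (len cur - 1) (by omega)
  have hregs : ∀ s' : State α, (∀ r, r ≠ 18 → r ≠ 20 → r ≠ 21 → r ≠ 29 → s'.reg r = s.reg r) →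
      b.Regs ρ fv cur s' := by
    intro s' hs'
    refine ⟨fun r h => ?_, ?_, ?_, ?_, fun r h => ?_, hr.k, hr.used, hr.K, hr.H, hr.top⟩
    · rw [hs' r (by omega) (by omega) (by omega) (by omega), hr.low r h]
    · simp [hs', hr.cur_eq]
    · simp [hs', hr.pow]
    · simp [hs', hr.height]
    · rw [hs' r (by omega) (by omega) (by omega) (by omega), hr.high r h]
  unfold route
  refine runs_assign_seq ?_ (by simp [hr.cur_eq]; omega)
  refine runs_assign_seq ?_ (by simp [hr.cur_eq, hr.pow, r7, hmid]; omega)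
  simp only [eval_sub, eval_V, eval_mul, eval_add, eval_div, eval_ofNat, setReg_reg, hr.cur_eq, hr.pow,
    r7]
  simp only [Nat.reduceEqDiff, if_false, hr.cur_eq, hr.pow, r7, hmid]
  rw [runs_ite]
  simp only [eval_sub, eval_V, setReg_reg, Nat.reduceEqDiff, if_false, if_true, r2]
  refine ⟨fun hc => ?_, fun hc => ?_⟩
  · have hsrc : loc b.K (2 * (cur - 1)) (b.used + (len cur - 1)) =
        b.tree.st cur + (len cur - 1) := by
      rw [st_add]
      simp [region, off, hvh]
    rw [runs_seq, runs_compare]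
    refine ⟨val cur (len cur - 1), b.P (b.mid cur - 1), ?_, ?_, ?_⟩
    · simp only [srcCell, eval_L, eval_sub, eval_V, eval_mul, eval_add, eval_ofNat, setReg_reg,
        setReg_mem, Nat.reduceEqDiff, if_false, r6, hr.cur_eq, r5, h17]
      rw [hsrc]
      exact hm.buf cur hv (by omega) _ (by omega)
    · simp only [eval_L, eval_sub, eval_V, eval_ofNat, setReg_reg,
        setReg_mem, Nat.reduceEqDiff, if_false, if_true, r6]
      rw [hm.keep _ (keep_of_region hb (by omega) (by omega))]
      exact hb.pivot _ (by omega)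
    have htr : ∀ c ∈ [loc b.K (2 * (cur - 1)) (b.used + (len cur - 1)),
        loc b.K 1 (b.mid cur - 1)], c ∈ b.tree.aux cur ∨ c = b.tree.st cur + (len cur - 1) := by
      intro c hc
      simp only [List.mem_cons, List.not_mem_nil, or_false] at hc
      rcases hc with rfl | rfl
      · exact Or.inr hsrc
      · left
        simp [tree, hvh]
    rw [runs_ite]
    simp only [srcCell, eval_L, eval_sub, eval_V, eval_mul, eval_add, eval_ofNat, setReg_reg,
      setReg_mem, Nat.reduceEqDiff, if_false, if_true, r6, hr.cur_eq, r5, h17]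
    refine ⟨fun hx => ?_, fun hx => ?_⟩
    · have hx' : val cur (len cur - 1) ≤ b.P (b.mid cur - 1) := by
        by_contra h
        simp [h] at hx
      rw [skip, runs_assign]
      refine ⟨by simp; omega, le_rfl, by omega, by simp, by simpa using htr, rfl,
        ⟨2 * cur, Or.inl rfl, by simp, hin.left hv hvh ?_⟩, by simp [h17], by simp,
        hregs _ ?_⟩
      · intro i _ hi
        rwa [show i = b.mid cur - 1 by omega]
      · intro r h1 h2 h3 h4
        simp [h1, h2, h3, h4]
    · have hx' : ¬ val cur (len cur - 1) ≤ b.P (b.mid cur - 1) := by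
        intro h
        simp [h] at hx
      rw [runs_assign]
      refine ⟨by simp; omega, le_rfl, by omega, by simp, by simpa using htr, rfl,
        ⟨2 * cur + 1, Or.inr rfl, by simp, hin.right hv hvh (by omega) ?_⟩, by simp [h17], by simp,
        hregs _ ?_⟩
      · intro i _ hi
        rw [show i = b.mid cur - 1 by omega]
        exact (not_le.1 hx').le
      · intro r h1 h2 h3 h4
        simp [h1, h2, h3]
  · rw [skip, runs_assign]
    refine ⟨by simp; omega, by omega, by omega, by simp, by simp, rfl,
      ⟨2 * cur, Or.inl rfl, by simp, hin.left hv hvh ?_⟩, by simp [h17], by simp,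
      hregs _ ?_⟩
    · intro i _ hi
      omega
    · intro r h1 h2 h3 h4
      simp [h1, h2, h4]

theorem Regs.congr (hr : b.Regs ρ fv cur s) (h : ∀ r, r < 16 ∨ 30 ≤ r → s'.reg r = s.reg r) :
    b.Regs ρ fv cur s' := by
  refine ⟨fun r h' => ?_, ?_, ?_, ?_, fun r h' => ?_, hr.k, hr.used, hr.K, hr.H, hr.top⟩
  · rw [h r (by omega), hr.low r h']
  · simp [h, hr.cur_eq]
  · simp [h, hr.pow]
  · simp [h, hr.height]
  · rw [h r (by omega), hr.high r h']

theorem Regs.change {cur' : ℕ} (hr : b.Regs ρ fv cur s)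
    (h : ∀ r, r < 13 ∨ 30 ≤ r → s'.reg r = s.reg r) (h1 : s'.reg 13 = cur')
    (h2 : s'.reg 14 = 2 ^ ht b.h cur') (h3 : s'.reg 15 = ht b.h cur') : b.Regs ρ fv cur' s' :=
  ⟨fun r h' => by rw [h r (by omega), hr.low r h'], h1, h2, h3,
    fun r h' => by rw [h r (by omega), hr.high r h'], hr.k, hr.used, hr.K, hr.H, hr.top⟩

theorem srcCell_eval (hr : b.Regs ρ fv cur s) (hvh : cur < 2 ^ b.h) (h17 : s.reg 17 = n) :
    srcCell.eval s.reg = b.tree.st cur + (n - 1) := by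
  rw [st_add]
  simp [srcCell, region, off, hvh, hr.cur_eq, h17, hr.low 5, hr.low 6, hr.used, hr.K]

theorem InB.lt {x : α} (h : b.InB v x) : v < 2 ^ b.h + b.k := by
  have h5 := h.1
  have : 1 ≤ 2 ^ ht b.h v := Nat.one_le_two_pow
  nlinarith

/-- What the buffer sizes require of the word size. -/
def Fits (b : Batch α) (W : ℕ) : Prop :=
  2 * b.K < W ∧ (∀ x ≤ b.h, 1 ≤ x → 2 * b.a * bufSize b.a x < W) ∧ 4 * b.a * b.h + 2 < W

theorem runs_deliverInner (hb : b.Ok) (hW : b.Fits W) (hr : b.Regs ρ fv cur s)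
    (hm : b.Mem len val s.mem) (hv : 1 ≤ cur) (hvh : cur < 2 ^ b.h) (hlen : 0 < len cur)
    (h17 : s.reg 17 = len cur) (h18 : s.reg 18 = u) (hu : u = 2 * cur ∨ u = 2 * cur + 1)
    (huh : u < 2 ^ b.h) (hin : b.InB u (val cur (len cur - 1))) :
    Runs W (deliverInner b.a) s fun n tr s' => n = 0 ∧ tr.length ≤ 5 ∧
      (∀ c ∈ tr, c ∈ b.tree.aux cur ∨ c ∈ b.tree.aux u ∨ c = b.tree.st cur + (len cur - 1) ∨
        c = b.tree.st u + len u) ∧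
      b.Mem (moveLen len cur u) (moveVal len val cur u) s'.mem ∧ s'.reg 16 = s.reg 16 ∧
      ((len u + 1 < bufSize b.a (ht b.h u) ∧ b.Regs ρ fv cur s') ∨
        (bufSize b.a (ht b.h u) ≤ len u + 1 ∧ b.Regs ρ fv u s')) := by
  obtain ⟨hWK, hW2, hW3⟩ := hW
  have hK := hb.K_gt
  have hle := hb.le_k
  have hut := hin.lt
  have r5 : s.reg 5 = b.used := by simp [hr.low, hr.used]
  have r6 : s.reg 6 = b.K := by simp [hr.low, hr.K]
  have hlc := hm.len_le hb cur
  have hlu := hm.len_le hb u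
  have hul := hb.used_lt
  have hcntv : b.cnt cur = loc b.K 5 cur := by simp [Batch.cnt, hvh]
  have hcntu : b.cnt u = loc b.K 5 u := by simp [Batch.cnt, huh]
  have hne := cnt_ne hb (show cur < 2 ^ b.h + b.k by omega) hut (show cur ≠ u by omega)
  have hstu : loc b.K (2 * (u - 1)) (b.used + len u) = b.tree.st u + len u := by
    rw [st_add]
    simp [region, off, huh]
  have n1 := st_ne_cnt hb (show cur < 2 ^ b.h + b.k by omega) (show cur < 2 ^ b.h + b.k by omega)
    (show len cur - 1 ≤ b.items.card by omega)
  have n2 := st_ne_cnt hb hut (show cur < 2 ^ b.h + b.k by omega) hlu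
  have n3 := st_ne_cnt hb hut hut hlu
  have hht := ht_child hv hvh hu
  have hhu := ht_pos (show 1 ≤ u by omega) huh
  have hhc : ht b.h cur ≤ b.h := ht_le
  unfold deliverInner
  rw [runs_seq, runs_store]
  refine ⟨by simp [h17]; omega, ?_⟩
  rw [runs_seq, runs_load]
  have e1 : (L 5 (V 13)).eval s.reg = b.cnt cur := by simp [r6, hr.cur_eq, hcntv]
  have e2 : (V 17 - 1 : Expr).eval s.reg = len cur - 1 := by simp [h17]
  have e3 : (L 5 (V 18)).eval s.reg = b.cnt u := by simp [r6, h18, hcntu]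
  simp only [setMem_reg, e1, e2, e3]
  refine ⟨len u, ?_, ?_⟩
  · rw [setMem_mem, if_neg hne.symm, hm.cnt u (by omega) hut]
    simp [Batch.base, huh]
  rw [runs_seq, runs_move]
  set s₀ := (s.setMem (b.cnt cur) (Cell.word (len cur - 1))).setReg 22 (len u) with hs₀
  have e4 : srcCell.eval s₀.reg = b.tree.st cur + (len cur - 1) :=
    srcCell_eval (hr.congr (s' := s₀) (fun r h => by simp [hs₀]; omega)) hvh (by simp [hs₀, h17])
  have e5 : (L (2 * (V 18 - 1)) (V 5 + V 22)).eval s₀.reg = b.tree.st u + len u := by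
    rw [← hstu]
    simp [hs₀, h18, r5, r6]
  rw [e4, e5]
  rw [runs_seq, runs_store]
  refine ⟨by simp [hs₀]; omega, ?_⟩
  have e6 : (L 5 (V 18)).eval s₀.reg = b.cnt u := by simp [hs₀, r6, h18, hcntu]
  have e7 : (V 22 + 1 : Expr).eval s₀.reg = len u + 1 := by simp [hs₀]
  simp only [setMem_reg, e6, e7]
  set s₁ := (s₀.setMem (b.tree.st u + len u) (s₀.mem (b.tree.st cur + (len cur - 1)))).setMem
      (b.cnt u) (.word (len u + 1)) with hs₁
  have hreg₁ : ∀ r, r ≠ 22 → s₁.reg r = s.reg r := by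
    intro r h
    simp [hs₁, hs₀, h]
  have hreg22 : s₁.reg 22 = len u := by simp [hs₁, hs₀]
  have hmem₁ : b.Mem (moveLen len cur u) (moveVal len val cur u) s₁.mem := by
    refine hm.move hb hv hvh hlen hu hin ?_ ?_ ?_ ?_
    · simp [hs₁, hs₀, hne, n2.symm, Batch.base, hvh]
    · simp [hs₁, hs₀, Batch.base, huh]
    · simp only [hs₁, hs₀, setMem_mem, setReg_mem, if_neg n3, if_true, if_neg n1]
      exact hm.buf cur hv (by omega) _ (by omega)
    · intro c h1 h2 h3
      simp [hs₁, hs₀, h1, h2, h3]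
  rw [runs_seq]
  refine (runs_flushSize (e := ht b.h u) (by rw [hreg₁ 15 (by norm_num), hr.height, hht]) hhu
    (fun x hx hx1 => hW2 x (by omega) hx1)
    (by
      have : 4 * b.a * ht b.h u ≤ 4 * b.a * b.h := Nat.mul_le_mul_left _ (by omega)
      omega) hb.a_ge).mono ?_
  rintro _ _ s₂ ⟨rfl, rfl, hmem₂, h23, hreg₂⟩
  have hr₂ : b.Regs ρ fv cur s₂ := hr.congr fun r h => by
    rw [hreg₂ r (by omega) (by omega) (by omega), hreg₁ r (by omega)]
  have h22 : s₂.reg 22 = len u := by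
    simp [hreg₂, hreg22]
  have h16 : s₂.reg 16 = s.reg 16 := by
    rw [hreg₂ 16 (by norm_num) (by norm_num) (by norm_num), hreg₁ 16 (by norm_num)]
  have h18' : s₂.reg 18 = u := by
    simp [hreg₂, hreg₁, h18]
  rw [← hmem₂] at hmem₁
  have hcells : ∀ c ∈ [b.cnt cur, b.cnt u, b.tree.st cur + (len cur - 1), b.tree.st u + len u,
      b.cnt u], c ∈ b.tree.aux cur ∨ c ∈ b.tree.aux u ∨ c = b.tree.st cur + (len cur - 1) ∨
        c = b.tree.st u + len u := by
    have a1 : b.cnt cur ∈ b.tree.aux cur := by simp [tree, hvh, hcntv]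
    have a2 : b.cnt u ∈ b.tree.aux u := by simp [tree, huh, hcntu]
    intro c hc
    simp only [List.mem_cons, List.not_mem_nil, or_false] at hc
    rcases hc with rfl | rfl | rfl | rfl | rfl <;> tauto
  -- The condition `len u + 2 - size` is nonzero exactly when the new count `len u + 1` reaches the
  -- capacity.
  rw [runs_ite]
  simp only [eval_sub, eval_V, eval_add, eval_ofNat, h22, h23]
  refine ⟨fun hc => ?_, fun hc => ?_⟩
  · have hpw : 2 ^ ht b.h cur / 2 = 2 ^ ht b.h u := by rw [← hht, pow_succ]; simp
    have hp2 : 2 ^ ht b.h u ≤ 2 ^ b.h := Nat.pow_le_pow_right (by norm_num) (by omega)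
    have hp3 : ht b.h cur < 2 ^ ht b.h cur := Nat.lt_two_pow_self
    refine runs_assign_seq ?_ (by simp [h18']; omega)
    refine runs_assign_seq ?_ (by simp [hr₂.pow, hpw]; omega)
    rw [runs_assign]
    refine ⟨by simp [hr₂.height]; omega, by simp, by simp, by simpa using hcells, hmem₁,
      by simp [h16], Or.inr ⟨by omega, hr₂.change ?_ ?_ ?_ ?_⟩⟩
    · intro r h
      simp
      rw [if_neg (by omega), if_neg (by omega), if_neg (by omega)]
    · simp [h18']
    · simp [hr₂.pow, hpw]
    · simp [hr₂.height]
      omega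
  · rw [skip, runs_assign]
    refine ⟨by simp; omega, by simp, by simp, by simpa using hcells, hmem₁, by simp [h16],
      Or.inl ⟨by omega, hr₂.congr fun r h => ?_⟩⟩
    simp
    omega

theorem runs_deliverLeaf (hb : b.Ok) (hW : b.Fits W) (hr : b.Regs ρ fv cur s)
    (hm : b.Mem len val s.mem) (hv : 1 ≤ cur) (hvh : cur < 2 ^ b.h) (hlen : 0 < len cur)
    (h17 : s.reg 17 = len cur) (h18 : s.reg 18 = u) (hu : u = 2 * cur ∨ u = 2 * cur + 1)
    (huh : 2 ^ b.h ≤ u) (hin : b.InB u (val cur (len cur - 1))) :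
    Runs W deliverLeaf s fun n tr s' => n = 0 ∧ tr.length ≤ 6 ∧
      (∀ c ∈ tr, c ∈ b.tree.aux cur ∨ c ∈ b.tree.aux u ∨ c = b.tree.st cur + (len cur - 1) ∨
        c = b.tree.st u + len u) ∧
      b.Mem (moveLen len cur u) (moveVal len val cur u) s'.mem ∧ s'.reg 16 = s.reg 16 ∧
      b.Regs ρ fv cur s' := by
  obtain ⟨hWK, hW2, hW3⟩ := hW
  have hK := hb.K_gt
  have hle := hb.le_k
  have hut := hin.lt
  have hnu : ¬ u < 2 ^ b.h := by omega
  have r6 : s.reg 6 = b.K := by simp [hr.low, hr.K]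
  have r7 : s.reg 7 = 2 ^ b.h := by simp [hr.low, hr.H]
  have hlc := hm.len_le hb cur
  have hlu := hm.len_le hb u
  have hsl := hb.size_lt (u - 2 ^ b.h) (by omega)
  have hcntv : b.cnt cur = loc b.K 5 cur := by simp [Batch.cnt, hvh]
  have hcntu : b.cnt u = loc b.K 3 (2 * (u - 2 ^ b.h) + 1) := by simp [Batch.cnt, hnu]
  have hne := cnt_ne hb (show cur < 2 ^ b.h + b.k by omega) hut (show cur ≠ u by omega)
  have n1 := st_ne_cnt hb (show cur < 2 ^ b.h + b.k by omega) (show cur < 2 ^ b.h + b.k by omega)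
    (show len cur - 1 ≤ b.items.card by omega)
  have n2 := st_ne_cnt hb hut (show cur < 2 ^ b.h + b.k by omega) hlu
  have n3 := st_ne_cnt hb hut hut hlu
  unfold deliverLeaf
  rw [runs_seq, runs_store]
  refine ⟨by simp [h17]; omega, ?_⟩
  have e1 : (L 5 (V 13)).eval s.reg = b.cnt cur := by simp [r6, hr.cur_eq, hcntv]
  have e2 : (V 17 - 1 : Expr).eval s.reg = len cur - 1 := by simp [h17]
  simp only [e1, e2]
  rw [runs_seq, runs_load]
  have e3 : (L 3 (2 * (V 18 - V 7))).eval (s.setMem (b.cnt cur) (Cell.word (len cur - 1))).reg =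
      loc b.K 3 (2 * (u - 2 ^ b.h)) := by simp [h18, r6, r7]
  rw [e3]
  refine ⟨loc b.K (11 + 2 * b.slot (u - 2 ^ b.h)) 0, ?_, ?_⟩
  · rw [setMem_mem, if_neg (by
      rw [hcntv, loc_eq_iff (by omega) (by omega)]
      omega), hm.keep _ (keep_of_region hb (by omega) (by omega)), hb.start _ (by omega)]
  rw [runs_seq, runs_load]
  have e4 : (L 3 (2 * (V 18 - V 7) + 1)).eval ((s.setMem (b.cnt cur)
      (Cell.word (len cur - 1))).setReg 26 (loc b.K (11 + 2 * b.slot (u - 2 ^ b.h)) 0)).reg =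
      b.cnt u := by simp [h18, r6, r7, hcntu]
  rw [e4]
  refine ⟨b.size (u - 2 ^ b.h) + len u, ?_, ?_⟩
  · rw [setReg_mem, setMem_mem, if_neg hne.symm, hm.cnt u (by omega) hut]
    simp [Batch.base, hnu]
  rw [runs_seq, runs_move]
  set s₀ := ((s.setMem (b.cnt cur) (Cell.word (len cur - 1))).setReg 26
    (loc b.K (11 + 2 * b.slot (u - 2 ^ b.h)) 0)).setReg 22 (b.size (u - 2 ^ b.h) + len u) with hs₀
  have e5 : srcCell.eval s₀.reg = b.tree.st cur + (len cur - 1) :=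
    srcCell_eval (hr.congr (s' := s₀) (fun r h => by
      simp [hs₀]
      rw [if_neg (by omega), if_neg (by omega)])) hvh (by simp [hs₀, h17])
  have e6 : (V 26 + V 22 : Expr).eval s₀.reg = b.tree.st u + len u := by
    rw [st_add]
    simp [hs₀, region, off, hnu, loc_add]
  rw [e5, e6, runs_store]
  have e7 : (L 3 (2 * (V 18 - V 7) + 1)).eval s₀.reg = b.cnt u := by
    simp [hs₀, h18, r6, r7, hcntu]
  have e8 : (V 22 + 1 : Expr).eval s₀.reg = b.size (u - 2 ^ b.h) + len u + 1 := by simp [hs₀]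
  simp only [setMem_reg, e7, e8]
  have hcells : ∀ c ∈ [b.cnt cur, loc b.K 3 (2 * (u - 2 ^ b.h)), b.cnt u,
      b.tree.st cur + (len cur - 1), b.tree.st u + len u,
      b.cnt u], c ∈ b.tree.aux cur ∨ c ∈ b.tree.aux u ∨ c = b.tree.st cur + (len cur - 1) ∨
        c = b.tree.st u + len u := by
    have a1 : b.cnt cur ∈ b.tree.aux cur := by simp [tree, hvh, hcntv]
    have a2 : b.cnt u ∈ b.tree.aux u := by simp [tree, hnu, hcntu]
    have a3 : loc b.K 3 (2 * (u - 2 ^ b.h)) ∈ b.tree.aux u := by simp [tree, hnu]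
    intro c hc
    simp only [List.mem_cons, List.not_mem_nil, or_false] at hc
    rcases hc with rfl | rfl | rfl | rfl | rfl | rfl <;> tauto
  refine ⟨by omega, by simp, by simp, by simpa using hcells, ?_, by simp [hs₀], ?_⟩
  · refine hm.move hb hv hvh hlen hu hin ?_ ?_ ?_ ?_
    · simp [hs₀, hne, n2.symm, Batch.base, hvh]
    · simp [hs₀, Batch.base, hnu]
      omega
    · simp only [hs₀, setMem_mem, setReg_mem, if_neg n3, if_true, if_neg n1]
      exact hm.buf cur hv (by omega) _ (by omega)
    · intro c h1 h2 h3
      simp [hs₀, h1, h2, h3]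
  · refine hr.congr fun r h => ?_
    simp [hs₀]
    rw [if_neg (by omega), if_neg (by omega)]

end Batch

/-! ### The loop that flushes one node -/

namespace Batch
variable {b : Batch α}

theorem mem_aux_cnt (b : Batch α) (v : ℕ) (hv : v < 2 ^ b.h) : loc b.K 5 v ∈ b.tree.aux v := by
  simp [tree, hv]

theorem runs_flushBody (hb : b.Ok) (hW : b.Fits W) (hr : b.Regs ρ fv g.cur s)
    (hm : b.Mem g.len val s.mem) (hI : FlushInv b.tree fv g) :
    Runs W (flushBody b.a) s fun n tr s' =>
      (∃ g' val', AStep b.tree fv g n tr g' ∧ (b.k = 1 → n = 0) ∧ b.Regs ρ fv g'.cur s' ∧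
        b.Mem g'.len val' s'.mem ∧ s'.reg 16 = s.reg 16) ∨
      (g.cur = fv ∧ g.len fv = 0 ∧ n = 0 ∧ tr = [loc b.K 5 fv] ∧ b.Regs ρ fv fv s' ∧
        b.Mem g.len val s'.mem ∧ s'.reg 16 = 0) := by
  obtain ⟨cur, len⟩ := g
  simp only at hr hm
  have hv : 1 ≤ cur := hI.cur_pos
  have hvh : cur < 2 ^ b.h := hI.cur_lt
  have hanc : Anc fv cur := hI.anc
  have r6 : s.reg 6 = b.K := by simp [hr.low, hr.K]
  have hK := hb.K_gt
  have hle := hb.le_k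
  have hWK := hW.1
  have e1 : (L 5 (V 13)).eval s.reg = b.cnt cur := by
    simp [r6, hr.cur_eq, Batch.cnt, hvh]
  have hcell : b.cnt cur = loc b.K 5 cur := by simp [Batch.cnt, hvh]
  unfold flushBody
  rw [runs_seq, runs_load]
  simp only [e1]
  refine ⟨len cur, ?_, ?_⟩
  · rw [hm.cnt cur hv (by omega)]
    simp [Batch.base, hvh]
  have hr₁ : b.Regs ρ fv cur (s.setReg 17 (len cur)) := hr.congr fun r h => by simp; omega
  rw [runs_ite]
  simp only [eval_V, setReg_reg, if_true]
  refine ⟨fun hc => ?_, fun hc => ?_⟩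
  · rw [runs_seq]
    refine (runs_route hb hWK hr₁ hm hv hvh (by omega) (by simp)).mono ?_
    rintro n tr s₂ ⟨hn, hn1, htl, htr, hmem, ⟨u, hu, h18, hin⟩, h17, h16, hr₂⟩
    rw [setReg_mem] at hmem
    rw [runs_ite]
    simp only [eval_V, eval_sub, eval_ofNat, hr₂.height]
    have huht := ht_child hv hvh hu
    refine ⟨fun hc1 => ?_, fun hc1 => ?_⟩
    · have huh : u < 2 ^ b.h := by
        by_contra hcon
        have := ht_leaf (h := b.h) (u := u) (by omega)
        omega
      refine (runs_deliverInner hb hW hr₂ (by rwa [hmem]) hv hvh (by omega) h17 h18 hu huh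
        hin).mono ?_
      rintro n' tr' s₃ ⟨rfl, htl', htr', hmem', h16', hcase⟩
      left
      have hcells : MoveCells b.tree len cur u ([b.cnt cur] ++ (tr ++ tr')) := by
        refine ⟨by simp; omega, ?_⟩
        intro c hc
        simp only [List.mem_append, List.mem_singleton] at hc
        rcases hc with rfl | hc | hc
        · rw [hcell]
          exact Or.inl (b.mem_aux_cnt cur hvh)
        · have := htr c hc
          tauto
        · exact htr' c hc
      rcases hcase with ⟨hfull, hr₃⟩ | ⟨hfull, hr₃⟩
      · exact ⟨_, _, .pop cur u len _ _ hvh (by omega) hu (by omega) hcells fun _ => hfull,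
          by omega, hr₃, hmem', by rw [h16', h16]; simp⟩
      · exact ⟨_, _, .popDown cur u len _ _ hvh (by omega) hu (by omega) hcells huh hfull,
          by omega, hr₃, hmem', by rw [h16', h16]; simp⟩
    · have huh : 2 ^ b.h ≤ u := by
        by_contra hcon
        have := ht_pos (h := b.h) (u := u) (by omega) (by omega)
        omega
      refine (runs_deliverLeaf hb hW hr₂ (by rwa [hmem]) hv hvh (by omega) h17 h18 hu huh
        hin).mono ?_
      rintro n' tr' s₃ ⟨rfl, htl', htr', hmem', h16', hr₃⟩
      left
      have hcells : MoveCells b.tree len cur u ([b.cnt cur] ++ (tr ++ tr')) := by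
        refine ⟨by simp; omega, ?_⟩
        intro c hc
        simp only [List.mem_append, List.mem_singleton] at hc
        rcases hc with rfl | hc | hc
        · rw [hcell]
          exact Or.inl (b.mem_aux_cnt cur hvh)
        · have := htr c hc
          tauto
        · exact htr' c hc
      exact ⟨_, _, .pop cur u len _ _ hvh (by omega) hu (by omega) hcells
        (fun h => absurd h (by simp only [tree]; omega)), by omega, hr₃, hmem',
        by rw [h16', h16]; simp⟩
  · rw [runs_ite]
    simp only [eval_V, eval_sub, hr₁.low 12 (by norm_num), hr₁.top, hr₁.height]
    refine ⟨fun hc1 => ?_, fun hc1 => ?_⟩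
    · have hne : cur ≠ fv := by
        rintro rfl
        omega
      have h2 : 2 ≤ cur := by
        have := hanc.le
        have := hI.fv_pos
        omega
      have hp := ht_parent h2 hvh
      have hle' : ht b.h (cur / 2) ≤ b.h := ht_le
      have hpow : 2 ^ (ht b.h cur + 1) ≤ 2 ^ b.h := Nat.pow_le_pow_right (by norm_num) (by omega)
      have hlt : ht b.h cur + 1 < 2 ^ (ht b.h cur + 1) := Nat.lt_two_pow_self
      rw [pow_succ] at hpow hlt
      refine runs_assign_seq ?_ (by simp [hr.cur_eq]; omega)
      refine runs_assign_seq ?_ (by simp [hr.pow]; omega)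
      rw [runs_assign]
      refine ⟨by simp [hr.height]; omega, Or.inl ⟨_, val, .up cur len _ hvh hc hne (by simp)
        (by simpa [hcell] using b.mem_aux_cnt cur hvh), by simp, ?_, hm, by simp⟩⟩
      refine hr.change ?_ ?_ ?_ ?_
      · intro r h
        simp
        rw [if_neg (by omega), if_neg (by omega), if_neg (by omega), if_neg (by omega)]
      · simp [hr.cur_eq]
      · simp [hr.pow, hp, pow_succ]
      · simp [hr.height, hp]
    -- A proper descendant of `fv` has smaller height, so comparing heights suffices to recognise
    -- `fv`.
    · have heq : cur = fv := by
        by_contra hne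
        have h3 := ht_anti (h := b.h) (anc_half hanc (Ne.symm hne)).le
        have h2 : 2 ≤ cur := by
          have := hanc.le
          have := hI.fv_pos
          omega
        have hp := ht_parent h2 hvh
        omega
      subst heq
      rw [runs_assign]
      refine ⟨by simp; omega, Or.inr ⟨rfl, hc, rfl, by simp [hcell], hr.congr fun r h => ?_, hm,
        by simp⟩⟩
      simp
      rw [if_neg (by omega), if_neg (by omega)]

/-- The loop terminates because the time potential `flushTime` decreases in every iteration. The
last access of the trace is the read of the count of `fv` that finds it empty. -/
theorem runs_flushLoop (hb : b.Ok) (hW : b.Fits W) (t : ℕ) :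
    ∀ {g : FlushState} {val : ℕ → ℕ → α} {s : State α}, flushTime b.tree fv g = t →
    b.Regs ρ fv g.cur s → b.Mem g.len val s.mem → FlushInv b.tree fv g → s.reg 16 = 1 →
    Runs W (.loop (V 16) (flushBody b.a)) s fun n tr s' => ∃ tr₁ len' val',
      tr = tr₁ ++ [loc b.K 5 fv] ∧ ASteps b.tree fv g n tr₁ ⟨fv, len'⟩ ∧ len' fv = 0 ∧
      (b.k = 1 → n = 0) ∧ b.Regs ρ fv fv s' ∧ b.Mem len' val' s'.mem := by
  induction t using Nat.strong_induction_on with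
  | _ t ih =>
    intro g val s ht hr hm hI h16
    refine runs_loop_succ (by simp [h16]) ((runs_flushBody hb hW hr hm hI).mono ?_)
    rintro n tr s₁ (⟨g', val', hs, hn, hr', hm', h16'⟩ | ⟨hcur, hlen, rfl, rfl, hr', hm', h16'⟩)
    · have hI' := hI.step (fun i => bufSize_pos b.a i) hs
      refine (ih _ (ht ▸ (hs.cost hI).2.2) rfl hr' hm' hI' (by rw [h16', h16])).mono ?_
      rintro n' tr' s₂ ⟨tr₁, len', val'', rfl, h1, h2, h3, h4, h5⟩
      exact ⟨tr ++ tr₁, len', val'', by simp, .head hs h1, h2, fun hk => by rw [hn hk, h3 hk],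
        h4, h5⟩
    · refine runs_loop_zero (by simp [h16']) ⟨[], g.len, val, by simp, ?_, hlen, by simp, hr', hm'⟩
      obtain ⟨cur, len⟩ := g
      subst hcur
      exact .refl _

theorem runs_flush (hb : b.Ok) (hW : b.Fits W) (hm : b.Mem len val s.mem)
    (hρ : ∀ r, r < 13 ∨ 30 ≤ r → s.reg r = ρ r) (hk : ρ 2 = b.k) (hused : ρ 5 = b.used)
    (hK : ρ 6 = b.K) (hH : ρ 7 = 2 ^ b.h) (hy : ρ 10 = y) (hp : ρ 11 = p) (hi : ρ 12 = i)
    (hpi : p = 2 ^ i) (hyh : 2 ^ b.h ≤ y) (hyh' : y < 2 ^ (b.h + 1)) (hi1 : 1 ≤ i) (hih : i ≤ b.h)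
    (hI : FlushInv b.tree (y / p) ⟨y / p, len⟩) :
    Runs W (flush b.a) s fun n tr s' => ∃ tr₁ len' val',
      tr = tr₁ ++ [loc b.K 5 (y / p)] ∧
      ASteps b.tree (y / p) ⟨y / p, len⟩ n tr₁ ⟨y / p, len'⟩ ∧ len' (y / p) = 0 ∧
      (b.k = 1 → n = 0) ∧ (∀ r, r < 13 ∨ 30 ≤ r → s'.reg r = ρ r) ∧ b.Mem len' val' s'.mem := by
  have hWK := hW.1
  have hKg := hb.K_gt
  have hle := hb.le_k
  have hht : ht b.h (y / p) = i := by rw [hpi]; exact ht_div_pow hyh hyh' hih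
  have hcl : y / p < 2 ^ b.h := hI.cur_lt
  have hpw : 2 ^ i ≤ 2 ^ b.h := Nat.pow_le_pow_right (by norm_num) hih
  have hil : i < 2 ^ i := Nat.lt_two_pow_self
  have r10 : s.reg 10 = y := by simp [hρ, hy]
  have r11 : s.reg 11 = p := by simp [hρ, hp]
  have r12 : s.reg 12 = i := by simp [hρ, hi]
  unfold flush
  refine runs_assign_seq ?_ (by simp [r10, r11]; omega)
  refine runs_assign_seq ?_ (by simp [r11]; omega)
  refine runs_assign_seq ?_ (by simp [r12]; omega)
  refine runs_assign_seq ?_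
  refine (runs_flushLoop (fv := y / p) (ρ := ρ) hb hW _ rfl (val := val) ?_ ?_ hI (by simp)).mono ?_
  · refine ⟨fun r h => ?_, by simp [r10, r11], by simp [r11, hht]; exact hpi, by simp [r12, hht],
      fun r h => ?_, hk, hused, hK, hH, by rw [hi, hht]⟩
    · simp
      rw [if_neg (by omega), if_neg (by omega), if_neg (by omega), if_neg (by omega),
        hρ r (by omega)]
    · simp
      rw [if_neg (by omega), if_neg (by omega), if_neg (by omega), if_neg (by omega),
        hρ r (by omega)]
  · simpa using hm
  rintro n tr s' ⟨tr₁, len', val', rfl, h1, h2, h3, h4, h5⟩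
  refine ⟨tr₁, len', val', by simp, by simpa using h1, h2, by simpa using h3, ?_, h5⟩
  rintro r (h | h)
  · exact h4.low r h
  · exact h4.high r h

end Batch

/-! ### All internal buffers are empty after the distribution -/

/-- Flushing `fv` touches only descendants of `fv`. -/
theorem ASteps.len_eq (hsz : ∀ i, 0 < T.sz i) (h : FlushInv T fv g) (hs : ASteps T fv g n tr g')
    (hu : ¬ Anc fv u) : g'.len u = g.len u := by
  induction hs with
  | refl => rfl
  | head h1 _ ih =>
    rw [ih (h.step hsz h1)]
    have hanc := h.anc
    have aux : ∀ {v w : ℕ}, Anc fv v → (w = 2 * v ∨ w = 2 * v + 1) → u ≠ v ∧ u ≠ w :=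
      fun {v w} hv hw => ⟨fun e => hu (e ▸ hv), fun e => hu (e ▸ (anc_child hw).2 (Or.inr hv))⟩
    cases h1 with
    | pop v w len n tr hvh hlen hw hn htr hfull =>
      obtain ⟨h2, h3⟩ := aux hanc hw
      simp [moveLen, h2, h3]
    | popDown v w len n tr hvh hlen hw hn htr huh hfull =>
      obtain ⟨h2, h3⟩ := aux hanc hw
      simp [moveLen, h2, h3]
    | up => rfl

/-- A node that has been flushed is refilled only by flushing one of its ancestors, and in the
preorder none of these comes later. -/
theorem DSteps.zero (hsz : ∀ i, 0 < T.sz i) (hvs : ∀ v ∈ vs, 1 ≤ v ∧ v < 2 ^ T.h)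
    (hI : ∀ v ∈ vs.head?, FlushInv T v ⟨v, len⟩) (hs : DSteps T vs len n tr len') :
    (∀ u, (∀ v ∈ vs, ¬ Anc v u) → len' u = len u) ∧
      (vs.Pairwise (fun v v' => ¬ Anc v' v) → ∀ v ∈ vs, len' v = 0) := by
  induction hs with
  | nil => simp
  | @cons v vs len len' len'' n n' tr te tr' h h0 hte haux h' ih =>
    have hI1 := hI v (by simp)
    have hI2 := hI1.steps hsz h
    obtain ⟨h1, h2⟩ := ih (fun x hx => hvs x (List.mem_cons_of_mem _ hx)) (by
      intro v' hv'
      have h3 := hvs v' (List.mem_cons_of_mem _ (List.mem_of_mem_head? hv'))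
      have h4 := hI2.not_full hsz h0
      exact .of_not_full h3.1 h3.2 (fun u h5 h6 => Or.inr (h4 u h5 h6)) fun _ => h4 v' h3.1 h3.2)
    refine ⟨?_, ?_⟩
    · intro u hu
      rw [h1 u fun x hx => hu x (List.mem_cons_of_mem _ hx)]
      exact h.len_eq hsz hI1 (hu v (by simp))
    · intro hp x hx
      rw [List.pairwise_cons] at hp
      rcases List.mem_cons.1 hx with rfl | hx
      · rw [h1 x hp.1, h0]
      · exact h2 hp.2 x hx

theorem mem_chain_iff : ∀ {i : ℕ}, v ∈ chain y i ↔ ∃ e, 1 ≤ e ∧ e ≤ i ∧ v = y / 2 ^ e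
  | 0 => by
    simp only [chain, List.not_mem_nil, false_iff]
    rintro ⟨e, h1, h2, -⟩
    omega
  | i + 1 => by
    simp only [chain, List.mem_cons, mem_chain_iff (i := i)]
    constructor
    · rintro (h | ⟨e, h1, h2, h3⟩)
      · exact ⟨i + 1, by omega, le_rfl, h⟩
      · exact ⟨e, h1, by omega, h3⟩
    · rintro ⟨e, h1, h2, h3⟩
      by_cases he : e = i + 1
      · subst he
        exact Or.inl h3
      · exact Or.inr ⟨e, h1, by omega, h3⟩

theorem mem_preorder_iff : ∀ {n y : ℕ}, v ∈ preorder n y ↔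
    ∃ x < n, ∃ e, 1 ≤ e ∧ e ≤ padicValNat 2 (y + 2 * x) ∧ v = (y + 2 * x) / 2 ^ e
  | 0, y => by simp [preorder]
  | n + 1, y => by
    rw [preorder, List.mem_append, mem_chain_iff, mem_preorder_iff (n := n)]
    constructor
    · rintro (h | ⟨x, hx, e, h1, h2, h3⟩)
      · exact ⟨0, by omega, by simpa using h⟩
      · refine ⟨x + 1, by omega, e, h1, ?_⟩
        rw [show y + 2 * (x + 1) = y + 2 + 2 * x by ring]
        exact ⟨h2, h3⟩
    · rintro ⟨x, hx, h⟩
      rcases x with _ | x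
      · exact Or.inl (by simpa using h)
      · right
        refine ⟨x, by omega, ?_⟩
        rwa [show y + 2 * (x + 1) = y + 2 + 2 * x by ring] at h

/-- The node `y' / 2 ^ e'` has leftmost leaf `y'`. If it were an ancestor of `y / 2 ^ e`, then `y`
would be one of its leaves and could not be smaller than `y'`. -/
theorem not_anc_of_lt {y' e' : ℕ} (h1 : 2 ^ h ≤ y) (h2 : y < 2 ^ (h + 1)) (h1' : 2 ^ h ≤ y')
    (h2' : y' < 2 ^ (h + 1)) (he' : e' ≤ h) (hd : 2 ^ e' ∣ y') (hlt : y < y') :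
    ¬ Anc (y' / 2 ^ e') (y / 2 ^ e) := by
  rintro ⟨f, hf⟩
  rw [Nat.div_div_eq_div_mul, ← pow_add] at hf
  have hpos := (div_pow_bounds h1' h2' he').1
  have hp : 1 ≤ y' / 2 ^ e' := le_trans Nat.one_le_two_pow hpos
  have hef : e + f ≤ h := by
    by_contra hcon
    have : y / 2 ^ (e + f) = 0 := by
      refine Nat.div_eq_of_lt (lt_of_lt_of_le h2 (Nat.pow_le_pow_right (by norm_num) (by omega)))
    omega
  have e1 := ht_div_pow h1 h2 hef
  have e2 := ht_div_pow h1' h2' he'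
  rw [hf, e2] at e1
  rw [← e1] at hf
  have h3 := Nat.div_mul_cancel hd
  have h4 := Nat.div_mul_le_self y (2 ^ e')
  rw [hf] at h4
  omega

theorem pairwise_chain (h1 : 2 ^ h ≤ y) (h2 : y < 2 ^ (h + 1)) :
    ∀ {i : ℕ}, i ≤ h → (chain y i).Pairwise (fun v v' => ¬ Anc v' v)
  | 0, _ => by simp [chain]
  | i + 1, hi => by
    rw [chain, List.pairwise_cons]
    refine ⟨?_, pairwise_chain h1 h2 (by omega)⟩
    intro v' hv' hanc
    obtain ⟨e, h3, h4, rfl⟩ := mem_chain_iff.1 hv'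
    have h5 := hanc.le
    have h6 := ht_anti (h := h) h5
    rw [ht_div_pow h1 h2 (by omega), ht_div_pow h1 h2 (by omega)] at h6
    omega

theorem pairwise_preorder : ∀ {n y : ℕ}, 2 ^ h ≤ y → y + 2 * n ≤ 2 ^ (h + 1) →
    (preorder n y).Pairwise (fun v v' => ¬ Anc v' v)
  | 0, y, _, _ => by simp [preorder]
  | n + 1, y, h1, h3 => by
    have hy : y < 2 ^ (h + 1) := by omega
    rw [preorder, List.pairwise_append]
    refine ⟨pairwise_chain h1 hy (padicValNat_two_le h1 hy),
      pairwise_preorder (by omega) (by omega), ?_⟩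
    intro v hv v' hv'
    obtain ⟨e, h4, h5, rfl⟩ := mem_chain_iff.1 hv
    obtain ⟨x, hx, e', h6, h7, rfl⟩ := mem_preorder_iff.1 hv'
    have h8 : y + 2 + 2 * x < 2 ^ (h + 1) := by omega
    refine not_anc_of_lt h1 hy (by omega) h8 (h7.trans (padicValNat_two_le (by omega) h8)) ?_
      (by omega)
    exact (pow_dvd_pow 2 h7).trans pow_padicValNat_dvd

/-- The node is listed with its leftmost leaf `u * 2 ^ ht h u`, which is even because `u` has
positive height. -/
theorem mem_preorder_of_internal (hu : 1 ≤ u) (huh : u < 2 ^ h) :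
    u ∈ preorder (2 ^ (h - 1)) (2 ^ h) := by
  have h1 := ht_pos hu huh
  have hlog := log_lt_of_internal hu huh
  have h2 := Nat.pow_log_le_self 2 (show u ≠ 0 by omega)
  have h3 := Nat.lt_pow_succ_log_self (b := 2) (by norm_num) u
  have e1 : 2 ^ Nat.log 2 u * 2 ^ ht h u = 2 ^ h := by
    rw [← pow_add, ht]
    congr 1
    omega
  have h4 : 2 ^ h ≤ u * 2 ^ ht h u := e1 ▸ Nat.mul_le_mul_right _ h2
  have h5 : u * 2 ^ ht h u < 2 * 2 ^ h := by
    rw [← e1, ← mul_assoc, ← pow_succ']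
    exact Nat.mul_lt_mul_of_pos_right h3 (Nat.two_pow_pos _)
  have hh : 1 ≤ h := by omega
  have hpow : 2 ^ h = 2 * 2 ^ (h - 1) := by rw [← pow_succ', Nat.sub_add_cancel hh]
  have hev : 2 ∣ u * 2 ^ ht h u :=
    Dvd.dvd.mul_left (dvd_pow_self 2 (by omega)) _
  refine mem_preorder_iff.2 ⟨(u * 2 ^ ht h u - 2 ^ h) / 2, by omega, ht h u, h1, ?_, ?_⟩
  · rw [show 2 ^ h + 2 * ((u * 2 ^ ht h u - 2 ^ h) / 2) = u * 2 ^ ht h u by omega]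
    exact (padicValNat_dvd_iff_le (by positivity)).1 (dvd_mul_left _ _)
  · rw [show 2 ^ h + 2 * ((u * 2 ^ ht h u - 2 ^ h) / 2) = u * 2 ^ ht h u by omega]
    simp

/-! ### The program for distributing a batch -/

/-- Flush the ancestors of leaf `y` of which it is the leftmost leaf. -/
def flushChain (a : ℕ) : Cmd :=
  .loop (V 12) (flush a ;; .assign 11 (V 11 / 2) ;; .assign 12 (V 12 - 1))

/-- Register `10` runs through the even leaves, as the leftmost leaf of an internal node is even.
Registers `11` and `12` receive the largest power of two that divides it and its exponent, found by
doubling. -/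
def flushAll (a : ℕ) : Cmd :=
  .loop (2 * V 7 - V 10)
    (.assign 11 1 ;; .assign 12 0 ;;
     .loop (1 - (V 10 - V 10 / (2 * V 11) * (2 * V 11)))
       (.assign 11 (2 * V 11) ;; .assign 12 (V 12 + 1)) ;;
     flushChain a ;;
     .assign 10 (V 10 + 2))

namespace Batch
variable {b : Batch α}

/-- The registers that are fixed during the distribution. -/
structure Fixed (b : Batch α) (s : State α) : Prop where
  k : s.reg 2 = b.k
  used : s.reg 5 = b.used
  K : s.reg 6 = b.K
  H : s.reg 7 = 2 ^ b.h

theorem Fixed.congr (h : b.Fixed s) (hs : ∀ r, r < 10 → s'.reg r = s.reg r) : b.Fixed s' :=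
  ⟨by simp [hs, h.k], by simp [hs, h.used],
    by simp [hs, h.K], by simp [hs, h.H]⟩

theorem runs_flushChain (hb : b.Ok) (hW : b.Fits W) (hyh : 2 ^ b.h ≤ y) (hyh' : y < 2 ^ (b.h + 1)) :
    ∀ (i : ℕ) {len : ℕ → ℕ} {val : ℕ → ℕ → α} {s : State α},
    i ≤ b.h → b.Mem len val s.mem → b.Fixed s → s.reg 10 = y → s.reg 11 = 2 ^ i → s.reg 12 = i →
    (∀ v ∈ (chain y i).head?, FlushInv b.tree v ⟨v, len⟩) →
    Runs W (flushChain b.a) s fun n tr s' => ∃ len' val', DSteps b.tree (chain y i) len n tr len' ∧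
      (b.k = 1 → n = 0) ∧ b.Mem len' val' s'.mem ∧
      (1 ≤ i → ∀ u, 1 ≤ u → u < 2 ^ b.h → len' u < b.tree.sz (ht b.h u)) ∧
      ∀ r, r < 11 ∨ 30 ≤ r → s'.reg r = s.reg r
  | 0, len, val, s, _, hm, hf, h10, h11, h12, _ =>
    runs_loop_zero (by simp [h12]) ⟨len, val, .nil _, by simp, hm, by omega, by simp⟩
  | i + 1, len, val, s, hi, hm, hf, h10, h11, h12, hI => by
    have hWK := hW.1
    have hKg := hb.K_gt
    have hle := hb.le_k
    have hI1 := hI (y / 2 ^ (i + 1)) (by simp [chain])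
    have hpw : 2 ^ (i + 1) ≤ 2 ^ b.h := Nat.pow_le_pow_right (by norm_num) hi
    have hil : i + 1 < 2 ^ (i + 1) := Nat.lt_two_pow_self
    refine runs_loop_succ (by simp [h12]) ?_
    rw [runs_seq]
    refine (runs_flush (ρ := s.reg) hb hW hm (fun _ _ => rfl) hf.k hf.used hf.K hf.H h10 h11 h12 rfl
      hyh hyh' (by omega) hi hI1).mono ?_
    rintro n tr s₁ ⟨tr₁, len', val', rfl, h1, h2, h3, h4, h5⟩
    have q11 : s₁.reg 11 = 2 ^ (i + 1) := by simp [h4, h11]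
    have q12 : s₁.reg 12 = i + 1 := by simp [h4, h12]
    have e1 : 2 ^ (i + 1) / 2 = 2 ^ i := by rw [pow_succ]; simp
    refine runs_assign_seq ?_ (by simp [q11]; omega)
    rw [runs_assign]
    refine ⟨by simp [q12]; omega, ?_⟩
    have hnf := (hI1.steps (fun i => bufSize_pos b.a i) h1).not_full
      (fun i => bufSize_pos b.a i) h2
    refine (runs_flushChain hb hW hyh hyh' i (len := len') (val := val') (by omega) (by simpa using h5)
      (hf.congr fun r hr => ?_) ?_ ?_ ?_ ?_).mono ?_
    · simp
      rw [if_neg (by omega), if_neg (by omega), h4 r (by omega)]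
    · simp
      simp [h4, h10]
    · simp [q11, e1]
    · simp [q12]
    · intro v hv
      have hmem := List.mem_of_mem_head? hv
      obtain ⟨e, g1, g2, rfl⟩ := mem_chain_iff.1 hmem
      have g3 := div_pow_bounds hyh hyh' (i := e) (by omega)
      have g4 : 1 ≤ y / 2 ^ e := le_trans Nat.one_le_two_pow g3.1
      have g5 : y / 2 ^ e < 2 ^ b.h := lt_of_lt_of_le g3.2
        (Nat.pow_le_pow_right (by norm_num) (by omega))
      exact .of_not_full g4 g5 (fun u h5 h6 => Or.inr (hnf u h5 h6)) fun _ => hnf _ g4 g5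
    rintro n' tr' s₂ ⟨len'', val'', h6, h7, h8, h9, h10'⟩
    refine ⟨len'', val'', ?_, ?_, h8, ?_, ?_⟩
    · have := DSteps.cons (te := [loc b.K 5 (y / 2 ^ (i + 1))]) h1 h2 (by simp)
        (by simpa using b.mem_aux_cnt _ hI1.cur_lt) h6
      rw [chain]
      simpa using this
    · intro hk
      rw [h3 hk, h7 hk]
    · intro _ u g1 g2
      rcases Nat.eq_zero_or_pos i with rfl | hi0
      · cases h6
        exact hnf u g1 g2
      · exact h9 hi0 u g1 g2
    · intro r hr
      rw [h10' r hr]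
      simp
      rw [if_neg (by omega), if_neg (by omega), h4 r (by omega)]

theorem runs_flushAll (hb : b.Ok) (hW : b.Fits W) : ∀ (n y : ℕ) {len : ℕ → ℕ}
    {val : ℕ → ℕ → α} {s : State α}, 2 ^ b.h ≤ y → Even y → y + 2 * n = 2 ^ (b.h + 1) →
    b.Mem len val s.mem → b.Fixed s → s.reg 10 = y →
    (∀ v ∈ (preorder n y).head?, FlushInv b.tree v ⟨v, len⟩) →
    Runs W (flushAll b.a) s fun c tr s' => ∃ len' val',
      DSteps b.tree (preorder n y) len c tr len' ∧ (b.k = 1 → c = 0) ∧ b.Mem len' val' s'.mem ∧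
      ∀ r, r < 10 ∨ 30 ≤ r → s'.reg r = s.reg r
  | 0, y, len, val, s, _, _, hy, hm, hf, h10, _ =>
    runs_loop_zero (by
      rw [pow_succ] at hy
      simp [h10, hf.H]
      omega) ⟨len, val, .nil _, by simp, hm, by simp⟩
  | n + 1, y, len, val, s, hyh, hev, hy, hm, hf, h10, hI => by
    have hWK := hW.1
    have hKg := hb.K_gt
    have hle := hb.le_k
    have hy2 : y < 2 ^ (b.h + 1) := by omega
    have hy0 : y ≠ 0 := by omega
    have hvle := padicValNat_two_le hyh hy2
    have hv1 := one_le_padicValNat_two hy0 hev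
    refine runs_loop_succ (by simp [h10, hf.H]; omega) ?_
    refine runs_assign_seq ?_
    refine runs_assign_seq ?_
    rw [runs_seq]
    refine (runs_loop_pure (G := ℕ) (fun j s' => s'.mem = s.mem ∧ s'.reg 11 = 2 ^ j ∧
      s'.reg 12 = j ∧ 2 ^ j ∣ y ∧ ∀ r, r ≠ 11 → r ≠ 12 → s'.reg r = s.reg r)
      (fun j => y - 2 ^ j) ?_ 0 _ ?_).mono ?_
    · rintro j s' ⟨h1, h2, h3, h4, h5⟩ hc
      have q10 : s'.reg 10 = y := by simp [h5, h10]
      simp only [eval_sub, eval_V, q10, eval_mul, eval_div, eval_ofNat, h2] at hc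
      have hd : 2 * 2 ^ j ∣ y := by
        have h5 := Nat.div_add_mod y (2 * 2 ^ j)
        rw [mul_comm] at h5
        exact Nat.dvd_of_mod_eq_zero (by omega)
      have hle := Nat.le_of_dvd (by omega) hd
      have hjl : j < 2 ^ j := Nat.lt_two_pow_self
      refine runs_assign_seq ?_ (by simp [h2]; omega)
      rw [runs_assign]
      refine ⟨by simp [h3]; omega, rfl, rfl, j + 1, ⟨by simpa using h1, ?_, ?_, ?_, ?_⟩, ?_⟩
      · simp [h2, pow_succ']
      · simp [h3]
      · rwa [pow_succ']
      · intro r h6 h7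
        simp [h6, h7, h5 r h6 h7]
      · rw [pow_succ']
        omega
    · refine ⟨rfl, by simp, by simp, by simp, ?_⟩
      intro r h6 h7
      simp [h6, h7]
    rintro _ _ s₁ ⟨rfl, rfl, j, ⟨h1, h2, h3, h4, h5⟩, hc⟩
    have q10 : s₁.reg 10 = y := by simp [h5, h10]
    simp only [eval_sub, eval_V, q10, eval_mul, eval_div, eval_ofNat, h2] at hc
    have hnd : ¬ 2 ^ (j + 1) ∣ y := by
      rintro hd
      rw [pow_succ'] at hd
      rw [Nat.div_mul_cancel hd] at hc
      omega
    have hj : padicValNat 2 y = j := padicValNat_two_unique hy0 h4 hnd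
    rw [preorder, hj] at hI
    rw [hj] at hvle hv1
    rw [runs_seq]
    have hhead : (chain y j).head? = some (y / 2 ^ j) := by
      obtain ⟨i, rfl⟩ : ∃ i, j = i + 1 := ⟨j - 1, by omega⟩
      simp [chain]
    refine (runs_flushChain hb hW hyh hy2 j (len := len) (val := val) hvle (by rwa [h1])
      (hf.congr fun r hr => h5 r (by omega) (by omega)) q10 h2 h3 (by
        intro v hv
        refine hI v ?_
        rw [List.head?_append, hhead]
        rw [hhead] at hv
        exact hv)).mono ?_
    rintro c tr s₂ ⟨len', val', g1, g2, g3, g4, g5⟩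
    have hnf := g4 hv1
    rw [runs_assign]
    have q10' : s₂.reg 10 = y := by simp [g5, q10]
    refine ⟨by simp [q10']; omega, ?_⟩
    refine (runs_flushAll hb hW n (y + 2) (len := len') (val := val') (by omega)
      (by rw [Nat.even_add]; simp [hev]) (by omega) (by simpa using g3)
      (hf.congr fun r hr => ?_) ?_ ?_).mono ?_
    · simp
      rw [if_neg (by omega), g5 r (by omega), h5 r (by omega) (by omega)]
    · simp [q10']
    · intro v hv
      obtain ⟨h6, h7⟩ := mem_preorder (h := b.h) (by omega) (by omega)
        (List.mem_of_mem_head? hv)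
      exact .of_not_full h6 h7 (fun u h5 h6 => Or.inr (hnf u h5 h6)) fun _ => hnf _ h6 h7
    rintro c' tr' s₃ ⟨len'', val'', f1, f2, f3, f4⟩
    refine ⟨len'', val'', ?_, ?_, f3, ?_⟩
    · rw [preorder, hj]
      simpa using g1.append f1
    · intro hk
      rw [g2 hk, f2 hk]
    · intro r hr
      rw [f4 r hr]
      simp
      rw [if_neg (by omega), g5 r (by omega), h5 r (by omega) (by omega)]

end Batch

/-! ### Scanning -/

/-- The cache contents of a scan with the fixed blocks `F` and three pointers. -/
def win (B : ℕ) (F : Finset ℕ) (p q r : ℕ) : Finset ℕ :=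
  F ∪ {p / B, p / B + 1, q / B, q / B + 1, r / B, r / B + 1}

theorem card_win_le (B : ℕ) (F : Finset ℕ) (p q r : ℕ) : (win B F p q r).card ≤ F.card + 6 := by
  refine (Finset.card_union_le _ _).trans ?_
  gcongr
  exact Finset.card_le_six

/-- The trace `tr` can be served while the pointers advance from `p, q, r` to `p', q', r'`, and
the loads are paid by the advance of the pointers. -/
def Scan (m B : ℕ) (F : Finset ℕ) (p q r : ℕ) (tr : List ℕ) (p' q' r' : ℕ) : Prop :=
  p ≤ p' ∧ q ≤ q' ∧ r ≤ r' ∧ ∃ n, Sched m B (win B F p q r) tr n (win B F p' q' r') ∧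
    n + 2 * (p / B + q / B + r / B) ≤ 2 * (p' / B + q' / B + r' / B)

theorem Scan.refl (m B : ℕ) (F : Finset ℕ) (p q r : ℕ) : Scan m B F p q r [] p q r :=
  ⟨le_rfl, le_rfl, le_rfl, 0, .nil _, by omega⟩

theorem Scan.trans {p' q' p'' q'' r'' : ℕ} (h : Scan m B F p q r tr p' q' r')
    (h' : Scan m B F p' q' r' tr' p'' q'' r'') : Scan m B F p q r (tr ++ tr') p'' q'' r'' := by
  obtain ⟨h1, h2, h3, n, h4, h5⟩ := h
  obtain ⟨h1', h2', h3', n', h4', h5'⟩ := h'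
  exact ⟨h1.trans h1', h2.trans h2', h3.trans h3', _, h4.append h4', by omega⟩

/-- Each pointer keeps its block and the next one in the cache. When it enters another block, at
most two blocks are new and the block number grows by at least one. -/
theorem card_win_sdiff_le {p' q' : ℕ} (hp : p ≤ p') (hq : q ≤ q') (hr : r ≤ r') :
    (win B F p' q' r' \ win B F p q r).card + 2 * (p / B + q / B + r / B) ≤
      2 * (p' / B + q' / B + r' / B) := by
  have h1 : p / B ≤ p' / B := Nat.div_le_div_right hp
  have h2 : q / B ≤ q' / B := Nat.div_le_div_right hq
  have h3 : r / B ≤ r' / B := Nat.div_le_div_right hr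
  have hsub : win B F p' q' r' \ win B F p q r ⊆
      ({p' / B, p' / B + 1} \ {p / B, p / B + 1}) ∪ ({q' / B, q' / B + 1} \ {q / B, q / B + 1}) ∪
        ({r' / B, r' / B + 1} \ {r / B, r / B + 1}) := by
    intro x hx
    simp only [win, Finset.mem_sdiff, Finset.mem_union, Finset.mem_insert,
      Finset.mem_singleton] at hx ⊢
    tauto
  have hone : ∀ x x' : ℕ, x ≤ x' →
      (({x', x' + 1} : Finset ℕ) \ {x, x + 1}).card + 2 * x ≤ 2 * x' := by
    intro x x' h
    by_cases he : x = x'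
    · subst he
      simp
    · have h4 := (Finset.card_le_card (Finset.sdiff_subset (s := ({x', x' + 1} : Finset ℕ))
        (t := {x, x + 1}))).trans Finset.card_le_two
      omega
  have h4 := (Finset.card_le_card hsub).trans ((Finset.card_union_le _ _).trans
    (Nat.add_le_add_right (Finset.card_union_le _ _) _))
  have h5 := hone _ _ h1
  have h6 := hone _ _ h2
  have h7 := hone _ _ h3
  omega

theorem Scan.step {p' q' : ℕ} (hF : F.card + 6 ≤ m) (hp : p ≤ p') (hq : q ≤ q') (hr : r ≤ r')
    (h : ∀ c ∈ tr, c / B ∈ win B F p q r) : Scan m B F p q r tr p' q' r' := by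
  have h1 := (Sched.of_subset h ((card_win_le _ _ _ _ _).trans hF)).append
    (Sched.change _ (win B F p' q' r'))
  rw [List.append_nil, zero_add] at h1
  exact ⟨hp, hq, hr, _, h1, card_win_sdiff_le hp hq hr⟩

theorem cast_div_sub_le (p p' : ℕ) (hB : 0 < B) :
    ((p' / B : ℕ) : ℝ) - ((p / B : ℕ) : ℝ) ≤ (p' - p) / B + 1 := by
  have h1 : ((p' / B : ℕ) : ℝ) ≤ p' / B := Nat.cast_div_le
  have h2 : (p : ℝ) / B ≤ ((p / B : ℕ) : ℝ) + 1 := by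
    rw [div_le_iff₀ (by exact_mod_cast hB)]
    have h3 := Nat.lt_div_mul_add (a := p) hB
    have h4 : p ≤ (p / B + 1) * B := by rw [add_mul, one_mul]; omega
    exact_mod_cast h4
  rw [sub_div]
  linarith

/-- Six blocks of the initial window and twice the rounding error of three block numbers give the
constant `12`. -/
theorem Scan.io {p' q' : ℕ} (hB : 0 < B) (h : Scan m B F p q r tr p' q' r') :
    IOB m B tr (F.card + 12 + 2 * (((p' - p) + (q' - q) + (r' - r) : ℝ) / B)) := by
  obtain ⟨h1, h2, h3, n, h4, h5⟩ := h
  refine IOB.of_sched h4 ?_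
  have h6 : ((win B F p q r).card : ℝ) ≤ F.card + 6 := by exact_mod_cast card_win_le _ _ _ _ _
  have h7 := cast_div_sub_le p p' hB
  have h8 := cast_div_sub_le q q' hB
  have h9 := cast_div_sub_le r r' hB
  have h10 : (n : ℝ) + 2 * ((p / B : ℕ) + (q / B : ℕ) + (r / B : ℕ)) ≤
      2 * ((p' / B : ℕ) + (q' / B : ℕ) + (r' / B : ℕ)) := by exact_mod_cast h5
  have h11 : ((p' - p) + (q' - q) + (r' - r) : ℝ) / B =
    (p' - p) / B + (q' - q) / B + (r' - r) / B := by ring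
  rw [h11]
  linarith

/-- Pointers that stay fixed cost nothing. -/
theorem IOB.of_intervals (hn : n < B) (hF : F.card + 6 ≤ m)
    (h : ∀ c ∈ tr, c / B ∈ F ∨ (x ≤ c ∧ c ≤ x + n) ∨ (y ≤ c ∧ c ≤ y + n)) :
    IOB m B tr (F.card + 6) := by
  have hdiv : ∀ {z c : ℕ}, z ≤ c → c ≤ z + n → c / B = z / B ∨ c / B = z / B + 1 := by
    intro z c h1 h2
    have h3 : z / B ≤ c / B := Nat.div_le_div_right h1
    have h4 : c / B ≤ (z + B) / B := Nat.div_le_div_right (by omega)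
    rw [Nat.add_div_right _ (by omega)] at h4
    omega
  refine (IOB.of_subset (win B F x y y) ?_ ((card_win_le _ _ _ _ _).trans hF)).mono
    (by exact_mod_cast card_win_le _ _ _ _ _)
  intro c hc
  simp only [win, Finset.mem_union, Finset.mem_insert, Finset.mem_singleton]
  rcases h c hc with h1 | h1 | h1
  · exact Or.inl h1
  · rcases hdiv h1.1 h1.2 with h2 | h2 <;> simp [h2]
  · rcases hdiv h1.1 h1.2 with h2 | h2 <;> simp [h2]

/-! ### Ranks in a group, and regular samples -/

/-- The order of positions by their elements, with ties broken by position. -/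
def Before (A : ℕ → α) (f e : ℕ) : Prop := A f < A e ∨ (A f = A e ∧ f < e)

instance (A : ℕ → α) (f e : ℕ) : Decidable (Before A f e) :=
  inferInstanceAs (Decidable (A f < A e ∨ (A f = A e ∧ f < e)))

theorem Before.trans {g : ℕ} (h : Before A e f) (h' : Before A f g) : Before A e g := by
  rcases h with h | ⟨h, h1⟩ <;> rcases h' with h' | ⟨h', h1'⟩
  · exact Or.inl (h.trans h')
  · exact Or.inl (h' ▸ h)
  · exact Or.inl (h ▸ h')
  · exact Or.inr ⟨h.trans h', h1.trans h1'⟩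

theorem Before.irrefl (e : ℕ) : ¬ Before A e e := by
  rintro (h | ⟨-, h⟩) <;> exact lt_irrefl _ h

theorem before_trichotomy (A : ℕ → α) (h : e ≠ f) : Before A e f ∨ Before A f e := by
  rcases lt_trichotomy (A e) (A f) with h1 | h1 | h1
  · exact Or.inl (Or.inl h1)
  · rcases lt_or_gt_of_ne h with h2 | h2
    · exact Or.inl (Or.inr ⟨h1, h2⟩)
    · exact Or.inr (Or.inr ⟨h1.symm, h2⟩)
  · exact Or.inr (Or.inl h1)

theorem Before.le (h : Before A e f) : A e ≤ A f := by
  rcases h with h | ⟨h, -⟩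
  · exact h.le
  · exact h.le

/-- The rank of position `e` in the group `G` of positions. -/
def rankIn (A : ℕ → α) (G : Finset ℕ) (e : ℕ) : ℕ :=
  (G.filter fun f => Before A f e).card

theorem rankIn_lt_of_before {G : Finset ℕ} (he : e ∈ G) (h : Before A e f) :
    rankIn A G e < rankIn A G f := by
  refine Finset.card_lt_card (Finset.ssubset_iff_subset_ne.2 ⟨?_, ?_⟩)
  · intro x hx
    rw [Finset.mem_filter] at hx ⊢
    exact ⟨hx.1, hx.2.trans h⟩
  · intro heq
    have : e ∈ G.filter fun x => Before A x f := Finset.mem_filter.2 ⟨he, h⟩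
    rw [← heq, Finset.mem_filter] at this
    exact Before.irrefl _ this.2

theorem rankIn_injOn (A : ℕ → α) (G : Finset ℕ) : Set.InjOn (rankIn A G) G := by
  intro e he f hf h
  by_contra hne
  rcases before_trichotomy A hne with h1 | h1
  · exact absurd h (rankIn_lt_of_before he h1).ne
  · exact absurd h (rankIn_lt_of_before hf h1).ne'

/-- The ranks in `G` of the members of a lower set `D` are below `D.card`, since everything before a
member belongs to `D`; being distinct, they are all the numbers below `D.card`. -/
theorem image_rankIn_of_lower {G D : Finset ℕ} (hD : D ⊆ G)
    (hlow : ∀ e ∈ D, ∀ f ∈ G, Before A f e → f ∈ D) :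
    D.image (rankIn A G) = Finset.range D.card := by
  have hinj : Set.InjOn (rankIn A G) D := (rankIn_injOn A G).mono (by exact_mod_cast hD)
  refine Finset.eq_of_subset_of_card_le ?_ ?_
  · intro x hx
    obtain ⟨e, he, rfl⟩ := Finset.mem_image.1 hx
    rw [Finset.mem_range]
    refine Finset.card_lt_card (Finset.ssubset_iff_subset_ne.2 ⟨?_, ?_⟩)
    · intro f hf
      rw [Finset.mem_filter] at hf
      exact hlow e he f hf.1 hf.2
    · intro heq
      rw [← heq, Finset.mem_filter] at he
      exact Before.irrefl _ he.2
  · rw [Finset.card_range, Finset.card_image_of_injOn hinj]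

theorem card_filter_mod (c : ℕ) : ((Finset.range c).filter fun r => r % 4 = 3).card = c / 4 := by
  induction c with
  | zero => rfl
  | succ c ih =>
    rw [Finset.range_add_one, Finset.filter_insert]
    split_ifs with h
    · rw [Finset.card_insert_of_notMem (by simp), ih]
      omega
    · rw [ih]
      omega

/-- Taking the ranks `3` modulo `4` gives exactly `⌊|D| / 4⌋` samples in every lower set, hence
never more than a quarter. The bounds for thresholds from below and from above both come from this
equality. -/
theorem card_sample_lower {G D : Finset ℕ} (hD : D ⊆ G)
    (hlow : ∀ e ∈ D, ∀ f ∈ G, Before A f e → f ∈ D) :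
    (D.filter fun e => rankIn A G e % 4 = 3).card = D.card / 4 := by
  have hinj : Set.InjOn (rankIn A G) D := (rankIn_injOn A G).mono (by exact_mod_cast hD)
  rw [← card_filter_mod, ← image_rankIn_of_lower hD hlow, Finset.filter_image,
    Finset.card_image_of_injOn (hinj.mono (by
      intro x hx
      exact (Finset.mem_filter.1 hx).1))]

theorem card_sample_le (A : ℕ → α) (G : Finset ℕ) (t : α) :
    4 * (G.filter fun e => A e ≤ t ∧ rankIn A G e % 4 = 3).card ≤
      (G.filter fun e => A e ≤ t).card := by
  have h := card_sample_lower (A := A) (G := G) (D := G.filter fun e => A e ≤ t)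
    (Finset.filter_subset _ _) (by
      intro e he f hf hb
      rw [Finset.mem_filter] at he ⊢
      exact ⟨hf, hb.le.trans he.2⟩)
  rw [Finset.filter_filter] at h
  rw [h]
  omega

/-- The elements `≥ t` form the complement of a lower set; subtracting two rounded quotients costs
the additional `3`. -/
theorem card_sample_ge (A : ℕ → α) (G : Finset ℕ) (t : α) :
    4 * (G.filter fun e => t ≤ A e ∧ rankIn A G e % 4 = 3).card ≤
      (G.filter fun e => t ≤ A e).card + 3 := by
  have h1 := card_sample_lower (A := A) (G := G) (D := G.filter fun e => ¬ t ≤ A e)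
    (Finset.filter_subset _ _) (by
      intro e he f hf hb
      rw [Finset.mem_filter, not_le] at he ⊢
      exact ⟨hf, lt_of_le_of_lt hb.le he.2⟩)
  have h2 := card_sample_lower (A := A) (G := G) (D := G) subset_rfl (fun _ _ f hf _ => hf)
  have h3 := Finset.card_filter_add_card_filter_not (s := G) (fun e => t ≤ A e)
  have h4 := Finset.card_filter_add_card_filter_not (s := G.filter fun e => rankIn A G e % 4 = 3)
    (fun e => t ≤ A e)
  rw [Finset.filter_filter, Finset.filter_filter] at h4
  rw [Finset.filter_filter] at h1
  simp only [and_comm (a := rankIn A G _ % 4 = 3)] at h4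
  omega

theorem card_sample (A : ℕ → α) (G : Finset ℕ) :
    4 * (G.filter fun e => rankIn A G e % 4 = 3).card ≤ G.card ∧
      G.card ≤ 4 * (G.filter fun e => rankIn A G e % 4 = 3).card + 3 := by
  have h2 := card_sample_lower (A := A) (G := G) (D := G) subset_rfl (fun _ _ f hf _ => hf)
  omega

/-- The position of rank `r`. -/
theorem exists_rankIn_eq (A : ℕ → α) {G : Finset ℕ} (hr : r < G.card) :
    ∃ e ∈ G, rankIn A G e = r := by
  have h := image_rankIn_of_lower (A := A) (G := G) (D := G) subset_rfl (fun _ _ f hf _ => hf)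
  have : r ∈ G.image (rankIn A G) := by rw [h]; exact Finset.mem_range.2 hr
  simpa using this

theorem card_le_of_rankIn {G : Finset ℕ} (he : e ∈ G) (h : rankIn A G e = r) :
    r + 1 ≤ (G.filter fun f => A f ≤ A e).card ∧
      G.card ≤ r + (G.filter fun f => A e ≤ A f).card := by
  constructor
  · rw [← h, rankIn]
    rw [← Finset.card_insert_of_notMem (s := G.filter fun f => Before A f e) (a := e)
      (by simp [Before.irrefl])]
    refine Finset.card_le_card ?_
    intro x hx
    rw [Finset.mem_insert, Finset.mem_filter] at hx
    rw [Finset.mem_filter]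
    rcases hx with rfl | hx
    · exact ⟨he, le_rfl⟩
    · exact ⟨hx.1, hx.2.le⟩
  · rw [← h, rankIn, ← Finset.card_filter_add_card_filter_not (s := G) (fun f => Before A f e)]
    gcongr with f _
    intro hf
    by_contra hcon
    exact hf (Or.inl (not_le.1 hcon))

/-! ### Samples of all groups -/

/-- The group of position `e` when `q` positions are divided into groups of size `g`. -/
def group (q g e : ℕ) : Finset ℕ := Finset.Ico (e / g * g) (min (e / g * g + g) q)

theorem group_eq {g : ℕ} (h : e / g = i) :
    group q g e = Finset.Ico (i * g) (min (i * g + g) q) := by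
  unfold group
  rw [h]

theorem filter_div_eq {g : ℕ} (hg : 0 < g) (i : ℕ) :
    (Finset.range q).filter (fun e => e / g = i) = Finset.Ico (i * g) (min (i * g + g) q) := by
  ext e
  rw [Finset.mem_filter, Finset.mem_range, Finset.mem_Ico, Nat.div_eq_iff hg]
  constructor <;> omega

theorem sum_groups {g : ℕ} (hg : 0 < g) (P : ℕ → Prop) [DecidablePred P] :
    ((Finset.range q).filter P).card = ∑ i ∈ Finset.range (q / g + 1),
      ((Finset.Ico (i * g) (min (i * g + g) q)).filter P).card := by
  have h1 : ∀ e ∈ (Finset.range q).filter P, e / g ∈ Finset.range (q / g + 1) := by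
    intro e he
    rw [Finset.mem_filter, Finset.mem_range] at he
    rw [Finset.mem_range, Nat.lt_succ_iff]
    exact Nat.div_le_div_right he.1.le
  rw [Finset.card_eq_sum_card_fiberwise h1]
  refine Finset.sum_congr rfl fun i _ => ?_
  rw [← filter_div_eq hg, Finset.filter_filter, Finset.filter_filter]
  simp only [and_comm]

/-- The positions chosen for the sample. -/
def Sampled (A : ℕ → α) (q g e : ℕ) : Prop := rankIn A (group q g e) e % 4 = 3

instance (A : ℕ → α) (q g e : ℕ) : Decidable (Sampled A q g e) :=
  inferInstanceAs (Decidable (rankIn A (group q g e) e % 4 = 3))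

/-- The error `c` of a single group occurs at most once for each of the `q / g + 1` groups. -/
theorem card_sampled {g : ℕ} (hg : 0 < g) (P : ℕ → Prop) [DecidablePred P] {c : ℕ} (h : ∀ G : Finset
    ℕ, 4 * (G.filter fun e => P e ∧ rankIn A G e % 4 = 3).card ≤ (G.filter P).card + c) :
    4 * ((Finset.range q).filter fun e => P e ∧ Sampled A q g e).card ≤
      ((Finset.range q).filter P).card + c * (q / g + 1) := by
  rw [sum_groups hg (fun e => P e ∧ Sampled A q g e), sum_groups hg P, Finset.mul_sum]
  calc _ ≤ ∑ i ∈ Finset.range (q / g + 1),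
        (((Finset.Ico (i * g) (min (i * g + g) q)).filter P).card + c) := by
        refine Finset.sum_le_sum fun i _ => ?_
        refine le_trans (le_of_eq ?_) (h (Finset.Ico (i * g) (min (i * g + g) q)))
        congr 2
        refine Finset.filter_congr fun e he => ?_
        have : e / g = i := by
          rw [Finset.mem_Ico] at he
          rw [Nat.div_eq_iff hg]
          omega
        rw [Sampled, group_eq this]
    _ = _ := by
      rw [Finset.sum_add_distrib, Finset.sum_const, Finset.card_range, smul_eq_mul]
      ring

theorem card_sampled_ge {g : ℕ} (hg : 0 < g) :
    q ≤ 4 * ((Finset.range q).filter fun e => Sampled A q g e).card + 3 * (q / g + 1) := by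
  have h0 : q = ((Finset.range q).filter fun _ => True).card := by simp
  conv_lhs => rw [h0]
  rw [sum_groups hg (fun _ => True), sum_groups hg (fun e => Sampled A q g e), Finset.mul_sum]
  calc _ ≤ ∑ i ∈ Finset.range (q / g + 1),
        (4 * ((Finset.Ico (i * g) (min (i * g + g) q)).filter fun e => Sampled A q g e).card + 3) := by
        refine Finset.sum_le_sum fun i _ => ?_
        rw [Finset.filter_true]
        refine (card_sample A (Finset.Ico (i * g) (min (i * g + g) q))).2.trans (le_of_eq ?_)
        congr 3
        refine Finset.filter_congr fun e he => ?_
        have : e / g = i := by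
          rw [Finset.mem_Ico] at he
          rw [Nat.div_eq_iff hg]
          omega
        rw [Sampled, group_eq this]
    _ = _ := by
      rw [Finset.sum_add_distrib, Finset.sum_const, Finset.card_range, smul_eq_mul]
      ring

/-! ### Computing a sample -/

/-- Register `43` gets the rank of position `e` in its group. -/
def rankLoop : Cmd :=
  .assign 43 0 ;; .assign 42 (V 40) ;;
  .loop (V 41 - V 42)
    (.ite (V 39 - V 42)
      (.compare 44 (V 34 + V 42) (V 34 + V 39) ;; .assign 43 (V 43 + V 44))
      (.compare 44 (V 34 + V 39) (V 34 + V 42) ;; .assign 43 (V 43 + (1 - V 44))) ;;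
     .assign 42 (V 42 + 1))

theorem rankIn_Ico_succ (A : ℕ → α) (e : ℕ) (h : a ≤ f) : rankIn A (Finset.Ico a (f + 1)) e =
      rankIn A (Finset.Ico a f) e + if Before A f e then 1 else 0 := by
  unfold rankIn
  rw [← Finset.insert_Ico_right_eq_Ico_add_one h, Finset.filter_insert]
  split_ifs
  · rw [Finset.card_insert_of_notMem (by simp)]
  · rfl

/-- Knowing which position comes first, the order with ties broken by position is decided by a
single `≤` comparison; the same holds for the next lemma with a negation. -/
theorem before_iff_of_lt (h : f < e) : Before A f e ↔ A f ≤ A e := by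
  unfold Before
  rw [le_iff_lt_or_eq]
  simp [h]

theorem before_iff_of_ge (h : e ≤ f) : Before A f e ↔ ¬ A e ≤ A f := by
  rw [not_le]
  constructor
  · rintro (h1 | h1)
    · exact h1
    · omega
  · exact Or.inl

theorem runs_rankLoop {bnd : ℕ} (hm : 7 ≤ m) (h34 : s.reg 34 = src) (h39 : s.reg 39 = e)
    (h40 : s.reg 40 = a) (h41 : s.reg 41 = bnd) (hA : ∀ i < q, s.mem (src + i) = .elem (A i))
    (he : e < q) (hab : a ≤ bnd) (hbq : bnd ≤ q) (hW : q + 1 < W) :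
    Runs W rankLoop s fun n tr s' => n = bnd - a ∧ tr.length = 2 * (bnd - a) ∧
      (∀ c ∈ tr, (src + a ≤ c ∧ c < src + bnd) ∨ c = src + e) ∧
      Scan m B {(src + e) / B} (src + a) 0 0 tr (src + bnd) 0 0 ∧ s'.mem = s.mem ∧
      s'.reg 43 = rankIn A (Finset.Ico a bnd) e ∧
      ∀ r, r ≠ 42 → r ≠ 43 → r ≠ 44 → s'.reg r = s.reg r := by
  unfold rankLoop
  refine runs_assign_seq ?_
  refine runs_assign_seq ?_ (by simp [h40]; omega)
  refine (runs_loop (G := ℕ) (fun f s' => a ≤ f ∧ f ≤ bnd ∧ s'.reg 42 = f ∧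
    s'.reg 43 = rankIn A (Finset.Ico a f) e ∧ s'.mem = s.mem ∧
    ∀ r, r ≠ 42 → r ≠ 43 → r ≠ 44 → s'.reg r = s.reg r) (fun f => bnd - f)
    (fun f n tr f' => f ≤ f' ∧ n + f = f' ∧ tr.length + 2 * f = 2 * f' ∧
      (∀ c ∈ tr, (src + a ≤ c ∧ c < src + bnd) ∨ c = src + e) ∧
      Scan m B {(src + e) / B} (src + f) 0 0 tr (src + f') 0 0) ?_ ?_ ?_ a _ ?_).mono ?_
  · intro f s' _
    exact ⟨le_rfl, by omega, by simp, by simp, Scan.refl _ _ _ _ _ _⟩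
  · rintro f n tr f' n' tr' f'' ⟨h1, h2, h3, h4, h5⟩ ⟨h1', h2', h3', h4', h5'⟩
    refine ⟨by omega, by omega, by simp; omega, ?_, h5.trans h5'⟩
    intro c hc
    rcases List.mem_append.1 hc with hc | hc
    · exact h4 c hc
    · exact h4' c hc
  · rintro f s' ⟨h1, h2, h3, h4, h5, h6⟩ hc
    have q34 : s'.reg 34 = src := by simp [h6, h34]
    have q39 : s'.reg 39 = e := by simp [h6, h39]
    have q41 : s'.reg 41 = bnd := by simp [h6, h41]
    simp only [eval_sub, eval_V, q41, h3] at hc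
    have hrk : rankIn A (Finset.Ico a f) e ≤ q := by
      refine (Finset.card_filter_le _ _).trans ?_
      rw [Nat.card_Ico]
      omega
    have hmem : ∀ i < q, s'.mem (src + i) = .elem (A i) := by rw [h5]; exact hA
    have hsucc := rankIn_Ico_succ A e h1
    have hscan : ∀ tr : List ℕ, (∀ c ∈ tr, c = src + f ∨ c = src + e) →
        (∀ c ∈ tr, (src + a ≤ c ∧ c < src + bnd) ∨ c = src + e) ∧
        Scan m B {(src + e) / B} (src + f) 0 0 tr (src + (f + 1)) 0 0 := by
      intro tr htr
      refine ⟨?_, Scan.step (by simpa using hm) (by omega) le_rfl le_rfl ?_⟩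
      · intro c hc
        rcases htr c hc with rfl | rfl
        · left; omega
        · right; rfl
      · intro c hc
        rcases htr c hc with rfl | rfl
        · simp [win]
        · simp [win]
    rw [runs_seq, runs_ite]
    simp only [eval_sub, eval_V, q39, h3]
    refine ⟨fun hfe => ?_, fun hfe => ?_⟩
    · rw [runs_seq, runs_compare]
      refine ⟨A f, A e, by simp [q34, h3, hmem f (by omega)], by simp [q34, q39, hmem e he], ?_⟩
      rw [runs_assign]
      refine ⟨by simp [h4]; split_ifs <;> omega, ?_⟩
      rw [runs_assign]
      refine ⟨by simp [h3]; omega, f + 1, ⟨by omega, by omega, by simp [h3], ?_, by simpa using h5,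
        ?_⟩, by omega, by omega, by omega, by simp; omega, hscan _ (by simp [q34, q39, h3])⟩
      · rw [hsucc]
        simp [h4, before_iff_of_lt (show f < e by omega)]
      · intro r g1 g2 g3
        simp [g1, g2, g3, h6 r g1 g2 g3]
    · rw [runs_seq, runs_compare]
      refine ⟨A e, A f, by simp [q34, q39, hmem e he], by simp [q34, h3, hmem f (by omega)], ?_⟩
      rw [runs_assign]
      refine ⟨by simp [h4]; split_ifs <;> omega, ?_⟩
      rw [runs_assign]
      refine ⟨by simp [h3]; omega, f + 1, ⟨by omega, by omega, by simp [h3], ?_, by simpa using h5,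
        ?_⟩, by omega, by omega, by omega, by simp; omega, hscan _ (by simp [q34, q39, h3])⟩
      · rw [hsucc]
        have hb := before_iff_of_ge (A := A) (show e ≤ f by omega)
        by_cases hx : A e ≤ A f
        · have hb' : ¬ Before A f e := fun h => hb.1 h hx
          simp [h4, hx, hb']
        · have hb' := hb.2 hx
          simp [h4, hx, hb']
      · intro r g1 g2 g3
        simp [g1, g2, g3, h6 r g1 g2 g3]
  · refine ⟨le_rfl, hab, by simp [h40], by simp [rankIn], rfl, ?_⟩
    intro r g1 g2 g3
    simp [g1, g2]
  rintro n tr s' ⟨f, ⟨h1, h2, h3, h4, h5, h6⟩, hc, h7, h8, h9, h10, h11⟩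
  have q41 : s'.reg 41 = bnd := by simp [h6, h41]
  simp only [eval_sub, eval_V, q41, h3] at hc
  obtain rfl : f = bnd := by omega
  exact ⟨by omega, by simp; omega, by simpa using h10, by simpa using h11, h5, h4, h6⟩

/-- The cell for the approximate median. -/
def medCell : Expr := L 7 0

/-- One pass over the array at register `34` of length register `35`: every fourth element of each
group is copied to the array at register `37`, and the median of the last group to `medCell`. -/
def sampleBody : Cmd :=
  .assign 40 (V 39 / V 36 * V 36) ;;
  .assign 41 (V 40 + V 36 - (V 40 + V 36 - V 35)) ;;
  rankLoop ;;
  .ite (V 43 + 1 - (V 43 + 1) / 4 * 4) (.assign 44 0)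
    (.move (V 37 + V 45) (V 34 + V 39) ;; .assign 45 (V 45 + 1)) ;;
  .ite ((V 43 - (V 41 - V 40) / 2) + ((V 41 - V 40) / 2 - V 43)) (.assign 44 0)
    (.move medCell (V 34 + V 39)) ;;
  .assign 39 (V 39 + 1)

def sampleLoop : Cmd :=
  .assign 39 0 ;; .assign 45 0 ;; .loop (V 35 - V 39) sampleBody

/-- The number of sampled positions below `e`. -/
def sampleCount (A : ℕ → α) (q g e : ℕ) : ℕ := ((Finset.range e).filter (Sampled A q g)).card

theorem sampleCount_succ (A : ℕ → α) (q g e : ℕ) :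
    sampleCount A q g (e + 1) = sampleCount A q g e + if Sampled A q g e then 1 else 0 := by
  unfold sampleCount
  rw [Finset.range_add_one, Finset.filter_insert]
  split_ifs
  · rw [Finset.card_insert_of_notMem (by simp)]
  · rfl

theorem sampleCount_le (A : ℕ → α) (q g e : ℕ) : sampleCount A q g e ≤ e :=
  (Finset.card_filter_le _ _).trans (by simp)

/-- Position `e` is the median of its group. -/
def IsMid (A : ℕ → α) (q g e : ℕ) : Prop :=
  rankIn A (group q g e) e = (group q g e).card / 2

/-- The state of a pass after `e` positions, with the sample `A'` so far. -/
structure SampleInv (A : ℕ → α) (q g src dst τ : ℕ) (s₀ : State α) (e : ℕ) (A' : ℕ → α)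
    (s : State α) : Prop where
  le : e ≤ q
  pos : s.reg 39 = e
  out : s.reg 45 = sampleCount A q g e
  regs : ∀ r, r < 39 ∨ 45 < r → s.reg r = s₀.reg r
  sample : ∀ i < sampleCount A q g e, s.mem (dst + i) = .elem (A' i)
  content : (Multiset.range (sampleCount A q g e)).map A' =
    ((Finset.range e).filter (Sampled A q g)).val.map A
  med : (∃ f < e, IsMid A q g f) → ∃ f < e, IsMid A q g f ∧ s.mem τ = .elem (A f)
  frame : ∀ c, c ≠ τ → (c < dst ∨ dst + q ≤ c) → s.mem c = s₀.mem c

/-- The costs of the part of a pass from position `e` to position `e'`. -/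
structure SampleCost (A : ℕ → α) (q g src dst τ m B : ℕ) (e n : ℕ) (tr : List ℕ) (e' : ℕ) :
    Prop where
  le : e ≤ e'
  comps : n + e * g ≤ e' * g
  length : tr.length + e * (2 * g + 4) ≤ e' * (2 * g + 4)
  cells : ∀ c ∈ tr, c = τ ∨ (src ≤ c ∧ c < src + q) ∨ (dst ≤ c ∧ c < dst + q)
  scan : g < B → Scan m B {τ / B} (src + e) (src + e / g * g) (dst + sampleCount A q g e) tr
    (src + e') (src + e' / g * g) (dst + sampleCount A q g e')
  io : B ≤ g → IOB m B tr ((e' - e) * (17 + 2 * (g / B)))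

theorem SampleCost.trans {g e' e'' : ℕ} (h : SampleCost A q g src dst τ m B e n tr e')
    (h' : SampleCost A q g src dst τ m B e' n' tr' e'') :
    SampleCost A q g src dst τ m B e (n + n') (tr ++ tr') e'' := by
  refine ⟨h.le.trans h'.le, ?_, ?_, ?_, fun hg => (h.scan hg).trans (h'.scan hg), fun hg => ?_⟩
  · have := h.comps
    have := h'.comps
    omega
  · have := h.length
    have := h'.length
    rw [List.length_append]
    omega
  · intro c hc
    rcases List.mem_append.1 hc with hc | hc
    · exact h.cells c hc
    · exact h'.cells c hc
  · exact ((h.io hg).append (h'.io hg)).mono (le_of_eq (by ring))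

theorem val_filter_range_succ (P : ℕ → Prop) [DecidablePred P] (e : ℕ) :
    ((Finset.range (e + 1)).filter P).val = if P e then
      e ::ₘ ((Finset.range e).filter P).val else ((Finset.range e).filter P).val := by
  rw [Finset.range_add_one, Finset.filter_insert]
  split_ifs
  · rw [Finset.insert_val_of_notMem (by simp)]
  · rfl

theorem map_range_update {β : Type*} (f : ℕ → β) (x : β) :
    (Multiset.range (n + 1)).map (Function.update f n x) = x ::ₘ (Multiset.range n).map f := by
  rw [Multiset.range_succ, Multiset.map_cons, Function.update_self]
  congr 1
  exact Multiset.map_congr rfl fun i hi => by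
    rw [Function.update_of_ne (Multiset.mem_range.1 hi).ne]

theorem runs_sampleBody {g : ℕ} {A' : ℕ → α} (hm : 7 ≤ m) (hB : 0 < B) (hg : 0 < g)
    (h34 : s₀.reg 34 = src) (h35 : s₀.reg 35 = q) (h36 : s₀.reg 36 = g) (h37 : s₀.reg 37 = dst)
    (hτ : loc (s₀.reg 6) 7 0 = τ) (hA : ∀ i < q, s₀.mem (src + i) = .elem (A i))
    (hdisj : src + q ≤ dst ∨ dst + q ≤ src) (hτs : τ < src) (hτd : τ < dst) (hW : q + 2 < W)
    (hI : SampleInv A q g src dst τ s₀ e A' s) (he : e < q) :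
    Runs W sampleBody s fun n tr s' => (∃ A'', SampleInv A q g src dst τ s₀ (e + 1) A'' s') ∧
      SampleCost A q g src dst τ m B e n tr (e + 1) := by
  have q34 : s.reg 34 = src := by simp [hI.regs, h34]
  have q35 : s.reg 35 = q := by simp [hI.regs, h35]
  have q36 : s.reg 36 = g := by simp [hI.regs, h36]
  have q37 : s.reg 37 = dst := by simp [hI.regs, h37]
  have q6 : s.reg 6 = s₀.reg 6 := hI.regs 6 (by norm_num)
  have hdm := Nat.div_mul_le_self e g
  set a := e / g * g with ha
  -- Truncated subtraction computes the minimum, here the end of a possibly incomplete last group.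
  have hbnd : a + g - (a + g - q) = min (a + g) q := by omega
  have hAs : ∀ i < q, s.mem (src + i) = .elem (A i) := by
    intro i hi
    rw [hI.frame _ (by omega) (by omega), hA i hi]
  have hoe := sampleCount_le A q g e
  have hcs := sampleCount_succ A q g e
  unfold sampleBody
  refine runs_assign_seq ?_ (by simp [hI.pos, q36]; omega)
  refine runs_assign_seq ?_ (by simp [hI.pos, q36, q35]; omega)
  rw [runs_seq]
  refine (runs_rankLoop (m := m) (B := B) (src := src) (e := e) (a := a) (bnd := min (a + g) q)
    (q := q) (A := A) hm (by simp [q34]) (by simp [hI.pos]) (by simp [hI.pos, q36, ha])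
    (by simp [hI.pos, q36, q35, ← ha, hbnd]) (by simpa using hAs) he (by omega) (by omega)
    (by omega)).mono ?_
  rintro n tr s₁ ⟨hn, hlen, hcells, hscan, hmem, h43, hregs⟩
  have hgr : Finset.Ico a (min (a + g) q) = group q g e := rfl
  rw [hgr] at h43
  have hmem' : s₁.mem = s.mem := by rw [hmem]; rfl
  have p34 : s₁.reg 34 = src := by simp [hregs, q34]
  have p37 : s₁.reg 37 = dst := by simp [hregs, q37]
  have p39 : s₁.reg 39 = e := by simp [hregs, hI.pos]
  have p40 : s₁.reg 40 = a := by
    simp [hregs, hI.pos, q36, ha]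
  have p41 : s₁.reg 41 = min (a + g) q := by
    simp [hregs, hI.pos, q36, q35, ← ha, hbnd]
  have p45 : s₁.reg 45 = sampleCount A q g e := by
    simp [hregs, hI.out]
  have p6 : s₁.reg 6 = s₀.reg 6 := by
    simp [hregs, q6]
  have plow : ∀ r, r < 39 ∨ 45 < r → s₁.reg r = s₀.reg r := by
    intro r hr
    rw [hregs r (by omega) (by omega) (by omega), ← hI.regs r hr]
    simp
    rw [if_neg (by omega), if_neg (by omega)]
  -- the copy to the sample
  have hstep1 : Runs W (.ite (V 43 + 1 - (V 43 + 1) / 4 * 4) (.assign 44 0)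
      (.move (V 37 + V 45) (V 34 + V 39) ;; .assign 45 (V 45 + 1))) s₁ fun n tr s₂ => n = 0 ∧
      tr.length ≤ 2 ∧ (∀ c ∈ tr, c = src + e ∨ c = dst + sampleCount A q g e) ∧
      (∃ A'', (∀ i < sampleCount A q g (e + 1), s₂.mem (dst + i) = .elem (A'' i)) ∧
        (Multiset.range (sampleCount A q g (e + 1))).map A'' =
          ((Finset.range (e + 1)).filter (Sampled A q g)).val.map A) ∧
      (∀ c, (c < dst ∨ dst + q ≤ c) → s₂.mem c = s.mem c) ∧
      s₂.reg 45 = sampleCount A q g (e + 1) ∧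
      ∀ r, r ≠ 44 → r ≠ 45 → s₂.reg r = s₁.reg r := by
    rw [runs_ite]
    simp only [eval_sub, eval_V, eval_mul, eval_add, eval_div, eval_ofNat, h43]
    -- The condition of the program is the remainder of `rank + 1` modulo `4`, which is zero exactly
    -- for the sampled ranks.
    have hiff : Sampled A q g e ↔ rankIn A (group q g e) e % 4 = 3 := Iff.rfl
    refine ⟨fun hc => ?_, fun hc => ?_⟩
    · have hns : ¬ Sampled A q g e := by rw [hiff]; omega
      rw [if_neg hns, add_zero] at hcs
      rw [runs_assign]
      refine ⟨by simp; omega, rfl, by simp, by simp, ⟨A', ?_, ?_⟩, ?_, ?_, ?_⟩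
      · intro i hi
        rw [setReg_mem, hmem']
        exact hI.sample i (by omega)
      · rw [val_filter_range_succ, if_neg hns, hcs, hI.content]
      · intro c _
        rw [setReg_mem, hmem']
      · simp [p45, hcs]
      · intro r h1 _
        simp [h1]
    · have hs : Sampled A q g e := by rw [hiff]; omega
      rw [if_pos hs] at hcs
      rw [runs_seq, runs_move]
      simp only [eval_add, eval_V, p37, p45, p34, p39, hmem', hAs e he]
      rw [runs_assign]
      refine ⟨by simp [p45]; omega, rfl, by simp, by simp,
        ⟨Function.update A' (sampleCount A q g e) (A e), ?_, ?_⟩, ?_, ?_, ?_⟩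
      · intro i hi
        by_cases hi' : i = sampleCount A q g e
        · subst hi'
          simp
        · rw [Function.update_of_ne hi', ← hI.sample i (by omega)]
          simp [hi', hmem']
      · rw [val_filter_range_succ, if_pos hs, hcs, map_range_update, Multiset.map_cons, hI.content]
      · intro c hc
        have : c ≠ dst + sampleCount A q g e := by omega
        simp [this, hmem']
      · simp [p45, hcs]
      · intro r _ h2
        simp [h2]
  rw [runs_seq]
  refine hstep1.mono ?_
  rintro n₂ tr₂ s₂ ⟨rfl, hlen₂, hcells₂, ⟨A'', hA1, hA2⟩, hmem₂, h45₂, hregs₂⟩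
  -- the median
  have hstep2 : Runs W (.ite ((V 43 - (V 41 - V 40) / 2) + ((V 41 - V 40) / 2 - V 43)) (.assign 44 0)
      (.move medCell (V 34 + V 39))) s₂ fun n tr s₃ => n = 0 ∧ tr.length ≤ 2 ∧
      (∀ c ∈ tr, c = src + e ∨ c = τ) ∧ (∀ c, c ≠ τ → s₃.mem c = s₂.mem c) ∧
      (IsMid A q g e → s₃.mem τ = .elem (A e)) ∧ (¬ IsMid A q g e → s₃.mem τ = s₂.mem τ) ∧
      ∀ r, r ≠ 44 → s₃.reg r = s₂.reg r := by
    rw [runs_ite]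
    have r40 : s₂.reg 40 = a := by simp [hregs₂, p40]
    have r41 : s₂.reg 41 = min (a + g) q := by simp [hregs₂, p41]
    have r43 : s₂.reg 43 = rankIn A (group q g e) e := by
      simp [hregs₂, h43]
    have hcard : (group q g e).card = min (a + g) q - a := by rw [← hgr, Nat.card_Ico]
    simp only [eval_sub, eval_V, eval_add, eval_div, eval_ofNat, r40, r41, r43]
    -- The condition of the program is the distance between the rank and half the group size, as a
    -- sum of two truncated differences.
    have hiff : IsMid A q g e ↔ rankIn A (group q g e) e = (min (a + g) q - a) / 2 := by
      rw [← hcard]; rfl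
    refine ⟨fun hc => ?_, fun hc => ?_⟩
    · rw [runs_assign]
      refine ⟨by simp; omega, rfl, by simp, by simp, fun c _ => rfl, fun h => ?_, fun _ => rfl, ?_⟩
      · rw [hiff] at h
        omega
      · intro r h
        simp [h]
    · rw [runs_move]
      have e1 : (V 34 + V 39 : Expr).eval s₂.reg = src + e := by
        simp [hregs₂ 34 (by norm_num) (by norm_num), hregs₂ 39 (by norm_num) (by norm_num), p34, p39]
      have e2 : medCell.eval s₂.reg = τ := by
        simp [medCell, hregs₂ 6 (by norm_num) (by norm_num), p6, hτ]
      rw [e1, e2]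
      refine ⟨rfl, by simp, by simp, fun c h => by simp [h], fun _ => ?_, fun h => ?_, fun r _ => rfl⟩
      · simp [hmem₂ (src + e) (by omega), hAs e he]
      · rw [hiff] at h
        omega
  rw [runs_seq]
  refine hstep2.mono ?_
  rintro n₃ tr₃ s₃ ⟨rfl, hlen₃, hcells₃, hmem₃, hmid, hnmid, hregs₃⟩
  rw [runs_assign]
  have r39 : s₃.reg 39 = e := by
    simp [hregs₃, hregs₂, p39]
  refine ⟨by simp [r39]; omega, ⟨A'', ?_⟩, ?_⟩
  · refine ⟨by omega, by simp [r39], ?_, ?_, ?_, hA2, ?_, ?_⟩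
    · simp [hregs₃ 45 (by norm_num), h45₂]
    · intro r hr
      simp
      rw [if_neg (by omega), hregs₃ r (by omega), hregs₂ r (by omega) (by omega), plow r hr]
    · intro i hi
      rw [setReg_mem, hmem₃ _ (by omega), hA1 i hi]
    · rintro ⟨f, hf, hfm⟩
      by_cases hem : IsMid A q g e
      · exact ⟨e, by omega, hem, hmid hem⟩
      · have hfe : f ≠ e := by rintro rfl; exact hem hfm
        obtain ⟨f', h1, h2, h3⟩ := hI.med ⟨f, by omega, hfm⟩
        refine ⟨f', by omega, h2, ?_⟩
        rw [setReg_mem, hnmid hem, hmem₂ _ (by omega), h3]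
    · intro c h1 h2
      rw [setReg_mem, hmem₃ c h1, hmem₂ c h2, hI.frame c h1 h2]
  · have htot : ∀ c ∈ [] ++ ([] ++ (tr ++ (tr₂ ++ (tr₃ ++ [])))),
        c ∈ tr ∨ c = src + e ∨ c = dst + sampleCount A q g e ∨ c = τ := by
      intro c hc
      simp only [List.nil_append, List.append_nil, List.mem_append] at hc
      rcases hc with hc | hc | hc
      · exact Or.inl hc
      · rcases hcells₂ c hc with h | h
        · exact Or.inr (Or.inl h)
        · exact Or.inr (Or.inr (Or.inl h))
      · rcases hcells₃ c hc with h | h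
        · exact Or.inr (Or.inl h)
        · exact Or.inr (Or.inr (Or.inr h))
    refine ⟨by omega, ?_, ?_, ?_, ?_, ?_⟩
    · rw [add_mul, one_mul]
      omega
    · rw [add_mul e 1, one_mul]
      simp only [List.nil_append, List.append_nil, List.length_append]
      omega
    · intro c hc
      rcases htot c hc with h | h | h | h
      · rcases hcells c h with h' | h'
        · right; left; omega
        · right; left; omega
      · right; left; omega
      · right; right; omega
      · exact Or.inl h
    · intro hgB
      have hmono : e / g ≤ (e + 1) / g := Nat.div_le_div_right (by omega)
      refine Scan.step (by simpa using hm) (by omega)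
        (Nat.add_le_add_left (Nat.mul_le_mul_right g hmono) _) (by omega) ?_
      intro c hc
      have hw : ∀ {x : ℕ}, x ∈ ({τ / B} : Finset ℕ) ∪ {(src + e) / B, (src + e) / B + 1,
          (src + e / g * g) / B, (src + e / g * g) / B + 1, (dst + sampleCount A q g e) / B,
          (dst + sampleCount A q g e) / B + 1} → x ∈ win B {τ / B} (src + e) (src + e / g * g)
            (dst + sampleCount A q g e) := fun h => h
      refine hw ?_
      rcases htot c hc with h | h | h | h
      · rcases hcells c h with h' | h'
        · have h3 : (src + a) / B ≤ c / B := Nat.div_le_div_right h'.1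
          have h4 : c / B ≤ (src + a + B) / B := Nat.div_le_div_right (by omega)
          rw [Nat.add_div_right _ hB] at h4
          rcases (show c / B = (src + a) / B ∨ c / B = (src + a) / B + 1 by omega) with h5 | h5
          · simp [h5, ha]
          · simp [h5, ha]
        · simp [h']
      · simp [h]
      · simp [h]
      · simp [h]
    · intro hgB
      -- The rank computation alone accounts for `1 + 12` loads plus `2 g / B`; the at most four
      -- remaining accesses complete the constant `17`.
      have h1 := hscan.io hB
      have h2 := IOB.of_length (m := m) (B := B) (by omega) (tr₂ ++ (tr₃ ++ []))
      have h3 := h1.append h2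
      refine IOB.mono (by simpa using h3) ?_
      have h4 : (((min (a + g) q : ℕ) : ℝ) - a) / B ≤ g / B := by
        gcongr
        have : ((min (a + g) q : ℕ) : ℝ) ≤ ((a + g : ℕ) : ℝ) := by exact_mod_cast min_le_left _ _
        push_cast at this ⊢
        linarith
      have h5 : ((tr₂ ++ (tr₃ ++ [])).length : ℝ) ≤ 4 := by
        have : (tr₂ ++ (tr₃ ++ [])).length ≤ 4 := by simp; omega
        exact_mod_cast this
      push_cast at h4 h5 ⊢
      simp only [List.append_nil, List.length_append, Nat.cast_add] at h5
      ring_nf at h4 h5 ⊢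
      linarith

theorem runs_sampleLoop {g : ℕ} (hm : 7 ≤ m) (hB : 0 < B) (hg : 0 < g) (h34 : s₀.reg 34 = src)
    (h35 : s₀.reg 35 = q) (h36 : s₀.reg 36 = g) (h37 : s₀.reg 37 = dst)
    (hτ : loc (s₀.reg 6) 7 0 = τ) (hA : ∀ i < q, s₀.mem (src + i) = .elem (A i))
    (hdisj : src + q ≤ dst ∨ dst + q ≤ src) (hτs : τ < src) (hτd : τ < dst) (hW : q + 2 < W) :
    Runs W sampleLoop s₀ fun n tr s' => (∃ A', SampleInv A q g src dst τ s₀ q A' s') ∧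
      SampleCost A q g src dst τ m B 0 n tr q := by
  unfold sampleLoop
  refine runs_assign_seq ?_
  refine runs_assign_seq ?_
  have hrefl : ∀ e, SampleCost A q g src dst τ m B e 0 [] e := by
    intro e
    refine ⟨le_rfl, by omega, by simp, by simp, fun _ => Scan.refl _ _ _ _ _ _, fun _ => ?_⟩
    rw [sub_self, zero_mul]
    exact IOB.nil le_rfl
  refine (runs_loop (G := ℕ × (ℕ → α)) (fun x s => SampleInv A q g src dst τ s₀ x.1 x.2 s)
    (fun x => q - x.1) (fun x n tr x' => SampleCost A q g src dst τ m B x.1 n tr x'.1)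
    (fun x s _ => hrefl x.1) ?_ ?_ (0, A) _ ?_).mono ?_
  · intro x n tr x' n' tr' x'' h h'
    exact h.trans h'
  · rintro ⟨e, A'⟩ s hI hc
    have q35 : s.reg 35 = q := by simp [hI.regs, h35]
    simp only [eval_sub, eval_V, q35, hI.pos] at hc
    refine (runs_sampleBody hm hB hg h34 h35 h36 h37 hτ hA hdisj hτs hτd hW hI
      (by omega)).mono ?_
    rintro n tr s' ⟨⟨A'', h1⟩, h2⟩
    exact ⟨(e + 1, A''), h1, by simp only; omega, h2⟩
  · refine ⟨by omega, by simp, by simp [sampleCount], ?_, ?_, ?_, ?_, ?_⟩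
    · intro r hr
      simp
      rw [if_neg (by omega), if_neg (by omega)]
    · intro i hi
      simp [sampleCount] at hi
    · simp [sampleCount]
    · rintro ⟨f, hf, -⟩
      omega
    · intro c _ _
      rfl
  rintro n tr s' ⟨⟨e, A'⟩, hI, hc, h⟩
  have q35 : s'.reg 35 = q := by simp [hI.regs, h35]
  simp only [eval_sub, eval_V, q35, hI.pos] at hc
  have := hI.le
  obtain rfl : e = q := by omega
  exact ⟨⟨A', hI⟩, by simpa using h⟩

/-- A group with `g < B` spans at most two blocks, and the pass is a scan with three pointers: the
position, the start of its group, and the output. For `g ≥ B` each position pays `O(g / B)` for a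
scan of its group. The assumption `B ≤ q` absorbs the constants. -/
theorem SampleCost.io_le {g : ℕ} (hB : 0 < B) (hg : 0 < g) (hq : B ≤ q)
    (h : SampleCost A q g src dst τ m B 0 n tr q) : IOB m B tr (20 * (q * g / B)) := by
  have hBR : (0 : ℝ) < B := by exact_mod_cast hB
  have hg1 : (1 : ℝ) ≤ g := by exact_mod_cast hg
  have h1q : (1 : ℝ) ≤ q / B := by rw [le_div_iff₀ hBR, one_mul]; exact_mod_cast hq
  have hqg : (q : ℝ) / B ≤ q * g / B := by
    rw [mul_div_right_comm]
    exact le_mul_of_one_le_right (by positivity) hg1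
  by_cases hgB : g < B
  · have h1 := (h.scan hgB).io hB
    refine h1.mono ?_
    have h2 : (((q / g * g : ℕ) : ℝ)) ≤ q := by exact_mod_cast Nat.div_mul_le_self q g
    have h3 : ((sampleCount A q g q : ℕ) : ℝ) ≤ q := by exact_mod_cast sampleCount_le A q g q
    have h4 : (((src + q : ℕ) - (src + 0 : ℕ)) + ((src + q / g * g : ℕ) - (src + 0 / g * g : ℕ)) +
        ((dst + sampleCount A q g q : ℕ) - (dst + sampleCount A q g 0 : ℕ)) : ℝ) / B ≤
        3 * (q / B) := by
      rw [← mul_div_assoc]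
      refine div_le_div_of_nonneg_right ?_ hBR.le
      have h5 : sampleCount A q g 0 = 0 := by simp [sampleCount]
      simp only [Nat.cast_add, h5, Nat.zero_div, zero_mul, Nat.cast_zero]
      linarith
    rw [Finset.card_singleton]
    linarith
  · have hgB' : B ≤ g := by omega
    have h1 : (1 : ℝ) ≤ g / B := by rw [le_div_iff₀ hBR, one_mul]; exact_mod_cast hgB'
    refine (h.io hgB').mono ?_
    have h2 : (q : ℝ) * g / B = q * (g / B) := by ring
    rw [h2, Nat.cast_zero, sub_zero]
    nlinarith

/-! ### An approximate median -/

/-- The number of positions with an element `≤ t`, and `≥ t`. -/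
def cntLe (A : ℕ → α) (q : ℕ) (t : α) : ℕ := ((Finset.range q).filter fun e => A e ≤ t).card
def cntGe (A : ℕ → α) (q : ℕ) (t : α) : ℕ := ((Finset.range q).filter fun e => t ≤ A e).card

theorem card_filter_eq_of_map_eq {A' : ℕ → α} {D : Finset ℕ} (P : α → Prop) [DecidablePred P]
    (h : (Multiset.range n).map A' = D.val.map A) :
    ((Finset.range n).filter fun e => P (A' e)).card = (D.filter fun e => P (A e)).card := by
  have h1 := congrArg (Multiset.countP P) h
  rw [Multiset.countP_map, Multiset.countP_map] at h1
  simpa [Finset.card, Finset.filter] using h1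

/-- Repeated sampling, with groups of increasing size. -/
def approxMedian : Cmd :=
  .loop (V 38)
    (sampleLoop ;; .assign 38 (V 35 - V 36) ;; .assign 34 (V 37) ;; .assign 37 (V 37 + V 45) ;;
     .assign 35 (V 45) ;; .assign 36 (2 * V 36))

/-- Let the sample satisfy the claim with `2 g`, thus with relative loss `9 / g`. Going back to the
array loses `6 / g` in the count, and the sample may be short of a quarter of the array by `6 / g`
relative to its size, which enters with factor `1 / 2`. The sum is `9 + 6 + 3 = 18`, so the constant
reproduces itself. -/
theorem approx_step {q g q' x x' : ℝ} (hg : 36 ≤ g) (hq : g < q) (hx : (1 / 2 - 18 / (2 * g)) * q' ≤ x')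
    (hxx : 4 * x' ≤ x + 6 * (q / g)) (hqq : q ≤ 4 * q' + 6 * (q / g)) :
    (1 / 2 - 18 / g) * q ≤ x := by
  have hg0 : 0 < g := by linarith
  have h1 : 18 / (2 * g) = 9 / g := by field_simp; norm_num
  have h2 : 9 / g ≤ 1 / 4 := by rw [div_le_iff₀ hg0]; linarith
  have h3 : 0 ≤ 9 / g := by positivity
  have h4 : q / g = q * (1 / g) := by ring
  have h5 : 18 / g = 18 * (1 / g) := by ring
  have h6 : 9 / g = 9 * (1 / g) := by ring
  rw [h1] at hx
  rw [h6] at hx h2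
  rw [h4] at hxx hqq
  rw [h5]
  have hq0 : 0 < q := by linarith
  have h9 : 0 ≤ q * (1 / g) := by positivity
  nlinarith

set_option maxHeartbeats 1000000 in
-- The sample has at most a quarter of the elements and the group size doubles, so `q * g` at least
-- halves from round to round and the total is twice the cost of the first round. The sample of the
-- sample is written behind it, and `medCell` keeps the value written in the last round.
theorem runs_approxMedian {G : ℕ} (hm : 7 ≤ m) (hB : 0 < B) (hτ : loc K 7 0 = τ) (hWG : 2 * G < W)
    (q : ℕ) : ∀ {src g dst : ℕ} {A : ℕ → α} {s : State α}, 1 ≤ q → 36 ≤ g → g ≤ G → 2 * q ≤ G →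
    s.reg 34 = src → s.reg 35 = q → s.reg 36 = g → s.reg 37 = dst → s.reg 38 ≠ 0 →
    s.reg 6 = K → (∀ i < q, s.mem (src + i) = .elem (A i)) →
    (src + q ≤ dst ∨ dst + q ≤ src) → τ < src → τ < dst → dst + 2 * q + 2 < W →
    Runs W approxMedian s fun n tr s' => (∃ t, s'.mem τ = .elem t ∧
      (1 / 2 - 18 / (g : ℝ)) * q ≤ cntLe A q t ∧ (1 / 2 - 18 / (g : ℝ)) * q ≤ cntGe A q t) ∧
      (∀ c, c ≠ τ → (c < dst ∨ dst + q ≤ c) → s'.mem c = s.mem c) ∧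
      (∀ r, r < 34 ∨ 45 < r → s'.reg r = s.reg r) ∧
      n ≤ 2 * (q * g) ∧ tr.length ≤ 12 * (q * g) ∧
      (∀ c ∈ tr, c = τ ∨ (src ≤ c ∧ c < src + q) ∨ (dst ≤ c ∧ c < dst + q)) ∧
      IOB m B tr (40 * (q * g / B) + 7) := by
  -- Once `q < B`, all cells touched, also in all later rounds, lie in seven blocks. The additive
  -- constant therefore occurs once and not in every round.
  have hconf : ∀ {q src dst : ℕ} {tr : List ℕ}, q < B → (∀ c ∈ tr, c = τ ∨
      (src ≤ c ∧ c < src + q) ∨ (dst ≤ c ∧ c < dst + q)) → IOB m B tr 7 := by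
    intro q src dst tr hq h
    refine (IOB.of_intervals (F := {τ / B}) (x := src) (y := dst) hq (by simpa using hm) ?_).mono
      (by rw [Finset.card_singleton]; norm_num)
    intro c hc
    rcases h c hc with rfl | h | h
    · left; simp
    · right; left; omega
    · right; right; omega
  induction q using Nat.strong_induction_on with
  | _ q ih =>
    intro src g dst A s hq1 hg hgG hqG h34 h35 h36 h37 h38 h6 hA hdisj hτs hτd hW
    refine runs_loop_succ (by simp [h38]) ?_
    rw [runs_seq]
    refine (runs_sampleLoop hm hB (by omega) h34 h35 h36 h37 (by rw [h6, hτ]) hA hdisj hτs hτd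
      (by omega)).mono ?_
    rintro n tr s₁ ⟨⟨A', hI⟩, hcost⟩
    set q' := sampleCount A q g q with hq'
    have p35 : s₁.reg 35 = q := by simp [hI.regs, h35]
    have p36 : s₁.reg 36 = g := by simp [hI.regs, h36]
    have p37 : s₁.reg 37 = dst := by simp [hI.regs, h37]
    have p45 : s₁.reg 45 = q' := hI.out
    have hg0 : 0 < g := by omega
    have hcnt := card_sampled (A := A) (q := q) (g := g) hg0 (fun _ => True) (c := 0) (by
      intro D
      simpa using (card_sample A D).1)
    simp only [true_and, Finset.filter_true, Finset.card_range, zero_mul, add_zero] at hcnt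
    have hq4 : 4 * q' ≤ q := hcnt
    have hcomps := hcost.comps
    have hlen := hcost.length
    have hlen6 : tr.length ≤ 6 * (q * g) := by
      have h1 : q * 4 ≤ q * g := Nat.mul_le_mul_left _ (by omega)
      have h2 : q * (2 * g + 4) = 2 * (q * g) + q * 4 := by ring
      omega
    have hq'q : q' * (2 * g) * 2 ≤ q * g := by
      have h1 : 4 * q' * g ≤ q * g := Nat.mul_le_mul_right _ hq4
      have h2 : q' * (2 * g) * 2 = 4 * q' * g := by ring
      omega
    refine runs_assign_seq ?_ (by simp [p35, p36]; omega)
    refine runs_assign_seq ?_ (by simp [p37]; omega)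
    refine runs_assign_seq ?_ (by simp [p37, p45]; omega)
    refine runs_assign_seq ?_ (by simp [p45]; omega)
    rw [runs_assign]
    refine ⟨by simp [p36]; omega, ?_⟩
    have hiolev : IOB m B tr (20 * (q * g / B) + 7) := by
      by_cases hqB : q < B
      · refine (hconf hqB hcost.cells).mono ?_
        have : (0 : ℝ) ≤ q * g / B := by positivity
        linarith
      · refine (hcost.io_le hB hg0 (by omega)).mono (by linarith)
    -- The last round: there is a single group, and the exact median of the array is written.
    by_cases hcase : q ≤ g
    · refine runs_loop_zero (by simp [p35, p36]; omega) ?_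
      have hgroup : ∀ f < q, group q g f = Finset.range q := by
        intro f hf
        unfold group
        rw [Nat.div_eq_of_lt (by omega), zero_mul, zero_add, min_eq_right hcase, Finset.range_eq_Ico]
      obtain ⟨f, hf, hfr⟩ := exists_rankIn_eq A (G := Finset.range q) (r := q / 2) (by simp; omega)
      rw [Finset.mem_range] at hf
      obtain ⟨f', hf', hmid, hmem⟩ := hI.med ⟨f, hf, by
        unfold IsMid
        rw [hgroup f hf, hfr, Finset.card_range]⟩
      have hmid' : rankIn A (Finset.range q) f' = q / 2 := by
        have := hmid
        unfold IsMid at this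
        rwa [hgroup f' hf', Finset.card_range] at this
      obtain ⟨h1, h2⟩ := card_le_of_rankIn (Finset.mem_range.2 hf') hmid'
      rw [Finset.card_range] at h2
      have h18 : (0 : ℝ) ≤ 18 / (g : ℝ) := by positivity
      have hbound : ∀ x : ℕ, q ≤ 2 * x → (1 / 2 - 18 / (g : ℝ)) * q ≤ x := by
        intro x hx
        have : (q : ℝ) ≤ 2 * x := by exact_mod_cast hx
        nlinarith
      refine ⟨⟨A f', by simpa using hmem, ?_, ?_⟩, ?_, ?_, ?_, ?_, ?_, ?_⟩
      · exact hbound _ (by unfold cntLe; omega)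
      · exact hbound _ (by unfold cntGe; omega)
      · intro c h1 h2
        simpa using hI.frame c h1 h2
      · intro r hr
        simp
        rw [if_neg (by omega), if_neg (by omega), if_neg (by omega), if_neg (by omega),
          if_neg (by omega), hI.regs r (by omega)]
      · omega
      · simp only [List.append_nil]
        omega
      · simpa using hcost.cells
      · refine IOB.mono (by simpa using hiolev) ?_
        have : (0 : ℝ) ≤ q * g / B := by positivity
        linarith
    · have hgq : g < q := by omega
      have hge := card_sampled_ge (A := A) (q := q) hg0
      change q ≤ 4 * q' + 3 * (q / g + 1) at hge
      have hgR : (0 : ℝ) < g := by exact_mod_cast hg0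
      have hdiv : ((3 * (q / g + 1) : ℕ) : ℝ) ≤ 6 * ((q : ℝ) / g) := by
        have h1 : ((q / g : ℕ) : ℝ) ≤ q / g := Nat.cast_div_le
        have h2 : (1 : ℝ) ≤ q / g := by rw [le_div_iff₀ hgR, one_mul]; exact_mod_cast hgq.le
        push_cast
        linarith
      have hq'1 : 1 ≤ q' := by
        have h1 : q / g ≤ q / 36 := Nat.div_le_div_left hg (by norm_num)
        omega
      refine (ih q' (by omega) (src := dst) (g := 2 * g) (dst := dst + q') (A := A') hq'1
        (by omega) (by omega) (by omega) ?_ ?_ ?_ ?_ ?_ ?_ ?_ (by omega) hτd (by omega)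
        (by omega)).mono ?_
      · simp [p37]
      · simp [p45]
      · simp [p36]
      · simp [p37, p45]
      · simp [p35, p36]
        omega
      · simp [hI.regs 6 (by norm_num), h6]
      · intro i hi
        simpa using hI.sample i hi
      rintro n' tr' s₂ ⟨⟨t, ht, hle, hge'⟩, hframe, hregs, hn', hlen', hcells', hio'⟩
      have hcle : (4 : ℝ) * cntLe A' q' t ≤ cntLe A q t + 6 * ((q : ℝ) / g) := by
        have h1 := card_sampled (A := A) (q := q) (g := g) hg0 (fun e => A e ≤ t) (c := 0)
          (by intro D; simpa using card_sample_le A D t)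
        have h2 := card_filter_eq_of_map_eq (fun x => x ≤ t) hI.content
        rw [Finset.filter_filter] at h2
        simp only [and_comm (a := A _ ≤ t)] at h1
        have h3 : 4 * cntLe A' q' t ≤ cntLe A q t := by
          unfold cntLe
          rw [h2]
          simpa using h1
        have h4 : (4 : ℝ) * cntLe A' q' t ≤ cntLe A q t := by exact_mod_cast h3
        linarith
      have hcge : (4 : ℝ) * cntGe A' q' t ≤ cntGe A q t + 6 * ((q : ℝ) / g) := by
        have h1 := card_sampled (A := A) (q := q) (g := g) hg0 (fun e => t ≤ A e) (c := 3)
          (by intro D; simpa using card_sample_ge A D t)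
        have h2 := card_filter_eq_of_map_eq (fun x => t ≤ x) hI.content
        rw [Finset.filter_filter] at h2
        simp only [and_comm (a := t ≤ A _)] at h1
        have h3 : 4 * cntGe A' q' t ≤ cntGe A q t + 3 * (q / g + 1) := by
          unfold cntGe
          rw [h2]
          simpa using h1
        have h4 : (4 : ℝ) * cntGe A' q' t ≤ cntGe A q t + (3 * (q / g + 1) : ℕ) := by
          exact_mod_cast h3
        linarith
      have hqq : (q : ℝ) ≤ 4 * q' + 6 * ((q : ℝ) / g) := by
        have h4 : (q : ℝ) ≤ 4 * q' + (3 * (q / g + 1) : ℕ) := by exact_mod_cast hge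
        linarith
      have hg36 : (36 : ℝ) ≤ g := by exact_mod_cast hg
      have hgqR : (g : ℝ) < q := by exact_mod_cast hgq
      push_cast at hle hge'
      refine ⟨⟨t, ht, approx_step hg36 hgqR hle hcle hqq, approx_step hg36 hgqR hge' hcge hqq⟩,
        ?_, ?_, ?_, ?_, ?_, ?_⟩
      · intro c h1 h2
        rw [hframe c h1 (by omega)]
        simpa using hI.frame c h1 h2
      · intro r hr
        rw [hregs r hr]
        simp
        rw [if_neg (by omega), if_neg (by omega), if_neg (by omega), if_neg (by omega),
          if_neg (by omega), hI.regs r (by omega)]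
      · omega
      · simp only [List.nil_append, List.append_nil, List.length_append]
        omega
      · intro c hc
        simp only [List.nil_append, List.append_nil, List.mem_append] at hc
        rcases hc with hc | hc
        · exact hcost.cells c hc
        · rcases hcells' c hc with h | h | h
          · exact Or.inl h
          · right; right; omega
          · right; right; omega
      · by_cases hqB : q < B
        · refine (hconf (src := src) (dst := dst) hqB ?_).mono ?_
          · intro c hc
            simp only [List.nil_append, List.append_nil, List.mem_append] at hc
            rcases hc with hc | hc
            · exact hcost.cells c hc
            · rcases hcells' c hc with h | h | h
              · exact Or.inl h
              · right; right; omega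
              · right; right; omega
          · have : (0 : ℝ) ≤ q * g / B := by positivity
            linarith
        · have h1 := (hcost.io_le hB hg0 (by omega)).append hio'
          refine IOB.mono (by simpa using h1) ?_
          have h2 : (q' : ℝ) * (2 * g : ℕ) * 2 ≤ q * g := by exact_mod_cast hq'q
          have h3 : (q' : ℝ) * (2 * g : ℕ) / B * 2 ≤ q * g / B := by
            rw [div_mul_eq_mul_div]
            gcongr
          push_cast at h3 ⊢
          linarith

/-! ### Partitioning an array in place -/

/-- A permutation that moves only positions in `[lo, hi)`. -/
def FixesOutside (σ : Equiv.Perm ℕ) (lo hi : ℕ) : Prop := ∀ c, c < lo ∨ hi ≤ c → σ c = c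

theorem FixesOutside.mem {c : ℕ} (h : FixesOutside σ lo hi) (h1 : lo ≤ c) (h2 : c < hi) :
    lo ≤ σ c ∧ σ c < hi := by
  by_contra hcon
  have h3 := h (σ c) (by omega)
  have h4 := σ.injective h3
  omega

theorem FixesOutside.mono {lo' hi' : ℕ} (h : FixesOutside σ lo hi) (h1 : lo' ≤ lo) (h2 : hi ≤ hi') :
    FixesOutside σ lo' hi' := fun c hc => h c (by omega)

theorem FixesOutside.mul {σ' : Equiv.Perm ℕ} (h : FixesOutside σ lo hi) (h' : FixesOutside σ' lo hi) :
    FixesOutside (σ * σ') lo hi := fun c hc => by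
  rw [Equiv.Perm.mul_apply, h' c hc, h c hc]

theorem FixesOutside.swap (hi1 : lo ≤ i) (hi2 : i < hi) (hj1 : lo ≤ j) (hj2 : j < hi) :
    FixesOutside (Equiv.swap i j) lo hi := fun c hc =>
  Equiv.swap_apply_of_ne_of_ne (by omega) (by omega)

theorem FixesOutside.map_eq {β : Type*} (h : FixesOutside σ lo hi) (f : ℕ → β) :
    (Finset.Ico lo hi).val.map (f ∘ σ) = (Finset.Ico lo hi).val.map f := by
  have h1 : (Finset.Ico lo hi).map (σ : ℕ ≃ ℕ).toEmbedding = Finset.Ico lo hi := by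
    refine Finset.map_perm ?_
    intro c hc
    rw [Finset.coe_Ico, Set.mem_Ico]
    by_contra hcon
    exact hc (h c (by omega))
  have h2 := congrArg Finset.val h1
  rw [Finset.map_val] at h2
  conv_rhs => rw [← h2]
  rw [Multiset.map_map]
  rfl

theorem FixesOutside.card_filter (h : FixesOutside σ lo hi) (f : ℕ → α) (P : α → Prop)
    [DecidablePred P] : ((Finset.Ico lo hi).filter fun c => P (f (σ c))).card =
      ((Finset.Ico lo hi).filter fun c => P (f c)).card := by
  have h1 := congrArg (Multiset.countP P) (h.map_eq f)
  rw [Multiset.countP_map, Multiset.countP_map] at h1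
  simpa [Finset.card, Finset.filter] using h1

/-- The cell for exchanging two elements. -/
def tmpCell : Expr := L 7 1

/-- Move the elements of `[i, end)` for which `cmp` sets register `44` to the front. -/
def partPass (cmp : Cmd) : Cmd :=
  .loop (V 48 - V 46)
    (cmp ;;
     .ite (V 44)
      (.move tmpCell (V 47) ;; .move (V 47) (V 46) ;; .move (V 46) tmpCell ;;
        .assign 47 (V 47 + 1))
      (.assign 44 0) ;;
     .assign 46 (V 46 + 1))

/-- The machine only decides `≤`; a strict comparison is the negation of the reversed one. -/
def cmpLt : Cmd := .compare 44 medCell (V 46) ;; .assign 44 (1 - V 44)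
def cmpLe : Cmd := .compare 44 (V 46) medCell

/-- The command `cmp` decides `p` for the element at register `46`. -/
def Decides (W K : ℕ) (t : α) (p : α → Prop) [DecidablePred p] (cmp : Cmd) : Prop :=
  ∀ (s : State α) (x : α), s.reg 6 = K → s.mem (s.reg 46) = .elem x →
    s.mem (loc K 7 0) = .elem t →
    Runs W cmp s fun n tr s' => n = 1 ∧ tr.length = 2 ∧
      (∀ c ∈ tr, c = loc K 7 0 ∨ c = s.reg 46) ∧ s'.mem = s.mem ∧
      s'.reg 44 = (if p x then 1 else 0) ∧ ∀ r, r ≠ 44 → s'.reg r = s.reg r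

theorem decides_cmpLt {t : α} (hW : 1 < W) : Decides W K t (· < t) cmpLt := by
  intro s x h6 hx ht
  unfold cmpLt
  rw [runs_seq, runs_compare]
  refine ⟨t, x, by simp [medCell, h6, ht], by simp [hx], ?_⟩
  rw [runs_assign]
  refine ⟨by simp; omega, rfl, by simp, by simp [medCell, h6], rfl, ?_, ?_⟩
  · by_cases h : x < t
    · simp [h, not_le.2 h]
    · simp [h, not_lt.1 h]
  · intro r hr
    simp [hr]

theorem decides_cmpLe {t : α} : Decides W K t (· ≤ t) cmpLe := by
  intro s x h6 hx ht
  unfold cmpLe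
  rw [runs_compare]
  refine ⟨x, t, by simp [hx], by simp [medCell, h6, ht], rfl, by simp, by simp [medCell, h6], rfl,
    by simp, ?_⟩
  intro r hr
  simp [hr]

/-- The state of a partitioning pass over `[lo, hi)`. -/
structure PartInv (lo hi K : ℕ) (p : α → Prop) (f : ℕ → α) (s₀ : State α) (i j : ℕ)
    (σ : Equiv.Perm ℕ) (s : State α) : Prop where
  lo_le : lo ≤ j
  le : j ≤ i
  le_hi : i ≤ hi
  pos : s.reg 46 = i
  split : s.reg 47 = j
  fixes : FixesOutside σ lo hi
  mem : ∀ c, lo ≤ c → c < hi → s.mem c = .elem (f (σ c))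
  front : ∀ c, lo ≤ c → c < j → p (f (σ c))
  back : ∀ c, j ≤ c → c < i → ¬ p (f (σ c))
  frame : ∀ c, (c < lo ∨ hi ≤ c) → c ≠ loc K 7 1 → s.mem c = s₀.mem c
  regs : ∀ r, r ≠ 44 → r ≠ 46 → r ≠ 47 → s.reg r = s₀.reg r

/-- The cells of the cache used for exchanging elements. -/
def cellBlocks (K B : ℕ) : Finset ℕ := {loc K 7 0 / B, loc K 7 1 / B}

theorem card_cellBlocks_le (K B : ℕ) : (cellBlocks K B).card ≤ 2 := Finset.card_le_two

structure PassCost (lo hi K m B : ℕ) (i j n : ℕ) (tr : List ℕ) (i' j' : ℕ) : Prop where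
  comps : n + i = i'
  length : tr.length + 8 * i ≤ 8 * i'
  cells : ∀ c ∈ tr, c = loc K 7 0 ∨ c = loc K 7 1 ∨ (lo ≤ c ∧ c < hi)
  scan : Scan m B (cellBlocks K B) i j 0 tr i' j' 0

/-- Both the read position and the boundary of the front part only move forward, so the pass is a
scan. A step makes one comparison and at most eight accesses: two for the comparison and six for an
exchange through the scratch cell. -/
theorem runs_partPass {j₀ : ℕ} {t : α} {p : α → Prop} [DecidablePred p] {cmp : Cmd}
    (hcmp : Decides W K t p cmp) (hm : 8 ≤ m) (hW : hi + 1 < W) {f : ℕ → α} (h6 : s₀.reg 6 = K)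
    (h46 : s₀.reg 46 = lo) (h47 : s₀.reg 47 = j₀) (hj₀ : j₀ = lo) (h48 : s₀.reg 48 = hi)
    (hlohi : lo ≤ hi) (hmem : ∀ c, lo ≤ c → c < hi → s₀.mem c = .elem (f c))
    (ht : s₀.mem (loc K 7 0) = .elem t) (hK : 1 < K) (hKlo : loc K 7 1 < lo) :
    Runs W (partPass cmp) s₀ fun n tr s' => ∃ j σ, PartInv lo hi K p f s₀ hi j σ s' ∧
      PassCost lo hi K m B lo lo n tr hi j := by
  have hτne : loc K 7 0 ≠ loc K 7 1 := by rw [Ne, loc_eq_iff (by omega) hK]; omega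
  have hτlo : loc K 7 0 < lo := by unfold loc at *; omega
  refine (runs_loop (G := ℕ × ℕ × Equiv.Perm ℕ)
    (fun x s => PartInv lo hi K p f s₀ x.1 x.2.1 x.2.2 s) (fun x => hi - x.1)
    (fun x n tr x' => PassCost lo hi K m B x.1 x.2.1 n tr x'.1 x'.2.1) ?_ ?_ ?_
    (lo, lo, 1) s₀ ?_).mono ?_
  · intro x s _
    exact ⟨by omega, by simp, by simp, Scan.refl _ _ _ _ _ _⟩
  · rintro x n tr x' n' tr' x'' h h'
    refine ⟨?_, ?_, ?_, h.scan.trans h'.scan⟩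
    · have := h.comps
      have := h'.comps
      omega
    · have := h.length
      have := h'.length
      rw [List.length_append]
      omega
    · intro c hc
      rcases List.mem_append.1 hc with hc | hc
      · exact h.cells c hc
      · exact h'.cells c hc
  · rintro ⟨i, j, σ⟩ s hI hc
    simp only at hI
    have q48 : s.reg 48 = hi := by simp [hI.regs, h48]
    have q6 : s.reg 6 = K := by simp [hI.regs, h6]
    simp only [eval_sub, eval_V, q48, hI.pos] at hc
    have hjl := hI.lo_le
    have hji := hI.le
    have hti : s.mem (loc K 7 0) = .elem t := by rw [hI.frame _ (Or.inl hτlo) hτne, ht]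
    have hxi := hI.mem i (by omega) (by omega)
    rw [runs_seq]
    refine (hcmp s (f (σ i)) q6 (by rw [hI.pos, hxi]) hti).mono ?_
    rintro n tr s₁ ⟨rfl, hlen, hcells, hmem₁, h44, hregs⟩
    have p46 : s₁.reg 46 = i := by simp [hregs, hI.pos]
    have p47 : s₁.reg 47 = j := by simp [hregs, hI.split]
    have p6 : s₁.reg 6 = K := by simp [hregs, q6]
    have hcost : ∀ (n : ℕ) (tr₂ : List ℕ) (j' : ℕ), n = 1 → tr₂.length ≤ 6 → j ≤ j' →
        (∀ c ∈ tr₂, c = loc K 7 1 ∨ c = i ∨ c = j) →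
        PassCost lo hi K m B i j n (tr ++ tr₂) (i + 1) j' := by
      rintro n tr₂ j' rfl hl hj hc2
      have hall : ∀ c ∈ tr ++ tr₂, c = loc K 7 0 ∨ c = loc K 7 1 ∨ c = i ∨ c = j := by
        intro c hc
        rcases List.mem_append.1 hc with hc | hc
        · rcases hcells c hc with h | h
          · exact Or.inl h
          · rw [hI.pos] at h
            exact Or.inr (Or.inr (Or.inl h))
        · exact Or.inr (hc2 c hc)
      refine ⟨by omega, by rw [List.length_append]; omega, ?_, ?_⟩
      · intro c hc
        rcases hall c hc with h | h | h | h
        · exact Or.inl h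
        · exact Or.inr (Or.inl h)
        · right; right; omega
        · right; right; omega
      · have hcb := card_cellBlocks_le K B
        refine Scan.step (by omega) (by omega) hj le_rfl ?_
        intro c hc
        rcases hall c hc with h | h | h | h <;> simp [win, cellBlocks, h]
    rw [runs_seq, runs_ite]
    simp only [eval_V, h44]
    refine ⟨fun hp => ?_, fun hp => ?_⟩
    · have hp' : p (f (σ i)) := by
        by_contra h
        simp [h] at hp
      have et : tmpCell.eval s₁.reg = loc K 7 1 := by simp [tmpCell, p6]
      rw [runs_seq, runs_move]
      simp only [eval_V, p47, et]
      rw [runs_seq, runs_move]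
      simp only [eval_V, setMem_reg, p46, p47]
      rw [runs_seq, runs_move]
      simp only [eval_V, setMem_reg, p46, et]
      rw [runs_assign]
      refine ⟨by simp [p47]; omega, ?_⟩
      rw [runs_assign]
      refine ⟨by simp [p46]; omega, (i + 1, j + 1, σ * Equiv.swap i j), ?_, by simp only; omega, ?_⟩
      · have hsw : FixesOutside (Equiv.swap i j) lo hi :=
          .swap (by omega) (by omega) hjl (by omega)
        have hjmem := hI.mem j hjl (by omega)
        have htmp : ∀ c, lo ≤ c → c ≠ loc K 7 1 := fun c hc => by omega
        refine ⟨by simp only; omega, by simp only; omega, by simp only; omega, by simp [p46],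
          by simp [p47], hI.fixes.mul hsw, ?_, ?_, ?_, ?_, ?_⟩
        · intro c h1 h2
          by_cases hci : c = i
          · subst hci
            have := htmp c (by omega)
            by_cases hjc : j = c
            · simp [hmem₁, hjmem, htmp j hjl, (htmp j hjl).symm]
            · simp [hmem₁, hjmem, htmp j hjl, this, this.symm, Ne.symm hjc, (htmp j hjl).symm]
          · by_cases hcj : c = j
            · subst hcj
              have hi' := htmp i (by omega)
              simp [hci, hmem₁, hxi, hi', htmp c hjl]
            · simp [hci, hcj, htmp c h1, hmem₁, Equiv.swap_apply_of_ne_of_ne hci hcj,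
                hI.mem c h1 h2]
        · intro c h1 h2
          by_cases hcj : c = j
          · subst hcj
            simpa using hp'
          · have hci : c ≠ i := by simp only at h2; omega
            simp only [Equiv.Perm.mul_apply, Equiv.swap_apply_of_ne_of_ne hci hcj]
            exact hI.front c h1 (by simp only at h2; omega)
        · intro c h1 h2
          simp only at h1 h2
          by_cases hci : c = i
          · subst hci
            simp only [Equiv.Perm.mul_apply, Equiv.swap_apply_left]
            exact hI.back j le_rfl (by omega)
          · have hcj : c ≠ j := by omega
            simp only [Equiv.Perm.mul_apply, Equiv.swap_apply_of_ne_of_ne hci hcj]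
            exact hI.back c (by omega) (by omega)
        · intro c h1 h2
          have hci : c ≠ i := by omega
          have hcj : c ≠ j := by omega
          simp [hci, hcj, h2, hmem₁, hI.frame c h1 h2]
        · intro r h1 h2 h3
          simp [h2, h3, hregs r h1, hI.regs r h1 h2 h3]
      · have := hcost 1 ([j, loc K 7 1] ++ ([i, j] ++ ([loc K 7 1, i] ++ []))) (j + 1) rfl
          (by simp) (by omega) (by simp)
        simpa using this
    · have hp' : ¬ p (f (σ i)) := by
        intro h
        simp [h] at hp
      rw [runs_assign]
      refine ⟨by simp; omega, ?_⟩
      rw [runs_assign]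
      refine ⟨by simp [p46]; omega, (i + 1, j, σ), ?_, by simp only; omega, ?_⟩
      · refine ⟨hjl, by simp only; omega, by simp only; omega, by simp [p46], by simp [p47],
          hI.fixes, ?_, hI.front, ?_, ?_, ?_⟩
        · intro c h1 h2
          simp [hmem₁, hI.mem c h1 h2]
        · intro c h1 h2
          by_cases hci : c = i
          · subst hci
            exact hp'
          · exact hI.back c h1 (by omega)
        · intro c h1 h2
          simp [hmem₁, hI.frame c h1 h2]
        · intro r h1 h2 h3
          simp [h1, h2, hregs r h1, hI.regs r h1 h2 h3]
      · simpa using hcost 1 [] j rfl (by simp) le_rfl (by simp)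
  · subst hj₀
    refine ⟨le_rfl, le_rfl, hlohi, h46, h47, fun _ _ => rfl, by simpa using hmem, ?_, ?_,
      fun _ _ _ => rfl, fun _ _ _ _ => rfl⟩
    · intro c h1 h2
      simp only at h2
      omega
    · intro c h1 h2
      simp only at h1 h2
      omega
  rintro n tr s' ⟨⟨i, j, σ⟩, hI, hc, hcost⟩
  have q48 : s'.reg 48 = hi := by simp [hI.regs, h48]
  simp only [eval_sub, eval_V, q48, hI.pos] at hc
  have := hI.le_hi
  obtain rfl : i = hi := by omega
  exact ⟨j, σ, hI, hcost⟩

/-! ### Selection -/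

/-- Partition the array at register `31` of length register `32` around an approximate median and
continue with the part that contains the position in register `33`. -/
def selectRound : Cmd :=
  .assign 34 (V 31) ;; .assign 35 (V 32) ;; .assign 36 128 ;; .assign 37 (L 9 0) ;; .assign 38 1 ;;
  approxMedian ;;
  .assign 46 (V 31) ;; .assign 47 (V 31) ;; .assign 48 (V 31 + V 32) ;;
  partPass cmpLt ;;
  .assign 49 (V 47) ;; .assign 46 (V 47) ;;
  partPass cmpLe ;;
  .ite (V 49 - V 33) (.assign 32 (V 49 - V 31))
    (.ite (V 47 - V 33) (.assign 32 0) (.assign 32 (V 31 + V 32 - V 47) ;; .assign 31 (V 47)))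

def select : Cmd := .loop (V 32) selectRound

theorem cnt_eq_card_Ico (f : ℕ → α) (lo q : ℕ) (P : α → Prop) [DecidablePred P] :
    ((Finset.range q).filter fun e => P (f (lo + e))).card =
      ((Finset.Ico lo (lo + q)).filter fun c => P (f c)).card := by
  refine Finset.card_bij (fun e _ => lo + e) ?_ ?_ ?_
  · intro e he
    simp only [Finset.mem_filter, Finset.mem_range, Finset.mem_Ico] at he ⊢
    exact ⟨by omega, he.2⟩
  · intro e _ e' _ h
    simpa using h
  · intro c hc
    simp only [Finset.mem_filter, Finset.mem_Ico] at hc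
    refine ⟨c - lo, ?_, by omega⟩
    simp only [Finset.mem_filter, Finset.mem_range]
    rw [Nat.add_sub_cancel' hc.1.1]
    exact ⟨by omega, hc.2⟩

/-- The effect of a round of selection on the array `f` in `[lo, lo + q)`. -/
structure Round (lo q K : ℕ) (f : ℕ → α) (s : State α) (t : α) (j₁ j₂ : ℕ) (σ : Equiv.Perm ℕ)
    (s' : State α) : Prop where
  lo_le : lo ≤ j₁
  le : j₁ ≤ j₂
  le_hi : j₂ ≤ lo + q
  fixes : FixesOutside σ lo (lo + q)
  mem : ∀ c, lo ≤ c → c < lo + q → s'.mem c = .elem (f (σ c))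
  lt : ∀ c, lo ≤ c → c < j₁ → f (σ c) < t
  eq : ∀ c, j₁ ≤ c → c < j₂ → f (σ c) = t
  gt : ∀ c, j₂ ≤ c → c < lo + q → t < f (σ c)
  left : 4 * (j₁ - lo) ≤ 3 * q
  right : 4 * (lo + q - j₂) ≤ 3 * q
  next : if s.reg 33 < j₁ then s'.reg 31 = lo ∧ s'.reg 32 = j₁ - lo else
    if s.reg 33 < j₂ then s'.reg 32 = 0 else s'.reg 31 = j₂ ∧ s'.reg 32 = lo + q - j₂
  frame : ∀ c, (c < lo ∨ lo + q ≤ c) → c ≠ loc K 7 0 → c ≠ loc K 7 1 →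
    (c < loc K 9 0 ∨ loc K 9 q ≤ c) → s'.mem c = s.mem c
  regs : ∀ r, r < 31 ∨ r = 33 ∨ 49 < r → s'.reg r = s.reg r

def SelCells (K lo q : ℕ) (tr : List ℕ) : Prop :=
  ∀ c ∈ tr, c = loc K 7 0 ∨ c = loc K 7 1 ∨ (lo ≤ c ∧ c < lo + q) ∨
    (loc K 9 0 ≤ c ∧ c < loc K 9 q)

/-- With `g = 128` the approximate median has at least `(1 / 2 - 18 / 128) q ≥ q / 4` elements on
either side, ties included. The constants are those of `runs_approxMedian` at `g = 128`, `2 * 128`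
comparisons, `12 * 128` accesses and `40 * 128` loads per unit, with those of two partitioning
passes added. -/
theorem runs_selectRound {f : ℕ → α} (hm : 8 ≤ m) (hB : 0 < B) (hK : 1 < K) (hq : 1 ≤ q)
    (h6 : s.reg 6 = K) (h31 : s.reg 31 = lo) (h32 : s.reg 32 = q) (h33 : s.reg 33 = π)
    (hmem : ∀ c, lo ≤ c → c < lo + q → s.mem c = .elem (f c)) (hlo : loc K 9 q ≤ lo)
    (hW : lo + 8 * q + 256 < W) :
    Runs W selectRound s fun n tr s' => (∃ t j₁ j₂ σ, Round lo q K f s t j₁ j₂ σ s') ∧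
      n ≤ 258 * q ∧ tr.length ≤ 1552 * q ∧ SelCells K lo q tr ∧
      IOB m B tr (5128 * (q / B : ℝ) + 35) := by
  have e70 : loc K 7 0 = 7 * K := rfl
  have e71 : loc K 7 1 = 7 * K + 1 := rfl
  have e90 : loc K 9 0 = 9 * K := rfl
  have e9q : loc K 9 q = 9 * K + q := rfl
  have hBR : (0 : ℝ) < B := by exact_mod_cast hB
  unfold selectRound
  refine runs_assign_seq ?_ (by simp [h31]; omega)
  refine runs_assign_seq ?_ (by simp [h32]; omega)
  refine runs_assign_seq ?_
  refine runs_assign_seq ?_ (by simp [h6]; omega)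
  refine runs_assign_seq ?_
  rw [runs_seq]
  refine (runs_approxMedian (m := m) (B := B) (K := K) (G := 2 * q + 128) (by omega) hB rfl
    (by omega) q (A := fun i => f (lo + i)) (src := lo) (g := 128) (dst := loc K 9 0) hq
    (by norm_num) (by omega) (by omega) (by simp [h31]) (by simp [h32]) (by simp)
    (by simp [h6]) (by simp) (by simp [h6]) (by
      intro i hi
      simpa using hmem (lo + i) (by omega) (by omega)) (by omega) (by omega) (by omega)
    (by omega)).mono ?_
  rintro n tr s₁ ⟨⟨t, ht, hle, hge⟩, hfr, hrg, hn, hlen, hcells, hio⟩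
  have p31 : s₁.reg 31 = lo := by simp [hrg, h31]
  have p32 : s₁.reg 32 = q := by simp [hrg, h32]
  have p33 : s₁.reg 33 = π := by simp [hrg, h33]
  have p6 : s₁.reg 6 = K := by simp [hrg, h6]
  refine runs_assign_seq ?_ (by simp [p31]; omega)
  refine runs_assign_seq ?_ (by simp [p31]; omega)
  refine runs_assign_seq ?_ (by simp [p31, p32]; omega)
  rw [runs_seq]
  refine (runs_partPass (m := m) (B := B) (K := K) (lo := lo) (hi := lo + q) (f := f)
    (decides_cmpLt (K := K) (t := t) (by omega)) hm
    (by omega) (by simp [p6]) (by simp [p31]) rfl (by simp [p31]) (by simp [p31, p32])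
    (by omega) (by
      intro c h1 h2
      simp only [setReg_mem]
      rw [hfr c (by omega) (by omega)]
      simpa using hmem c h1 h2) (by simpa using ht) hK (by omega)).mono ?_
  rintro n₁ tr₁ s₂ ⟨j₁, σ, hI, hC⟩
  have g1 := hI.lo_le
  have g2 := hI.le
  have q31 : s₂.reg 31 = lo := by simp [hI.regs, p31]
  have q32 : s₂.reg 32 = q := by simp [hI.regs, p32]
  have q33 : s₂.reg 33 = π := by simp [hI.regs, p33]
  have q6 : s₂.reg 6 = K := by simp [hI.regs, p6]
  have q48 : s₂.reg 48 = lo + q := by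
    simp [hI.regs, p31, p32]
  have q47 := hI.split
  have hne : loc K 7 0 ≠ loc K 7 1 := by omega
  refine runs_assign_seq ?_ (by simp [q47]; omega)
  refine runs_assign_seq ?_ (by simp [q47]; omega)
  rw [runs_seq]
  refine (runs_partPass (m := m) (B := B) (K := K) (lo := j₁) (hi := lo + q)
    (f := fun c => f (σ c)) (decides_cmpLe (K := K) (t := t)) hm
    (by omega) (by simp [q6]) (by simp [q47]) rfl (by simp [q47]) (by simp [q48])
    (by omega) (by
      intro c h1 h2
      simpa using hI.mem c (by omega) h2) (by
      simp only [setReg_mem]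
      rw [hI.frame _ (Or.inl (by omega)) hne]
      simpa using ht) hK (by omega)).mono ?_
  rintro n₂ tr₂ s₃ ⟨j₂, σ', hI', hC'⟩
  have g3 := hI'.lo_le
  have g4 := hI'.le
  have r31 : s₃.reg 31 = lo := by
    simp [hI'.regs, q31]
  have r32 : s₃.reg 32 = q := by
    simp [hI'.regs, q32]
  have r33 : s₃.reg 33 = π := by
    simp [hI'.regs, q33]
  have r49 : s₃.reg 49 = j₁ := by
    simp [hI'.regs, q47]
  have r47 := hI'.split
  have hσ := hI'.fixes.mono g1 le_rfl
  have hlt : ∀ c, lo ≤ c → c < j₁ → f ((σ * σ') c) < t := by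
    intro c h1 h2
    rw [Equiv.Perm.mul_apply, hI'.fixes c (Or.inl h2)]
    exact hI.front c h1 h2
  have hnlt : ∀ c, j₁ ≤ c → c < lo + q → t ≤ f ((σ * σ') c) := by
    intro c h1 h2
    have h3 := hI'.fixes.mem h1 h2
    exact not_lt.1 (hI.back _ h3.1 h3.2)
  have hfix := hI.fixes.mul hσ
  have hcle : ((Finset.Ico lo (lo + q)).filter fun c => f c ≤ t).card ≤ j₂ - lo := by
    rw [← hfix.card_filter f (· ≤ t), ← Nat.card_Ico]
    refine Finset.card_le_card ?_
    intro c hc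
    simp only [Finset.mem_filter, Finset.mem_Ico] at hc ⊢
    refine ⟨hc.1.1, ?_⟩
    by_contra hcon
    exact hI'.back c (by omega) hc.1.2 hc.2
  have hcge : ((Finset.Ico lo (lo + q)).filter fun c => t ≤ f c).card ≤ lo + q - j₁ := by
    rw [← hfix.card_filter f (t ≤ ·), ← Nat.card_Ico]
    refine Finset.card_le_card ?_
    intro c hc
    simp only [Finset.mem_filter, Finset.mem_Ico] at hc ⊢
    refine ⟨?_, hc.1.2⟩
    by_contra hcon
    exact absurd hc.2 (not_le.2 (hlt c hc.1.1 (by omega)))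
  -- The elements `≥ t` all lie at positions from `j₁` on.
  have hleft : 4 * (j₁ - lo) ≤ 3 * q := by
    have h1 : (q : ℝ) ≤ 4 * (lo + q - j₁ : ℕ) := by
      unfold cntGe at hge
      rw [cnt_eq_card_Ico f lo q (t ≤ ·)] at hge
      have h2 : ((_ : ℕ) : ℝ) ≤ ((lo + q - j₁ : ℕ) : ℝ) := Nat.cast_le.2 hcge
      have h3 : (0 : ℝ) ≤ q := Nat.cast_nonneg q
      push_cast at hge
      linarith
    have h2 : q ≤ 4 * (lo + q - j₁) := by exact_mod_cast h1
    omega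
  have hright : 4 * (lo + q - j₂) ≤ 3 * q := by
    have h1 : (q : ℝ) ≤ 4 * (j₂ - lo : ℕ) := by
      unfold cntLe at hle
      rw [cnt_eq_card_Ico f lo q (· ≤ t)] at hle
      have h2 : ((_ : ℕ) : ℝ) ≤ ((j₂ - lo : ℕ) : ℝ) := Nat.cast_le.2 hcle
      have h3 : (0 : ℝ) ≤ q := Nat.cast_nonneg q
      push_cast at hle
      linarith
    have h2 : q ≤ 4 * (j₂ - lo) := by exact_mod_cast h1
    omega
  have hframe : ∀ c, (c < lo ∨ lo + q ≤ c) → c ≠ loc K 7 0 → c ≠ loc K 7 1 →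
      (c < loc K 9 0 ∨ loc K 9 q ≤ c) → s₃.mem c = s.mem c := by
    intro c h1 h2 h3 h4
    rw [hI'.frame c (by omega) h3]
    simp only [setReg_mem]
    rw [hI.frame c h1 h3]
    simp only [setReg_mem]
    rw [hfr c h2 (by omega)]
    simp
  have hregs : ∀ r, r < 31 ∨ r = 33 ∨ 49 < r → s₃.reg r = s.reg r := by
    intro r hr
    have : ∀ x, 34 ≤ x → x ≤ 49 → r ≠ x := fun x _ _ => by omega
    rw [hI'.regs r (by omega) (by omega) (by omega)]
    simp only [setReg_reg, this 49, this 46, Nat.reduceLeDiff, ne_eq, if_false, le_refl]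
    rw [hI.regs r (by omega) (by omega) (by omega)]
    simp only [setReg_reg, this 48, this 47, this 46, Nat.reduceLeDiff, ne_eq, if_false, le_refl]
    rw [hrg r (by omega)]
    simp only [setReg_reg, this 38, this 37, this 36, this 35, this 34, Nat.reduceLeDiff, ne_eq,
      if_false, le_refl]
  have hcost : n + (n₁ + n₂) ≤ 258 * q ∧ (tr ++ (tr₁ ++ tr₂)).length ≤ 1552 * q ∧
      SelCells K lo q (tr ++ (tr₁ ++ tr₂)) ∧
      IOB m B (tr ++ (tr₁ ++ tr₂)) (5128 * (q / B : ℝ) + 35) := by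
    refine ⟨?_, ?_, ?_, ?_⟩
    · have := hC.comps
      have := hC'.comps
      omega
    · have := hC.length
      have := hC'.length
      simp only [List.length_append]
      omega
    · intro c hc
      rcases List.mem_append.1 hc with hc | hc
      · have := hcells c hc
        omega
      · rcases List.mem_append.1 hc with hc | hc
        · have := hC.cells c hc
          omega
        · have := hC'.cells c hc
          omega
    · refine (hio.append ((hC.scan.io hB).append (hC'.scan.io hB))).mono ?_
      have hcb : ((cellBlocks K B).card : ℝ) ≤ 2 := by exact_mod_cast card_cellBlocks_le K B
      have k1 : (((lo + q : ℕ) : ℝ) - lo + (j₁ - lo) + ((0 : ℕ) - (0 : ℕ))) / B ≤ 2 * (q / B) := by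
        rw [← mul_div_assoc]
        refine div_le_div_of_nonneg_right ?_ hBR.le
        have : (j₁ : ℝ) ≤ (lo + q : ℕ) := by exact_mod_cast g2
        push_cast at this ⊢
        linarith
      have k2 : (((lo + q : ℕ) : ℝ) - j₁ + (j₂ - j₁) + ((0 : ℕ) - (0 : ℕ))) / B ≤ 2 * (q / B) := by
        rw [← mul_div_assoc]
        refine div_le_div_of_nonneg_right ?_ hBR.le
        have h1 : (j₂ : ℝ) ≤ (lo + q : ℕ) := by exact_mod_cast g4
        have h2 : (lo : ℝ) ≤ j₁ := by exact_mod_cast g1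
        push_cast at h1 ⊢
        linarith
      have k3 : (q : ℝ) * (128 : ℕ) / B = 128 * (q / B) := by push_cast; ring
      rw [k3]
      linarith
  have hround : ∀ s' : State α, s'.mem = s₃.mem →
      (∀ r, r < 31 ∨ r = 33 ∨ 49 < r → s'.reg r = s₃.reg r) →
      (if s.reg 33 < j₁ then s'.reg 31 = lo ∧ s'.reg 32 = j₁ - lo else
        if s.reg 33 < j₂ then s'.reg 32 = 0 else s'.reg 31 = j₂ ∧ s'.reg 32 = lo + q - j₂) →
      Round lo q K f s t j₁ j₂ (σ * σ') s' := by
    intro s' h1 h2 h3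
    refine ⟨g1, g3, g4, hfix, ?_, hlt, ?_, ?_, hleft, hright, h3, ?_, ?_⟩
    · intro c k1 k2
      rw [h1]
      by_cases hc : j₁ ≤ c
      · exact hI'.mem c hc k2
      · rw [hI'.frame c (by omega) (by omega), Equiv.Perm.mul_apply, hI'.fixes c (by omega)]
        simpa using hI.mem c k1 k2
    · intro c k1 k2
      exact le_antisymm (hI'.front c k1 k2) (hnlt c k1 (by omega))
    · intro c k1 k2
      exact not_le.1 (hI'.back c k1 k2)
    · intro c k1 k2 k3 k4
      rw [h1, hframe c k1 k2 k3 k4]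
    · intro r hr
      rw [h2 r hr, hregs r hr]
  rw [runs_ite]
  simp only [eval_sub, eval_V, r49, r33, r47]
  constructor
  · intro hc
    rw [runs_assign]
    refine ⟨by simp [r49, r31]; omega, ⟨t, j₁, j₂, σ * σ', hround _ rfl ?_ ?_⟩, by simpa using hcost⟩
    · intro r hr
      have : r ≠ 32 := by omega
      simp [this]
    · rw [if_pos (by omega)]
      simp [r31, r49]
  · intro hc
    rw [runs_ite]
    simp only [eval_sub, eval_V, r33, r47]
    constructor
    · intro hc2
      rw [runs_assign]
      refine ⟨by simp; omega, ⟨t, j₁, j₂, σ * σ', hround _ rfl ?_ ?_⟩, by simpa using hcost⟩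
      · intro r hr
        have : r ≠ 32 := by omega
        simp [this]
      · rw [if_neg (by omega), if_pos (by omega)]
        simp
    · intro hc2
      refine runs_assign_seq ?_ (by simp [r31, r32, r47]; omega)
      rw [runs_assign]
      refine ⟨by simp [r47]; omega, ⟨t, j₁, j₂, σ * σ', hround _ rfl ?_ ?_⟩, by simpa using hcost⟩
      · intro r hr
        have : r ≠ 32 := by omega
        have : r ≠ 31 := by omega
        simp [*]
      · rw [if_neg (by omega), if_neg (by omega)]
        simp [r31, r32, r47]

/-- The array `f` in `[lo, lo + q)` is permuted so that the position `π` separates the smaller from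
the larger elements. -/
structure Selected (lo q K π : ℕ) (f : ℕ → α) (s : State α) (σ : Equiv.Perm ℕ) (s' : State α) :
    Prop where
  fixes : FixesOutside σ lo (lo + q)
  mem : ∀ c, lo ≤ c → c < lo + q → s'.mem c = .elem (f (σ c))
  le : ∀ c, lo ≤ c → c < π → f (σ c) ≤ f (σ π)
  ge : ∀ c, π < c → c < lo + q → f (σ π) ≤ f (σ c)
  frame : ∀ c, (c < lo ∨ lo + q ≤ c) → c ≠ loc K 7 0 → c ≠ loc K 7 1 →
    (c < loc K 9 0 ∨ loc K 9 q ≤ c) → s'.mem c = s.mem c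
  regs : ∀ r, r < 31 ∨ r = 33 ∨ 49 < r → s'.reg r = s.reg r

theorem SelCells.io (hm : 8 ≤ m) (hq : q < B) (h : SelCells K lo q tr) : IOB m B tr 8 := by
  have hcb := card_cellBlocks_le K B
  refine (IOB.of_intervals (F := cellBlocks K B) (x := lo) (y := loc K 9 0) hq (by omega) ?_).mono ?_
  · intro c hc
    rcases h c hc with rfl | rfl | h | h
    · simp [cellBlocks]
    · simp [cellBlocks]
    · omega
    · unfold loc at *
      omega
  · have : ((cellBlocks K B).card : ℝ) ≤ 2 := by exact_mod_cast hcb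
    linarith

/-- At most three quarters of the array remain after a round, so the constants are four times those
of one round. In the bound for the loads, the additive `35` is first turned into `35 q / B`. -/
theorem runs_select (hm : 8 ≤ m) (hB : 0 < B) (hK : 1 < K) (q : ℕ) :
    ∀ {lo : ℕ} {f : ℕ → α} {s : State α}, lo ≤ π → π < lo + q → s.reg 6 = K → s.reg 31 = lo →
    s.reg 32 = q → s.reg 33 = π → (∀ c, lo ≤ c → c < lo + q → s.mem c = .elem (f c)) →
    loc K 9 q ≤ lo → lo + 8 * q + 256 < W →
    Runs W select s fun n tr s' => (∃ σ, Selected lo q K π f s σ s') ∧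
      n ≤ 1032 * q ∧ tr.length ≤ 6208 * q ∧ SelCells K lo q tr ∧
      IOB m B tr (20652 * (q / B : ℝ) + 8) := by
  have hBR : (0 : ℝ) < B := by exact_mod_cast hB
  induction q using Nat.strong_induction_on with
  | _ q ih =>
    intro lo f s hπ1 hπ2 h6 h31 h32 h33 hmem hlo hW
    refine runs_loop_succ (by simp [h32]; omega) ?_
    refine (runs_selectRound hm hB hK (by omega) h6 h31 h32 h33 hmem hlo hW).mono ?_
    rintro n tr s₁ ⟨⟨t, j₁, j₂, σ, hR⟩, hn, hlen, hcells, hio⟩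
    have g1 := hR.lo_le
    have g2 := hR.le
    have g3 := hR.le_hi
    have hnext := hR.next
    rw [h33] at hnext
    -- For `q < B` the entire rest of the selection takes place within eight blocks, so rounds on
    -- short arrays have no constant cost of their own.
    have hio0 : ∀ tr' : List ℕ, SelCells K lo q tr' → (B ≤ q → IOB m B tr' (20652 * (q / B : ℝ) + 8)) →
        IOB m B tr' (20652 * (q / B : ℝ) + 8) := by
      intro tr' h1 h2
      by_cases hqB : q < B
      · refine (h1.io hm hqB).mono ?_
        have : (0 : ℝ) ≤ q / B := by positivity
        linarith
      · exact h2 (not_lt.1 hqB)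
    have hone : B ≤ q → (1 : ℝ) ≤ q / B := by
      intro h
      rw [le_div_iff₀ hBR, one_mul]
      exact_mod_cast h
    have hrec : ∀ lo' q', lo ≤ lo' → lo' + q' ≤ lo + q → 4 * q' ≤ 3 * q → lo' ≤ π → π < lo' + q' →
        s₁.reg 31 = lo' → s₁.reg 32 = q' →
        (∀ c c', lo ≤ c → c < lo' → lo' ≤ c' → c' < lo' + q' → f (σ c) ≤ f (σ c')) →
        (∀ c c', lo' + q' ≤ c → c < lo + q → lo' ≤ c' → c' < lo' + q' → f (σ c') ≤ f (σ c)) →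
        Runs W select s₁ fun n' tr' s' => (∃ σ, Selected lo q K π f s σ s') ∧
          n + n' ≤ 1032 * q ∧ (tr ++ tr').length ≤ 6208 * q ∧ SelCells K lo q (tr ++ tr') ∧
          IOB m B (tr ++ tr') (20652 * (q / B : ℝ) + 8) := by
      intro lo' q' k1 k2 k3 k4 k5 k6 k7 hl hh
      have e9 : loc K 9 q' = 9 * K + q' := rfl
      have e9' : loc K 9 q = 9 * K + q := rfl
      refine (ih q' (by omega) (f := fun c => f (σ c)) k4 k5 (by simp [hR.regs, h6])
        k6 k7 (by simp [hR.regs, h33])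
        (fun c c1 c2 => hR.mem c (by omega) (by omega)) (by omega) (by omega)).mono ?_
      rintro n' tr' s' ⟨⟨σ', hS⟩, hn', hlen', hcells', hio'⟩
      have hmv : ∀ c, lo' ≤ c → c < lo' + q' → lo' ≤ σ' c ∧ σ' c < lo' + q' :=
        fun c c1 c2 => hS.fixes.mem c1 c2
      have hsel : SelCells K lo q (tr ++ tr') := by
        intro c hc
        rcases List.mem_append.1 hc with hc | hc
        · exact hcells c hc
        · have := hcells' c hc
          omega
      refine ⟨⟨σ * σ', hR.fixes.mul (hS.fixes.mono k1 k2), ?_, ?_, ?_, ?_, ?_⟩, by omega,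
        by rw [List.length_append]; omega, hsel, hio0 _ hsel fun hqB => ?_⟩
      · intro c c1 c2
        by_cases hc : lo' ≤ c ∧ c < lo' + q'
        · exact hS.mem c hc.1 hc.2
        · have e70 : loc K 7 0 = 7 * K := rfl
          have e71 : loc K 7 1 = 7 * K + 1 := rfl
          rw [hS.frame c (by omega) (by omega) (by omega) (by omega), Equiv.Perm.mul_apply,
            hS.fixes c (by omega)]
          exact hR.mem c c1 c2
      · intro c c1 c2
        by_cases hc : lo' ≤ c
        · exact hS.le c hc c2
        · rw [Equiv.Perm.mul_apply, Equiv.Perm.mul_apply, hS.fixes c (by omega)]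
          have := hmv π k4 k5
          exact hl c _ c1 (by omega) this.1 this.2
      · intro c c1 c2
        by_cases hc : c < lo' + q'
        · exact hS.ge c c1 hc
        · rw [Equiv.Perm.mul_apply, Equiv.Perm.mul_apply, hS.fixes c (by omega)]
          have := hmv π k4 k5
          exact hh c _ (by omega) c2 this.1 this.2
      · intro c c1 c2 c3 c4
        rw [hS.frame c (by omega) c2 c3 (by omega), hR.frame c c1 c2 c3 c4]
      · intro r hr
        rw [hS.regs r hr, hR.regs r hr]
      · refine (hio.append hio').mono ?_
        have h1 := hone hqB
        have h2 : (q' : ℝ) / B ≤ 3 / 4 * (q / B) := by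
          rw [← mul_div_assoc]
          refine div_le_div_of_nonneg_right ?_ hBR.le
          have : (4 * q' : ℝ) ≤ 3 * q := by exact_mod_cast k3
          linarith
        linarith
    split_ifs at hnext with h1 h2
    · refine hrec lo (j₁ - lo) le_rfl (by omega) hR.left hπ1 (by omega) hnext.1 hnext.2 ?_ ?_
      · intro c c' _ _ _ _
        omega
      · intro c c' c1 c2 c3 c4
        refine (hR.lt c' c3 (by omega)).le.trans ?_
        by_cases hc : c < j₂
        · exact (hR.eq c (by omega) hc).ge
        · exact (hR.gt c (by omega) c2).le
    · refine runs_loop_zero (by simp [hnext]) ⟨⟨σ, hR.fixes, hR.mem, ?_, ?_, hR.frame, hR.regs⟩,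
        by omega, by simp; omega, by simpa using hcells, hio0 _ (by simpa using hcells) fun hqB => ?_⟩
      · intro c c1 c2
        rw [hR.eq π (by omega) h2]
        by_cases hc : c < j₁
        · exact (hR.lt c c1 hc).le
        · exact (hR.eq c (by omega) (by omega)).le
      · intro c c1 c2
        rw [hR.eq π (by omega) h2]
        by_cases hc : c < j₂
        · exact (hR.eq c (by omega) hc).ge
        · exact (hR.gt c (by omega) c2).le
      · rw [List.append_nil]
        refine hio.mono ?_
        have := hone hqB
        linarith
    · refine hrec j₂ (lo + q - j₂) (by omega) (by omega) hR.right (by omega) (by omega) hnext.1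
        hnext.2 ?_ ?_
      · intro c c' c1 c2 c3 c4
        refine le_trans ?_ (hR.gt c' c3 (by omega)).le
        by_cases hc : c < j₁
        · exact (hR.lt c c1 hc).le
        · exact (hR.eq c (by omega) c2).le
      · intro c c' _ _ _ _
        omega

/-! ### Configurations in memory -/

/-- The memory stores the configuration `c` and the input `S`; bucket `i` is in slot `slot i`. -/
structure ConfMem (S : List α) (K : ℕ) (c : Config α) (slot : ℕ → ℕ) (m : ℕ → Cell α) : Prop where
  pivots : ∀ i p, c.pivots[i]? = some p → m (loc K 1 i) = .elem p
  inj : ∀ i j, i < c.buckets.length → j < c.buckets.length → slot i = slot j → i = j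
  slot_lt : ∀ i, i < c.buckets.length → slot i < c.buckets.length
  start : ∀ i, i < c.buckets.length → m (loc K 3 (2 * i)) = .word (loc K (11 + 2 * slot i) 0)
  size : ∀ i b, c.buckets[i]? = some b → m (loc K 3 (2 * i + 1)) = .word b.card
  items : ∀ i b, c.buckets[i]? = some b →
    (Multiset.range b.card).map (fun x => m (loc K (11 + 2 * slot i) x)) = b.map .elem
  input : ∀ i x, S[i]? = some x → m i = .elem x
  idle : ∀ x, x < K → m (loc K 5 x) = .word 0

structure ConfRegs (S : List α) (Δ K : ℕ) (c : Config α) (s : State α) : Prop where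
  N : s.reg 0 = S.length
  Δ : s.reg 1 = Δ
  k : s.reg 2 = c.buckets.length
  P : s.reg 3 = loc K 1 0
  T : s.reg 4 = loc K 3 0
  used : s.reg 5 = c.used
  K : s.reg 6 = K

theorem disjoint_regions (hij : i ≠ j) (hn : n ≤ K) (hn' : n' ≤ K) :
    Disjoint (Finset.Ico (loc K i 0) (loc K i 0 + n)) (Finset.Ico (loc K j 0) (loc K j 0 + n')) := by
  rw [Finset.disjoint_left]
  intro c hc hc'
  rw [Finset.mem_Ico] at hc hc'
  obtain ⟨e, rfl⟩ : ∃ e, c = loc K i 0 + e := ⟨c - loc K i 0, by omega⟩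
  obtain ⟨e', he'⟩ : ∃ e', loc K i 0 + e = loc K j 0 + e' := ⟨loc K i 0 + e - loc K j 0, by omega⟩
  rw [he'] at hc'
  rw [loc_add, loc_add, zero_add, zero_add, loc_eq_iff (by omega) (by omega)] at he'
  exact hij he'.1

theorem Valid.card_le (h : Valid S Δ c) {b : Multiset α} (hb : b ∈ c.buckets) :
    b.card ≤ S.length := by
  have h1 := h.card_total
  have h2 := h.used_le
  have h3 : b.card ≤ c.buckets.sum.card := by
    obtain ⟨l, l', hl⟩ := List.append_of_mem hb
    rw [hl]
    simp only [List.sum_append, List.sum_cons, Multiset.card_add]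
    omega
  omega

theorem Valid.length_pos (h : Valid S Δ c) : 1 ≤ c.buckets.length := by
  have := h.length
  omega

theorem ConfMem.represents (h : ConfMem S K c slot s.mem) (hr : ConfRegs S Δ K c s)
    (hv : Valid S Δ c) (hK : 2 * S.length ≤ K) : Represents s c := by
  have hlt : ∀ {i b}, c.buckets[i]? = some b → i < c.buckets.length :=
    fun hb => (List.getElem?_eq_some_iff.1 hb).1
  have hcard : ∀ {i : ℕ} {b : Multiset α}, c.buckets[i]? = some b → b.card ≤ K := by
    intro i b hb
    have := hv.card_le (List.mem_of_getElem? hb)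
    omega
  refine ⟨hr.k, ?_, fun i => loc K (11 + 2 * slot i) 0, ?_, ?_⟩
  · intro i p hp
    rw [hr.P, loc_add, zero_add]
    exact h.pivots i p hp
  · intro i b hb
    refine ⟨?_, ?_, ?_, ?_⟩
    · rw [hr.T, loc_add, zero_add]
      exact h.start i (hlt hb)
    · rw [hr.T, loc_add, loc_add, zero_add]
      exact h.size i b hb
    · simp only [loc_add, zero_add]
      exact h.items i b hb
    · rw [hr.P]
      refine disjoint_regions (by omega) (hcard hb) ?_
      have h1 := hv.card_total
      have h2 := hv.used_le
      omega
  · intro i i' b b' hne hb hb'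
    refine disjoint_regions ?_ (hcard hb) (hcard hb')
    intro he
    exact hne (h.inj i i' (hlt hb) (hlt hb') (by omega))

/-! ### Splitting a bucket -/

/-- Move the cells `[y, x)` of region `r` up by `d`, where register `54` is `x` and `55` is `y`. -/
def shiftUp (r d : ℕ) : Cmd :=
  .loop (V 54 - V 55)
    (.assign 54 (V 54 - 1) ;; .move (L (.const r) (V 54 + .const d)) (L (.const r) (V 54)))

/-- The cells are moved from the top down, so that no cell is overwritten before it has been copied.
-/
theorem runs_shiftUp {d : ℕ} (n : ℕ) (h54 : s.reg 54 = y + n) (h55 : s.reg 55 = y)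
    (h6 : s.reg 6 = K) (hK : y + n + d < K) (hd : 0 < d) (hW : y + n < W) :
    Runs W (shiftUp r d) s fun c tr s' => c = 0 ∧ tr.length = 2 * n ∧
      (∀ i, y ≤ i → i < y + n → s'.mem (loc K r (i + d)) = s.mem (loc K r i)) ∧
      (∀ c, (∀ i, y ≤ i → i < y + n → c ≠ loc K r (i + d)) → s'.mem c = s.mem c) ∧
      ∀ q, q ≠ 54 → s'.reg q = s.reg q := by
  induction n generalizing s with
  | zero =>
    refine runs_loop_zero (by simp [h54, h55]) ⟨rfl, rfl, ?_, fun _ _ => rfl, fun _ _ => rfl⟩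
    intro i h1 h2
    omega
  | succ n ih =>
    refine runs_loop_succ (by simp [h54, h55]) ?_
    refine runs_assign_seq ?_ (by simp [h54]; omega)
    rw [runs_move]
    have e : y + (n + 1) - 1 = y + n := by omega
    simp only [eval_L, eval_sub, eval_add, eval_V, eval_const, setReg_reg, if_true, h6, h54, e,
      eval_one, show (6 : ℕ) ≠ 54 by norm_num, if_false, setReg_mem]
    refine (ih (by simp) (by simp [h55]) (by simp [h6]) (by omega) (by omega)).mono ?_
    rintro c tr s' ⟨rfl, h1, h2, h3, h4⟩
    have hne : ∀ i, y ≤ i → i < y + n → loc K r (y + n + d) ≠ loc K r (i + d) := by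
      intro i _ _
      exact loc_ne
    refine ⟨rfl, by simp [h1]; omega, ?_, ?_, ?_⟩
    · intro i i1 i2
      by_cases hi : i = y + n
      · subst hi
        rw [h3 _ hne]
        simp
      · rw [h2 i i1 (by omega)]
        have : loc K r i ≠ loc K r (y + n + d) := by
          exact loc_ne
        simp [this]
    · intro c hc
      rw [h3 c (fun i i1 i2 => hc i i1 (by omega))]
      have : c ≠ loc K r (y + n + d) := hc (y + n) (by omega) (by omega)
      simp [this]
    · intro q hq
      rw [h4 q hq]
      simp [hq]

/-- Copy the upper half of a bucket to a new slot. -/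
def copyHalf : Cmd :=
  .loop (V 53 - V 54)
    (.move (L (11 + 2 * V 2) (V 54)) (V 33 + 1 + V 54) ;; .assign 54 (V 54 + 1))

theorem runs_copyHalf (hm : 6 ≤ m) (hB : 0 < B) (h53 : s.reg 53 = n) (h54 : s.reg 54 = 0)
    (h2 : s.reg 2 = k) (h33 : s.reg 33 = π) (h6 : s.reg 6 = K) (hW : n < W)
    (hdisj : ∀ i j, i < n → j < n → loc K (11 + 2 * k) i ≠ π + 1 + j) :
    Runs W copyHalf s fun c tr s' => c = 0 ∧ tr.length = 2 * n ∧
      IOB m B tr (12 + 4 * (n / B : ℝ)) ∧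
      (∀ i, i < n → s'.mem (loc K (11 + 2 * k) i) = s.mem (π + 1 + i)) ∧
      (∀ c, (∀ i, i < n → c ≠ loc K (11 + 2 * k) i) → s'.mem c = s.mem c) ∧
      ∀ q, q ≠ 54 → s'.reg q = s.reg q := by
  refine (runs_loop (G := ℕ)
    (fun x s' => x ≤ n ∧ s'.reg 54 = x ∧ (∀ q, q ≠ 54 → s'.reg q = s.reg q) ∧
      (∀ i, i < x → s'.mem (loc K (11 + 2 * k) i) = s.mem (π + 1 + i)) ∧
      (∀ c, (∀ i, i < n → c ≠ loc K (11 + 2 * k) i) → s'.mem c = s.mem c))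
    (fun x => n - x)
    (fun x c tr x' => c = 0 ∧ tr.length + 2 * x = 2 * x' ∧
      Scan m B ∅ (π + 1 + x) (loc K (11 + 2 * k) x) 0 tr (π + 1 + x') (loc K (11 + 2 * k) x') 0)
    ?_ ?_ ?_ 0 s ⟨by omega, h54, fun _ _ => rfl, by simp, fun _ _ => rfl⟩).mono ?_
  · intro x s' _
    exact ⟨rfl, by simp, Scan.refl _ _ _ _ _ _⟩
  · rintro x c tr x' c' tr' x'' ⟨rfl, a2, a3⟩ ⟨rfl, b2, b3⟩
    exact ⟨rfl, by rw [List.length_append]; omega, a3.trans b3⟩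
  · rintro x s' ⟨hx, q54, hq, hcp, hfr⟩ hc
    have q53 : s'.reg 53 = n := by simp [hq, h53]
    have q2 : s'.reg 2 = k := by simp [hq, h2]
    have q33 : s'.reg 33 = π := by simp [hq, h33]
    have q6 : s'.reg 6 = K := by simp [hq, h6]
    simp only [eval_sub, eval_V, q53, q54] at hc
    rw [runs_seq, runs_move]
    simp only [eval_L, eval_add, eval_mul, eval_V, eval_ofNat, eval_one, q2, q33, q54, q6]
    rw [runs_assign]
    refine ⟨by simp [q54]; omega, x + 1, ⟨by omega, by simp [q54], ?_, ?_, ?_⟩, by omega, rfl,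
      by simp; omega, ?_⟩
    · intro q hq'
      simp [hq', hq q hq']
    · intro i hi
      by_cases hix : i = x
      · subst hix
        simp
        rw [hfr _ (fun j hj => (hdisj j i hj (by omega)).symm)]
      · have : loc K (11 + 2 * k) i ≠ loc K (11 + 2 * k) x := by unfold loc; omega
        simp [this]
        exact hcp i (by omega)
    · intro c hc'
      have := hc' x (by omega)
      simp [this]
      exact hfr c hc'
    · refine Scan.step (by simpa using hm) (by omega) (by unfold loc; omega) le_rfl ?_
      simp [win]
  · rintro c tr s' ⟨x, ⟨hx, q54, hq, hcp, hfr⟩, hc, rfl, hl, hs⟩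
    have q53 : s'.reg 53 = n := by simp [hq, h53]
    simp only [eval_sub, eval_V, q53, q54] at hc
    obtain rfl : x = n := by omega
    refine ⟨rfl, by omega, (hs.io hB).mono ?_, hcp, hfr, hq⟩
    unfold loc
    push_cast
    simp only [Finset.card_empty, Nat.cast_zero]
    rw [← mul_div_assoc, ← mul_div_assoc]
    refine le_of_eq ?_
    ring

/-- Split the bucket whose number is in register `50`. -/
def splitBucket : Cmd :=
  .load 31 (L 3 (2 * V 50)) ;; .load 32 (L 3 (2 * V 50 + 1)) ;;
  .assign 52 ((V 32 + 1) / 2 - 1) ;; .assign 53 (V 32 - V 52 - 1) ;; .assign 33 (V 31 + V 52) ;;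
  select ;;
  .assign 54 0 ;; copyHalf ;;
  .assign 54 (V 2 - 1) ;; .assign 55 (V 50) ;; shiftUp 1 1 ;;
  .move (L 1 (V 50)) (V 33) ;;
  .assign 54 (2 * V 2) ;; .assign 55 (2 * V 50 + 2) ;; shiftUp 3 2 ;;
  .store (L 3 (2 * V 50 + 1)) (V 52) ;;
  .store (L 3 (2 * V 50 + 2)) (L (11 + 2 * V 2) 0) ;;
  .store (L 3 (2 * V 50 + 3)) (V 53) ;;
  .assign 2 (V 2 + 1)

theorem map_Ico_val {β : Type*} (g : ℕ → β) (lo n : ℕ) :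
    (Finset.Ico lo (lo + n)).val.map g = (Multiset.range n).map fun i => g (lo + i) := by
  have h : Finset.Ico lo (lo + n) = (Finset.range n).map (addLeftEmbedding lo) := by
    rw [Finset.range_eq_Ico, Finset.map_add_left_Ico, add_zero]
  rw [h, Finset.map_val, Multiset.map_map]
  rfl

theorem region_cases (h : r ≠ r') (hx : x < K) (hq : q ≤ K) :
    loc K r x < loc K r' 0 ∨ loc K r' q ≤ loc K r x := by
  unfold loc
  rcases Nat.lt_or_gt_of_ne h with h | h
  · left
    have := Nat.mul_le_mul_right K (show r + 1 ≤ r' by omega)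
    rw [add_mul] at this
    omega
  · right
    have := Nat.mul_le_mul_right K (show r' + 1 ≤ r by omega)
    rw [add_mul] at this
    omega

theorem exists_elems {β : Type*} {g : ℕ → Cell β} {b : Multiset β} [Nonempty β]
    (h : (Multiset.range n).map g = b.map .elem) : ∃ f : ℕ → β, ∀ i < n, g i = .elem (f i) := by
  have h1 : ∀ i, ∃ y, i < n → g i = .elem y := by
    intro i
    by_cases hi : i < n
    · have h2 : g i ∈ b.map Cell.elem := by
        rw [← h]
        exact Multiset.mem_map_of_mem _ (Multiset.mem_range.2 hi)
      obtain ⟨y, -, hy⟩ := Multiset.mem_map.1 h2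
      exact ⟨y, fun _ => hy.symm⟩
    · exact ⟨Classical.arbitrary β, fun h => absurd h hi⟩
  choose f hf using h1
  exact ⟨f, hf⟩

theorem Cell.elem_injective {β : Type*} : Function.Injective (Cell.elem : β → Cell β) := by
  intro a b h
  injection h

/-- The slots after a split of bucket `j` of `k`. -/
def splitSlot (slot : ℕ → ℕ) (j k i : ℕ) : ℕ :=
  if i ≤ j then slot i else if i = j + 1 then k else slot (i - 1)

set_option maxHeartbeats 1000000 in
-- The lower half stays in its slot and the upper half is copied to the first unused slot, so no
-- other bucket moves; only the pivots and the table are shifted, which costs `O(k)`. The lower half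
-- does not overflow because a bucket never has more than `2 Δ` elements; the upper half is examined
-- next by `splitPass`.
theorem runs_splitBucket {b : Multiset α} (hm : 8 ≤ m) (hB : 0 < B) (hK : K = 4 * S.length + 8)
    (hW : (2 * K + 20) * K + 300 ≤ W) (hv : Valid S Δ c) (hkN : c.buckets.length ≤ S.length)
    (hM : ConfMem S K c slot s.mem) (hR : ConfRegs S Δ K c s) (h50 : s.reg 50 = j)
    (hb : c.buckets[j]? = some b) (hover : Δ < b.card) :
    RunsV W splitBucket s fun n tr ss s' => ∃ c' slot', Step S Δ c c' ∧
      ConfMem S K c' slot' s'.mem ∧ ConfRegs S Δ K c' s' ∧ ss = [s'] ∧ s'.reg 50 = j ∧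
      c'.buckets.length = c.buckets.length + 1 ∧ c'.used = c.used ∧
      (∀ i < j, c'.buckets[i]? = c.buckets[i]?) ∧
      (∀ b', c'.buckets[j]? = some b' → b'.card ≤ Δ) ∧
      n ≤ 1032 * b.card ∧ tr.length ≤ 6210 * b.card + 6 * c.buckets.length + 10 ∧
      IOB m B tr (20656 * (b.card / B : ℝ) + 6 * c.buckets.length + 40) := by
  have hj : j < c.buckets.length := (List.getElem?_eq_some_iff.1 hb).1
  set k := c.buckets.length with hk
  set q := b.card with hq
  clear_value k q
  have hqN : q ≤ S.length := hq ▸ hv.card_le (List.mem_of_getElem? hb)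
  have hqΔ : q ≤ 2 * Δ := hq ▸ hv.upper b (List.mem_of_getElem? hb)
  have hlenP := hv.length
  obtain ⟨y, hy⟩ : ∃ y, y = slot j := ⟨_, rfl⟩
  have hyk : y < k := by
    rw [hy, hk]
    exact hM.slot_lt j (hk ▸ hj)
  obtain ⟨lo, hlo⟩ : ∃ lo, lo = loc K (11 + 2 * y) 0 := ⟨_, rfl⟩
  obtain ⟨r₀, hr₀⟩ : ∃ r₀, r₀ = (q + 1) / 2 - 1 := ⟨_, rfl⟩
  obtain ⟨nh, hnh⟩ : ∃ nh, nh = q - r₀ - 1 := ⟨_, rfl⟩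
  have haddr : ∀ z x, z ≤ k → x ≤ 2 * K + 256 → loc K (11 + 2 * z) x < W := by
    intro z x h1 h2
    have h3 := Nat.mul_le_mul_right K (show 11 + 2 * z ≤ 2 * K + 11 by omega)
    have h4 : (2 * K + 20) * K = (2 * K + 11) * K + 9 * K := by ring
    unfold loc
    omega
  have hWK : 13 * K + 256 < W := by
    have := haddr 0 (2 * K + 256) (by omega) (le_refl _)
    unfold loc at this
    linarith
  have : Nonempty α := by
    have : 0 < b.card := by omega
    obtain ⟨x, -⟩ := Multiset.card_pos_iff_exists_mem.1 this
    exact ⟨x⟩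
  have hitems := hM.items j b hb
  rw [← hy, ← hq] at hitems
  obtain ⟨f₀, hf₀⟩ := exists_elems hitems
  set f : ℕ → α := fun c => f₀ (c - lo) with hf
  have hfb : (Multiset.range q).map f₀ = b := by
    have h1 := hitems
    rw [Multiset.map_congr rfl (fun i hi => hf₀ i (Multiset.mem_range.1 hi))] at h1
    refine Multiset.map_injective Cell.elem_injective ?_
    rw [Multiset.map_map]
    exact h1
  have h31 := hM.start j (hk ▸ hj)
  rw [← hy, ← hlo] at h31
  have h32 := hM.size j b hb
  unfold splitBucket
  refine runsV_seq_left ?_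
  rw [runs_load]
  refine ⟨lo, by simpa [hR.K, h50] using h31, runsV_seq_left ?_⟩
  rw [runs_load]
  refine ⟨q, by simpa [hR.K, h50, hq] using h32, runsV_seq_left ?_⟩
  rw [runs_assign]
  refine ⟨by simp; omega, runsV_seq_left ?_⟩
  rw [runs_assign]
  refine ⟨by simp; omega, runsV_seq_left ?_⟩
  have hloW := haddr y (2 * K + 256) hyk.le (by omega)
  have elo : ∀ x, loc K (11 + 2 * y) x = lo + x := fun x => by rw [hlo, loc_add, zero_add]
  rw [elo] at hloW
  rw [runs_assign]
  refine ⟨by simp; omega, runsV_seq_left ?_⟩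
  simp only [eval_L, eval_add, eval_mul, eval_sub, eval_div, eval_V, eval_ofNat, eval_one, eval_zero,
    setReg_reg, setReg_mem, hR.K, h50, Nat.reduceEqDiff, if_false, if_true, ← hr₀, ← hnh]
  have hmem : ∀ x, lo ≤ x → x < lo + q → s.mem x = .elem (f x) := by
    intro x h1 h2
    have := hf₀ (x - lo) (by omega)
    rw [elo, Nat.add_sub_cancel' h1] at this
    rw [this]
  refine (runs_select (K := K) (π := lo + r₀) hm hB (by omega) q (lo := lo) (f := f) (by omega)
    (by omega) (by simp [hR.K]) (by simp) (by simp) (by simp) (by simpa using hmem)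
    ?_ (by linarith)).mono ?_
  · have := Nat.mul_le_mul_right K (show 10 ≤ 11 + 2 * y by omega)
    rw [hlo]
    unfold loc
    omega
  rintro n tr s₁ ⟨⟨σ, hS⟩, hn, hlen, -, hio⟩
  have h6 : s₁.reg 6 = K := by simp [hS.regs, hR.K]
  have h2 : s₁.reg 2 = k := by simp [hS.regs, hR.k, hk]
  have p50 : s₁.reg 50 = j := by simp [hS.regs, h50]
  have p33 : s₁.reg 33 = lo + r₀ := by simp [hS.regs]
  have p52 : s₁.reg 52 = r₀ := by simp [hS.regs]
  have p53 : s₁.reg 53 = nh := by simp [hS.regs]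
  have pr : ∀ r, r < 31 → s₁.reg r = s.reg r := by
    intro r hr
    rw [hS.regs r (Or.inl hr)]
    have hne : ∀ x, 31 ≤ x → r ≠ x := fun x _ => by omega
    simp only [setReg_reg, hne 33, hne 53, hne 52, hne 32, hne 31, Nat.reduceLeDiff, if_false, le_refl]
  have hfr₁ : ∀ r x, x < K → r ≠ 7 → r ≠ 9 → r ≠ 11 + 2 * y →
      s₁.mem (loc K r x) = s.mem (loc K r x) := by
    intro r x h1 h2 h3 h4
    rw [hS.frame]
    · simp
    · have := region_cases (q := q) h4 h1 (by omega)
      rw [← hlo, elo q] at this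
      exact this
    · exact loc_ne h1 (by omega) (Or.inl h2)
    · exact loc_ne h1 (by omega) (Or.inl h2)
    · exact region_cases h3 h1 (by omega)
  refine runsV_seq_left ?_
  rw [runs_assign]
  refine ⟨by simp; omega, runsV_seq_left ?_⟩
  refine (runs_copyHalf (m := m) (B := B) (K := K) (k := k) (π := lo + r₀) (n := nh) (by omega) hB
    (by simp [p53]) (by simp) (by simp [h2]) (by simp [p33]) (by simp [h6]) (by omega) ?_).mono ?_
  · intro i x hi hx
    have e : lo + r₀ + 1 + x = loc K (11 + 2 * y) (r₀ + 1 + x) := by rw [elo]; omega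
    rw [e]
    exact loc_ne
  rintro n₂ tr₂ s₂ ⟨rfl, hlen₂, hio₂, hcp, hfr₂, hrg₂⟩
  refine runsV_seq_left ?_
  rw [runs_assign]
  refine ⟨by simp [hrg₂, h2]; omega, runsV_seq_left ?_⟩
  rw [runs_assign]
  refine ⟨by simp [hrg₂, p50]; omega, runsV_seq_left ?_⟩
  refine (runs_shiftUp (K := K) (y := j) (k - 1 - j) (by simp [hrg₂, h2]; omega)
    (by simp [hrg₂, p50]) (by simp [hrg₂, h6]) (by omega) (by omega) (by omega)).mono ?_
  rintro n₃ tr₃ s₃ ⟨rfl, hlen₃, hsh₃, hfr₃, hrg₃⟩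
  refine runsV_seq_left ?_
  rw [runs_move]
  refine runsV_seq_left ?_
  rw [runs_assign]
  refine ⟨by simp [hrg₂, hrg₃, h2]; omega, runsV_seq_left ?_⟩
  rw [runs_assign]
  refine ⟨by simp [hrg₂, hrg₃, p50]; omega, runsV_seq_left ?_⟩
  refine (runs_shiftUp (K := K) (y := 2 * j + 2) (2 * k - (2 * j + 2))
    (by simp [hrg₂, hrg₃, h2]; omega)
    (by simp [hrg₂, hrg₃, p50]) (by simp [hrg₂, hrg₃, h6]) (by omega) (by omega) (by omega)).mono ?_
  rintro n₅ tr₅ s₅ ⟨rfl, hlen₅, hsh₅, hfr₅, hrg₅⟩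
  have hrg : ∀ r, r ≠ 54 → r ≠ 55 → s₅.reg r = s₁.reg r := by
    intro r h1 h2
    simp [hrg₅ r h1, h1, h2, hrg₃, hrg₂]
  refine runsV_seq_left ?_
  rw [runs_store]
  refine ⟨by simp [hrg, p52]; omega, runsV_seq_left ?_⟩
  rw [runs_store]
  have hnewW := haddr k 0 le_rfl (by omega)
  refine ⟨by simp [hrg, h6, h2, hnewW], runsV_seq_left ?_⟩
  rw [runs_store]
  refine ⟨by simp [hrg, p53]; omega, ?_⟩
  -- The configuration after the split is stored only once the number of buckets has been increased,
  -- so the state after this last assignment is the marked one.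
  refine runsV_assign (by simp [hrg, h2]; omega) ?_
  set g : ℕ → α := fun i => f (σ (lo + i)) with hg
  have hgb : (Multiset.range q).map g = b := by
    have h1 := hS.fixes.map_eq f
    rw [map_Ico_val, map_Ico_val] at h1
    rw [← hfb, hg]
    refine Eq.trans h1 (Multiset.map_congr rfl fun i _ => ?_)
    simp [hf]
  have hqs : q = r₀ + (1 + nh) := by omega
  have hsplit : b = (Multiset.range r₀).map g + {g r₀} +
      (Multiset.range nh).map fun i => g (r₀ + 1 + i) := by
    rw [← hgb, hqs, Multiset.range_add, Multiset.map_add, Multiset.map_map, Multiset.range_add,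
      Multiset.map_add, Multiset.map_map, add_assoc]
    congr 1
    congr 1
    refine Multiset.map_congr rfl fun i _ => ?_
    simp [add_assoc]
  have hstep : Step S Δ c _ := Step.split c j b ((Multiset.range r₀).map g)
    ((Multiset.range nh).map fun i => g (r₀ + 1 + i)) (g r₀) hb (hq ▸ hover) hsplit
    (by rw [Multiset.card_map, Multiset.card_range]; omega)
    (by
      intro x hx
      obtain ⟨i, hi, rfl⟩ := Multiset.mem_map.1 hx
      rw [Multiset.mem_range] at hi
      exact hS.le _ (by omega) (by omega))
    (by
      intro x hx
      obtain ⟨i, hi, rfl⟩ := Multiset.mem_map.1 hx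
      rw [Multiset.mem_range] at hi
      exact hS.ge _ (by omega) (by omega))
  have hbk := getElem?_replace_two c.buckets j ((Multiset.range r₀).map g)
    ((Multiset.range nh).map fun i => g (r₀ + 1 + i)) (hk ▸ hj)
  have hpv := getElem?_insert_at c.pivots j (g r₀) (by omega)
  have hlk : (c.buckets.take j ++ (Multiset.range r₀).map g ::
      ((Multiset.range nh).map fun i => g (r₀ + 1 + i)) :: c.buckets.drop (j + 1)).length =
      k + 1 := by
    simp only [List.length_append, List.length_take, List.length_cons, List.length_drop]
    omega
  -- the memory contents region by region
  have hs₂ : ∀ r x, x < K → r ≠ 7 → r ≠ 9 → r ≠ 11 + 2 * y → r ≠ 11 + 2 * k →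
      s₂.mem (loc K r x) = s.mem (loc K r x) := by
    intro r x h1 h2 h3 h4 h5
    rw [hfr₂ _ fun i hi => loc_ne h1 (by omega) (Or.inl h5)]
    simpa using hfr₁ r x h1 h2 h3 h4
  have hold : ∀ x, x < q → s₂.mem (loc K (11 + 2 * y) x) = .elem (g x) := by
    intro x hx
    rw [hfr₂ _ fun i hi => loc_ne, elo]
    simpa using hS.mem (lo + x) (by omega) (by omega)
  have hnew : ∀ x, x < nh → s₂.mem (loc K (11 + 2 * k) x) = .elem (g (r₀ + 1 + x)) := by
    intro x hx
    rw [hcp x hx]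
    have := hS.mem (lo + (r₀ + 1 + x)) (by omega) (by omega)
    simpa [add_assoc] using this
  simp only [eval_L, eval_add, eval_mul, eval_sub, eval_V, eval_ofNat, eval_one, eval_zero,
    setReg_reg, setMem_reg, setReg_mem, Nat.reduceEqDiff, if_false, if_true] at hsh₃ hfr₃ hsh₅ hfr₅ ⊢
  simp only [hrg₃, hrg₂, ne_eq, Nat.reduceEqDiff, not_false_eq_true, setReg_reg, if_false, h6, p33, p50]
    at hsh₅ hfr₅
  have t6 : s₅.reg 6 = K := by simp [hrg, h6]
  have t2 : s₅.reg 2 = k := by simp [hrg, h2]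
  have t50 : s₅.reg 50 = j := by simp [hrg, p50]
  have t52 : s₅.reg 52 = r₀ := by simp [hrg, p52]
  have t53 : s₅.reg 53 = nh := by simp [hrg, p53]
  simp only [t6, t2, t50, t52, t53]
  generalize hmf : (((s₅.setMem (loc K 3 (2 * j + 1)) (Cell.word r₀)).setMem
    (loc K 3 (2 * j + 2)) (Cell.word (loc K (11 + 2 * k) 0))).setMem
    (loc K 3 (2 * j + 3)) (Cell.word nh)) = s₆
  have hmem₆ : ∀ c, s₆.mem c = if c = loc K 3 (2 * j + 3) then .word nh else
      if c = loc K 3 (2 * j + 2) then .word (loc K (11 + 2 * k) 0) else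
      if c = loc K 3 (2 * j + 1) then .word r₀ else s₅.mem c := by
    intro c
    simp [← hmf]
  have hreg₆ : s₆.reg = s₅.reg := by rw [← hmf]; simp
  have h3ne : ∀ {r x x'}, r ≠ 3 → x < K → x' < K → loc K r x ≠ loc K 3 x' :=
    fun hr hx hx' => loc_ne hx hx' (Or.inl hr)
  have hother : ∀ r x, x < K → r ≠ 1 → r ≠ 3 → s₆.mem (loc K r x) = s₂.mem (loc K r x) := by
    intro r x hx h1 h3
    rw [hmem₆, if_neg (h3ne h3 hx (by omega)), if_neg (h3ne h3 hx (by omega)),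
      if_neg (h3ne h3 hx (by omega)), hfr₅ _ fun i _ _ => h3ne h3 hx (by omega), setMem_mem,
      if_neg (loc_ne hx (by omega) (Or.inl h1)),
      hfr₃ _ fun i _ _ => loc_ne hx (by omega) (Or.inl h1)]
  have hpiv₆ : ∀ x, x < K → s₆.mem (loc K 1 x) =
      if x = j then s₃.mem (lo + r₀) else s₃.mem (loc K 1 x) := by
    intro x hx
    rw [hmem₆, if_neg (h3ne (by omega) hx (by omega)), if_neg (h3ne (by omega) hx (by omega)),
      if_neg (h3ne (by omega) hx (by omega)), hfr₅ _ fun i _ _ => h3ne (by omega) hx (by omega),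
      setMem_mem]
    simp only [loc_eq_iff hx (show j < K by omega), true_and]
  have hmed : s₃.mem (lo + r₀) = .elem (g r₀) := by
    rw [← elo, hfr₃ _ fun i _ _ => loc_ne]
    exact hold r₀ (by omega)
  have htab : ∀ x, x < 2 * k + 2 → s₆.mem (loc K 3 x) = if x = 2 * j + 3 then .word nh else
      if x = 2 * j + 2 then .word (loc K (11 + 2 * k) 0) else if x = 2 * j + 1 then .word r₀ else
      if x ≤ 2 * j then s.mem (loc K 3 x) else s.mem (loc K 3 (x - 2)) := by
    intro x hx
    have h3 : ∀ x, x < K → s₃.mem (loc K 3 x) = s.mem (loc K 3 x) := by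
      intro x hx
      rw [hfr₃ _ fun i _ _ => loc_ne hx,
        hs₂ 3 x hx (by omega) (by omega) (by omega) (by omega)]
    rw [hmem₆]
    simp only [loc_eq_iff (show x < K by omega) (show 2 * j + 3 < K by omega),
      loc_eq_iff (show x < K by omega) (show 2 * j + 2 < K by omega),
      loc_eq_iff (show x < K by omega) (show 2 * j + 1 < K by omega), true_and]
    split_ifs with c1 c2 c3 c4
    · rfl
    · rfl
    · rfl
    · rw [hfr₅ _ fun i _ _ => loc_ne, setMem_mem,
        if_neg loc_ne, h3 x (by omega)]
    · have := hsh₅ (x - 2) (by omega) (by omega)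
      rw [Nat.sub_add_cancel (by omega)] at this
      rw [this, setMem_mem, if_neg loc_ne,
        h3 _ (by omega)]
  have hkP : ∀ i p, c.pivots[i]? = some p → i + 1 < k := by
    intro i p hp
    have := (List.getElem?_eq_some_iff.1 hp).1
    omega
  have hkB : ∀ (i : ℕ) b', c.buckets[i]? = some b' → i < k := by
    intro i b' hb'
    have := (List.getElem?_eq_some_iff.1 hb').1
    omega
  have hs₂1 : ∀ x, x < K → s₂.mem (loc K 1 x) = s.mem (loc K 1 x) :=
    fun x hx => hs₂ 1 x hx (by omega) (by omega) (by omega) (by omega)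
  have hbuck : ∀ i b', i ≠ j → c.buckets[i]? = some b' →
      (Multiset.range b'.card).map (fun x => s₆.mem (loc K (11 + 2 * slot i) x)) =
        b'.map .elem := by
    intro i b' hij hb'
    rw [← hM.items i b' hb']
    refine Multiset.map_congr rfl fun x hx => ?_
    rw [Multiset.mem_range] at hx
    have h1 := hv.card_le (List.mem_of_getElem? hb')
    have h2 : slot i ≠ y := fun h => hij (hM.inj i j (hk ▸ hkB i b' hb') (hk ▸ hj) (h.trans hy))
    have h3 := hM.slot_lt i (hk ▸ hkB i b' hb')
    rw [hother _ x (by omega) (by omega) (by omega), hs₂ _ x (by omega) (by omega) (by omega)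
      (by omega) (by omega)]
  refine ⟨_, splitSlot slot j k, hstep, ⟨?_, ?_, ?_, ?_, ?_, ?_, ?_, ?_⟩, ⟨?_, ?_, ?_, ?_, ?_, ?_, ?_⟩,
    trivial, trivial, hlk, rfl, ?_, ?_, ?_, ?_, ?_⟩
  · intro i p hp
    simp only at hp
    rw [hpv] at hp
    split_ifs at hp with c1 c2
    · have := hkP i p hp
      rw [hpiv₆ i (by omega), if_neg (by omega),
        hfr₃ _ fun i' _ _ => loc_ne, hs₂1 i (by omega)]
      exact hM.pivots i p hp
    · rw [hpiv₆ i (by omega), if_pos c2, hmed]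
      rw [Option.some.injEq] at hp
      rw [hp]
    · have := hkP _ p hp
      rw [hpiv₆ i (by omega), if_neg c2]
      have h4 := hsh₃ (i - 1) (by omega) (by omega)
      rw [Nat.sub_add_cancel (by omega)] at h4
      rw [h4, hs₂1 _ (by omega)]
      exact hM.pivots _ p hp
  · intro i i' hi hi' he
    simp only [hlk] at hi hi'
    have hsl : ∀ x, x < k → slot x < k := fun x hx => by
      have := hM.slot_lt x (hk ▸ hx)
      omega
    have hin : ∀ x x', x < k → x' < k → slot x = slot x' → x = x' :=
      fun x x' hx hx' => hM.inj x x' (hk ▸ hx) (hk ▸ hx')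
    unfold splitSlot at he
    have e1 := hsl i
    have e2 := hsl i'
    have e3 := hsl (i - 1)
    have e4 := hsl (i' - 1)
    split_ifs at he
    · exact hin _ _ (by omega) (by omega) he
    · omega
    · have := hin _ _ (by omega) (by omega) he
      omega
    · omega
    · omega
    · omega
    · have := hin _ _ (by omega) (by omega) he
      omega
    · omega
    · have := hin _ _ (by omega) (by omega) he
      omega
  · intro i hi
    simp only [hlk] at hi ⊢
    have e1 := hM.slot_lt i
    have e3 := hM.slot_lt (i - 1)
    unfold splitSlot
    split_ifs
    · have := e1 (by omega)
      omega
    · omega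
    · have := e3 (by omega)
      omega
  · intro i hi
    simp only [hlk] at hi
    rw [htab _ (by omega)]
    unfold splitSlot
    rw [if_neg (by omega)]
    by_cases c1 : i = j + 1
    · subst c1
      rw [if_pos (by omega), if_neg (by omega), if_pos rfl]
    · rw [if_neg (by omega), if_neg (by omega)]
      by_cases c2 : i ≤ j
      · rw [if_pos (by omega), if_pos c2]
        exact hM.start i (by omega)
      · rw [if_neg (by omega), if_neg c2, if_neg c1]
        have := hM.start (i - 1) (by omega)
        rw [show 2 * i - 2 = 2 * (i - 1) by omega]
        exact this
  · intro i b' hb'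
    simp only at hb'
    rw [hbk] at hb'
    split_ifs at hb' with c1 c2 c3
    · rw [htab _ (by have := hkB _ _ hb'; omega), if_neg (by omega), if_neg (by omega),
        if_neg (by omega), if_pos (by omega)]
      exact hM.size i b' hb'
    · rw [htab _ (by omega), if_neg (by omega), if_neg (by omega), if_pos (by omega)]
      rw [Option.some.injEq] at hb'
      rw [← hb', Multiset.card_map, Multiset.card_range]
    · rw [htab _ (by omega), if_pos (by omega)]
      rw [Option.some.injEq] at hb'
      rw [← hb', Multiset.card_map, Multiset.card_range]
    · rw [htab _ (by have := hkB _ _ hb'; omega), if_neg (by omega), if_neg (by omega),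
        if_neg (by omega), if_neg (by omega)]
      rw [show 2 * i + 1 - 2 = 2 * (i - 1) + 1 by omega]
      exact hM.size _ b' hb'
  · intro i b' hb'
    simp only at hb'
    rw [hbk] at hb'
    unfold splitSlot
    split_ifs at hb' with c1 c2 c3
    · rw [if_pos (by omega)]
      exact hbuck i b' (by omega) hb'
    · rw [Option.some.injEq] at hb'
      rw [if_pos (by omega), ← hb', Multiset.card_map, Multiset.card_range, Multiset.map_map, c2,
        ← hy]
      refine Multiset.map_congr rfl fun x hx => ?_
      rw [Multiset.mem_range] at hx
      rw [hother _ x (by omega) (by omega) (by omega), hold x (by omega)]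
      rfl
    · rw [Option.some.injEq] at hb'
      rw [if_neg (by omega), if_pos c3, ← hb', Multiset.card_map, Multiset.card_range,
        Multiset.map_map]
      refine Multiset.map_congr rfl fun x hx => ?_
      rw [Multiset.mem_range] at hx
      rw [hother _ x (by omega) (by omega) (by omega), hnew x hx]
      rfl
    · rw [if_neg (by omega), if_neg c3]
      exact hbuck (i - 1) b' (by omega) hb'
  · intro i x hx
    have h1 := (List.getElem?_eq_some_iff.1 hx).1
    have h3 : loc K 0 i = i := by unfold loc; omega
    have h4 := hother 0 i (by omega) (by omega) (by omega)
    rw [hs₂ 0 i (by omega) (by omega) (by omega) (by omega) (by omega), h3] at h4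
    rw [h4]
    exact hM.input i x hx
  · intro x hx
    rw [hother 5 x hx (by omega) (by omega),
      hs₂ 5 x hx (by omega) (by omega) (by omega) (by omega)]
    exact hM.idle x hx
  · simp [hreg₆, hrg, pr, hR.N]
  · simp [hreg₆, hrg, pr, hR.Δ]
  · simp only [hlk, setReg_reg, if_true]
  · simp [hreg₆, hrg, pr, hR.P]
  · simp [hreg₆, hrg, pr, hR.T]
  · simp [hreg₆, hrg, pr, hR.used]
  · simp [hreg₆, hrg, pr, hR.K]
  · intro i hi
    simp only
    rw [hbk, if_pos hi]
  · intro b' hb'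
    simp only at hb'
    rw [hbk, if_neg (by omega), if_pos rfl, Option.some.injEq] at hb'
    rw [← hb', Multiset.card_map, Multiset.card_range]
    omega
  · simpa using hn
  · simp only [List.length_append, List.length_cons, List.length_nil, hlen₂, hlen₃, hlen₅]
    have k1 : nh ≤ q := by rw [hqs]; linarith
    have k2 : k - 1 - j ≤ k := (Nat.sub_le _ _).trans (Nat.sub_le _ _)
    have k3 : 2 * k - (2 * j + 2) ≤ 2 * k := Nat.sub_le _ _
    linarith
  · have hm0 : 0 < m := by omega
    simp only [List.nil_append, List.append_nil]
    have h1 : ∀ x, IOB m B [x] 1 := fun x => by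
      simpa using IOB.of_length (B := B) hm0 [x]
    have h2 : ∀ x y, IOB m B [x, y] 2 := fun x y => by
      simpa using IOB.of_length (B := B) hm0 [x, y]
    refine ((h1 _).append ((h1 _).append (hio.append (hio₂.append ((IOB.of_length hm0 tr₃).append
      ((h2 _ _).append ((IOB.of_length hm0 tr₅).append ((h1 _).append ((h1 _).append
        (h1 _)))))))))).mono ?_
    have k1 : (tr₃.length : ℝ) ≤ 2 * k := by
      rw [hlen₃]
      exact_mod_cast (by omega : 2 * (k - 1 - j) ≤ 2 * k)
    have k2 : (tr₅.length : ℝ) ≤ 4 * k := by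
      rw [hlen₅]
      exact_mod_cast (by omega : 2 * (2 * k - (2 * j + 2)) ≤ 4 * k)
    have k3 : (nh / B : ℝ) ≤ q / B := by
      gcongr
      omega
    linarith

/-! ### Accounting -/

/-- Costs per phase and per new bucket, which may grow with the number of buckets. -/
structure Rate where
  u : ℕ → ℝ
  w : ℕ → ℝ
  mono_u : Monotone u
  mono_w : Monotone w

/-- The cost of going from `k` buckets after `t` phases to `k'` buckets after `t'` phases. -/
def Rate.cost (R : Rate) (k t k' t' : ℕ) : ℝ := ((t' : ℝ) - t) * R.u k' + ((k' : ℝ) - k) * R.w k'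

theorem Rate.cost_self (R : Rate) (k t : ℕ) : R.cost k t k t = 0 := by
  simp [Rate.cost]

/-- Since the rates grow with the number of buckets, every step may be charged at the rate of the
final number; the charges then telescope. -/
theorem Rate.cost_add (R : Rate) {k' t' k'' t'' : ℕ} (hk : k ≤ k') (hk' : k' ≤ k'') (ht : t ≤ t') :
    R.cost k t k' t' + R.cost k' t' k'' t'' ≤ R.cost k t k'' t'' := by
  have h1 : ((t' : ℝ) - t) * R.u k' ≤ ((t' : ℝ) - t) * R.u k'' :=
    mul_le_mul_of_nonneg_left (R.mono_u hk') (sub_nonneg.2 (by exact_mod_cast ht))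
  have h2 : ((k' : ℝ) - k) * R.w k' ≤ ((k' : ℝ) - k) * R.w k'' :=
    mul_le_mul_of_nonneg_left (R.mono_w hk') (sub_nonneg.2 (by exact_mod_cast hk))
  unfold Rate.cost
  linarith

/-- Going from configuration `c` after `t` phases to `c'` after `t'` phases: the states `ss` that
are passed store the configurations after `c`, and the numbers of comparisons, of accesses and of
loads are bounded by the given rates. -/
structure Progress (S : List α) (Δ m B : ℕ) (R₁ R₂ R₃ : Rate) (c : Config α) (t n : ℕ)
    (tr : List ℕ) (ss : List (State α)) (c' : Config α) (t' : ℕ) : Prop where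
  run : ∃ cs, List.Forall₂ Represents ss cs ∧ (c :: cs).IsChain (Step S Δ) ∧
    (c :: cs).getLast? = some c'
  le_k : c.buckets.length ≤ c'.buckets.length
  le_t : t ≤ t'
  comps : (n : ℝ) ≤ R₁.cost c.buckets.length t c'.buckets.length t'
  length : (tr.length : ℝ) ≤ R₂.cost c.buckets.length t c'.buckets.length t'
  io : IOB m B tr (R₃.cost c.buckets.length t c'.buckets.length t')

theorem Progress.refl (S : List α) (Δ m B : ℕ) (R₁ R₂ R₃ : Rate) (c : Config α) (t : ℕ) :
    Progress S Δ m B R₁ R₂ R₃ c t 0 [] [] c t :=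
  ⟨⟨[], .nil, by simp, rfl⟩, le_rfl, le_rfl, by simp [Rate.cost_self], by simp [Rate.cost_self],
    IOB.nil (Rate.cost_self _ _ _).ge⟩

theorem run_append {c'' : Config α} {ss ss' : List (State α)} (h : ∃ cs, List.Forall₂ Represents ss
    cs ∧ (c :: cs).IsChain (Step S Δ) ∧ (c :: cs).getLast? = some c') (h' : ∃ cs, List.Forall₂
    Represents ss' cs ∧ (c' :: cs).IsChain (Step S Δ) ∧ (c' :: cs).getLast? = some c'') :
    ∃ cs, List.Forall₂ Represents (ss ++ ss') cs ∧ (c :: cs).IsChain (Step S Δ) ∧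
      (c :: cs).getLast? = some c'' := by
  obtain ⟨cs, h1, h2, h3⟩ := h
  obtain ⟨cs', h1', h2', h3'⟩ := h'
  refine ⟨cs ++ cs', List.rel_append h1 h1', ?_, ?_⟩
  · rw [← List.cons_append, List.isChain_append]
    refine ⟨h2, h2'.tail, ?_⟩
    intro x hx y hy
    rw [h3, Option.mem_def, Option.some.injEq] at hx
    subst hx
    cases cs' with
    | nil => simp at hy
    | cons z cs' =>
      simp only [List.head?_cons, Option.mem_def, Option.some.injEq] at hy
      subst hy
      exact h2'.rel
  · rw [← List.cons_append, List.getLast?_append, h3]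
    cases cs' with
    | nil => simpa using h3'
    | cons z cs' =>
      rw [List.getLast?_cons_cons] at h3'
      rw [h3']
      rfl

theorem Progress.trans {R₁ R₂ R₃ : Rate} {c'' : Config α} {t' t'' : ℕ} {ss ss' : List (State α)}
    (h : Progress S Δ m B R₁ R₂ R₃ c t n tr ss c' t')
    (h' : Progress S Δ m B R₁ R₂ R₃ c' t' n' tr' ss' c'' t'') :
    Progress S Δ m B R₁ R₂ R₃ c t (n + n') (tr ++ tr') (ss ++ ss') c'' t'' where
  run := run_append h.run h'.run
  le_k := h.le_k.trans h'.le_k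
  le_t := h.le_t.trans h'.le_t
  comps := by
    have := R₁.cost_add (t'' := t'') h.le_k h'.le_k h.le_t
    have := h.comps
    have := h'.comps
    push_cast
    linarith
  length := by
    have := R₂.cost_add (t'' := t'') h.le_k h'.le_k h.le_t
    have := h.length
    have := h'.length
    rw [List.length_append]
    push_cast
    linarith
  io := (h.io.append h'.io).mono (R₃.cost_add h.le_k h'.le_k h.le_t)

theorem ConfRegs.congr (h : ConfRegs S Δ K c s) (hs : ∀ r, r < 7 → s'.reg r = s.reg r) :
    ConfRegs S Δ K c s' :=
  ⟨(hs 0 (by norm_num)).trans h.N, (hs 1 (by norm_num)).trans h.Δ, (hs 2 (by norm_num)).trans h.k,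
    (hs 3 (by norm_num)).trans h.P, (hs 4 (by norm_num)).trans h.T,
    (hs 5 (by norm_num)).trans h.used, (hs 6 (by norm_num)).trans h.K⟩

/-! ### Splitting all overflowing buckets -/

/-- Register `50` is the number of the bucket examined and advances also after a split: the lower
half has at most `Δ` elements, and the upper half comes next. -/
def splitPass : Cmd :=
  .assign 50 0 ;;
  .loop (V 2 - V 50)
    (.load 51 (L 3 (2 * V 50 + 1)) ;;
     .ite (V 51 - V 1) splitBucket skip ;;
     .assign 50 (V 50 + 1))

/-- Constant costs per phase and per new bucket. -/
def Rate.const (x y : ℝ) : Rate := ⟨fun _ => x, fun _ => y, monotone_const, monotone_const⟩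

/-- The loads for splitting a bucket when there are `k` buckets. -/
noncomputable def splitLoads (Δ B : ℕ) (k : ℕ) : ℝ := 41312 * (Δ / B) + 6 * k + 40

theorem splitLoads_mono (Δ B : ℕ) : Monotone (splitLoads Δ B) := by
  intro k k' h
  unfold splitLoads
  have : (k : ℝ) ≤ k' := by exact_mod_cast h
  linarith

noncomputable def passLoads (Δ B : ℕ) : Rate :=
  ⟨fun _ => 1, splitLoads Δ B, monotone_const, splitLoads_mono Δ B⟩

theorem Valid.length_le (h2 : 2 ≤ Δ) (hΔS : Δ ≤ S.length) (h : Valid S Δ c) :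
    c.buckets.length ≤ S.length := by
  have h1 := h.bucket_count hΔS
  have h3 := Nat.mul_le_mul_left c.buckets.length h2
  omega

/-- Having `k ≤ Δ`, the `O(k)` accesses for shifting the tables are absorbed by the `O(Δ)` accesses
of the selection. -/
theorem Valid.length_le_cap (h2 : 2 ≤ Δ) (hΔS : Δ ≤ S.length) (hN : 2 * S.length ≤ Δ * Δ)
    (h : Valid S Δ c) : c.buckets.length ≤ Δ :=
  Nat.le_of_mul_le_mul_right ((h.bucket_count hΔS).trans hN) (by omega)

/-- The phases of `Progress` here are the buckets examined, at one access each. A bucket that is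
split has at most `2 Δ` elements, so the constants per new bucket come from twice those of
`runs_splitBucket`, with the table shifts absorbed by `k ≤ Δ`. -/
theorem runs_splitPass (hm : 8 ≤ m) (hB : 0 < B) (hK : K = 4 * S.length + 8)
    (hW : (2 * K + 20) * K + 300 ≤ W) (h2 : 2 ≤ Δ) (hΔS : Δ ≤ S.length) (hN : 2 * S.length ≤ Δ * Δ)
    (hv : Valid S Δ c) (hM : ConfMem S K c slot s.mem) (hR : ConfRegs S Δ K c s) :
    RunsV W splitPass s fun n tr ss s' => ∃ c' slot', ConfMem S K c' slot' s'.mem ∧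
      ConfRegs S Δ K c' s' ∧ Valid S Δ c' ∧ c'.used = c.used ∧ (∀ b ∈ c'.buckets, b.card ≤ Δ) ∧
      Progress S Δ m B (.const 0 (2064 * Δ))
        (.const 1 (12440 * Δ)) (passLoads Δ B) c 0 n tr ss c'
        c'.buckets.length := by
  have hWK : K + 300 ≤ W := by nlinarith
  refine runsV_seq_left ?_
  rw [runs_assign]
  refine ⟨by simp; omega, ?_⟩
  refine (runsV_loop (G := Config α × (ℕ → ℕ) × ℕ)
    (fun g s' => ConfMem S K g.1 g.2.1 s'.mem ∧ ConfRegs S Δ K g.1 s' ∧ Valid S Δ g.1 ∧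
      g.1.used = c.used ∧ s'.reg 50 = g.2.2 ∧ g.2.2 ≤ g.1.buckets.length ∧
      ∀ i < g.2.2, ∀ b, g.1.buckets[i]? = some b → b.card ≤ Δ)
    -- A split adds a bucket that still has to be examined; the factor `2` makes the measure
    -- decrease nevertheless.
    (fun g => 2 * (S.length - g.1.buckets.length) + (g.1.buckets.length - g.2.2))
    (fun g n tr ss g' => Progress S Δ m B (.const 0 (2064 * Δ))
        (.const 1 (12440 * Δ)) (passLoads Δ B) g.1 g.2.2 n tr ss g'.1
        g'.2.2) ?_ ?_ ?_ (c, slot, 0) _ ⟨by simpa using hM, hR.congr ?_, hv, rfl, by simp,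
      Nat.zero_le _, by simp⟩).mono ?_
  · intro g s' _
    exact Progress.refl _ _ _ _ _ _ _ _ _
  · intro g n tr ss g' n' tr' ss' g'' h h'
    exact h.trans h'
  · rintro ⟨c₁, slot₁, j⟩ s' ⟨iM, iR, iv, iu, i50, ij, ib⟩ hc
    simp only at iM iR iv iu i50 ij ib
    simp only [eval_sub, eval_V, iR.k, i50] at hc
    have hkN := iv.length_le h2 hΔS
    have hj : j < c₁.buckets.length := by omega
    obtain ⟨b, hb⟩ : ∃ b, c₁.buckets[j]? = some b := ⟨_, List.getElem?_eq_getElem hj⟩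
    have hsz := iM.size j b hb
    refine runsV_seq_left ?_
    rw [runs_load]
    refine ⟨b.card, by simp [iR.K, i50, hsz], ?_⟩
    simp only [eval_L, eval_add, eval_mul, eval_V, eval_ofNat, eval_one, iR.K, i50]
    have hm0 : 0 < m := by omega
    have h1 : ∀ x, IOB m B [x] 1 := fun x => by simpa using IOB.of_length (B := B) hm0 [x]
    have iR' : ConfRegs S Δ K c₁ (s'.setReg 51 b.card) := iR.congr fun r hr => by
      simp only [setReg_reg, if_neg (show r ≠ 51 by omega)]
    refine runsV_seq (runsV_ite ?_ ?_)
    · intro hc1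
      simp [iR.Δ] at hc1
      refine (runs_splitBucket hm hB hK hW iv hkN (by simpa using iM) iR' (by simp [i50]) hb
        (by omega)).mono ?_
      rintro n tr ss s₁ ⟨c₂, slot₂, hst, kM, kR, rfl, k50, kl, ku, ki, kj, kn, kt, kio⟩
      have kv := iv.step hst
      have hkN' := kv.length_le h2 hΔS
      refine (Runs.toRunsV (runs_assign.2 ⟨by simp [k50]; omega, ?_⟩) :
        RunsV W _ s₁ fun n tr ss s' => ss = [] ∧ (n = 0 ∧ tr = [] ∧ s' = s₁.setReg 50 (j + 1))).mono ?_
      · simp [k50]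
      rintro _ _ _ _ ⟨rfl, rfl, rfl, rfl⟩
      refine ⟨(c₂, slot₂, j + 1), ⟨by simpa using kM, kR.congr fun r hr => by
        simp only [setReg_reg, if_neg (show r ≠ 50 by omega)], kv, ku.trans iu, by simp,
        by simp only; omega, ?_⟩, by simp only; omega, ?_⟩
      · intro i hi b' hb'
        simp only at hi hb'
        rcases Nat.lt_or_ge i j with h | h
        · exact ib i h b' (ki i h ▸ hb')
        · obtain rfl : i = j := by omega
          exact kj b' hb'
      · have hcap : (b.card : ℝ) ≤ 2 * Δ := by exact_mod_cast iv.upper b (List.mem_of_getElem? hb)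
        have hkΔ : (c₁.buckets.length : ℝ) ≤ Δ := by exact_mod_cast iv.length_le_cap h2 hΔS hN
        have hΔ2 : (2 : ℝ) ≤ Δ := by exact_mod_cast h2
        have hkl : (c₂.buckets.length : ℝ) = c₁.buckets.length + 1 := by rw [kl]; push_cast; ring
        refine ⟨⟨[c₂], ?_, ?_, rfl⟩, by simp only; omega, by simp only; omega, ?_, ?_, ?_⟩
        · simp only [List.append_nil, List.forall₂_cons, List.forall₂_nil_right_iff, and_true]
          exact kM.represents kR kv (by omega)
        · simpa using hst
        · have kn' : (n : ℝ) ≤ 1032 * b.card := by exact_mod_cast kn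
          simp only [Rate.cost, Rate.const, hkl]
          push_cast
          linarith
        · have kt' : (tr.length : ℝ) ≤ 6210 * b.card + 6 * c₁.buckets.length + 10 := by
            exact_mod_cast kt
          simp only [Rate.cost, Rate.const, hkl, List.length_append, List.length_cons,
            List.length_nil]
          push_cast
          linarith
        · rw [List.append_nil]
          refine ((h1 _).append kio).mono ?_
          have hq : (b.card / B : ℝ) ≤ 2 * (Δ / B) := by
            rw [← mul_div_assoc]
            gcongr
          simp only [Rate.cost, passLoads, splitLoads, hkl]
          push_cast
          linarith
    · intro hc1
      simp [iR.Δ] at hc1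
      refine (Runs.toRunsV (runs_assign.2 ⟨by simp; omega, ?_⟩) :
        RunsV W _ _ fun n tr ss s₁ => ss = [] ∧ (n = 0 ∧ tr = [] ∧
          s₁ = (s'.setReg 51 b.card).setReg 29 0)).mono ?_
      · simp
      rintro _ _ _ s₁ ⟨rfl, rfl, rfl, rfl⟩
      refine (Runs.toRunsV (runs_assign.2 ⟨by simp [i50]; omega, ?_⟩) :
        RunsV W _ _ fun n tr ss s₂ => ss = [] ∧ (n = 0 ∧ tr = [] ∧
          s₂ = ((s'.setReg 51 b.card).setReg 29 0).setReg 50 (j + 1))).mono ?_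
      · simp [i50]
      rintro _ _ _ s₁ ⟨rfl, rfl, rfl, rfl⟩
      refine ⟨(c₁, slot₁, j + 1), ⟨by simpa using iM, iR.congr fun r hr => by
        simp only [setReg_reg, if_neg (show r ≠ 50 by omega), if_neg (show r ≠ 51 by omega),
          if_neg (show r ≠ 29 by omega)], iv, iu, by simp,
        by simp only; omega, ?_⟩, by simp only; omega, ?_⟩
      · intro i hi b' hb'
        simp only at hi hb'
        rcases Nat.lt_or_ge i j with h | h
        · exact ib i h b' hb'
        · obtain rfl : i = j := by omega
          rw [hb, Option.some.injEq] at hb'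
          subst hb'
          omega
      · refine ⟨⟨[], .nil, by simp, rfl⟩, le_rfl, by simp only; omega, ?_, ?_, ?_⟩
        · simp [Rate.cost, Rate.const]
        · simp [Rate.cost, Rate.const]
        · refine (h1 _).mono ?_
          simp [Rate.cost, passLoads]
  · intro r hr
    simp only [setReg_reg, if_neg (show r ≠ 50 by omega)]
  · rintro n tr ss s' ⟨⟨c₁, slot₁, j⟩, ⟨iM, iR, iv, iu, i50, ij, ib⟩, hc, hp⟩
    simp only at iM iR iv iu i50 ij ib hp
    simp only [eval_sub, eval_V, iR.k, i50] at hc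
    obtain rfl : j = c₁.buckets.length := by omega
    refine ⟨c₁, slot₁, iM, iR, iv, iu, ?_, ?_⟩
    · intro b hb
      obtain ⟨i, hi⟩ := List.mem_iff_getElem?.1 hb
      exact ib i (List.getElem?_eq_some_iff.1 hi).1 b hi
    · simpa using hp

/-! ### Distributing a batch -/

theorem length_preorder_le (hh : 1 ≤ h) : (preorder (2 ^ (h - 1)) (2 ^ h)).length ≤ 2 ^ h := by
  have hpow : 2 ^ h + 2 * 2 ^ (h - 1) ≤ 2 ^ (h + 1) := by
    rw [← pow_succ', Nat.sub_add_cancel hh, pow_succ]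
    omega
  have hnd : (preorder (2 ^ (h - 1)) (2 ^ h)).Nodup :=
    (pairwise_preorder (h := h) le_rfl hpow).imp (by
      rintro v _ hv rfl
      exact hv (Anc.refl _))
  rw [← List.toFinset_card_of_nodup hnd]
  refine le_of_le_of_eq (Finset.card_le_card (t := Finset.range (2 ^ h)) ?_) (Finset.card_range _)
  intro v hv
  rw [List.mem_toFinset] at hv
  exact Finset.mem_range.2 (mem_preorder le_rfl hpow hv).2

/-- The loads for distributing a batch. -/
def BatchLoads (a m B : ℕ) (D θ : ℝ) : Prop :=
  ∀ (T : BufTree) (n : ℕ) (tr : List ℕ) (len len' : ℕ → ℕ), 1 ≤ T.h → T.sz = bufSize a →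
    (∀ u, (T.aux u).length ≤ 2) → (∀ u, u ≠ 1 → len u = 0) →
    DSteps T (preorder (2 ^ (T.h - 1)) (2 ^ T.h)) len n tr len' →
    IOB m B tr (D * (len 1 / B * (1 + T.h * θ) + 2 ^ T.h + 2 ^ (a * T.h) / B))

/-- All elements are in the buffer of the root. -/
def rootLen (n : ℕ) : ℕ → ℕ := fun u => if u = 1 then n else 0

theorem rootLen_flushInv (hh : 1 ≤ T.h) (hsz : ∀ i, 0 < T.sz i) (n : ℕ) :
    ∀ v ∈ (preorder (2 ^ (T.h - 1)) (2 ^ T.h)).head?, FlushInv T v ⟨v, rootLen n⟩ := by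
  intro v hv
  rw [head?_preorder, if_neg (by omega), Option.mem_def, Option.some.injEq] at hv
  subst hv
  refine .of_not_full le_rfl (Nat.one_lt_two_pow (by omega)) ?_ (by simp)
  intro u _ _
  by_cases hu : u = 1
  · exact Or.inl hu
  · right
    simpa [rootLen, hu] using hsz _

/-- Initially all `q` elements are at the root, each with `h` moves to go; the additional `2 ^ h`
accesses are the final reads of empty counts, one for each flush. -/
theorem batch_cost (hh : 1 ≤ T.h) (hsz : ∀ i, 0 < T.sz i)
    (hs : DSteps T (preorder (2 ^ (T.h - 1)) (2 ^ T.h)) (rootLen q) n tr len') :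
    n ≤ q * T.h ∧ tr.length ≤ 10 * (q * T.h) + 2 ^ T.h ∧ ∀ u, 1 ≤ u → u < 2 ^ T.h → len' u = 0 := by
  have hpow : 2 ^ T.h + 2 * 2 ^ (T.h - 1) ≤ 2 ^ (T.h + 1) := by
    rw [← pow_succ', Nat.sub_add_cancel hh, pow_succ]
    omega
  have hvs : ∀ v ∈ preorder (2 ^ (T.h - 1)) (2 ^ T.h), 1 ≤ v ∧ v < 2 ^ T.h :=
    fun v hv => mem_preorder le_rfl hpow hv
  have hI := rootLen_flushInv hh hsz q
  obtain ⟨h1, h2⟩ := hs.cost hsz hvs hI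
  have hw : workLeft T.h (rootLen q) = q * T.h := by
    unfold workLeft
    rw [Finset.sum_eq_single 1]
    · simp [rootLen, ht]
    · intro v _ hv
      simp [rootLen, hv]
    · intro h
      exact absurd (Finset.mem_range.2 (Nat.one_lt_two_pow (by omega))) h
  have hl := length_preorder_le hh
  refine ⟨by omega, by omega, fun u hu1 hu2 => ?_⟩
  exact (hs.zero hsz hvs hI).2 (pairwise_preorder (h := T.h) le_rfl hpow) u
    (mem_preorder_of_internal hu1 hu2)

/-- The batch that is distributed next. -/
def nextBatch (S : List α) (Δ K : ℕ) (c : Config α) (slot : ℕ → ℕ) (h a : ℕ) (x₀ : α)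
    (m : ℕ → Cell α) : Batch α :=
  ⟨c.buckets.length, K, c.used, h, a, fun i => c.pivots.getD i x₀, slot,
    fun i => (c.buckets.getD i 0).card, ((S.drop c.used).take Δ : List α), m⟩

/-! ### The next batch of the input as an instance of the abstract distribution -/

section NextBatch
variable {S : List α} {Δ K : ℕ} {c : Config α} {slot : ℕ → ℕ} {h a : ℕ} {x₀ : α}
  {m : ℕ → Cell α}

local notation "bb" => nextBatch S Δ K c slot h a x₀ m

theorem card_nextBatch : (bb).items.card = min Δ (S.length - c.used) := by
  simp [nextBatch]

theorem nextBatch_ok (hK : K = 4 * S.length + 8) (h2 : 2 ≤ Δ) (hΔS : Δ ≤ S.length)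
    (hv : Valid S Δ c) (hM : ConfMem S K c slot m) (hk : c.buckets.length ≤ 2 ^ h)
    (hk' : 2 ^ h ≤ 2 * c.buckets.length) (ha : 2 ≤ a) : (bb).Ok where
  k_le := hk
  le_k := hk'
  K_gt := by
    have := hv.length_le h2 hΔS
    change 4 * c.buckets.length + 4 ≤ K
    omega
  a_ge := ha
  slot_inj := hM.inj
  used_lt := by
    rw [card_nextBatch]
    have := hv.used_le
    change c.used + _ + 4 ≤ K
    omega
  size_lt := by
    intro i hi
    rw [card_nextBatch]
    have h1 : (c.buckets.getD i 0).card ≤ S.length := by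
      rw [List.getD_eq_getElem _ _ hi]
      exact hv.card_le (List.getElem_mem hi)
    change (c.buckets.getD i 0).card + _ + 4 ≤ K
    omega
  pivot := by
    intro i hi
    have h1 := hv.length
    have h3 : i < c.pivots.length := by
      change i + 1 < c.buckets.length at hi
      omega
    refine hM.pivots i _ ?_
    change _ = some (c.pivots.getD i x₀)
    rw [List.getD_eq_getElem _ _ h3, List.getElem?_eq_getElem h3]
  start := hM.start

/-- Writing the batch size into the count of the root is all that is needed to fill its buffer, as
the batch already lies there in the input array. -/
theorem nextBatch_mem (hv : Valid S Δ c) (hM : ConfMem S K c slot m) (hh : 1 ≤ h)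
    (hk' : c.buckets.length ≤ 2 ^ h) (hKh : 2 * 2 ^ h ≤ K)
    {m' : ℕ → Cell α} (hm' : m' = fun x => if x = loc K 5 1 then .word (bb).items.card else m x)
    (hK : S.length + 1 < K) : (bb).Mem (rootLen (bb).items.card)
      (fun _ i => (S.drop c.used).getD i x₀) m' := by
  have hroot : 1 < 2 ^ h := Nat.one_lt_two_pow (by omega)
  have hkb : (bb).k = c.buckets.length := rfl
  have hhb : (bb).h = h := rfl
  have hcard : (bb).items.card = min Δ (S.length - c.used) := card_nextBatch
  have hget : ∀ i, i < (bb).items.card → (S.drop c.used)[i]? = some ((S.drop c.used).getD i x₀) := by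
    intro i hi
    have h1 : i < (S.drop c.used).length := by rw [List.length_drop]; omega
    rw [List.getD_eq_getElem _ _ h1, List.getElem?_eq_getElem h1]
  refine ⟨?_, ?_, ?_, ?_, ?_, ?_⟩
  · intro v hv1 hv2
    rw [hhb, hkb] at hv2
    rw [hm']
    by_cases c1 : v < 2 ^ h
    · simp only [Batch.cnt, Batch.base, hhb, rootLen, c1, if_true, zero_add]
      change (if loc K 5 v = loc K 5 1 then _ else m (loc K 5 v)) = _
      simp only [loc_eq_iff (show v < K by omega) (show 1 < K by omega), true_and]
      by_cases c2 : v = 1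
      · simp [c2]
      · simpa [c2] using hM.idle v (by omega)
    · have hlt : v - 2 ^ h < c.buckets.length := by omega
      have hv1' : v ≠ 1 := by omega
      have h3 := hM.size (v - 2 ^ h) _ (List.getElem?_eq_getElem hlt)
      simp only [Batch.cnt, Batch.base, hhb, rootLen, c1, hv1', if_false, add_zero]
      change (if loc K 3 (2 * (v - 2 ^ h) + 1) = loc K 5 1 then _
        else m (loc K 3 (2 * (v - 2 ^ h) + 1))) = Cell.word ((c.buckets.getD (v - 2 ^ h) 0).card)
      rw [if_neg, h3, List.getD_eq_getElem _ _ hlt]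
      unfold loc
      omega
  · intro v hv1 hv2 i hi
    have hv1' : v = 1 := by
      by_contra h1
      simp [rootLen, h1] at hi
    subst hv1'
    simp only [rootLen, if_true] at hi
    have e : (bb).tree.st 1 + i = c.used + i := by
      rw [Batch.st_add]
      simp only [Batch.region, Batch.off, hhb, hroot, if_true]
      change loc K (2 * (1 - 1)) (c.used + i) = _
      simp [loc]
    rw [e, hm']
    have hne : c.used + i ≠ loc K 5 1 := by
      unfold loc
      omega
    simp only [hne, if_false]
    refine hM.input _ _ ?_
    rw [← hget i hi, List.getElem?_drop]
  · intro x hx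
    rw [hm']
    have h1 := (hx 1 le_rfl (by rw [hhb]; omega)).1
    simp only [Batch.cnt, hhb, hroot, if_true] at h1
    change x ≠ loc K 5 1 at h1
    simp only [h1, if_false]
    rfl
  · rw [Finset.sum_eq_single 1]
    · simp only [rootLen, if_true]
      change _ = (((S.drop c.used).take Δ : List α) : Multiset α)
      rw [← Multiset.coe_range, Multiset.map_coe, Multiset.coe_eq_coe]
      refine List.Perm.of_eq (List.ext_getElem? fun i => ?_)
      rw [List.getElem?_map, List.getElem?_take]
      by_cases hi : i < (bb).items.card
      · rw [List.getElem?_range hi, if_pos (by omega), hget i hi]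
        rfl
      · rw [List.getElem?_eq_none (by rw [List.length_range]; omega)]
        split_ifs
        · rw [List.getElem?_eq_none (by rw [List.length_drop]; omega)]
          rfl
        · rfl
    · intro v _ hv
      simp [rootLen, hv]
    · intro h1
      exact absurd (Finset.mem_range.2 (by rw [hhb, pow_succ]; omega)) h1
  · intro v i hi
    have hv1' : v = 1 := by
      by_contra h1
      simp [rootLen, h1] at hi
    subst hv1'
    have hpos := hv.length_pos
    have e : ht h 1 = h := by simp [ht]
    refine ⟨?_, ?_, ?_⟩
    · rw [hhb, e]
      omega
    · intro i' _ h2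
      rw [hhb, e] at h2
      omega
    · intro i' h1 h2
      rw [hhb, e] at h2
      omega
  · intro v hv1
    rw [hhb] at hv1
    have : v ≠ 1 := by omega
    simp [rootLen, this]

/-- The elements of the batch that bucket `i` gets. -/
def batchPart (h : ℕ) (len : ℕ → ℕ) (val : ℕ → ℕ → α) (i : ℕ) : Multiset α :=
  (Multiset.range (len (2 ^ h + i))).map (val (2 ^ h + i))

/-- At a leaf, which has height `0`, `InB` says that the element lies between the two pivots next to
its bucket. -/
theorem nextBatch_between {m' : ℕ → Cell α} (hv : Valid S Δ c) (hmem : (bb).Mem len val m') :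
    Between c.pivots ((List.range c.buckets.length).map (batchPart h len val)) := by
  intro i b hb x hx
  have hlen := hv.length
  rw [List.getElem?_map] at hb
  obtain ⟨i', hi', rfl⟩ := Option.map_eq_some_iff.1 hb
  rw [List.getElem?_eq_some_iff] at hi'
  obtain ⟨hi, rfl⟩ := hi'
  rw [List.length_range] at hi
  rw [List.getElem_range] at hx
  obtain ⟨e, he, rfl⟩ := Multiset.mem_map.1 hx
  have h1 := hmem.inb (2 ^ h + i) e (Multiset.mem_range.1 he)
  have hht : ht (bb).h (2 ^ h + i) = 0 := ht_leaf (Nat.le_add_right _ _)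
  obtain ⟨-, h2, h3⟩ := h1
  rw [hht, pow_zero, mul_one] at h2 h3
  change ∀ i', i' + 1 < c.buckets.length → i' + 1 + 2 ^ h = _ → c.pivots.getD i' x₀ ≤ _ at h2
  change ∀ i', i' + 1 < c.buckets.length → i' + 1 + 2 ^ h = _ → _ ≤ c.pivots.getD i' x₀ at h3
  have hget : ∀ {y p}, c.pivots[y]? = some p → y + 1 < c.buckets.length ∧ c.pivots.getD y x₀ = p := by
    intro y p hp
    have := (List.getElem?_eq_some_iff.1 hp).1
    exact ⟨by omega, by rw [List.getD, hp]; rfl⟩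
  refine ⟨?_, ?_⟩
  · intro p hp
    obtain ⟨h4, h5⟩ := hget hp
    rw [← h5]
    exact h3 i h4 (by omega)
  · intro y p hy hp
    obtain ⟨h4, h5⟩ := hget hp
    rw [← h5]
    exact h2 y h4 (by omega)

/-- The internal nodes and the leaves without a bucket are empty, so the parts of the buckets are
the whole batch. -/
theorem nextBatch_sum {m' : ℕ → Cell α} (hmem : (bb).Mem len val m') (hk : c.buckets.length ≤ 2 ^ h)
    (hzero : ∀ u, 1 ≤ u → u < 2 ^ h → len u = 0) :
    ((List.range c.buckets.length).map (batchPart h len val)).sum =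
      (((S.drop c.used).take Δ : List α) : Multiset α) := by
  have h1 := hmem.total
  change _ = (((S.drop c.used).take Δ : List α) : Multiset α) at h1
  rw [← h1]
  change _ = ∑ v ∈ Finset.range (2 ^ (h + 1)), _
  rw [pow_succ, mul_two, Finset.sum_range_add, Finset.sum_eq_zero, zero_add]
  · obtain ⟨e, he⟩ : ∃ e, 2 ^ h = c.buckets.length + e := ⟨2 ^ h - c.buckets.length, by omega⟩
    conv_rhs => rw [he]
    rw [Finset.sum_range_add, ← he, Finset.sum_eq_zero (s := Finset.range e), add_zero,
      Finset.sum, Finset.range_val, ← Multiset.coe_range, Multiset.map_coe, Multiset.sum_coe]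
    · rfl
    · intro x hx
      rw [hmem.zero _ (Or.inr _)]
      · rfl
      · change 2 ^ h + c.buckets.length ≤ _
        omega
  · intro v hv
    rcases Nat.eq_zero_or_pos v with rfl | hpos
    · rw [hmem.zero 0 (Or.inl (by omega))]
      rfl
    · rw [hzero v hpos (Finset.mem_range.1 hv)]
      rfl

theorem nextBatch_conf {m' : ℕ → Cell α} (hb : (bb).Ok) (hv : Valid S Δ c)
    (hM : ConfMem S K c slot m) (hmem : (bb).Mem len val m') (hK : K = 4 * S.length + 8)
    (hzero : ∀ u, 1 ≤ u → u < 2 ^ h → len u = 0) :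
    ConfMem S K ⟨c.pivots, List.zipWith (· + ·) c.buckets
      ((List.range c.buckets.length).map (batchPart h len val)), t⟩ slot m' := by
  have hl : (List.zipWith (· + ·) c.buckets
      ((List.range c.buckets.length).map (batchPart h len val))).length = c.buckets.length := by
    simp
  have hkeep : ∀ {r x}, x < K → (r = 0 ∨ r = 1 ∨ (r = 3 ∧ x % 2 = 0) ∨ r = 7 ∨ r = 9) →
      m' (loc K r x) = m (loc K r x) :=
    fun hx hr => hmem.keep _ (Batch.keep_of_region hb hx hr)
  have hget : ∀ {i b}, (List.zipWith (· + ·) c.buckets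
      ((List.range c.buckets.length).map (batchPart h len val)))[i]? = some b →
      ∃ b₀, c.buckets[i]? = some b₀ ∧ b = b₀ + batchPart h len val i ∧
        (c.buckets.getD i 0).card = b₀.card := by
    intro i b hb
    rw [List.getElem?_zipWith_eq_some] at hb
    obtain ⟨b₀, b₁, h1, h2, h3⟩ := hb
    rw [List.getElem?_map] at h2
    obtain ⟨i', hi', rfl⟩ := Option.map_eq_some_iff.1 h2
    obtain ⟨_, rfl⟩ := List.getElem?_eq_some_iff.1 hi'
    rw [List.getElem_range] at h3
    exact ⟨b₀, h1, h3.symm, by rw [List.getD, h1]; rfl⟩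
  have hcard : ∀ i, (batchPart h len val i).card = len (2 ^ h + i) := by
    intro i
    simp [batchPart]
  have hcnt : ∀ {i}, i < c.buckets.length →
      m' (loc K 3 (2 * i + 1)) = .word ((c.buckets.getD i 0).card + len (2 ^ h + i)) := by
    intro i hi
    have h1 := hmem.cnt (2 ^ h + i) (by have := Nat.two_pow_pos h; omega) (by
      change _ < 2 ^ h + c.buckets.length
      omega)
    have hn : ¬ 2 ^ h + i < 2 ^ h := by omega
    simp only [Batch.cnt, Batch.base] at h1
    change m' (if 2 ^ h + i < 2 ^ h then _ else loc K 3 (2 * (2 ^ h + i - 2 ^ h) + 1)) =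
      .word ((if 2 ^ h + i < 2 ^ h then 0 else (c.buckets.getD (2 ^ h + i - 2 ^ h) 0).card) + _) at h1
    simpa [hn, Nat.add_sub_cancel_left] using h1
  refine ⟨?_, ?_, ?_, ?_, ?_, ?_, ?_, ?_⟩
  · intro i p hp
    have h1 := (List.getElem?_eq_some_iff.1 hp).1
    have h2 := hv.card_total
    have h3 := hv.used_le
    simp only at h1
    rw [hkeep (by omega) (by omega)]
    exact hM.pivots i p hp
  · simpa [hl] using hM.inj
  · simpa [hl] using hM.slot_lt
  · intro i hi
    rw [hl] at hi
    have := hb.K_gt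
    change 4 * c.buckets.length + 4 ≤ K at this
    rw [hkeep (by omega) (by omega)]
    exact hM.start i hi
  · intro i b hb'
    obtain ⟨b₀, h1, rfl, h3⟩ := hget hb'
    rw [hcnt (List.getElem?_eq_some_iff.1 h1).1, h3, Multiset.card_add, hcard]
  · intro i b hb'
    obtain ⟨b₀, h1, rfl, h3⟩ := hget hb'
    have hi := (List.getElem?_eq_some_iff.1 h1).1
    rw [Multiset.card_add, hcard, Multiset.range_add, Multiset.map_add, Multiset.map_map,
      Multiset.map_add, ← hM.items i b₀ h1]
    congr 1
    · refine Multiset.map_congr rfl fun x hx => ?_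
      rw [Multiset.mem_range, ← h3] at hx
      exact hmem.keep _ (Batch.keep_of_size hb hi hx)
    · rw [batchPart, Multiset.map_map]
      refine Multiset.map_congr rfl fun x hx => ?_
      rw [Multiset.mem_range] at hx
      have h4 := hmem.buf (2 ^ h + i) (by have := Nat.two_pow_pos h; omega) (by
        change _ < 2 ^ h + c.buckets.length
        omega) x hx
      rw [Batch.st_add] at h4
      have hn : ¬ 2 ^ h + i < 2 ^ h := by omega
      simp only [Batch.region, Batch.off] at h4
      change m' (loc K (if 2 ^ h + i < 2 ^ h then _ else 11 + 2 * slot (2 ^ h + i - 2 ^ h))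
        ((if 2 ^ h + i < 2 ^ h then _ else (c.buckets.getD (2 ^ h + i - 2 ^ h) 0).card) + x)) = _ at h4
      rw [if_neg hn, if_neg hn, Nat.add_sub_cancel_left, h3] at h4
      exact h4
  · intro i x hx
    have h1 := (List.getElem?_eq_some_iff.1 hx).1
    have h2 : loc K 0 i = i := by simp [loc]
    have h3 := hkeep (r := 0) (x := i) (by omega) (by omega)
    rw [h2] at h3
    rw [h3]
    exact hM.input i x hx
  · intro x hx
    by_cases hx1 : 1 ≤ x ∧ x < 2 ^ h
    · have h1 := hmem.cnt x hx1.1 (by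
        change _ < 2 ^ h + c.buckets.length
        omega)
      simp only [Batch.cnt, Batch.base] at h1
      change m' (if x < 2 ^ h then loc K 5 x else _) =
        .word ((if x < 2 ^ h then 0 else _) + _) at h1
      rw [if_pos hx1.2, if_pos hx1.2, hzero x hx1.1 hx1.2] at h1
      exact h1
    · rw [hmem.keep]
      · exact hM.idle x hx
      · intro v hv1 hv2
        have hoff := hb.off_lt hv2
        have := hb.K_gt
        have := hb.le_k
        refine ⟨?_, fun _ i hi => ?_⟩
        · change 2 ^ h ≤ 2 * c.buckets.length at this
          change v < 2 ^ h + c.buckets.length at hv2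
          change loc K 5 x ≠ if v < 2 ^ h then loc K 5 v else loc K 3 (2 * (v - 2 ^ h) + 1)
          change 4 * c.buckets.length + 4 ≤ K at *
          split_ifs with h5
          · exact loc_ne hx
          · exact loc_ne hx
        · rw [Batch.st_add]
          change _ + _ + 4 ≤ K at hoff
          refine loc_ne hx (by omega) (Or.inl ?_)
          unfold Batch.region
          split_ifs
          · omega
          · omega

end NextBatch

/-! ### The program -/

/-- Register `7` becomes a power of two that is at least the number of buckets. It starts at `2`, so
that the tree has height at least `1` and its root is internal. Register `9` is the minimum of `Δ`
and the number of remaining elements. -/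
def distribute (a : ℕ) : Cmd :=
  .assign 7 2 ;; .loop (V 2 - V 7) (.assign 7 (2 * V 7)) ;;
  .assign 9 (V 1 - (V 1 - (V 0 - V 5))) ;;
  .store (L 5 1) (V 9) ;;
  .assign 10 (V 7) ;; flushAll a ;;
  .assign 5 (V 5 + V 9)

/-- The words of the machine are large enough for arrays of `N` elements. -/
structure WordSize (a N K W : ℕ) : Prop where
  addr : (2 * K + 20) * K + 300 ≤ W
  buf : ∀ h, 2 ^ h ≤ 2 * N → (∀ x ≤ h, 1 ≤ x → 2 * a * bufSize a x < W) ∧ 4 * a * h + 2 < W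

theorem runs_distribute {D : ℝ} (hm : 8 ≤ m) (hK : K = 4 * S.length + 8)
    (hW : WordSize a S.length K W) (ha : 2 ≤ a) (h2 : 2 ≤ Δ) (hΔS : Δ ≤ S.length) (hD : 0 ≤ D)
    (hθ : 0 ≤ θ) (hio : BatchLoads a m B D θ) (hv : Valid S Δ c) (hM : ConfMem S K c slot s.mem)
    (hR : ConfRegs S Δ K c s) (hused : c.used < S.length) (hfit : ∀ b ∈ c.buckets, b.card ≤ Δ) :
    RunsV W (distribute a) s fun n tr ss s' => ∃ c' h, Step S Δ c c' ∧
      ConfMem S K c' slot s'.mem ∧ ConfRegs S Δ K c' s' ∧ ss = [s'] ∧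
      c'.buckets.length = c.buckets.length ∧ c'.used = min (c.used + Δ) S.length ∧
      2 ^ h ≤ 2 * c.buckets.length ∧ n ≤ Δ * h ∧ (c.buckets.length = 1 → n = 0) ∧
      tr.length ≤ 10 * (Δ * h) + 2 ^ h + 1 ∧
      IOB m B tr (1 + D * (Δ / B * (1 + h * θ) + 2 ^ h + 2 ^ (a * h) / B)) := by
  have hWK : 2 * K + 300 ≤ W := by
    have h1 := hW.addr
    have h3 : 2 * K ≤ (2 * K + 20) * K := by
      have : 2 * K * 1 ≤ (2 * K + 20) * K := Nat.mul_le_mul (by omega) (by omega)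
      omega
    omega
  have hkN := hv.length_le h2 hΔS
  have hk1 := hv.length_pos
  set k := c.buckets.length with hk
  obtain ⟨x₀⟩ : Nonempty α := by
    cases S with
    | nil => simp at hused
    | cons x _ => exact ⟨x⟩
  refine runsV_seq_left ?_
  rw [runs_assign]
  refine ⟨by simp; omega, runsV_seq_left ?_⟩
  refine (runs_loop_pure (G := ℕ)
    (fun e s' => s'.mem = s.mem ∧ s'.reg 7 = 2 ^ e ∧ 1 ≤ e ∧ 2 ^ e ≤ 2 * k ∧
      ∀ r, r ≠ 7 → s'.reg r = s.reg r) (fun e => k - 2 ^ e) ?_ 1 _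
      ⟨by simp, by simp, le_rfl, by omega, fun r hr => by simp [hr]⟩).mono ?_
  · rintro e s' ⟨i1, i2, i3, i4, i5⟩ hc
    have q2 : s'.reg 2 = k := by rw [i5 2 (by norm_num), hR.k, hk]
    simp only [eval_sub, eval_V, q2, i2] at hc
    rw [runs_assign]
    refine ⟨by simp [i2]; omega, rfl, rfl, e + 1, ⟨by simp [i1], by simp [i2, pow_succ'], by omega,
      by rw [pow_succ]; omega, fun r hr => by simp [hr, i5 r hr]⟩, ?_⟩
    have := Nat.two_pow_pos e
    simp only [pow_succ]
    omega
  rintro _ _ s₁ ⟨rfl, rfl, h, ⟨i1, i2, i3, i4, i5⟩, hc⟩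
  have q : ∀ r, r < 7 → s₁.reg r = s.reg r := fun r hr => i5 r (by omega)
  have q0 : s₁.reg 0 = S.length := by simp [q, hR.N]
  have q1 : s₁.reg 1 = Δ := by simp [q, hR.Δ]
  have q2 : s₁.reg 2 = k := by rw [q 2 (by norm_num), hR.k, hk]
  have q5 : s₁.reg 5 = c.used := by simp [q, hR.used]
  have q6 : s₁.reg 6 = K := by simp [q, hR.K]
  simp only [eval_sub, eval_V, q2, i2] at hc
  have hkh : k ≤ 2 ^ h := by omega
  set b := nextBatch S Δ K c slot h a x₀ s.mem with hbdef
  have hcard : b.items.card = min Δ (S.length - c.used) := card_nextBatch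
  have hcard' : Δ - (Δ - (S.length - c.used)) = b.items.card := by omega
  have hb : b.Ok := nextBatch_ok hK h2 hΔS hv hM (hk ▸ hkh) (hk ▸ i4) ha
  have hbk : b.k = k := hk.symm
  have hbh : b.h = h := rfl
  have hbK : b.K = K := rfl
  have hbt : b.tree.h = h := rfl
  have hsz : b.tree.sz = bufSize a := rfl
  refine runsV_seq_left ?_
  rw [runs_assign]
  refine ⟨by simp [q0, q1, q5]; omega, runsV_seq_left ?_⟩
  rw [runs_store]
  refine ⟨by simp [q0, q1, q5]; omega, runsV_seq_left ?_⟩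
  rw [runs_assign]
  refine ⟨by simp [i2]; omega, runsV_seq_left ?_⟩
  simp only [eval_L, eval_sub, eval_V, eval_ofNat, eval_one, setReg_reg, setMem_reg, q0, q1, q5, q6,
    i2, hcard', Nat.reduceEqDiff, if_true, if_false]
  have hfits : b.Fits W := by
    have := hW.buf h (by omega)
    refine ⟨?_, this.1, this.2⟩
    rw [hbK]
    omega
  have hpow2 : 2 ^ h + 2 * 2 ^ (h - 1) = 2 ^ (h + 1) := by
    rw [← pow_succ', Nat.sub_add_cancel i3, pow_succ]
    omega
  have hinv := rootLen_flushInv (T := b.tree) i3 (fun i => bufSize_pos a i) b.items.card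
  refine (Batch.runs_flushAll hb hfits (2 ^ (h - 1)) (2 ^ h) (len := rootLen b.items.card)
    (val := fun _ i => (S.drop c.used).getD i x₀) le_rfl
    (Nat.even_pow.2 ⟨even_two, by omega⟩) hpow2 ?_ ⟨?_, ?_, ?_, ?_⟩ ?_ hinv).mono ?_
  · refine nextBatch_mem hv hM i3 (hk ▸ hkh) (by omega) ?_ (by omega)
    funext x
    simp only [setReg_mem, setMem_mem, i1]
    rfl
  · simpa [hbk] using q2
  · simpa using q5.trans (show c.used = b.used from rfl)
  · simpa [hbK] using q6
  · simpa [hbh] using i2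
  · simp
  rintro n tr s₂ ⟨len', val', hds, hk0, hmem, hrg⟩
  have hds' : DSteps b.tree (preorder (2 ^ (b.tree.h - 1)) (2 ^ b.tree.h)) (rootLen b.items.card) n tr
    len' := hds
  obtain ⟨c1, c2, hzero⟩ := batch_cost (T := b.tree) i3 (fun i => bufSize_pos a i) hds'
  rw [hbt] at c1 c2 hzero
  have hio' := hio b.tree n tr (rootLen b.items.card) len' i3 hsz (fun u => by
    simp only [Batch.tree]
    split_ifs <;> simp) (fun u hu => by simp [rootLen, hu]) hds'
  have p5 : s₂.reg 5 = c.used := by simp [hrg, q5]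
  have p9 : s₂.reg 9 = b.items.card := by simp [hrg]
  have hΔc : b.items.card ≤ Δ := by omega
  refine runsV_assign (by simp [p5, p9]; omega) ?_
  simp only [eval_add, eval_V, p5, p9]
  have hst : Step S Δ c _ := Step.distribute c
    ((List.range c.buckets.length).map (batchPart h len' val')) hused hfit (by simp)
    (nextBatch_sum hmem (hk ▸ hkh) hzero) (nextBatch_between hv hmem)
  have hch : b.items.card * h ≤ Δ * h := Nat.mul_le_mul_right h hΔc
  refine ⟨_, h, hst, ?_, ?_, trivial, by simp [hk], rfl, i4, by omega, ?_, ?_, ?_⟩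
  · exact nextBatch_conf hb hv hM hmem hK hzero
  · have hrr : ∀ r, r < 7 → s₂.reg r = s.reg r := by
      intro r hr
      rw [hrg r (by omega)]
      simp only [setReg_reg, setMem_reg, if_neg (show r ≠ 10 by omega), if_neg (show r ≠ 9 by omega)]
      exact q r hr
    refine ⟨?_, ?_, ?_, ?_, ?_, ?_, ?_⟩
    · simp [hrr, hR.N]
    · simp [hrr, hR.Δ]
    · simp [hrr, hR.k]
    · simp [hrr, hR.P]
    · simp [hrr, hR.T]
    · simp only [setReg_reg, if_true]
      omega
    · simp [hrr, hR.K]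
  · intro hk1'
    simpa using hk0 (hbk.trans hk1')
  · simp only [List.length_append, List.length_cons, List.length_nil]
    omega
  · simp only [List.nil_append, List.append_nil]
    have h1 : IOB m B [loc K 5 1] 1 := by
      simpa using IOB.of_length (B := B) (by omega : 0 < m) [loc K 5 1]
    refine (h1.append hio').mono ?_
    rw [hbt]
    simp only [rootLen, if_true]
    gcongr

/-- The rates of the main loop. -/
noncomputable def mainComps (Δ : ℕ) : Rate where
  u k := 2 * Δ * Nat.log 2 k
  w _ := 2064 * Δ
  mono_u := fun k k' h => by
    dsimp only
    gcongr
  mono_w := monotone_const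

noncomputable def mainLength (Δ : ℕ) : Rate where
  u k := 10 * Δ * (1 + Nat.log 2 k) + 3 * k + 1
  w _ := 12440 * Δ
  mono_u := fun k k' h => by
    dsimp only
    gcongr
  mono_w := monotone_const

noncomputable def mainLoads (Δ a B : ℕ) (D θ : ℝ) (hD : 0 ≤ D) (hθ : 0 ≤ θ) : Rate where
  u k := D * (Δ / B * (1 + (1 + Nat.log 2 k) * θ) + 2 * k + (2 * k) ^ a / B) + k + 1
  w := splitLoads Δ B
  mono_u := fun k k' h => by
    dsimp only
    gcongr
  mono_w := splitLoads_mono Δ B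

def mainLoop (a : ℕ) : Cmd := .loop (V 0 - V 5) (distribute a ;; splitPass)

/-- The cell for the size of the first bucket is `0` from the start, so only its address is stored.
The assignment to register `5` comes last because the state after it is marked as the initial
configuration. -/
def multiPartition (a : ℕ) : Cmd :=
  .assign 6 (4 * V 0 + 8) ;; .assign 2 1 ;; .assign 3 (V 6) ;; .assign 4 (3 * V 6) ;;
  .store (L 3 0) (L 11 0) ;; .assign 5 0 ;; mainLoop a

theorem runs_mainBody {D : ℝ} (hm : 8 ≤ m) (hB : 0 < B) (hK : K = 4 * S.length + 8)
    (hW : WordSize a S.length K W) (ha : 2 ≤ a) (h2 : 2 ≤ Δ) (hΔS : Δ ≤ S.length)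
    (hN : 2 * S.length ≤ Δ * Δ) (hD : 0 ≤ D) (hθ : 0 ≤ θ) (hio : BatchLoads a m B D θ)
    (hv : Valid S Δ c) (hM : ConfMem S K c slot s.mem) (hR : ConfRegs S Δ K c s)
    (hused : c.used < S.length) (hfit : ∀ b ∈ c.buckets, b.card ≤ Δ) :
    RunsV W (distribute a ;; splitPass) s fun n tr ss s' => ∃ c' slot',
      ConfMem S K c' slot' s'.mem ∧ ConfRegs S Δ K c' s' ∧ Valid S Δ c' ∧
      c'.used = min (c.used + Δ) S.length ∧ (∀ b ∈ c'.buckets, b.card ≤ Δ) ∧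
      Progress S Δ m B (mainComps Δ) (mainLength Δ) (mainLoads Δ a B D θ hD hθ) c t n tr ss c'
        (t + 1) := by
  refine runsV_seq ((runs_distribute hm hK hW ha h2 hΔS hD hθ hio hv hM hR hused hfit).mono ?_)
  rintro n tr ss s₁ ⟨c₁, h, hst, iM, iR, rfl, hk, hu, hh, hn, hn0, hl, hio₁⟩
  have hv₁ := hv.step hst
  refine (runs_splitPass hm hB hK hW.addr h2 hΔS hN hv₁ iM iR).mono ?_
  rintro n' tr' ss' s₂ ⟨c₂, slot₂, jM, jR, jv, ju, jf, jp⟩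
  refine ⟨c₂, slot₂, jM, jR, jv, ju.trans hu, jf, ?_⟩
  have hkk : c.buckets.length ≤ c₂.buckets.length := hk ▸ jp.le_k
  have hkR : (c.buckets.length : ℝ) ≤ c₂.buckets.length := by exact_mod_cast hkk
  have hk1 := hv.length_pos
  have hlog : h ≤ 1 + Nat.log 2 c.buckets.length := by
    have h3 : h ≤ Nat.log 2 (c.buckets.length * 2) :=
      Nat.le_log_of_pow_le (by norm_num) (by omega)
    rw [Nat.log_mul_base (by norm_num) (by omega)] at h3
    omega
  have hlog' := Nat.log_mono_right (b := 2) hkk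
  have hhR : (h : ℝ) ≤ 1 + Nat.log 2 c₂.buckets.length := by
    exact_mod_cast (by omega : h ≤ 1 + Nat.log 2 c₂.buckets.length)
  have hpR : (2 : ℝ) ^ h ≤ 2 * c₂.buckets.length := by
    have : (2 : ℝ) ^ h ≤ 2 * c.buckets.length := by exact_mod_cast hh
    linarith
  have ht1 : ((t + 1 : ℕ) : ℝ) - t = 1 := by push_cast; ring
  have hkl : (c₁.buckets.length : ℝ) = c.buckets.length := by rw [hk]
  refine ⟨run_append ⟨[c₁], ?_, by simpa using hst, rfl⟩ jp.run, hkk, by omega, ?_, ?_, ?_⟩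
  · simp only [List.forall₂_cons, List.forall₂_nil_right_iff, and_true]
    exact iM.represents iR hv₁ (by omega)
  · have h3 := jp.comps
    simp only [Rate.cost, Rate.const, mainComps, hkl, ht1] at h3 ⊢
    -- With one bucket nothing is compared. With at least two, the height `h ≤ 1 + log k` is at most
    -- twice the logarithm.
    have h4 : (n : ℝ) ≤ 2 * Δ * Nat.log 2 c₂.buckets.length := by
      by_cases hc : c.buckets.length = 1
      · rw [hn0 hc]
        push_cast
        positivity
      · have h5 : 1 ≤ Nat.log 2 c.buckets.length := Nat.log_pos (by norm_num) (by omega)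
        have h6 : Δ * h ≤ Δ * (2 * Nat.log 2 c₂.buckets.length) :=
          Nat.mul_le_mul_left _ (by omega)
        have h7 : n ≤ 2 * Δ * Nat.log 2 c₂.buckets.length := by
          calc n ≤ _ := hn.trans h6
            _ = _ := by ring
        exact_mod_cast h7
    push_cast at h3 ⊢
    linarith
  · have h3 := jp.length
    simp only [Rate.cost, Rate.const, mainLength, hkl, ht1] at h3 ⊢
    have h4 : (tr.length : ℝ) ≤ 10 * (Δ * h) + 2 ^ h + 1 := by exact_mod_cast hl
    have h5 : (Δ * h : ℝ) ≤ Δ * (1 + Nat.log 2 c₂.buckets.length) := by gcongr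
    rw [List.length_append]
    push_cast at h3 ⊢
    linarith
  · refine (hio₁.append jp.io).mono ?_
    simp only [Rate.cost, passLoads, mainLoads, hkl, ht1]
    have h5 : D * (Δ / B * (1 + h * θ) + 2 ^ h + 2 ^ (a * h) / B) ≤
        D * (Δ / B * (1 + (1 + Nat.log 2 c₂.buckets.length) * θ) + 2 * c₂.buckets.length +
          (2 * c₂.buckets.length) ^ a / B) := by
      rw [mul_comm a h, pow_mul]
      gcongr
    linarith

theorem runs_multiPartition {D : ℝ} (hm : 8 ≤ m) (hB : 0 < B) (hK : K = 4 * S.length + 8)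
    (hW : WordSize a S.length K W) (ha : 2 ≤ a) (h2 : 2 ≤ Δ) (hΔS : Δ ≤ S.length)
    (hN : 2 * S.length ≤ Δ * Δ) (hD : 0 ≤ D) (hθ : 0 ≤ θ) (hio : BatchLoads a m B D θ) :
    RunsV W (multiPartition a) (initState S Δ) fun n tr ss s' => ∃ cs c t, IsRun S Δ cs c ∧
      List.Forall₂ Represents ss cs ∧ Represents s' c ∧ t * Δ ≤ 2 * S.length ∧
      (n : ℝ) ≤ (mainComps Δ).cost 1 0 c.buckets.length t ∧
      (tr.length : ℝ) ≤ 1 + (mainLength Δ).cost 1 0 c.buckets.length t ∧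
      IOB m B tr (1 + (mainLoads Δ a B D θ hD hθ).cost 1 0 c.buckets.length t) := by
  have hWK : 11 * K + 300 ≤ W := by
    have h1 := hW.addr
    have h3 : 11 * K ≤ (2 * K + 20) * K := Nat.mul_le_mul_right K (by omega)
    omega
  have i0 : (initState S Δ).reg 0 = S.length := rfl
  have i1 : (initState S Δ).reg 1 = Δ := rfl
  have hin : ∀ x, S.length ≤ x → (initState S Δ).mem x = .word 0 := by
    intro x hx
    simp [initState, hx]
  refine runsV_seq_left ?_
  rw [runs_assign]
  refine ⟨by simp [i0]; omega, runsV_seq_left ?_⟩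
  rw [runs_assign]
  refine ⟨by simp; omega, runsV_seq_left ?_⟩
  rw [runs_assign]
  refine ⟨by simp [i0]; omega, runsV_seq_left ?_⟩
  rw [runs_assign]
  refine ⟨by simp [i0]; omega, runsV_seq_left ?_⟩
  rw [runs_store]
  refine ⟨by simp [i0, loc]; omega, runsV_seq ?_⟩
  refine runsV_assign (by simp; omega) ?_
  simp only [eval_L, eval_add, eval_mul, eval_V, eval_ofNat, eval_one, eval_zero, setReg_reg, i0,
    Nat.reduceEqDiff, if_true, if_false, ← hK, one_ne_zero, OfNat.ofNat_ne_zero]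
  generalize hs₀ : State.setReg _ 5 0 = s₀
  have hreg : ∀ r, s₀.reg r = if r = 5 then 0 else if r = 4 then 3 * K else if r = 3 then K else
      if r = 2 then 1 else if r = 6 then K else (initState S Δ).reg r := by
    intro r
    rw [← hs₀]
    simp
  have hmem : ∀ x, s₀.mem x = if x = loc K 3 0 then .word (loc K 11 0) else
      (initState S Δ).mem x := by
    intro x
    rw [← hs₀]
    simp
  have hM : ConfMem S K (Config.init α) (fun _ => 0) s₀.mem := by
    have hne : ∀ r x, x < K → (r ≠ 3 ∨ x ≠ 0) → s₀.mem (loc K r x) = (initState S Δ).mem (loc K r x) := by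
      intro r x hx hr
      rw [hmem, if_neg (loc_ne hx (by omega) hr)]
    refine ⟨?_, ?_, ?_, ?_, ?_, ?_, ?_, ?_⟩
    · intro i p hp
      simp [Config.init] at hp
    · intro i j hi hj _
      simp only [Config.init, List.length_cons, List.length_nil] at hi hj
      omega
    · intro i hi
      simp [Config.init]
    · intro i hi
      simp only [Config.init, List.length_cons, List.length_nil] at hi
      obtain rfl : i = 0 := by omega
      simp [hmem]
    · intro i b hb
      have hi := (List.getElem?_eq_some_iff.1 hb).1
      simp only [Config.init, List.length_cons, List.length_nil] at hi
      obtain rfl : i = 0 := by omega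
      simp only [Config.init, List.getElem?_cons_zero, Option.some.injEq] at hb
      subst hb
      rw [hne 3 _ (by omega) (by omega), hin _ (by unfold loc; omega)]
      rfl
    · intro i b hb
      have hi := (List.getElem?_eq_some_iff.1 hb).1
      simp only [Config.init, List.length_cons, List.length_nil] at hi
      obtain rfl : i = 0 := by omega
      simp only [Config.init, List.getElem?_cons_zero, Option.some.injEq] at hb
      subst hb
      rfl
    · intro i x hx
      have hi := (List.getElem?_eq_some_iff.1 hx).1
      have h3 := hne 0 i (by omega) (by omega)
      rw [show loc K 0 i = i by simp [loc]] at h3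
      rw [h3]
      simp [initState, hx]
    · intro x hx
      rw [hne 5 x hx (by omega), hin _ (by unfold loc; omega)]
  have hR : ConfRegs S Δ K (Config.init α) s₀ := by
    refine ⟨?_, ?_, ?_, ?_, ?_, ?_, ?_⟩ <;> simp [hreg, i0, i1, loc, Config.init]
  refine (runsV_loop (G := Config α × (ℕ → ℕ) × ℕ)
    (fun g s' => ConfMem S K g.1 g.2.1 s'.mem ∧ ConfRegs S Δ K g.1 s' ∧ Valid S Δ g.1 ∧
      (∀ b ∈ g.1.buckets, b.card ≤ Δ) ∧ g.1.used = min (g.2.2 * Δ) S.length ∧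
      g.2.2 * Δ ≤ S.length + Δ)
    (fun g => S.length - g.1.used)
    (fun g n tr ss g' => Progress S Δ m B (mainComps Δ) (mainLength Δ)
      (mainLoads Δ a B D θ hD hθ) g.1 g.2.2 n tr ss g'.1 g'.2.2) ?_ ?_ ?_
    (Config.init α, fun _ => 0, 0) s₀ ⟨hM, hR, Valid.initial S Δ, ?_, by simp [Config.init],
      by simp⟩).mono ?_
  · intro g s' _
    exact Progress.refl _ _ _ _ _ _ _ _ _
  · intro g n tr ss g' n' tr' ss' g'' h h'
    exact h.trans h'
  · rintro ⟨c, slot, t⟩ s' ⟨jM, jR, jv, jf, ju, jt⟩ hc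
    simp only at jM jR jv jf ju jt
    simp only [eval_sub, eval_V, jR.N, jR.used] at hc
    refine (runs_mainBody (t := t) hm hB hK hW ha h2 hΔS hN hD hθ hio jv jM jR (by omega) jf).mono ?_
    rintro n tr ss s₁ ⟨c', slot', kM, kR, kv, ku, kf, kp⟩
    refine ⟨(c', slot', t + 1), ⟨kM, kR, kv, kf, ?_, ?_⟩, ?_, kp⟩
    · simp only [add_mul, one_mul]
      omega
    · simp only [add_mul, one_mul]
      omega
    · simp only
      omega
  · intro b hb
    simp only [Config.init, List.mem_singleton] at hb
    subst hb
    simp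
  · rintro n tr ss s' ⟨⟨c, slot, t⟩, ⟨jM, jR, jv, jf, ju, jt⟩, hc, jp⟩
    simp only at jM jR jv jf ju jt jp
    simp only [eval_sub, eval_V, jR.N, jR.used] at hc
    obtain ⟨cs, h3, h4, h5⟩ := jp.run
    have hl : (Config.init α).buckets.length = 1 := rfl
    have jc := jp.comps
    have jl := jp.length
    have jio := jp.io
    rw [hl] at jc jl jio
    refine ⟨Config.init α :: cs, c, t, ⟨rfl, h4, h5, ?_⟩, ?_, jM.represents jR jv (by omega),
      by omega, ?_, ?_, ?_⟩
    · intro c' hst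
      cases hst with
      | distribute parts h1 => omega
      | split j b lo hi p hb hover => exact absurd (jf b (List.mem_of_getElem? hb)) (by omega)
    · refine List.Forall₂.cons ?_ h3
      exact hM.represents hR (Valid.initial S Δ) (by omega)
    · simpa using jc
    · simp only [List.length_append, List.length_cons, List.length_nil]
      push_cast
      linarith
    · simp only [List.nil_append, List.singleton_append]
      have h1 : IOB m B [loc K 3 0] 1 := by
        simpa using IOB.of_length (B := B) (by omega : 0 < m) [loc K 3 0]
      exact h1.append jio

/-! ### Parameters -/

/-- Raise the hypothesis to the power `a / d ≤ 1`: the exponent on the right becomes `a + a / d ≤ a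
+ 1`. -/
theorem pow_le_pow_of_rpow_le {x y d : ℝ} (hx : 0 ≤ x) (hy : 1 ≤ y) (hd : 0 < d) (had : (a : ℝ) ≤ d)
    (h : x ^ d ≤ y ^ (d + 1)) : x ^ a ≤ y ^ (a + 1) := by
  have ha : (0 : ℝ) ≤ a / d := by positivity
  have h1 := Real.rpow_le_rpow (Real.rpow_nonneg hx d) h ha
  rw [← Real.rpow_mul hx, ← Real.rpow_mul (by linarith), mul_div_cancel₀ _ hd.ne',
    Real.rpow_natCast] at h1
  refine h1.trans ?_
  rw [← Real.rpow_natCast y]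
  refine Real.rpow_le_rpow_of_exponent_le hy ?_
  have h2 : (a : ℝ) / d ≤ 1 := (div_le_one hd).2 had
  rw [add_mul, mul_div_cancel₀ _ hd.ne']
  push_cast
  linarith

/-- The choice is `a = ⌈1 + 1 / ε⌉`. For `ε ≥ 1` this is at most `2`; for `ε < 1` it is less than `2
+ 1 / ε`, which is below `1 + 2 / ε`. -/
theorem exists_degree {ε : ℝ} (hε : 0 < ε) : ∃ a : ℕ, 2 ≤ a ∧ (a : ℝ) ≤ max (1 + 2 / ε) 2 ∧
    1 ≤ ε * (a - 1) := by
  have h0 : 0 < 1 / ε := by positivity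
  refine ⟨⌈1 + 1 / ε⌉₊, Nat.lt_ceil.2 (by linarith), ?_, ?_⟩
  · rcases le_or_gt 1 ε with h | h
    · refine le_trans ?_ (le_max_right _ _)
      have : 1 / ε ≤ 1 := (div_le_one hε).2 h
      exact_mod_cast Nat.ceil_le.2 (by linarith)
    · refine le_trans ?_ (le_max_left _ _)
      have h1 := Nat.ceil_lt_add_one (show (0 : ℝ) ≤ 1 + 1 / ε by linarith)
      have h2 : 1 < 1 / ε := (one_lt_div hε).2 h
      have h3 : 2 / ε = 1 / ε + 1 / ε := by ring
      linarith
  · have h1 := Nat.le_ceil (1 + 1 / ε)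
    have h2 : ε * (1 / ε) = 1 := mul_one_div_cancel hε.ne'
    nlinarith

/-- Raise the hypothesis to the power `a - 1` and use `(1 + ε) (a - 1) ≥ a`. -/
theorem pow_le_of_tall {ε : ℝ} (ha : 2 ≤ a) (hε : 1 ≤ ε * (a - 1)) (hB : 1 ≤ B)
    (h : (B : ℝ) ^ (1 + ε) ≤ M) : B ^ a ≤ M ^ (a - 1) := by
  have hB' : (1 : ℝ) ≤ B := by exact_mod_cast hB
  have h1 := pow_le_pow_left₀ (by positivity) h (a - 1)
  rw [← Real.rpow_natCast, ← Real.rpow_mul (by positivity)] at h1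
  have h2 : ((a - 1 : ℕ) : ℝ) = a - 1 := by push_cast [show 1 ≤ a by omega]; ring
  have h3 : (B : ℝ) ^ (a : ℝ) ≤ (B : ℝ) ^ ((1 + ε) * ((a - 1 : ℕ) : ℝ)) :=
    Real.rpow_le_rpow_of_exponent_le hB' (by rw [h2]; linarith)
  rw [Real.rpow_natCast] at h3
  exact_mod_cast h3.trans h1

/-- A bound on `M` when neither `x` blocks nor `y` cells fill the memory. -/
theorem lt_of_not_fit (ha : 2 ≤ a) (hBM : B ^ a ≤ M ^ (a - 1)) (h : M < x * B + y) :
    M < (2 * x) ^ a ∨ M < 2 * y := by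
  by_cases hy : M < 2 * y
  · exact Or.inr hy
  · left
    have h1 : M < 2 * x * B := by
      rw [mul_assoc]
      omega
    have h2 := Nat.pow_lt_pow_left h1 (show a ≠ 0 by omega)
    rw [mul_pow] at h2
    have h3 : M * M ^ (a - 1) < (2 * x) ^ a * M ^ (a - 1) := by
      rw [← pow_succ', Nat.sub_add_cancel (by omega)]
      exact h2.trans_le (Nat.mul_le_mul_left _ hBM)
    exact lt_of_mul_lt_mul_right h3 (Nat.zero_le _)

/-- Choose `j` such that base trees of height `2 ^ j` fit and those of height `2 ^ (j + 1)` do not.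
The failure at `j + 1` bounds `M` by a constant times `2 ^ (2 a * 2 ^ j)`, so `2 ^ j` is at least of
order `log M`, and with `B ^ a ≤ M ^ (a - 1)` it bounds `B`. If even `j = 0` does not fit, `M` is
bounded by a constant. -/
theorem exists_scale (ha : 2 ≤ a) (hB : 1 ≤ B) (hBM : B ^ a ≤ M ^ (a - 1)) :
    M ≤ 2 ^ (8 * a) ∨ ∃ j, 2 * (14 * 2 ^ 2 ^ j + 8 * 2 ^ (a * 2 ^ j) / B) ≤ M / B ∧
      B ≤ 56 ^ (a - 1) * 2 ^ ((2 * a - 2) * 2 ^ j) ∧ M ≤ 2 ^ (8 * a * 2 ^ j) := by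
  set F : ℕ → Prop := fun j => 28 * 2 ^ 2 ^ j * B + 16 * 2 ^ (a * 2 ^ j) ≤ M with hF
  by_cases h0 : F 0
  · right
    obtain ⟨j, h1, h2⟩ : ∃ j, F j ∧ ¬ F (j + 1) := by
      by_contra! hcon
      have h1 : ∀ j, F j := fun j => by
        induction j with
        | zero => exact h0
        | succ j ih => exact hcon j ih
      -- Base trees of height `2 ^ M` need more than `M` cells, so not all scales fit.
      have h2 := h1 M
      have h3 : M < 2 ^ M := Nat.lt_two_pow_self
      have h4 : 2 ^ M < 2 ^ 2 ^ M := Nat.lt_two_pow_self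
      have h5 : 2 ^ 2 ^ M * 1 ≤ 28 * 2 ^ 2 ^ M * B := Nat.mul_le_mul (by omega) hB
      simp only [hF] at h2
      omega
    obtain ⟨X, hX⟩ : ∃ X, X = 2 ^ 2 ^ j := ⟨_, rfl⟩
    have e1 : 2 ^ 2 ^ (j + 1) = X ^ 2 := by rw [hX, ← pow_mul, pow_succ]
    have e2 : ∀ b, 2 ^ (b * 2 ^ j) = X ^ b := fun b => by rw [hX, ← pow_mul, mul_comm]
    have e3 : 2 ^ (a * 2 ^ (j + 1)) = X ^ (2 * a) := by
      rw [← e2]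
      congr 1
      rw [pow_succ]
      ring
    have h3 : M < 56 ^ a * X ^ (2 * a) := by
      simp only [hF, e1, e3, not_le] at h2
      rcases lt_of_not_fit ha hBM h2 with h | h
      · calc M < _ := h
          _ = _ := by rw [← mul_assoc, mul_pow, ← pow_mul]; norm_num
      · refine h.trans_le ?_
        rw [← mul_assoc]
        refine Nat.mul_le_mul_right _ ?_
        calc 2 * 16 ≤ 56 ^ 1 := by norm_num
          _ ≤ 56 ^ a := Nat.pow_le_pow_right (by norm_num) (by omega)
    refine ⟨j, ?_, ?_, ?_⟩
    · rw [Nat.le_div_iff_mul_le (by omega)]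
      refine le_trans ?_ h1
      have h4 := Nat.div_mul_le_self (8 * 2 ^ (a * 2 ^ j)) B
      calc _ = 28 * 2 ^ 2 ^ j * B + 2 * (8 * 2 ^ (a * 2 ^ j) / B * B) := by ring
        _ ≤ _ := by omega
    · rw [e2]
      refine (Nat.pow_le_pow_iff_left (show a ≠ 0 by omega)).1 (hBM.trans ?_)
      refine (Nat.pow_le_pow_left h3.le _).trans (le_of_eq ?_)
      rw [mul_pow, mul_pow, ← pow_mul, ← pow_mul, ← pow_mul, ← pow_mul]
      congr 2
      · ring
      · rw [show 2 * a - 2 = 2 * (a - 1) by omega]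
        ring
    · refine h3.le.trans ?_
      have h4 : 56 ^ a ≤ 2 ^ (6 * a * 2 ^ j) := by
        calc 56 ^ a ≤ (2 ^ 6) ^ a := Nat.pow_le_pow_left (by norm_num) a
          _ = 2 ^ (6 * a) := by rw [← pow_mul]
          _ ≤ _ := Nat.pow_le_pow_right (by norm_num) (Nat.le_mul_of_pos_right _ (by positivity))
      calc _ ≤ 2 ^ (6 * a * 2 ^ j) * 2 ^ (2 * a * 2 ^ j) := by
            rw [e2 (2 * a)]
            exact Nat.mul_le_mul_right _ h4
        _ = _ := by
          rw [← pow_add]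
          congr 1
          ring
  · left
    simp only [hF, pow_zero, pow_one, mul_one, not_le] at h0
    rcases lt_of_not_fit ha hBM h0 with h | h
    · calc M ≤ (2 * (28 * 2)) ^ a := h.le
        _ ≤ (2 ^ 8) ^ a := Nat.pow_le_pow_left (by norm_num) a
        _ = _ := by rw [← pow_mul]
    · calc M ≤ 2 * (16 * 2 ^ a) := h.le
        _ = 2 ^ (a + 5) := by ring
        _ ≤ _ := Nat.pow_le_pow_right (by norm_num) (by omega)

/-- Words below a fixed power of `N + 2` suffice, that is, words of `O(log N)` bits: addresses are
quadratic in `N`, and a buffer size is at most `(2 ^ h) ^ (2 a - 1)` with `2 ^ h ≤ 2 N`. -/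
theorem wordSize (ha : 2 ≤ a) (hN : 4 ≤ N) : WordSize a N (4 * N + 8) ((N + 2) ^ (6 * a + 6)) := by
  obtain ⟨n, hn⟩ : ∃ n, n = N + 2 := ⟨_, rfl⟩
  rw [← hn]
  have hn2 : 2 ≤ n := by omega
  have hpow : ∀ {x y}, x ≤ y → n ^ x ≤ n ^ y := fun h => Nat.pow_le_pow_right (by omega) h
  have htwo : ∀ x, 2 ^ x ≤ n ^ x := fun x => Nat.pow_le_pow_left hn2 x
  have hsq : 2 * N ≤ n ^ 2 := by rw [hn]; nlinarith
  refine ⟨?_, fun h hh => ⟨fun x hx hx1 => ?_, ?_⟩⟩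
  · refine le_trans ?_ (hpow (show 5 ≤ 6 * a + 6 by omega))
    have h1 : 4 * N + 8 = 4 * n := by omega
    have h2 : 6 * 6 * 6 * n ^ 2 ≤ n * n * n * n ^ 2 := by gcongr <;> omega
    rw [h1]
    nlinarith
  · have h1 : bufSize a x ≤ n ^ (2 * (2 * a - 1)) := by
      calc bufSize a x ≤ 2 ^ ((2 * a - 1) * h) :=
            Nat.pow_le_pow_right (by norm_num) (Nat.mul_le_mul_left _ ((ruler_le hx1).trans hx))
        _ = (2 ^ h) ^ (2 * a - 1) := by rw [mul_comm, pow_mul]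
        _ ≤ (n ^ 2) ^ (2 * a - 1) := Nat.pow_le_pow_left (hh.trans hsq) _
        _ = _ := by rw [← pow_mul]
    have h2 : 2 * a < n ^ (2 * a) := (Nat.lt_two_pow_self).trans_le (htwo _)
    calc 2 * a * bufSize a x ≤ n ^ (2 * a) * n ^ (2 * (2 * a - 1)) := Nat.mul_le_mul h2.le h1
      _ = n ^ (2 * a + 2 * (2 * a - 1)) := by rw [← pow_add]
      _ < _ := Nat.pow_lt_pow_right (by omega) (by omega)
  · have h1 : h ≤ n ^ 2 := (Nat.lt_two_pow_self.le.trans hh).trans hsq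
    have h2 : 4 * a ≤ n ^ (4 * a) := (Nat.lt_two_pow_self).le.trans (htwo _)
    have h3 : 2 ≤ n ^ (4 * a + 2) := hn2.trans (by simpa using hpow (show 1 ≤ 4 * a + 2 by omega))
    calc 4 * a * h + 2 ≤ n ^ (4 * a) * n ^ 2 + n ^ (4 * a + 2) :=
          Nat.add_le_add (Nat.mul_le_mul h2 h1) h3
      _ = n ^ (4 * a + 2) * 2 := by rw [← pow_add]; ring
      _ ≤ n ^ (4 * a + 2) * n := Nat.mul_le_mul_left _ hn2
      _ = n ^ (4 * a + 3) := by rw [← pow_succ]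
      _ < _ := Nat.pow_lt_pow_right (by omega) (by omega)

/-- Every access counted as one load, in units of single cells. This instance serves to obtain the
execution together with its numbers of comparisons and accesses. -/
theorem batchLoads_length (a : ℕ) : BatchLoads a 8 1 10 1 := by
  intro T n tr len len' hh hsz _ hlen hs
  have e : len = rootLen (len 1) := by
    funext u
    by_cases hu : u = 1
    · simp [rootLen, hu]
    · simp [rootLen, hu, hlen u hu]
  rw [e] at hs
  have h1 := (batch_cost hh (fun i => hsz ▸ bufSize_pos a i) hs).2.1
  refine (IOB.of_length (by norm_num) tr).mono ?_
  have h2 : (tr.length : ℝ) ≤ 10 * (len 1 * T.h) + 2 ^ T.h := by exact_mod_cast h1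
  have h3 : (0 : ℝ) ≤ 2 ^ T.h := by positivity
  have h4 : (0 : ℝ) ≤ 2 ^ (a * T.h) := by positivity
  push_cast
  rw [div_one, div_one]
  linarith

theorem batchLoads_scale {C : ℝ} (ha : 2 ≤ a) (hB : 0 < B) (hC : 0 ≤ C)
    (hm : 2 * (14 * 2 ^ 2 ^ j + 8 * 2 ^ (a * 2 ^ j) / B) ≤ m)
    (hBC : (B : ℝ) ≤ C * 2 ^ ((2 * a - 2) * 2 ^ j)) : BatchLoads a m B (42 + 28 * C) (1 / 2 ^ j) := by
  intro T n tr len len' hh hsz haux hlen hs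
  refine (batch_io ha hB hh hsz haux hC hm hBC hlen hs).mono (le_of_eq ?_)
  rw [mul_one_div]
  push_cast
  rfl

/-! ### Total costs -/

/-- Here `L` stands for `log₂ k`, `θ` for the reciprocal of the height of a base tree, `l` for
`log_M k`, `x` for `B` and `p` for `(2 k) ^ a`. There are `t ≤ 4 k` batches, so the `O(k)` loads per
batch and per split sum up to `O(k ^ 2)`, while the terms with `Δ` sum up to `N` since `t Δ` and `k
Δ` are at most `2 N`. -/
theorem total_loads {N Δ k t x D l L p : ℝ} (ha : 1 ≤ a) (hx : 0 < x) (hD : 0 ≤ D) (hθ : θ ≤ 1)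
    (ht : 0 ≤ t) (hΔ : 0 ≤ Δ) (hk : 1 ≤ k) (hl : 0 ≤ l) (hL : L * θ ≤ 8 * a * l)
    (h1 : t * Δ ≤ 2 * N) (h2 : k * Δ ≤ 2 * N) (h3 : t ≤ 4 * k) (hp : p ≤ 2 ^ a * Δ) :
    1 + (t * (D * (Δ / x * (1 + (1 + L) * θ) + 2 * k + p / x) + k + 1) +
      (k - 1) * (41312 * (Δ / x) + 6 * k + 40)) ≤
      (D * (16 * a + 8 + 2 * 2 ^ a) + 82700) * (k ^ 2 + N / x * (1 + l)) := by
  have ha' : (1 : ℝ) ≤ a := by exact_mod_cast ha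
  obtain ⟨n, hn⟩ : ∃ n, n = N / x := ⟨_, rfl⟩
  obtain ⟨δ, hδ⟩ : ∃ δ, δ = Δ / x := ⟨_, rfl⟩
  have hδ0 : 0 ≤ δ := by rw [hδ]; positivity
  have g1 : t * δ ≤ 2 * n := by
    rw [hn, hδ, ← mul_div_assoc, ← mul_div_assoc]
    gcongr
  have g2 : k * δ ≤ 2 * n := by
    rw [hn, hδ, ← mul_div_assoc, ← mul_div_assoc]
    gcongr
  have g3 : p / x ≤ 2 ^ a * δ := by
    rw [hδ, ← mul_div_assoc]
    gcongr
  rw [← hn, ← hδ]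
  have hn0 : 0 ≤ n := by nlinarith
  have hnl : 0 ≤ n * l := mul_nonneg hn0 hl
  have hkk : k ≤ k ^ 2 := by nlinarith
  have htk : t * k ≤ 4 * k ^ 2 := by nlinarith
  have c1 : t * (δ * (1 + (1 + L) * θ)) ≤ 16 * a * (n * (1 + l)) := by
    calc t * (δ * (1 + (1 + L) * θ)) = t * δ * (1 + θ + L * θ) := by ring
      _ ≤ t * δ * (2 + 8 * a * l) := by gcongr; linarith
      _ ≤ 2 * n * (2 + 8 * a * l) := by gcongr
      _ = 4 * n + 16 * a * (n * l) := by ring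
      _ ≤ 16 * a * (n * (1 + l)) := by nlinarith
  have c2 : t * (p / x) ≤ 2 * 2 ^ a * n := by
    calc t * (p / x) ≤ t * (2 ^ a * δ) := by gcongr
      _ = 2 ^ a * (t * δ) := by ring
      _ ≤ 2 ^ a * (2 * n) := by gcongr
      _ = _ := by ring
  have c3 : D * (t * (δ * (1 + (1 + L) * θ)) + 2 * (t * k) + t * (p / x)) ≤
      D * ((16 * a + 8 + 2 * 2 ^ a) * (k ^ 2 + n * (1 + l))) := by
    refine mul_le_mul_of_nonneg_left ?_ hD
    have e1 : (0 : ℝ) ≤ a * k ^ 2 := by positivity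
    have e2 : (0 : ℝ) ≤ 2 ^ a * k ^ 2 := by positivity
    have e3 : (0 : ℝ) ≤ 2 ^ a * (n * l) := by positivity
    linarith
  linarith

/-- The case of a bounded memory: as `B = x ≤ X` with `X` constant, `N` is at most `X * (N / B)`,
and the number of accesses is a sufficient bound. -/
theorem total_length {N Δ k t x X l L : ℝ} (hx : 1 ≤ x) (hxX : x ≤ X) (ht : 0 ≤ t)
    (hΔ : 0 ≤ Δ) (hk : 1 ≤ k) (hl : 0 ≤ l) {A : ℝ} (hA : 1 ≤ A) (hL : L ≤ A * l)
    (h1 : t * Δ ≤ 2 * N) (h2 : k * Δ ≤ 2 * N) (h3 : t ≤ 4 * k) :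
    1 + (t * (10 * Δ * (1 + L) + 3 * k + 1) + (k - 1) * (12440 * Δ)) ≤
      24920 * A * X * (k ^ 2 + N / x * (1 + l)) := by
  obtain ⟨n, hn⟩ : ∃ n, n = N / x := ⟨_, rfl⟩
  have hN0 : 0 ≤ N := by nlinarith
  have hn0 : 0 ≤ n := by rw [hn]; positivity
  have hNn : N ≤ X * n := by
    rw [hn, ← mul_div_assoc, le_div_iff₀ (by linarith), mul_comm]
    gcongr
  have hX : 1 ≤ X := hx.trans hxX
  rw [← hn]
  have c1 : t * (10 * Δ * (1 + L)) ≤ 20 * N * (1 + A * l) := by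
    calc t * (10 * Δ * (1 + L)) = 10 * (t * Δ) * (1 + L) := by ring
      _ ≤ 10 * (t * Δ) * (1 + A * l) := by gcongr
      _ ≤ 10 * (2 * N) * (1 + A * l) := by gcongr
      _ = _ := by ring
  have c4 : 20 * N * (1 + A * l) + 24880 * N ≤ 24900 * A * (N * (1 + l)) := by
    have e1 : N ≤ A * N := le_mul_of_one_le_left hN0 hA
    nlinarith
  have c5 : 24900 * A * (N * (1 + l)) ≤ 24900 * A * (X * n * (1 + l)) := by gcongr
  have c6 : k ^ 2 ≤ A * X * k ^ 2 := le_mul_of_one_le_left (by positivity) (by nlinarith)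
  have c7 : 0 ≤ A * X * (n * (1 + l)) := by positivity
  nlinarith

theorem log_le_mul_logb (hk : 1 ≤ k) (hM : 2 ≤ M) (h : M ≤ 2 ^ e) :
    (Nat.log 2 k : ℝ) ≤ e * Real.logb M k := by
  have hM' : (2 : ℝ) ≤ M := by exact_mod_cast hM
  have h1 : (Nat.log 2 k : ℝ) ≤ Real.logb 2 k := by exact_mod_cast Real.natLog_le_logb k 2
  have h2 : Real.logb 2 M ≤ e := by
    rw [Real.logb_le_iff_le_rpow (by norm_num) (by linarith), Real.rpow_natCast]
    exact_mod_cast h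
  have h3 : 0 ≤ Real.logb M k := Real.logb_nonneg (by linarith) (by exact_mod_cast hk)
  rw [← Real.mul_logb (b := (M : ℝ)) (by linarith) (by linarith) (by linarith)] at h1
  exact h1.trans (mul_le_mul_of_nonneg_right h2 h3)

theorem pow_le_cap (hΔ : 0 < Δ) (hN : (2 * N) ^ a ≤ Δ ^ (a + 1)) (hk : k * Δ ≤ 2 * N) :
    k ^ a ≤ Δ := by
  have h1 := (Nat.pow_le_pow_left hk a).trans hN
  rw [mul_pow, pow_succ'] at h1
  exact Nat.le_of_mul_le_mul_right h1 (Nat.pow_pos hΔ)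

/-- Because `a + 1 ≤ 2 a`, the right-hand side of the hypothesis is at most `(Δ * Δ) ^ a`. -/
theorem two_mul_le_sq (ha : 2 ≤ a) (hΔ : 0 < Δ) (hN : (2 * N) ^ a ≤ Δ ^ (a + 1)) :
    2 * N ≤ Δ * Δ := by
  refine (Nat.pow_le_pow_iff_left (show a ≠ 0 by omega)).1 (hN.trans ?_)
  rw [← sq, ← pow_mul]
  exact Nat.pow_le_pow_right hΔ (by omega)

/-- In the result `N ≤ k Δ + (k - 1)`. This bounds the number of batches by `4 k`. -/
theorem IsRun.length_le {cs : List (Config α)} (hΔ : 0 < Δ) (h : IsRun S Δ cs c) :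
    S.length ≤ 2 * (c.buckets.length * Δ) := by
  have hv := h.valid
  obtain ⟨h1, h2⟩ := hv.of_stuck h.2.2.2
  have h3 := hv.card_total
  have h4 := hv.length
  have h5 : ∀ l : List (Multiset α), (∀ b ∈ l, b.card ≤ Δ) → l.sum.card ≤ l.length * Δ := by
    intro l hl
    induction l with
    | nil => simp
    | cons b l ih =>
      have := ih fun b hb => hl b (List.mem_cons_of_mem _ hb)
      have := hl b List.mem_cons_self
      rw [List.sum_cons, Multiset.card_add, List.length_cons, add_mul]
      omega
  have h6 := h5 _ h2
  have h7 := Nat.le_mul_of_pos_right c.buckets.length hΔ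
  omega

theorem multiPartition_cost (ha : 2 ≤ a) (hΔ : 0 < Δ) (hΔS : Δ ≤ S.length)
    (hN : (2 * S.length) ^ a ≤ Δ ^ (a + 1)) : ∃ cs c t s, IsRun S Δ cs c ∧
      Exec ((S.length + 2) ^ (6 * a + 6)) (multiPartition a) (initState S Δ) t s ∧
      CarriesOut t s cs c ∧
      (comparisonCount t : ℝ) ≤ 4132 * (S.length * Real.logb 2 c.buckets.length) ∧
      ∀ M B : ℕ, 1 ≤ B → 2 ≤ M → B ≤ M → B ^ a ≤ M ^ (a - 1) →
        (ioCost M B (addressTrace t) : ℝ) ≤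
          2 * ((42 + 28 * 56 ^ (a - 1)) * (16 * a + 8 + 2 * 2 ^ a) + 82700 +
            24920 * (8 * a) * 2 ^ (8 * a)) * ((c.buckets.length : ℝ) ^ 2 +
              S.length / B * (1 + Real.logb M c.buckets.length)) := by
  -- `pow_le_cap` for `k = 2`, whose condition `2 Δ ≤ 2 N` is the assumption `Δ ≤ N`, gives `2 ^ a ≤
  -- Δ`.
  have h4 : 4 ≤ Δ := (Nat.pow_le_pow_right (n := 2) (by norm_num) ha).trans
    (pow_le_cap hΔ hN (by omega))
  have hW := wordSize ha (h4.trans hΔS)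
  have hN2 := two_mul_le_sq ha hΔ hN
  obtain ⟨t, s, ss, hex, hsub, cs, c, τ, hrun, hrep, hfin, hτ, hcomps, hlen, -⟩ :=
    runs_multiPartition (m := 8) (B := 1) le_rfl one_pos rfl hW ha (by omega) hΔS hN2
      (D := 10) (by norm_num) zero_le_one (batchLoads_length a)
  have hv := hrun.valid
  have hk1 := hv.length_pos
  have hkΔ := hv.bucket_count hΔS
  have hNk := hrun.length_le hΔ
  have hpow := pow_le_cap hΔ hN hkΔ
  obtain ⟨k, hk⟩ : ∃ k, k = c.buckets.length := ⟨_, rfl⟩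
  rw [← hk] at hk1 hkΔ hNk hpow hcomps hlen
  have hτ4 : ∀ {τ}, τ * Δ ≤ 2 * S.length → τ ≤ 4 * k := by
    intro τ hτ
    refine Nat.le_of_mul_le_mul_right (?_ : τ * Δ ≤ 4 * k * Δ) hΔ
    rw [mul_assoc]
    omega
  have rk1 : (1 : ℝ) ≤ k := by exact_mod_cast hk1
  have rkΔ : (k : ℝ) * Δ ≤ 2 * S.length := by exact_mod_cast hkΔ
  have rτ : (τ : ℝ) * Δ ≤ 2 * S.length := by exact_mod_cast hτ
  refine ⟨cs, c, t, s, hrun, hex, ⟨⟨ss, hsub, hrep⟩, hfin⟩, ?_, ?_⟩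
  · refine hcomps.trans ?_
    rw [← hk]
    have h1 : (Nat.log 2 k : ℝ) ≤ Real.logb 2 k := by exact_mod_cast Real.natLog_le_logb k 2
    -- For `k = 1` both sides vanish; otherwise the logarithm is at least `1`. This lets the splits
    -- be charged to `N lg k`.
    have h2 : ((k : ℝ) - 1) * Δ ≤ 2 * S.length * Nat.log 2 k := by
      rcases Nat.lt_or_ge 1 k with h | h
      · have h3 : (1 : ℝ) ≤ Nat.log 2 k := by exact_mod_cast Nat.log_pos (by norm_num) h
        nlinarith
      · obtain rfl : k = 1 := by omega
        simp
    have h3 : (τ : ℝ) * Δ * Nat.log 2 k ≤ 2 * S.length * Nat.log 2 k := by gcongr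
    have h4 : (S.length : ℝ) * Nat.log 2 k ≤ S.length * Real.logb 2 k := by gcongr
    simp only [Rate.cost, mainComps]
    push_cast
    linarith
  · intro M B hB hM hBle hBM
    rw [← hk]
    have hM0 : 0 < M / B := Nat.div_pos hBle hB
    have hB1 : (1 : ℝ) ≤ B := by exact_mod_cast hB
    have hl : 0 ≤ Real.logb M k := Real.logb_nonneg (by exact_mod_cast hM) rk1
    have hsize : (0 : ℝ) ≤ (k : ℝ) ^ 2 + S.length / B * (1 + Real.logb M k) := by positivity
    have hio : ∀ {x : ℝ}, IOB (M / B) B (addressTrace t) x →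
        (ioCost M B (addressTrace t) : ℝ) ≤ 2 * x := by
      intro x hx
      obtain ⟨C', n, h1, h2⟩ := hx ∅
      have h3 : (ioCost M B (addressTrace t) : ℝ) ≤ 2 * n := by
        exact_mod_cast ioCost_le_of_sched h1
      linarith
    rcases exists_scale ha hB hBM with hsmall | ⟨j, hj1, hj2, hj3⟩
    · refine (hio (IOB.of_length hM0 _)).trans ?_
      have hL := log_le_mul_logb hk1 hM hsmall
      have hBX : (B : ℝ) ≤ 2 ^ (8 * a) := by exact_mod_cast hBle.trans hsmall
      have h1 := total_length (t := τ) (A := (8 * a : ℕ)) hB1 hBX (by positivity) (by positivity) rk1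
        hl (by exact_mod_cast (by omega : 1 ≤ 8 * a)) hL rτ rkΔ (by exact_mod_cast hτ4 hτ)
      simp only [Rate.cost, mainLength] at hlen
      push_cast at hlen h1
      rw [sub_zero] at hlen
      have h2 : (0 : ℝ) ≤ (42 + 28 * 56 ^ (a - 1)) * (16 * a + 8 + 2 * 2 ^ a) + 82700 := by positivity
      nlinarith [mul_nonneg h2 hsize]
    · have hm8 : 8 ≤ M / B := by
        refine le_trans ?_ hj1
        have h1 : 1 ≤ 2 ^ 2 ^ j := Nat.one_le_two_pow
        generalize 8 * 2 ^ (a * 2 ^ j) / B = q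
        omega
      have hθ1 : (1 : ℝ) / 2 ^ j ≤ 1 := by
        rw [div_le_one (by positivity)]
        exact one_le_pow₀ (by norm_num)
      have hDC : (0 : ℝ) ≤ 42 + 28 * 56 ^ (a - 1) := by positivity
      -- The specification is applied a second time, now with the parameters of this `M` and `B`; by
      -- determinism it speaks about the same execution.
      obtain ⟨t', s', ss', hex', -, cs', c', τ', hrun', -, hfin', hτ', -, -, hio'⟩ :=
        runs_multiPartition (α := α) hm8 hB rfl hW ha (by omega) hΔS hN2
          hDC (show (0 : ℝ) ≤ 1 / 2 ^ j by positivity)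
          (batchLoads_scale ha hB (by positivity) hj1 (by exact_mod_cast hj2))
      obtain ⟨rfl, rfl⟩ := hex.deterministic hex'
      -- The two applications may produce different abstract runs, but both results are stored in
      -- the same final state, whose register `2` is the number of buckets.
      have hkk : c'.buckets.length = k := by
        rw [hk, ← hfin.1, hfin'.1]
      rw [hkk] at hio'
      refine (hio hio').trans ?_
      have hL : (Nat.log 2 k : ℝ) * (1 / 2 ^ j) ≤ 8 * a * Real.logb M k := by
        have := log_le_mul_logb hk1 hM hj3
        rw [mul_one_div, div_le_iff₀ (by positivity)]
        push_cast at this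
        linarith
      have hp : (2 * (k : ℝ)) ^ a ≤ 2 ^ a * Δ := by
        rw [mul_pow]
        gcongr
        exact_mod_cast hpow
      have h1 := total_loads (x := B) (t := τ') (N := S.length) (by omega : 1 ≤ a) (by linarith) hDC
        hθ1 (by positivity) (by positivity) rk1 hl hL (by exact_mod_cast hτ') rkΔ
        (by exact_mod_cast hτ4 hτ') hp
      simp only [Rate.cost, mainLoads, splitLoads]
      push_cast at h1 ⊢
      rw [sub_zero]
      have h2 : (0 : ℝ) ≤ 24920 * (8 * a) * 2 ^ (8 * a) := by positivity
      nlinarith [mul_nonneg h2 hsize]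

end FunnelSelect

theorem mainTheorem2 (ε : ℝ) (hε : 0 < ε) :
    ∃ (prog : FunnelSelect.Cmd) (w : ℕ) (C : ℝ),
      ∀ (α : Type u) [LinearOrder α] (S : List α) (Δ : ℕ),
        0 < Δ → Δ ≤ S.length →
        (2 * (S.length : ℝ)) ^ (max (1 + 2 / ε) 2) ≤ (Δ : ℝ) ^ (max (1 + 2 / ε) 2 + 1) →
        -- the procedure terminates, and every complete execution of it has a result as claimed
        FunnelSelect.Terminates S Δ ∧
        (∀ cs c, FunnelSelect.IsRun S Δ cs c →
          (c.buckets.length : ℝ) ≤ 2 * (S.length : ℝ) / Δ ∧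
          FunnelSelect.IsPartition S c ∧
          ∀ b ∈ c.buckets, b.card ≤ Δ) ∧
        -- the cache-oblivious implementation and its cost
        ∃ cs c t s,
          FunnelSelect.IsRun S Δ cs c ∧
          FunnelSelect.Exec ((S.length + 2) ^ w) prog (FunnelSelect.initState S Δ) t s ∧
          FunnelSelect.CarriesOut t s cs c ∧
          (FunnelSelect.comparisonCount t : ℝ) ≤
            C * ((S.length : ℝ) * Real.logb 2 (c.buckets.length : ℝ)) ∧
          ∀ M B : ℕ, 1 ≤ B → 2 ≤ M → (B : ℝ) ^ (1 + ε) ≤ (M : ℝ) →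
            (FunnelSelect.ioCost M B (FunnelSelect.addressTrace t) : ℝ) ≤
              C * ((c.buckets.length : ℝ) ^ 2 +
                (S.length : ℝ) / B * (1 + Real.logb M (c.buckets.length : ℝ))) := by
  obtain ⟨a, ha, had, hεa⟩ := FunnelSelect.exists_degree hε
  refine ⟨FunnelSelect.multiPartition a, 6 * a + 6,
    4132 + 2 * ((42 + 28 * 56 ^ (a - 1)) * (16 * a + 8 + 2 * 2 ^ a) + 82700 +
      24920 * (8 * a) * 2 ^ (8 * a)), ?_⟩
  intro α _ S Δ hΔ hΔS hN
  have hN' : (2 * S.length) ^ a ≤ Δ ^ (a + 1) := by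
    have := FunnelSelect.pow_le_pow_of_rpow_le (a := a) (by positivity) (by exact_mod_cast hΔ)
      (lt_of_lt_of_le two_pos (le_max_right _ _)) had hN
    exact_mod_cast this
  obtain ⟨cs, c, t, s, h1, h2, h3, h4, h5⟩ :=
    FunnelSelect.multiPartition_cost ha hΔ hΔS hN'
  have hk : (1 : ℝ) ≤ c.buckets.length := by exact_mod_cast h1.valid.length_pos
  refine ⟨FunnelSelect.terminates S hΔ, fun cs c h => h.result hΔ hΔS, cs, c, t, s, h1, h2, h3, ?_, ?_⟩
  · refine h4.trans ?_
    have := Real.logb_nonneg one_lt_two hk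
    gcongr
    exact le_add_of_nonneg_right (by positivity)
  · intro M B hB hM hBM
    have hB1 : (1 : ℝ) ≤ B := by exact_mod_cast hB
    have hBle : B ≤ M := by
      have : (B : ℝ) ^ (1 : ℝ) ≤ B ^ (1 + ε) :=
        Real.rpow_le_rpow_of_exponent_le hB1 (by linarith)
      rw [Real.rpow_one] at this
      exact_mod_cast this.trans hBM
    refine (h5 M B hB hM hBle (FunnelSelect.pow_le_of_tall ha hεa hB hBM)).trans ?_
    have := Real.logb_nonneg (show (1 : ℝ) < M by exact_mod_cast hM) hk
    gcongr
    exact le_add_of_nonneg_left (by norm_num)
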